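/- Let $\mathbb K$ be a field of characteristic $0$ and $R$ a $\mathbb Z/2$-graded, graded-commutative $\mathbb K$-algebra. Let $\mathcal C,\mathcal D$ be strictly unital, uncurved, $R$-linear, $\mathbb Z/2$-graded $A_\infty$-categories whose morphism spaces are free graded $R$-modules with chosen homogeneous bases containing the units $\mathbf e$, and let $F:\mathcal C\to\mathcal D$ be a unital $R$-linear $A_\infty$-functor. Graded $\mathbb K$-derivations $v\in Der_{\mathbb K}R$ act on morphisms through the coefficients in these bases; this defines $v(\mathfrak m)$ and $v(F)$. Write $|x|'=|x|-1$. Conventions: $\mathfrak m_2(\mathbf e,x)=x=(-1)^{|x|}\mathfrak m_2(x,\mathbf e)$, all signs are Koszul signs for reduced degrees, and an operator depending on $v$ carries the sign of moving $v$ from the far left to its place. Let $CC_*$ be the normalised Hochschild chains, $|\alpha_0[\alpha_1|\dots|\alpha_k]|=|\alpha_0|+\sum_{i\ge1}|\alpha_i|'$, let $CC^-_*=CC_*[[u]]$ with $d^-=b+uB$, and let $$\nabla_v=v-u^{-1}b^{1,1}(v(\mathfrak m);\,\cdot\,)-B^{1,1}(v(\mathfrak m);\,\cdot\,)$$ be the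 Getzler–Gauss–Manin connection, where $b^{1,1}(v(\mathfrak m);\alpha)=\sum\pm\,\mathfrak m(\alpha^3,v(\mathfrak m)(\alpha^4),\alpha^5,\alpha_0,\alpha^1)[\alpha^2]$ and $B^{1,1}(v(\mathfrak m);\alpha)=\sum\pm\,\mathbf e[\alpha^2|v(\mathfrak m)(\alpha^3)|\alpha^4|\alpha_0|\alpha^1]$, the sums running over all ways to cut $(\alpha_1,\dots,\alpha_k)$ into consecutive, possibly empty pieces. Let $H_v=u^{-1}(H^2_v-H^1_v)+H^3_v$, where, for $\alpha=\alpha_0[\alpha_1|\dots|\alpha_k]$ and $F^*$ applied to consecutive pieces of the cyclic word in all possible ways, \begin{align*} H^1_v(\alpha)&=\sum\pm F^*(\dots,v(\mathfrak m_{\mathcal C})(\dots),\dots,\alpha_0,\dots)[F^*(\dots)|\dots|F^*(\dots)],\\ H^2_v(\alpha)&=\sum\pm \mathfrak m_{\mathcal D}(F^*(\dots),\dots,v(F^*)(\dots),F^*(\dots),\dots,F^*(\dots,\alpha_0,\dots),\dots,F^*(\dots))[F^*(\dots)|\dots],\\ H^3_v(\alpha)&=\sum\pm \mathbf e[F^*(\dots)|\dots|v(F^*)(\dots)|\dots|F^*(\dots,\alpha_0,\dots)|\dots].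 \end{align*} On $CC^-_*(F)=CC^-_*(\mathcal C)[1]\oplus CC^-_*(\mathcal D)$ put $$d^-_F(\alpha,\beta)=(d^-\alpha,\;d^-\beta+(-1)^{|\alpha|}F_*\alpha),\qquad \nabla^F_v(\alpha,\beta)=(\nabla_v\alpha,\;(-1)^{|\alpha|'}H_v(\alpha)+\nabla_v\beta).$$ Let $u^nHC^-_*(F)$ denote the homology of $u^nCC^-_*(F)$, for $n\in\mathbb Z$. Let $E\in Der_{\mathbb K}R$ be even. Suppose $\mathcal C$ and $\mathcal D$ are Euler-graded with Euler vector field $E$: there are even maps $Gr$ on the morphism spaces with $Gr(fx)=2E(f)x+f\,Gr(x)$, $Gr\circ\mathfrak m_k=\mathfrak m_k\circ Gr+(2-k)\mathfrak m_k$ and $Gr(\mathbf e)=0$; and suppose $F$ is Euler-graded: $Gr_{\mathcal D}\circ F^k=F^k\circ Gr_{\mathcal C}+(1-k)F^k$. Put $Gr^-=\mathcal L_{Gr}+\Gamma+2u\partial_u$ with $\Gamma(\alpha_0[\alpha_1|\dots|\alpha_k])=-k\,\alpha_0[\alpha_1|\dots|\alpha_k]$ and $\mathcal L_{Gr}$ the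 action of $Gr$ on the entries one by one, and $Gr^-_F(\alpha,\beta)=(Gr^-\alpha-\alpha,\,Gr^-\beta)$. Then: 1. $[Gr^-_F,d^-_F]=d^-_F$; hence $Gr^-_F$ descends to $HC^-_*(F)$, and to each $u^nHC^-_*(F)$. Suppose moreover that on the morphism spaces of $\mathcal C$ and $\mathcal D$ the map $Gr$ is compatible with the action of derivations, i.e. $[Gr,v]=[2E,v]$ for all $v\in Der_{\mathbb K}R$ (equivalently, the matrix entries of $Gr$ in the chosen bases are killed by all derivations). Then: 2. $[Gr^-,H_v]=H_{[2E,v]}-H_v$ for all homogeneous $v\in Der_{\mathbb K}R$, as maps on chains. 3. $\nabla^F_v$ and $Gr^-_F$ descend to $\nabla_v:u^nHC^-_*(F)\to u^{n-1}HC^-_*(F)$ and $Gr:u^nHC^-_*(F)\to u^nHC^-_*(F)$ for all $n$. Here $\nabla$ is an even connection, additive and $R$-linear in $v$, with $\nabla_v(fa)=v(f)a+(-1)^{|v||f|}f\nabla_va$ for $f\in R[[u]]$; $Gr$ is even and satisfies $Gr(fa)=(2u\partial_u+2E)(f)a+f\,Gr(a)$ and $[Gr,\nabla_v]=\nabla_{[2E,v]}$.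 The operator $\nabla_{\partial_u}:=\frac{Gr}{2u}-u^{-1}\nabla_E:u^nHC^-_*(F)\to u^{n-2}HC^-_*(F)$ is an even connection in the $u$-direction: it is additive and $\nabla_{\partial_u}(fa)=\partial_u(f)a+f\nabla_{\partial_u}a$. 4. Suppose $\nabla^F$ is flat on $HC^-_*(F)$. Then $\nabla$ is flat on all $u^nHC^-_*(F)$ and $[\nabla_{\partial_u},\nabla_v]=0$ for all $v$. If also $HC^-_*(F)$ is a free, finitely generated $\mathbb Z/2$-graded $R[[u]]$-module, then $(HC^-_*(F),\nabla,Gr)$ is an Euler-graded T-structure: a free, finitely generated graded $R[[u]]$-module with a flat even connection $\nabla$ and an Euler grading $Gr$ as in 3. -/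

import Mathlib

open scoped PowerSeries

namespace RelCyc

noncomputable section

/-! ### Super-commutative algebras and their derivations -/

/-- The sign `(-1)^i`. -/
def sgn (i : ZMod 2) : ℤ := if i = 0 then 1 else -1

section Super

variable {K R : Type*} [Field K] [Ring R] [Algebra K R]
variable (𝓡 : ZMod 2 → Submodule K R)

/-- Graded commutativity `r s = (-1)^{|r||s|} s r`. -/
def IsSuperComm : Prop :=
  ∀ (i j : ZMod 2) (r s : R), r ∈ 𝓡 i → s ∈ 𝓡 j → r * s = sgn (i * j) • (s * r)

/-- The linear map `r ↦ (-1)^{i|r|} r`. -/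
def twist [GradedAlgebra 𝓡] (i : ZMod 2) : R →ₗ[K] R :=
  if i = 0 then LinearMap.id else GradedAlgebra.proj 𝓡 0 - GradedAlgebra.proj 𝓡 1

/-- The `K`-linear graded derivations of `R` of parity `i`:
`v (r s) = v r * s + (-1)^{i|r|} r * v s`. -/
def superDer [GradedAlgebra 𝓡] (i : ZMod 2) : Submodule K (R →ₗ[K] R) where
  carrier := {v | (∀ (j : ZMod 2) (r : R), r ∈ 𝓡 j → v r ∈ 𝓡 (i + j)) ∧
    ∀ r s : R, v (r * s) = v r * s + twist 𝓡 i r * v s}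
  add_mem' := by
    rintro v w ⟨hv, hv'⟩ ⟨hw, hw'⟩
    refine ⟨fun j r hr => add_mem (hv j r hr) (hw j r hr), fun r s => ?_⟩
    simp only [LinearMap.add_apply, hv', hw', add_mul, mul_add]
    abel
  zero_mem' := ⟨fun j r _ => by simp, fun r s => by simp⟩
  smul_mem' := by
    rintro c v ⟨hv, hv'⟩
    refine ⟨fun j r hr => (𝓡 (i + j)).smul_mem c (hv j r hr), fun r s => ?_⟩
    simp only [LinearMap.smul_apply, hv', smul_add, smul_mul_assoc, mul_smul_comm]

/-- The graded commutator `[v, w] = v w - (-1)^{ij} w v` of maps of parities `i` and `j`. -/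
def superBracket (i j : ZMod 2) (v w : R →ₗ[K] R) : R →ₗ[K] R :=
  v ∘ₗ w - sgn (i * j) • (w ∘ₗ v)

variable [GradedAlgebra 𝓡]

theorem twist_of_mem (i j : ZMod 2) (r : R) (hr : r ∈ 𝓡 j) :
    twist 𝓡 i r = sgn (i * j) • r := by
  have h01 : ∀ k : ZMod 2, k = 0 ∨ k = 1 := by decide
  rcases h01 i with rfl | rfl
  · simp [twist, sgn]
  · rcases h01 j with rfl | rfl
    · simp [twist, sgn, GradedAlgebra.proj_apply, DirectSum.decompose_of_mem_same 𝓡 hr,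
        DirectSum.decompose_of_mem_ne 𝓡 hr (show (0 : ZMod 2) ≠ 1 by decide)]
    · simp [twist, sgn, GradedAlgebra.proj_apply, DirectSum.decompose_of_mem_same 𝓡 hr,
        DirectSum.decompose_of_mem_ne 𝓡 hr (show (1 : ZMod 2) ≠ 0 by decide)]

theorem sgn_add (i j : ZMod 2) : sgn (i + j) = sgn i * sgn j := by
  revert i j; decide

theorem twist_mul (i : ZMod 2) (r s : R) :
    twist 𝓡 i (r * s) = twist 𝓡 i r * twist 𝓡 i s := by
  induction r using DirectSum.Decomposition.inductionOn 𝓡 with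
  | zero => simp
  | add a b ha hb => simp only [add_mul, map_add, ha, hb]
  | @homogeneous j a =>
    induction s using DirectSum.Decomposition.inductionOn 𝓡 with
    | zero => simp
    | add c d hc hd => simp only [mul_add, map_add, hc, hd]
    | @homogeneous k b =>
      rw [twist_of_mem 𝓡 i (j + k) _ (SetLike.mul_mem_graded a.2 b.2),
        twist_of_mem 𝓡 i j _ a.2, twist_of_mem 𝓡 i k _ b.2, mul_add, sgn_add,
        smul_mul_smul_comm]

theorem twist_twist (i : ZMod 2) (r : R) : twist 𝓡 i (twist 𝓡 i r) = r := by
  induction r using DirectSum.Decomposition.inductionOn 𝓡 with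
  | zero => simp
  | add a b ha hb => simp only [map_add, ha, hb]
  | @homogeneous j a =>
    rw [twist_of_mem 𝓡 i j _ a.2, map_zsmul, twist_of_mem 𝓡 i j _ a.2, smul_smul]
    have h : ∀ k : ZMod 2, sgn k * sgn k = 1 := by decide
    rw [h, one_smul]

/-- The map on a free module that sends `r x`, for `x` in the basis, to `(-1)^{i|r|} r φ(x)`. -/
def superExt {X M : Type*} [AddCommGroup M] [Module R M] (i : ZMod 2) (φ : X → M) :
    (X →₀ R) →+ M :=
  Finsupp.liftAddHom fun x =>
    ((smulAddHom R M).flip (φ x)).comp (twist 𝓡 i).toAddMonoidHom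

theorem superExt_smul {X M : Type*} [AddCommGroup M] [Module R M] (i : ZMod 2) (φ : X → M)
    (r : R) (a : X →₀ R) : superExt 𝓡 i φ (r • a) = twist 𝓡 i r • superExt 𝓡 i φ a := by
  induction a using Finsupp.induction_linear with
  | zero => simp
  | add a b ha hb => rw [smul_add, map_add, map_add, smul_add, ha, hb]
  | single x s =>
    rw [Finsupp.smul_single, superExt, Finsupp.liftAddHom_apply_single,
      Finsupp.liftAddHom_apply_single]
    show twist 𝓡 i (r • s) • φ x = twist 𝓡 i r • twist 𝓡 i s • φ x
    rw [smul_eq_mul, twist_mul, mul_smul]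

/-- The action of `v : R → R` on the coefficients of an element of a free module. -/
def coeffMap {X : Type*} (v : R →ₗ[K] R) : (X →₀ R) →+ (X →₀ R) :=
  Finsupp.mapRange.addMonoidHom v.toAddMonoidHom

end Super

/-! ### Graded quivers with units, tensors of morphisms -/

/-- Sum over all ways to cut a list into two consecutive, possibly empty, pieces. -/
def splitSum {B M : Type*} [AddCommMonoid M] (l : List B) (f : List B → List B → M) : M :=
  ∑ i ∈ Finset.range (l.length + 1), f (l.take i) (l.drop i)

/-- Homogeneous bases of all the morphism spaces of a category with objects `Ob`, containing the
identity morphisms. The space `hom X Y` is the free `R`-module on the `x` with `src x = X` and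
`tgt x = Y`; the sum of all of them is `B →₀ R`. -/
structure HomBasis.{w, o} (Ob : Type o) where
  B : Type w
  src : B → Ob
  tgt : B → Ob
  /-- The degree `|x|`. -/
  deg : B → ZMod 2
  /-- The identity morphism of an object. -/
  unit : Ob → B
  src_unit : ∀ X, src (unit X) = X
  tgt_unit : ∀ X, tgt (unit X) = X
  deg_unit : ∀ X, deg (unit X) = 0

namespace HomBasis

universe w o
variable {Ob : Type o} (Q : HomBasis.{w, o} Ob)

/-- The reduced degree `|x|' = |x| - 1`. -/
def rdeg (x : Q.B) : ZMod 2 := Q.deg x + 1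

/-- `ε(x₁, …, xₖ) = |x₁|' + ⋯ + |xₖ|'`. -/
def eps (l : List Q.B) : ZMod 2 := (l.map Q.rdeg).sum

/-- The list is a composable sequence of morphisms from `X` to `Y`. -/
def IsPath : Ob → List Q.B → Ob → Prop
  | X, [], Y => X = Y
  | X, x :: l, Y => Q.src x = X ∧ IsPath (Q.tgt x) l Y

section Tensors

variable {K R : Type*} [Field K] [Ring R] [Algebra K R]
variable (𝓡 : ZMod 2 → Submodule K R) [GradedAlgebra 𝓡]

/-- Concatenation of tensors: `(r w) (s w') = (-1)^{ε(w)|s|} (r s) (w w')`. A tensor of shifted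
morphisms is an `R`-combination of words in the basis. -/
def cat (s t : List Q.B →₀ R) : List Q.B →₀ R :=
  s.sum fun w f => t.sum fun w' g => Finsupp.single (w ++ w') (f * twist 𝓡 (Q.eps w) g)

/-- The concatenation of several tensors. -/
def cats (ts : List (List Q.B →₀ R)) : List Q.B →₀ R :=
  ts.foldr (Q.cat 𝓡) (Finsupp.single [] 1)

/-- A word as a tensor. -/
def word (l : List Q.B) : List Q.B →₀ R := Finsupp.single l 1

/-- A morphism as a tensor of length one. -/
def toTen (a : Q.B →₀ R) : List Q.B →₀ R := Finsupp.mapDomain (fun x => [x]) a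

end Tensors

/-- The words `x₀[x₁|…|xₖ]` that form a basis of the normalised Hochschild chains: cyclically
composable, with no identity morphism among `x₁, …, xₖ`. The word is stored as `x₀ :: [x₁, …, xₖ]`. -/
def IsHochWord (w : List Q.B) : Prop :=
  w ≠ [] ∧ (∃ X, Q.IsPath X w X) ∧ ∀ x ∈ w.tail, ∀ X, x ≠ Q.unit X

/-- Normalised Hochschild chains `CC_*`. -/
abbrev CC (R : Type*) [Ring R] : Type _ := {w : List Q.B // Q.IsHochWord w} →₀ R

/-- The class of a tensor in the normalised chains: words with an identity morphism behind the
first entry are zero. -/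
def toCC {R : Type*} [Ring R] (t : List Q.B →₀ R) : Q.CC R := t.subtypeDomain Q.IsHochWord

/-- The degree `|x₀| + |x₁|' + ⋯ + |xₖ|'` of `x₀[x₁|…|xₖ]`. -/
def chainDeg (w : List Q.B) : ZMod 2 := Q.eps w + 1

section Chains

variable {K R : Type*} [Field K] [Ring R] [Algebra K R]
variable (𝓡 : ZMod 2 → Submodule K R) [GradedAlgebra 𝓡]

/-- The operator of parity `i` on chains with the given values `φ x₀ [x₁, …, xₖ]` on words. -/
def chainOp {Ob' : Type*} {Q' : HomBasis Ob'} (i : ZMod 2)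
    (φ : Q.B → List Q.B → (List Q'.B →₀ R)) : Q.CC R →+ Q'.CC R :=
  superExt 𝓡 i fun w => match w.1 with
    | [] => 0
    | x :: l => Q'.toCC (φ x l)

theorem chainOp_smul {Ob' : Type*} {Q' : HomBasis Ob'} (i : ZMod 2)
    (φ : Q.B → List Q.B → (List Q'.B →₀ R)) (r : R) (a : Q.CC R) :
    Q.chainOp 𝓡 i φ (r • a) = twist 𝓡 i r • Q.chainOp 𝓡 i φ a :=
  superExt_smul 𝓡 i _ r a

/-- The sign involution `α ↦ (-1)^{|α|} α`. -/
def signInv : Q.CC R →+ Q.CC R :=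
  superExt 𝓡 1 fun w => sgn (Q.chainDeg w.1) • Finsupp.single w 1

/-- The chains of parity `j`. -/
def chainPar (j : ZMod 2) : Set (Q.CC R) := {a | ∀ w, a w ∈ 𝓡 (j + Q.chainDeg w.1)}

end Chains

end HomBasis

/-! ### Laurent series in `u` -/

/-- Laurent series in `u` with coefficients in `V`. -/
def Lau (R V : Type*) [Ring R] [AddCommGroup V] [Module R V] : Type _ := HahnModule ℤ R V

namespace Lau

variable {R V V' : Type*} [Ring R] [AddCommGroup V] [Module R V] [AddCommGroup V'] [Module R V']

instance : AddCommGroup (Lau R V) := inferInstanceAs (AddCommGroup (HahnModule ℤ R V))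

instance instLaurent : Module (HahnSeries ℤ R) (Lau R V) :=
  inferInstanceAs (Module (HahnSeries ℤ R) (HahnModule ℤ R V))

/-- The `R[[u]]`-module structure. -/
instance instPower : Module R⟦X⟧ (Lau R V) :=
  Module.compHom _ (HahnSeries.ofPowerSeries ℤ R)

/-- The coefficient of `u^n`. -/
def coeff (a : Lau R V) (n : ℤ) : V := ((HahnModule.of R).symm a : HahnSeries ℤ V).coeff n

@[ext] theorem ext {a b : Lau R V} (h : ∀ n, a.coeff n = b.coeff n) : a = b :=
  HahnModule.ext a b (funext h)

theorem coeff_zero (n : ℤ) : (0 : Lau R V).coeff n = 0 := rfl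
theorem coeff_add (a b : Lau R V) (n : ℤ) : (a + b).coeff n = a.coeff n + b.coeff n := rfl

/-- An additive map acting on the coefficients. -/
def map (T : V →+ V') : Lau R V →+ Lau R V' where
  toFun a := HahnModule.of R (((HahnModule.of R).symm a : HahnSeries ℤ V).map T)
  map_zero' := by
    apply Lau.ext; intro n; exact map_zero T
  map_add' a b := by
    apply Lau.ext; intro n; exact map_add T _ _

theorem coeff_map (T : V →+ V') (a : Lau R V) (n : ℤ) : (map T a).coeff n = T (a.coeff n) := rfl

/-- Multiplication by `u^k`. -/
def uPow (k : ℤ) : Lau R V →+ Lau R V :=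
  DistribSMul.toAddMonoidHom (Lau R V) (HahnSeries.single k (1 : R))

/-- The operator `u ∂/∂u`. -/
def uDu : Lau R V →+ Lau R V where
  toFun a := HahnModule.of R
    { coeff := fun n => n • a.coeff n
      isPWO_support' := ((HahnModule.of R).symm a : HahnSeries ℤ V).isPWO_support.mono (by
        intro n hn h0
        apply hn
        show n • a.coeff n = 0
        rw [show a.coeff n = 0 from h0, smul_zero]) }
  map_zero' := by
    apply Lau.ext; intro n; exact smul_zero n
  map_add' a b := by
    apply Lau.ext; intro n; exact smul_add n _ _

theorem coeff_smul (f : R⟦X⟧) (a : Lau R V) (n : ℤ) :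
    (f • a).coeff n = ∑ p ∈ Finset.VAddAntidiagonal n
      (Set.VAddAntidiagonal.finite_of_isPWO (HahnSeries.ofPowerSeries ℤ R f).isPWO_support
        ((HahnModule.of R).symm a).isPWO_support n),
      (HahnSeries.ofPowerSeries ℤ R f).coeff p.1 • ((HahnModule.of R).symm a).coeff p.2 :=
  rfl

theorem coeff_ofPowerSeries_neg (f : R⟦X⟧) {k : ℤ} (hk : k < 0) :
    (HahnSeries.ofPowerSeries ℤ R f).coeff k = 0 := by
  rw [HahnSeries.ofPowerSeries_apply]
  apply HahnSeries.embDomain_of_notMem_range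
  rintro ⟨m, hm⟩
  have : (m : ℤ) = k := hm
  omega

/-- A map `σ` applied to the coefficients of a power series. -/
def coeffwise (σ : R →+ R) (f : R⟦X⟧) : R⟦X⟧ := PowerSeries.mk fun n => σ (PowerSeries.coeff n f)

theorem coeff_ofPowerSeries_coeffwise (σ : R →+ R) (f : R⟦X⟧) (k : ℤ) :
    (HahnSeries.ofPowerSeries ℤ R (coeffwise σ f)).coeff k =
      σ ((HahnSeries.ofPowerSeries ℤ R f).coeff k) := by
  rcases lt_or_ge k 0 with hk | hk
  · rw [coeff_ofPowerSeries_neg _ hk, coeff_ofPowerSeries_neg _ hk, map_zero]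
  · lift k to ℕ using hk
    rw [HahnSeries.ofPowerSeries_apply_coeff, HahnSeries.ofPowerSeries_apply_coeff, coeffwise,
      PowerSeries.coeff_mk]

theorem map_smul (σ : R →+ R) (T : V →+ V') (h : ∀ (r : R) (x : V), T (r • x) = σ r • T x)
    (f : R⟦X⟧) (a : Lau R V) : map T (f • a) = coeffwise σ f • map T a := by
  apply Lau.ext
  intro n
  rw [coeff_map, coeff_smul, map_sum]
  have e1 := HahnModule.coeff_smul_left (x := HahnSeries.ofPowerSeries ℤ R (coeffwise σ f))
    (y := (map T a : HahnModule ℤ R V')) (a := n)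
    (HahnSeries.ofPowerSeries ℤ R f).isPWO_support (by
      intro k hk h0
      apply hk
      rw [coeff_ofPowerSeries_coeffwise, h0, map_zero])
  have e2 : (coeffwise σ f • map T a : Lau R V').coeff n = _ := e1
  rw [e2]
  symm
  apply Finset.sum_subset_zero_on_sdiff
  · intro p hp
    rw [Finset.mem_vaddAntidiagonal] at hp ⊢
    refine ⟨hp.1, fun h0 => hp.2.1 ?_, hp.2.2⟩
    show T (a.coeff p.2) = 0
    rw [show a.coeff p.2 = 0 from h0, map_zero]
  · intro p hp
    rw [Finset.mem_sdiff, Finset.mem_vaddAntidiagonal, Finset.mem_vaddAntidiagonal] at hp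
    have : T (a.coeff p.2) = 0 := by
      by_contra hne
      exact hp.2 ⟨hp.1.1, hne, hp.1.2.2⟩
    rw [h]
    show _ • T (a.coeff p.2) = 0
    rw [this, smul_zero]
  · intro p hp
    rw [h, coeff_ofPowerSeries_coeffwise]
    rfl

theorem uPow_smul (k : ℤ) (f : R⟦X⟧) (a : Lau R V) : uPow k (f • a) = f • uPow k a := by
  show HahnSeries.single k (1 : R) • (HahnSeries.ofPowerSeries ℤ R f • a) =
    HahnSeries.ofPowerSeries ℤ R f • (HahnSeries.single k (1 : R) • a)
  rw [smul_smul, smul_smul]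
  congr 1
  ext n
  obtain ⟨m, rfl⟩ : ∃ m, n = m + k := ⟨n - k, by ring⟩
  rw [HahnSeries.coeff_mul_single_add, HahnSeries.coeff_single_mul_add, one_mul, mul_one]

theorem coeff_uPow (k : ℤ) (a : Lau R V) (n : ℤ) : (uPow k a).coeff (n + k) = a.coeff n := by
  have h := HahnModule.coeff_single_smul_vadd (r := (1 : R)) (x := (a : HahnModule ℤ R V))
    (a := n) (b := k)
  rw [one_smul, vadd_eq_add, add_comm k n] at h
  exact h

theorem map_uPow (k : ℤ) (T : V →+ V') (a : Lau R V) : map T (uPow k a) = uPow k (map T a) := by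
  apply Lau.ext
  intro n
  obtain ⟨m, rfl⟩ : ∃ m, n = m + k := ⟨n - k, by ring⟩
  rw [coeff_map, coeff_uPow, coeff_uPow, coeff_map]

/-- The `R[[u]]`-submodule of series `∑ i ≥ n, aᵢ uⁱ`. -/
def level (n : ℤ) : Submodule R⟦X⟧ (Lau R V) where
  carrier := {a | ∀ i < n, a.coeff i = 0}
  add_mem' ha hb i hi := by rw [coeff_add, ha i hi, hb i hi, add_zero]
  zero_mem' i _ := rfl
  smul_mem' f a ha i hi := by
    rw [coeff_smul]
    refine Finset.sum_eq_zero fun p hp => ?_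
    rw [Finset.mem_vaddAntidiagonal] at hp
    obtain ⟨h1, h2, h3⟩ := hp
    rw [vadd_eq_add] at h3
    have h0 : 0 ≤ p.1 := by
      by_contra hneg
      exact h1 (coeff_ofPowerSeries_neg f (not_le.mp hneg))
    have : (a.coeff p.2) = 0 := ha _ (by omega)
    rw [show ((HahnModule.of R).symm a).coeff p.2 = 0 from this, smul_zero]

end Lau

/-! ### A-infinity categories and functors -/

section AInf

universe w o w' o'
variable {K R : Type*} [Field K] [Ring R] [Algebra K R]
variable (𝓡 : ZMod 2 → Submodule K R) [GradedAlgebra 𝓡]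

/-- A strictly unital, uncurved, `R`-linear A-infinity category, with `ℤ/2`-graded morphism spaces
that are free over `R` with a given homogeneous basis containing the identity morphisms.
`m [x₁, …, xₖ]` is `𝔪ₖ(x₁, …, xₖ)`; `𝔪` has reduced degree one and is extended to all tensors
`R`-multilinearly with Koszul signs by `superExt 𝓡 1 m`. -/
structure AInfCat (Ob : Type o) extends HomBasis.{w, o} Ob where
  m : List B → (B →₀ R)
  m_nil : m [] = 0
  m_path : ∀ l y, m l y ≠ 0 → toHomBasis.IsPath (src y) l (tgt y)
  m_deg : ∀ l y, m l y ∈ 𝓡 (toHomBasis.eps l + 1 + toHomBasis.rdeg y)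
  /-- `∑ (-1)^{ε(l₁)} 𝔪(l₁, 𝔪(l₂), l₃) = 0`. -/
  ainf : ∀ l, splitSum l (fun l₁ r => splitSum r fun l₂ l₃ =>
    sgn (toHomBasis.eps l₁) • superExt 𝓡 1 m
      (toHomBasis.cats 𝓡 [toHomBasis.word l₁, toHomBasis.toTen (m l₂), toHomBasis.word l₃])) = 0
  m_unit_left : ∀ x, m [unit (src x), x] = Finsupp.single x 1
  m_unit_right : ∀ x, m [x, unit (tgt x)] = sgn (deg x) • Finsupp.single x 1
  m_unit_mem : ∀ (l : List B) (X : Ob), unit X ∈ l → l.length ≠ 2 → m l = 0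

variable {𝓡}

namespace AInfCat

variable {Ob : Type o} (C : AInfCat.{w, o} 𝓡 Ob)

/-- `𝔪` on tensors. -/
def mT (t : List C.B →₀ R) : C.B →₀ R := superExt 𝓡 1 C.m t

/-- `v(𝔪)` on words: the derivation `v` acts on the coefficients with respect to the bases. -/
def vm (v : R →ₗ[K] R) (l : List C.B) : C.B →₀ R := coeffMap v (C.m l)

/-- The tensor `𝐞` of length one for the identity of the object at which the composable word
`l, x` starts. -/
def unitAt (l : List C.B) (x : C.B) : List C.B →₀ R := C.word [C.unit (C.src (l.headD x))]

/-- The Hochschild differential: the sum of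
`(-1)^{|x|' + ε₁} x[l₁|𝔪(l₂)|l₃]` and `(-1)^{ε₃ (|x|' + ε₁ + ε₂)} 𝔪(l₃, x, l₁)[l₂]`. -/
def b : C.CC R →+ C.CC R :=
  C.chainOp 𝓡 1 fun x l => splitSum l fun l₁ r => splitSum r fun l₂ l₃ =>
    sgn (C.rdeg x + C.eps l₁) •
      C.cats 𝓡 [C.word (x :: l₁), C.toTen (C.m l₂), C.word l₃] +
    sgn (C.eps l₃ * (C.rdeg x + C.eps l₁ + C.eps l₂)) •
      C.cats 𝓡 [C.toTen (C.m (l₃ ++ x :: l₁)), C.word l₂]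

/-- The Connes operator, the sum of `(-1)^{ε₂ (|x|' + ε₁)} 𝐞[l₂|x|l₁]`. -/
def connesB : C.CC R →+ C.CC R :=
  C.chainOp 𝓡 1 fun x l => splitSum l fun l₁ l₂ =>
    sgn (C.eps l₂ * (C.rdeg x + C.eps l₁)) • C.cats 𝓡 [C.unitAt l₂ x, C.word (l₂ ++ x :: l₁)]

/-- `b^{1,1}(v(𝔪); -)`, the sum of `± 𝔪(l₃, v(𝔪)(l₄), l₅, x, l₁)[l₂]`. The sign is the Koszul sign
of the permutation of the inputs, of moving `v(𝔪)` behind `l₃` and of moving `v` behind `𝔪`. -/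
def b11 (i : ZMod 2) (v : R →ₗ[K] R) : C.CC R →+ C.CC R :=
  C.chainOp 𝓡 i fun x l => splitSum l fun l₁ r => splitSum r fun l₂ r => splitSum r fun l₃ r =>
    splitSum r fun l₄ l₅ =>
      sgn ((C.eps l₃ + C.eps l₄ + C.eps l₅) * (C.rdeg x + C.eps l₁ + C.eps l₂)
          + C.eps l₃ * (i + 1) + i) •
        C.cats 𝓡 [C.toTen (C.mT
          (C.cats 𝓡 [C.word l₃, C.toTen (C.vm v l₄), C.word (l₅ ++ x :: l₁)])), C.word l₂]

/-- `B^{1,1}(v(𝔪); -)`, the sum of `± 𝐞[l₂|v(𝔪)(l₃)|l₄|x|l₁]`, with the Koszul sign. -/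
def B11 (i : ZMod 2) (v : R →ₗ[K] R) : C.CC R →+ C.CC R :=
  C.chainOp 𝓡 i fun x l => splitSum l fun l₁ r => splitSum r fun l₂ r => splitSum r fun l₃ l₄ =>
    sgn ((C.eps l₂ + C.eps l₃ + C.eps l₄) * (C.rdeg x + C.eps l₁) + C.eps l₂ * (i + 1) + i) •
      C.cats 𝓡 [C.unitAt (l₂ ++ l₃ ++ l₄) x, C.word l₂, C.toTen (C.vm v l₃),
        C.word (l₄ ++ x :: l₁)]

/-- Laurent series in `u` of Hochschild chains; the negative cyclic chains `CC^-_*` are the series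
without negative powers of `u`. -/
abbrev CCu : Type _ := Lau R (C.CC R)

/-- `d^- = b + u B`. -/
def dMinus : C.CCu →+ C.CCu := Lau.map C.b + (Lau.uPow 1).comp (Lau.map C.connesB)

/-- The Getzler-Gauss-Manin connection
`∇_v = v - u⁻¹ b^{1,1}(v(𝔪); -) - B^{1,1}(v(𝔪); -)` for `v` of parity `i`. -/
def nabla (i : ZMod 2) (v : R →ₗ[K] R) : C.CCu →+ C.CCu :=
  Lau.map (coeffMap v) - (Lau.uPow (-1)).comp (Lau.map (C.b11 i v)) - Lau.map (C.B11 i v)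

end AInfCat

/-- A unital (strictly unital, uncurved) `R`-linear A-infinity functor. `F [x₁, …, xₖ]` is
`F^k(x₁, …, xₖ)`; it has reduced degree zero and is extended `R`-multilinearly by
`superExt 𝓡 0 F`. -/
structure AInfFun {Ob : Type o} {Ob' : Type o'} (C : AInfCat.{w, o} 𝓡 Ob)
    (D : AInfCat.{w', o'} 𝓡 Ob') where
  obj : Ob → Ob'
  F : List C.B → (D.B →₀ R)
  F_nil : F [] = 0
  F_path : ∀ l y, F l y ≠ 0 → ∃ X Y, C.IsPath X l Y ∧ D.src y = obj X ∧ D.tgt y = obj Y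
  F_deg : ∀ l y, F l y ∈ 𝓡 (C.eps l + D.rdeg y)
  /-- `∑ (-1)^{ε(l₁)} F(l₁, 𝔪(l₂), l₃) = ∑ 𝔪(F(l¹), …, F(lʳ))`, the second sum over all ways to cut
  `l` into consecutive nonempty pieces. -/
  ainf : ∀ l X Y, C.IsPath X l Y →
    splitSum l (fun l₁ r => splitSum r fun l₂ l₃ =>
      sgn (C.eps l₁) • superExt 𝓡 0 F
        (C.cats 𝓡 [C.word l₁, C.toTen (C.m l₂), C.word l₃])) =
    ∑ c : Composition l.length,
      D.mT (D.cats 𝓡 ((l.splitWrtComposition c).map fun p => D.toTen (F p)))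
  F_unit : ∀ X, F [C.unit X] = Finsupp.single (D.unit (obj X)) 1
  F_unit_mem : ∀ (l : List C.B) (X : Ob), C.unit X ∈ l → l.length ≠ 1 → F l = 0

namespace AInfFun

variable {Ob : Type o} {Ob' : Type o'} {C : AInfCat.{w, o} 𝓡 Ob} {D : AInfCat.{w', o'} 𝓡 Ob'}
variable (F : AInfFun C D)

/-- `F` on tensors. -/
def FT (t : List C.B →₀ R) : D.B →₀ R := superExt 𝓡 0 F.F t

/-- `F(l)` as a tensor of length one. -/
def one (l : List C.B) : List D.B →₀ R := D.toTen (F.F l)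

/-- `v(F)(l)` as a tensor of length one. -/
def vone (v : R →ₗ[K] R) (l : List C.B) : List D.B →₀ R := D.toTen (coeffMap v (F.F l))

/-- `∑ F(l¹) ⊗ ⋯ ⊗ F(lʳ)` over all ways to cut `l` into consecutive nonempty pieces. -/
def bar (l : List C.B) : List D.B →₀ R :=
  ∑ c : Composition l.length, D.cats 𝓡 ((l.splitWrtComposition c).map F.one)

/-- `F_* : CC_*(C) → CC_*(D)`, the sum of `± F(l₃, x, l₁)[F(…)|…|F(…)]`. -/
def push : C.CC R →+ D.CC R :=
  C.chainOp (Q' := D.toHomBasis) 𝓡 0 fun x l => splitSum l fun l₁ r => splitSum r fun l₂ l₃ =>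
    sgn (C.eps l₃ * (C.rdeg x + C.eps l₁ + C.eps l₂)) •
      D.cats 𝓡 [F.one (l₃ ++ x :: l₁), F.bar l₂]

/-- `H¹_v`, the sum of `± F(l₃, v(𝔪_C)(l₄), l₅, x, l₁)[F(…)|…|F(…)]`. -/
def H1 (i : ZMod 2) (v : R →ₗ[K] R) : C.CC R →+ D.CC R :=
  C.chainOp (Q' := D.toHomBasis) 𝓡 (i + 1) fun x l => splitSum l fun l₁ r =>
    splitSum r fun l₂ r => splitSum r fun l₃ r => splitSum r fun l₄ l₅ =>
      sgn ((C.eps l₃ + C.eps l₄ + C.eps l₅) * (C.rdeg x + C.eps l₁ + C.eps l₂)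
          + C.eps l₃ * (i + 1)) •
        D.cats 𝓡 [D.toTen (F.FT
          (C.cats 𝓡 [C.word l₃, C.toTen (C.vm v l₄), C.word (l₅ ++ x :: l₁)])), F.bar l₂]

/-- `H²_v`, the sum of
`± 𝔪_D(F(…), …, v(F)(l₅), F(…), …, F(l₇, x, l₁), F(…), …)[F(…)|…]`; the pieces of `l₄`, `l₆`, `l₂`,
`l₃` fill the four groups of dots, and the sign includes those of moving `v` behind `𝔪_D` and
behind `l₄`. -/
def H2 (i : ZMod 2) (v : R →ₗ[K] R) : C.CC R →+ D.CC R :=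
  C.chainOp (Q' := D.toHomBasis) 𝓡 (i + 1) fun x l => splitSum l fun l₁ r =>
    splitSum r fun l₂ r => splitSum r fun l₃ r => splitSum r fun l₄ r => splitSum r fun l₅ r =>
    splitSum r fun l₆ l₇ =>
      sgn ((C.eps l₄ + C.eps l₅ + C.eps l₆ + C.eps l₇) *
            (C.rdeg x + C.eps l₁ + C.eps l₂ + C.eps l₃) + C.eps l₄ * i + i) •
        D.cats 𝓡 [D.toTen (D.mT (D.cats 𝓡
          [F.bar l₄, F.vone v l₅, F.bar l₆, F.one (l₇ ++ x :: l₁), F.bar l₂])), F.bar l₃]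

/-- `H³_v`, the sum of `± 𝐞[F(…)|…|v(F)(l₄)|F(…)|…|F(l₆, x, l₁)|F(…)|…]`; the pieces of `l₃`, `l₅`,
`l₂` fill the three groups of dots, and the sign includes those of moving `v` behind `𝐞` and
behind `l₃`. -/
def H3 (i : ZMod 2) (v : R →ₗ[K] R) : C.CC R →+ D.CC R :=
  C.chainOp (Q' := D.toHomBasis) 𝓡 (i + 1) fun x l => splitSum l fun l₁ r =>
    splitSum r fun l₂ r => splitSum r fun l₃ r => splitSum r fun l₄ r => splitSum r fun l₅ l₆ =>
      sgn ((C.eps l₃ + C.eps l₄ + C.eps l₅ + C.eps l₆) * (C.rdeg x + C.eps l₁ + C.eps l₂)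
          + C.eps l₃ * i + i) •
        D.cats 𝓡 [D.word [D.unit (F.obj (C.src ((l₃ ++ l₄ ++ l₅ ++ l₆).headD x)))],
          F.bar l₃, F.vone v l₄, F.bar l₅, F.one (l₆ ++ x :: l₁), F.bar l₂]

/-- The homotopy `H_v = u⁻¹ (H²_v - H¹_v) + H³_v`. -/
def H (i : ZMod 2) (v : R →ₗ[K] R) : C.CCu →+ D.CCu :=
  (Lau.uPow (-1)).comp (Lau.map (F.H2 i v - F.H1 i v)) + Lau.map (F.H3 i v)

/-! ### The cone complex -/

/-- Pairs `(α, β)` of Laurent series of chains of `C` and `D`. -/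
abbrev Cone (_F : AInfFun C D) : Type _ := C.CCu × D.CCu

/-- `d_F^-(α, β) = (d^- α, d^- β + (-1)^{|α|} F_* α)`. -/
def dCone : F.Cone →+ F.Cone :=
  (C.dMinus.comp (AddMonoidHom.fst _ _)).prod
    (D.dMinus.comp (AddMonoidHom.snd _ _) +
      ((Lau.map F.push).comp (Lau.map (C.signInv 𝓡))).comp (AddMonoidHom.fst _ _))

/-- `∇^F_v(α, β) = (∇_v α, ∇_v β + (-1)^{|α|'} H_v α)`, where `|α|' = |α| - 1`. -/
def nablaCone (i : ZMod 2) (v : R →ₗ[K] R) : F.Cone →+ F.Cone :=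
  ((C.nabla i v).comp (AddMonoidHom.fst _ _)).prod
    ((D.nabla i v).comp (AddMonoidHom.snd _ _) -
      ((F.H i v).comp (Lau.map (C.signInv 𝓡))).comp (AddMonoidHom.fst _ _))

/-- `u^n CC^-_*(F)`. -/
def level (n : ℤ) : Submodule R⟦X⟧ F.Cone := (Lau.level n).prod (Lau.level n)

/-- The elements of `CC^-_*(F)[u⁻¹]` of parity `j`; the first summand is shifted by one. -/
def conePar (j : ZMod 2) : Set F.Cone :=
  {a | (∀ n, a.1.coeff n ∈ C.chainPar 𝓡 (j + 1)) ∧ ∀ n, a.2.coeff n ∈ D.chainPar 𝓡 j}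

/-- The map `(-1)^{|f|} f` on power series. -/
def sigma (f : R⟦X⟧) : R⟦X⟧ := Lau.coeffwise (twist 𝓡 1).toAddMonoidHom f

theorem signInv_smul {Ob : Type*} (Q : HomBasis Ob) (r : R) (a : Q.CC R) :
    Q.signInv 𝓡 (r • a) = twist 𝓡 1 r • Q.signInv 𝓡 a :=
  superExt_smul 𝓡 1 _ r a

theorem dMinus_smul {Ob : Type*} (A : AInfCat 𝓡 Ob) (f : R⟦X⟧) (a : A.CCu) :
    A.dMinus (f • a) = sigma (𝓡 := 𝓡) f • A.dMinus a := by
  have h1 := Lau.map_smul (twist 𝓡 1).toAddMonoidHom A.b (fun r x => A.chainOp_smul 𝓡 1 _ r x) f a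
  have h2 := Lau.map_smul (twist 𝓡 1).toAddMonoidHom A.connesB
    (fun r x => A.chainOp_smul 𝓡 1 _ r x) f a
  simp only [AInfCat.dMinus, AddMonoidHom.add_apply, AddMonoidHom.comp_apply, h1, h2, sigma,
    smul_add, Lau.uPow_smul]

theorem coeffwise_id (f : R⟦X⟧) : Lau.coeffwise (AddMonoidHom.id R) f = f := by
  ext n
  simp [Lau.coeffwise]

theorem dCone_smul (f : R⟦X⟧) (a : F.Cone) :
    F.dCone (f • a) = sigma (𝓡 := 𝓡) f • F.dCone a := by
  have h1 := Lau.map_smul (twist 𝓡 1).toAddMonoidHom (C.signInv 𝓡)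
    (fun r x => signInv_smul C.toHomBasis r x) f a.1
  have h2 : ∀ (g : R⟦X⟧) (x : C.CCu), Lau.map F.push (g • x) = g • Lau.map F.push x := by
    intro g x
    have := Lau.map_smul (AddMonoidHom.id R) F.push (fun r y => by
      have := C.chainOp_smul (Q' := D.toHomBasis) 𝓡 0 (fun x l => splitSum l fun l₁ r =>
        splitSum r fun l₂ l₃ =>
          sgn (C.eps l₃ * (C.rdeg x + C.eps l₁ + C.eps l₂)) •
            D.cats 𝓡 [F.one (l₃ ++ x :: l₁), F.bar l₂]) r y
      exact this.trans (by simp [twist, push])) g x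
    rwa [coeffwise_id] at this
  refine Prod.ext ?_ ?_
  · exact dMinus_smul C f a.1
  · show D.dMinus (f • a.2) + Lau.map F.push (Lau.map (C.signInv 𝓡) (f • a.1)) =
      sigma (𝓡 := 𝓡) f • (D.dMinus a.2 + Lau.map F.push (Lau.map (C.signInv 𝓡) a.1))
    rw [dMinus_smul, h1, h2, smul_add]
    rfl

theorem sigma_sigma (f : R⟦X⟧) : sigma (𝓡 := 𝓡) (sigma (𝓡 := 𝓡) f) = f := by
  ext n
  simp only [sigma, Lau.coeffwise, PowerSeries.coeff_mk]
  exact twist_twist 𝓡 1 _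

/-- The cycles of `u^n CC^-_*(F)`. -/
def cycles (n : ℤ) : Submodule R⟦X⟧ F.Cone where
  carrier := {a | a ∈ F.level n ∧ F.dCone a = 0}
  add_mem' ha hb := ⟨add_mem ha.1 hb.1, by rw [map_add, ha.2, hb.2, add_zero]⟩
  zero_mem' := ⟨zero_mem _, map_zero _⟩
  smul_mem' f a ha := ⟨(F.level n).smul_mem f ha.1, by rw [dCone_smul, ha.2, smul_zero]⟩

/-- The boundaries of `u^n CC^-_*(F)`, as a submodule of the cycles. -/
def boundaries (n : ℤ) : Submodule R⟦X⟧ (F.cycles n) where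
  carrier := {a | ∃ c ∈ F.level n, F.dCone c = a.1}
  add_mem' := by
    rintro a b ⟨c, hc, hc'⟩ ⟨e, he, he'⟩
    exact ⟨c + e, add_mem hc he, by rw [map_add, hc', he']; rfl⟩
  zero_mem' := ⟨0, zero_mem _, map_zero _⟩
  smul_mem' := by
    rintro f a ⟨c, hc, hc'⟩
    refine ⟨sigma (𝓡 := 𝓡) f • c, (F.level n).smul_mem _ hc, ?_⟩
    rw [dCone_smul, sigma_sigma, hc']
    rfl

/-- `u^n HC^-_*(F)`, the homology of `u^n CC^-_*(F)`; relative negative cyclic homology is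
`F.HC 0`. -/
abbrev HC (n : ℤ) : Type _ := F.cycles n ⧸ F.boundaries n

/-- The class of a cycle. -/
def cls {n : ℤ} (a : F.Cone) (ha : a ∈ F.cycles n) : F.HC n := (F.boundaries n).mkQ ⟨a, ha⟩

/-- `φ` is the map on homology induced by the operator `T` on chains; in particular `T` maps cycles
to cycles. -/
def Induces {n k : ℤ} (T : F.Cone →+ F.Cone) (φ : F.HC n →+ F.HC k) : Prop :=
  ∀ (a : F.Cone) (ha : a ∈ F.cycles n), ∃ h : T a ∈ F.cycles k, φ (F.cls a ha) = F.cls (T a) h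

/-- The classes of parity `j`. -/
def HCpar (n : ℤ) (j : ZMod 2) : Set (F.HC n) :=
  {x | ∃ (a : F.Cone) (ha : a ∈ F.cycles n), a ∈ F.conePar j ∧ x = F.cls a ha}

/-- The map on homology induced by an `R[[u]]`-linear chain map. -/
def homMap {n k : ℤ} (T : F.Cone →ₗ[R⟦X⟧] F.Cone) (hd : ∀ a, F.dCone (T a) = T (F.dCone a))
    (hl : ∀ a ∈ F.level n, T a ∈ F.level k) : F.HC n →ₗ[R⟦X⟧] F.HC k :=
  Submodule.mapQ _ _
    (T.restrict (p := F.cycles n) (q := F.cycles k)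
      (fun a ha => ⟨hl a ha.1, by rw [hd, ha.2, map_zero]⟩))
    (by
      rintro a ⟨c, hc, hc'⟩
      exact ⟨T c, hl c hc, by rw [hd, hc']; rfl⟩)

/-- The map `u^n HC^-_*(F) → u^{n-1} HC^-_*(F)` induced by the inclusion. -/
def incl (n : ℤ) : F.HC n →ₗ[R⟦X⟧] F.HC (n - 1) :=
  F.homMap LinearMap.id (fun _ => rfl)
    (fun _ ha => ⟨fun i hi => ha.1 i (by omega), fun i hi => ha.2 i (by omega)⟩)

/-- Multiplication by `u⁻¹` on the cone. -/
def coneUInv : F.Cone →ₗ[R⟦X⟧] F.Cone where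
  toFun a := (Lau.uPow (-1) a.1, Lau.uPow (-1) a.2)
  map_add' a b := by
    refine Prod.ext ?_ ?_ <;> exact map_add _ _ _
  map_smul' f a := by
    refine Prod.ext ?_ ?_ <;> exact Lau.uPow_smul _ _ _

theorem dMinus_uPow {Ob : Type*} (A : AInfCat 𝓡 Ob) (k : ℤ) (a : A.CCu) :
    A.dMinus (Lau.uPow k a) = Lau.uPow k (A.dMinus a) := by
  have hc : ∀ x : A.CCu, Lau.uPow 1 (Lau.uPow k x) = Lau.uPow k (Lau.uPow 1 x) := by
    intro x
    apply Lau.ext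
    intro n
    obtain ⟨m, rfl⟩ : ∃ m, n = m + k + 1 := ⟨n - k - 1, by ring⟩
    rw [Lau.coeff_uPow, Lau.coeff_uPow, show m + k + 1 = m + 1 + k by ring, Lau.coeff_uPow,
      Lau.coeff_uPow]
  simp only [AInfCat.dMinus, AddMonoidHom.add_apply, AddMonoidHom.comp_apply, Lau.map_uPow,
    map_add, hc]

theorem level_uInv {V : Type*} [AddCommGroup V] [Module R V] {n : ℤ} {a : Lau R V}
    (ha : a ∈ Lau.level n) : Lau.uPow (-1) a ∈ Lau.level (V := V) (R := R) (n - 1) := by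
  intro i hi
  obtain ⟨j, rfl⟩ : ∃ j, i = j + -1 := ⟨i + 1, by ring⟩
  rw [Lau.coeff_uPow]
  exact ha j (by omega)

/-- Multiplication by `u⁻¹`, an isomorphism `u^n HC^-_*(F) → u^{n-1} HC^-_*(F)`. -/
def uInv (n : ℤ) : F.HC n →ₗ[R⟦X⟧] F.HC (n - 1) :=
  F.homMap F.coneUInv
    (fun a => by
      refine Prod.ext ?_ ?_
      · exact dMinus_uPow C (-1) a.1
      · show D.dMinus (Lau.uPow (-1) a.2) +
            Lau.map F.push (Lau.map (C.signInv 𝓡) (Lau.uPow (-1) a.1)) =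
          Lau.uPow (-1) (D.dMinus a.2 + Lau.map F.push (Lau.map (C.signInv 𝓡) a.1))
        rw [dMinus_uPow, Lau.map_uPow, Lau.map_uPow, map_add])
    (fun _ ha => ⟨level_uInv ha.1, level_uInv ha.2⟩)

end AInfFun

/-! ### Euler gradings -/

/-- An Euler grading with Euler vector field `E`. `gr x` is `Gr(x)` for `x` in the basis; on all
morphisms `Gr` is determined by `Gr(r x) = 2 E(r) x + r Gr(x)`, see `grHom`. -/
structure EulerGrading {Ob : Type o} (C : AInfCat.{w, o} 𝓡 Ob) (E : R →ₗ[K] R) where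
  gr : C.B → (C.B →₀ R)
  gr_ends : ∀ x y, gr x y ≠ 0 → C.src y = C.src x ∧ C.tgt y = C.tgt x
  gr_even : ∀ x y, gr x y ∈ 𝓡 (C.deg x + C.deg y)
  gr_unit : ∀ X, gr (C.unit X) = 0
  /-- `Gr ∘ 𝔪ₖ = 𝔪ₖ ∘ Gr + (2 - k) 𝔪ₖ`, where on the right `Gr` acts on the inputs one by one. -/
  gr_m : ∀ l : List C.B,
    coeffMap ((2 : ℤ) • E) (C.m l) + superExt 𝓡 0 gr (C.m l) =
      C.mT (splitSum l fun l₁ r => match r with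
        | [] => 0
        | x :: l₂ => C.cats 𝓡 [C.word l₁, C.toTen (gr x), C.word l₂]) +
      (2 - (l.length : ℤ)) • C.m l

namespace EulerGrading

variable {Ob : Type o} {C : AInfCat.{w, o} 𝓡 Ob} {E : R →ₗ[K] R} (g : EulerGrading C E)

/-- `Gr` on morphisms: `Gr(r x) = 2 E(r) x + r Gr(x)`. -/
def grHom : (C.B →₀ R) →+ (C.B →₀ R) := coeffMap ((2 : ℤ) • E) + superExt 𝓡 0 g.gr

/-- `Gr` acting on the entries of a word one by one. -/
def grWord (l : List C.B) : List C.B →₀ R :=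
  splitSum l fun l₁ r => match r with
    | [] => 0
    | x :: l₂ => C.cats 𝓡 [C.word l₁, C.toTen (g.gr x), C.word l₂]

/-- `𝓛_{Gr} + Γ` on Hochschild chains: `Gr` acts on every entry, and on coefficients by `2E`;
`Γ` is multiplication by `-k` on `x₀[x₁|…|xₖ]`. -/
def grChain : C.CC R →+ C.CC R :=
  coeffMap ((2 : ℤ) • E) + superExt 𝓡 0 fun w =>
    C.toCC (g.grWord w.1) - ((w.1.length : ℤ) - 1) • Finsupp.single w 1

/-- `Gr^- = 𝓛_{Gr} + Γ + 2u ∂/∂u`. -/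
def grMinus : C.CCu →+ C.CCu := Lau.map g.grChain + (2 : ℤ) • Lau.uDu

/-- The derivations of `R` act on morphisms coefficientwise, and `Gr` is compatible with this
action: `Gr(v(a)) - v(Gr(a)) = [2E, v](a)`. -/
def Compatible : Prop :=
  ∀ (i : ZMod 2), ∀ v ∈ superDer 𝓡 i, ∀ a : C.B →₀ R,
    g.grHom (coeffMap v a) - coeffMap v (g.grHom a) =
      coeffMap (superBracket 0 i ((2 : ℤ) • E) v) a

end EulerGrading

namespace AInfFun

variable {Ob : Type o} {Ob' : Type o'} {C : AInfCat.{w, o} 𝓡 Ob} {D : AInfCat.{w', o'} 𝓡 Ob'}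
variable (F : AInfFun C D) {E : R →ₗ[K] R} (gC : EulerGrading C E) (gD : EulerGrading D E)

/-- `Gr_D ∘ F^k = F^k ∘ Gr_C + (1 - k) F^k`. -/
def IsEulerGraded : Prop :=
  ∀ l : List C.B,
    gD.grHom (F.F l) = F.FT (gC.grWord l) + (1 - (l.length : ℤ)) • F.F l

/-- `Gr^-_F(α, β) = (Gr^- α - α, Gr^- β)`. -/
def grCone : F.Cone →+ F.Cone :=
  ((gC.grMinus - AddMonoidHom.id _).comp (AddMonoidHom.fst _ _)).prod
    (gD.grMinus.comp (AddMonoidHom.snd _ _))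

/-- `f ↦ v(f)` on power series, `v` acting on the coefficients. -/
def derU (v : R →ₗ[K] R) (f : R⟦X⟧) : R⟦X⟧ := Lau.coeffwise v.toAddMonoidHom f

/-- `f ↦ ∂f/∂u` on power series. -/
def duU (f : R⟦X⟧) : R⟦X⟧ :=
  PowerSeries.mk fun n => ((n : R) + 1) * PowerSeries.coeff (n + 1) f

/-- The relative connection is flat on `HC^-_*(F)`:
`∇_v ∇_w - (-1)^{|v||w|} ∇_w ∇_v = ∇_{[v, w]}` as maps from `HC^-_*(F)` to `u⁻² HC^-_*(F)`. -/
def NablaFlat : Prop :=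
  ∀ (i j : ZMod 2), ∀ v ∈ superDer 𝓡 i, ∀ w ∈ superDer 𝓡 j, ∀ a ∈ F.cycles 0,
    ∃ c ∈ F.level (-2), F.dCone c =
      F.nablaCone i v (F.nablaCone j w a) - sgn (i * j) • F.nablaCone j w (F.nablaCone i v a) -
        F.nablaCone (i + j) (superBracket i j v w) a

/-- `HC^-_*(F)` is a free and finitely generated `ℤ/2`-graded `R[[u]]`-module. -/
def HCFree : Prop :=
  ∃ (r : ℕ) (β : Module.Basis (Fin r) R⟦X⟧ (F.HC 0)), ∀ k, ∃ j, β k ∈ F.HCpar 0 j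

/-- The family `nabla` is an even connection `Der_K R ⊗ HC^-_*(F) → u⁻¹ HC^-_*(F)`, extended to all
`u^n HC^-_*(F)`. -/
structure IsConnection
    (nabla : ∀ (n : ℤ), ZMod 2 → (R →ₗ[K] R) → (F.HC n →+ F.HC (n - 1))) : Prop where
  add : ∀ n i, ∀ v ∈ superDer 𝓡 i, ∀ w ∈ superDer 𝓡 i, nabla n i (v + w) = nabla n i v + nabla n i w
  smul : ∀ n i j, ∀ v ∈ superDer 𝓡 i, ∀ r ∈ 𝓡 j, ∀ a,
    nabla n (j + i) (LinearMap.mulLeft K r ∘ₗ v) a = PowerSeries.C r • nabla n i v a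
  even : ∀ n i j, ∀ v ∈ superDer 𝓡 i, ∀ a ∈ F.HCpar n j, nabla n i v a ∈ F.HCpar (n - 1) (i + j)
  leibniz : ∀ n i, ∀ v ∈ superDer 𝓡 i, ∀ (f : R⟦X⟧) (a : F.HC n),
    nabla n i v (f • a) =
      derU v f • F.incl n a + derU (twist 𝓡 i) f • nabla n i v a

/-- The connection is flat. -/
def IsFlat (nabla : ∀ (n : ℤ), ZMod 2 → (R →ₗ[K] R) → (F.HC n →+ F.HC (n - 1))) : Prop :=
  ∀ n i j, ∀ v ∈ superDer 𝓡 i, ∀ w ∈ superDer 𝓡 j, ∀ a,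
    nabla (n - 1) i v (nabla n j w a) - sgn (i * j) • nabla (n - 1) j w (nabla n i v a) =
      F.incl (n - 1) (nabla n (i + j) (superBracket i j v w) a)

/-- `gr` is an Euler grading of the connection `nabla` with Euler vector field `E`: an even map with
`Gr(f a) = (2u ∂_u + 2E)(f) a + f Gr(a)` and `[Gr, ∇_v] = ∇_{[2E, v]}`. -/
structure IsEulerGradingOf (E : R →ₗ[K] R)
    (nabla : ∀ (n : ℤ), ZMod 2 → (R →ₗ[K] R) → (F.HC n →+ F.HC (n - 1)))
    (gr : ∀ n : ℤ, F.HC n →+ F.HC n) : Prop where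
  even : ∀ n j, ∀ a ∈ F.HCpar n j, gr n a ∈ F.HCpar n j
  leibniz : ∀ n (f : R⟦X⟧) (a : F.HC n),
    gr n (f • a) =
      ((2 : ℤ) • (PowerSeries.X * duU f) + (2 : ℤ) • derU E f) • a + f • gr n a
  comm : ∀ n i, ∀ v ∈ superDer 𝓡 i, ∀ a,
    gr (n - 1) (nabla n i v a) - nabla n i v (gr n a) =
      nabla n i (superBracket 0 i ((2 : ℤ) • E) v) a

/-- `(nabla, gr)` is an Euler-graded T-structure on `HC^-_*(F)`. -/
structure IsEulerGradedTStructure (E : R →ₗ[K] R)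
    (nabla : ∀ (n : ℤ), ZMod 2 → (R →ₗ[K] R) → (F.HC n →+ F.HC (n - 1)))
    (gr : ∀ n : ℤ, F.HC n →+ F.HC n) : Prop where
  free : F.HCFree
  connection : F.IsConnection nabla
  flat : F.IsFlat nabla
  euler : F.IsEulerGradingOf E nabla gr

/-- The canonical connection in the `u`-direction, `∇_{∂_u} = Gr / (2u) - u⁻¹ ∇_E`. -/
def canonicalU (E : R →ₗ[K] R)
    (nabla : ∀ (n : ℤ), ZMod 2 → (R →ₗ[K] R) → (F.HC n →+ F.HC (n - 1)))
    (gr : ∀ n : ℤ, F.HC n →+ F.HC n) (n : ℤ) (a : F.HC n) : F.HC (n - 1 - 1) :=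
  PowerSeries.C (algebraMap K R 2⁻¹) • F.incl (n - 1) (F.uInv n (gr n a)) -
    F.uInv (n - 1) (nabla n 0 E a)

/-- `D` is an even connection in the `u`-direction, with a pole of order two. -/
structure IsUConnection (D : ∀ n : ℤ, F.HC n → F.HC (n - 1 - 1)) : Prop where
  add : ∀ n a a', D n (a + a') = D n a + D n a'
  even : ∀ n j, ∀ a ∈ F.HCpar n j, D n a ∈ F.HCpar (n - 1 - 1) j
  leibniz : ∀ n (f : R⟦X⟧) a,
    D n (f • a) = duU f • F.incl (n - 1) (F.incl n a) + f • D n a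

/-- `[∇_{∂_u}, ∇_v] = 0` for all `v`. -/
def UCommutes (nabla : ∀ (n : ℤ), ZMod 2 → (R →ₗ[K] R) → (F.HC n →+ F.HC (n - 1)))
    (D : ∀ n : ℤ, F.HC n → F.HC (n - 1 - 1)) : Prop :=
  ∀ n i, ∀ v ∈ superDer 𝓡 i, ∀ a : F.HC n,
    D (n - 1) (nabla n i v a) = nabla (n - 1 - 1) i v (D n a)

end AInfFun

end AInf

end

end RelCyc

namespace RelCyc

noncomputable section

set_option linter.unusedSectionVars false

open Finsupp (supported single_mem_supported)

/-! ### Signs -/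

theorem sgn_zero : sgn 0 = 1 := rfl

theorem sgn_one : sgn 1 = -1 := rfl

theorem sgn_mul_self (i : ZMod 2) : sgn i * sgn i = 1 := by
  revert i; decide

theorem zmod_two_mul_self (i : ZMod 2) : i * i = i := by
  revert i; decide

theorem sgn_smul_sgn_smul {M : Type*} [AddCommGroup M] (i j : ZMod 2) (x : M) :
    sgn i • sgn j • x = sgn (i + j) • x := by
  rw [smul_smul, sgn_add]

theorem sgn_smul_self {M : Type*} [AddCommGroup M] (i : ZMod 2) (x : M) :
    sgn i • sgn i • x = x := by
  rw [smul_smul, sgn_mul_self, one_smul]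

theorem sgn_add_one_smul {M : Type*} [AddCommGroup M] (i : ZMod 2) (x : M) :
    sgn (i + 1) • x = -(sgn i • x) := by
  rw [sgn_add, sgn_one, mul_neg_one, neg_smul]

theorem sgn_smul_congr {M : Type*} [AddCommGroup M] {i j : ZMod 2} {x y : M} (h : i = j)
    (h' : x = y) : sgn i • x = sgn j • y := by
  rw [h, h']

/-! ### Sums over cuts of a list -/

section SplitSum

variable {B M M' : Type*} [AddCommGroup M] [AddCommGroup M']

theorem splitSum_nil (f : List B → List B → M) : splitSum [] f = f [] [] := by
  simp [splitSum]

theorem splitSum_cons (x : B) (l : List B) (f : List B → List B → M) :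
    splitSum (x :: l) f = f [] (x :: l) + splitSum l fun a b => f (x :: a) b := by
  simp only [splitSum, List.length_cons]
  rw [Finset.sum_range_succ']
  simp [add_comm]

theorem splitSum_congr {l : List B} {f g : List B → List B → M}
    (h : ∀ a b, a ++ b = l → f a b = g a b) : splitSum l f = splitSum l g :=
  Finset.sum_congr rfl fun i _ => h _ _ (List.take_append_drop i l)

theorem splitSum_zero (l : List B) : splitSum l (fun _ _ => (0 : M)) = 0 := by
  simp [splitSum]

theorem splitSum_eq_zero {l : List B} {f : List B → List B → M}
    (h : ∀ a b, a ++ b = l → f a b = 0) : splitSum l f = 0 :=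
  (splitSum_congr h).trans (splitSum_zero l)

theorem splitSum_add (l : List B) (f g : List B → List B → M) :
    splitSum l (fun a b => f a b + g a b) = splitSum l f + splitSum l g :=
  Finset.sum_add_distrib

theorem splitSum_neg (l : List B) (f : List B → List B → M) :
    splitSum l (fun a b => -f a b) = -splitSum l f :=
  Finset.sum_neg_distrib _

theorem splitSum_zsmul (l : List B) (n : ℤ) (f : List B → List B → M) :
    splitSum l (fun a b => n • f a b) = n • splitSum l f :=
  Finset.smul_sum.symm

theorem map_splitSum {F : Type*} [FunLike F M M'] [AddMonoidHomClass F M M'] (T : F)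
    (l : List B) (f : List B → List B → M) :
    T (splitSum l f) = splitSum l fun a b => T (f a b) :=
  map_sum T _ _

theorem splitSum_apply (T : List B → List B → M →+ M') (l : List B) (x : M) :
    (splitSum l T) x = splitSum l fun a b => T a b x := by
  simp [splitSum, AddMonoidHom.finsetSum_apply]

theorem splitSum_comm {B' : Type*} (l : List B) (l' : List B')
    (f : List B → List B → List B' → List B' → M) :
    splitSum l (fun a b => splitSum l' fun c d => f a b c d) =
      splitSum l' fun c d => splitSum l fun a b => f a b c d :=
  Finset.sum_comm

theorem splitSum_assoc (l : List B) (f : List B → List B → List B → M) :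
    splitSum l (fun r c => splitSum r fun a b => f a b c) =
      splitSum l (fun a r => splitSum r fun b c => f a b c) := by
  induction l generalizing f with
  | nil => simp only [splitSum_nil]
  | cons x l ih =>
    simp only [splitSum_cons, splitSum_nil, splitSum_add, add_assoc]
    rw [ih fun a b c => f (x :: a) b c]

theorem splitSum_append (l : List B) (x : B) (l' : List B) (f : List B → List B → M) :
    splitSum (l ++ x :: l') f =
      splitSum l (fun a b => f a (b ++ x :: l')) +
        splitSum l' fun a b => f (l ++ x :: a) b := by
  induction l generalizing f with
  | nil => rw [List.nil_append, splitSum_cons, splitSum_nil]; rfl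
  | cons y l ih =>
    rw [List.cons_append, splitSum_cons, ih, splitSum_cons, add_assoc]
    rfl

theorem splitSum_eq_left {l : List B} {f : List B → List B → M}
    (h : ∀ a b, a ++ b = l → a ≠ [] → f a b = 0) : splitSum l f = f [] l := by
  cases l with
  | nil => exact splitSum_nil f
  | cons _ l =>
    rw [splitSum_cons, splitSum_eq_zero (fun a b hab => h _ _ (by rw [List.cons_append, hab])
      (List.cons_ne_nil _ _)), add_zero]

theorem splitSum_eq_right {l : List B} {f : List B → List B → M}
    (h : ∀ a b, a ++ b = l → b ≠ [] → f a b = 0) : splitSum l f = f l [] := by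
  induction l generalizing f with
  | nil => exact splitSum_nil f
  | cons x l ih =>
    rw [splitSum_cons, h [] (x :: l) rfl (List.cons_ne_nil _ _), zero_add]
    exact ih fun a b hab hb => h _ _ (by rw [List.cons_append, hab]) hb

theorem splitSum_concat (l : List B) (y : B) (f : List B → List B → M) :
    splitSum (l ++ [y]) f = splitSum l (fun a b => f a (b ++ [y])) + f (l ++ [y]) [] := by
  rw [splitSum_append, splitSum_nil]

theorem splitSum_double (l : List B) (f g : List B → List B → M) (n : ℤ) :
    splitSum l (fun a b => f a b + n • g a b) = splitSum l f + n • splitSum l g := by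
  rw [splitSum_add, splitSum_zsmul]

end SplitSum

/-! ### Parities and superlinear maps -/

/-- A type whose elements have a parity. -/
class Par (X : Type*) where
  par : X → ZMod 2

namespace HomBasis

variable {Ob : Type*} (Q : HomBasis Ob)

instance : Par (List Q.B) := ⟨Q.eps⟩

instance : Par Q.B := ⟨Q.rdeg⟩

theorem eps_nil : Q.eps [] = 0 := rfl

theorem eps_cons (x : Q.B) (l : List Q.B) : Q.eps (x :: l) = Q.rdeg x + Q.eps l := by
  simp [eps]

theorem eps_append (l l' : List Q.B) : Q.eps (l ++ l') = Q.eps l + Q.eps l' := by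
  simp [eps]

end HomBasis

instance {X Y : Type*} [Par X] [Par Y] : Par (X × Y) := ⟨fun p => Par.par p.1 + Par.par p.2⟩

open Par

section SuperLinear

variable {K R : Type*} [Field K] [Ring R] [Algebra K R]
variable (𝓡 : ZMod 2 → Submodule K R)

/-- The elements of parity `j` of a free module with homogeneous basis. -/
def parSub {X : Type*} [Par X] (j : ZMod 2) : AddSubgroup (X →₀ R) where
  carrier := {a | ∀ x, a x ∈ 𝓡 (j + par x)}
  add_mem' ha hb x := add_mem (ha x) (hb x)
  zero_mem' _ := zero_mem _
  neg_mem' ha x := neg_mem (ha x)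

/-- A family of elements `f x` of parity `i + |x|`. -/
def HomF {X Y : Type*} [Par X] [Par Y] (i : ZMod 2) (f : X → (Y →₀ R)) : Prop :=
  ∀ x, f x ∈ parSub 𝓡 (i + par x)

variable [GradedAlgebra 𝓡]

theorem twist_zero (r : R) : twist 𝓡 0 r = r := rfl

theorem twist_add (i j : ZMod 2) (r : R) : twist 𝓡 (i + j) r = twist 𝓡 i (twist 𝓡 j r) := by
  induction r using DirectSum.Decomposition.inductionOn 𝓡 with
  | zero => simp
  | add a b ha hb => simp only [map_add, ha, hb]
  | @homogeneous k a =>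
    rw [twist_of_mem 𝓡 _ k _ a.2, twist_of_mem 𝓡 j k _ a.2, map_zsmul, twist_of_mem 𝓡 i k _ a.2,
      smul_smul, add_mul, sgn_add, mul_comm]

theorem twist_mem (i j : ZMod 2) (r : R) (h : r ∈ 𝓡 j) : twist 𝓡 i r ∈ 𝓡 j := by
  rw [twist_of_mem 𝓡 i j r h]
  exact zsmul_mem h _

theorem twist_one (i : ZMod 2) : twist 𝓡 i 1 = 1 := by
  rw [twist_of_mem 𝓡 i 0 1 (SetLike.one_mem_graded 𝓡), mul_zero, sgn_zero, one_smul]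

theorem superComm_swap (hR : IsSuperComm 𝓡) {i j : ZMod 2} {r s : R} (hr : r ∈ 𝓡 i) (hs : s ∈ 𝓡 j) :
    r * s = sgn (i * j) • (s * r) := hR i j r s hr hs

theorem mul_eq_twist_mul (hR : IsSuperComm 𝓡) {i : ZMod 2} {r : R} (hr : r ∈ 𝓡 i) (s : R) :
    r * s = twist 𝓡 i s * r := by
  induction s using DirectSum.Decomposition.inductionOn 𝓡 with
  | zero => simp
  | add a b ha hb => simp only [mul_add, map_add, add_mul, ha, hb]
  | @homogeneous k a =>
    rw [twist_of_mem 𝓡 i k _ a.2, hR i k r a hr a.2, smul_mul_assoc]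

section Ext

variable {X Y Z M M' : Type*} [AddCommGroup M] [Module R M] [AddCommGroup M'] [Module R M']

theorem superExt_single (i : ZMod 2) (f : X → M) (x : X) (r : R) :
    superExt 𝓡 i f (Finsupp.single x r) = twist 𝓡 i r • f x := by
  rw [superExt, Finsupp.liftAddHom_apply_single]
  rfl

theorem superExt_single_one (i : ZMod 2) (f : X → M) (x : X) :
    superExt 𝓡 i f (Finsupp.single x 1) = f x := by
  rw [superExt_single, twist_one, one_smul]

theorem superExt_comp (i j : ZMod 2) (f : X → (Y →₀ R)) (g : Y → M) (a : X →₀ R) :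
    superExt 𝓡 j g (superExt 𝓡 i f a) = superExt 𝓡 (j + i) (fun x => superExt 𝓡 j g (f x)) a := by
  induction a using Finsupp.induction_linear with
  | zero => simp
  | add a b ha hb => simp only [map_add, ha, hb]
  | single x r => rw [superExt_single, superExt_single, superExt_smul, twist_add]

theorem superExt_add_fun (i : ZMod 2) (f g : X → M) (a : X →₀ R) :
    superExt 𝓡 i (fun x => f x + g x) a = superExt 𝓡 i f a + superExt 𝓡 i g a := by
  induction a using Finsupp.induction_linear with
  | zero => simp
  | add a b ha hb => simp only [map_add, ha, hb]; abel
  | single x r => simp only [superExt_single, smul_add]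

theorem superExt_zsmul_fun (i : ZMod 2) (n : ℤ) (f : X → M) (a : X →₀ R) :
    superExt 𝓡 i (fun x => n • f x) a = n • superExt 𝓡 i f a := by
  induction a using Finsupp.induction_linear with
  | zero => simp
  | add a b ha hb => simp only [map_add, ha, hb, smul_add]
  | single x r => rw [superExt_single, superExt_single, smul_comm]

theorem superExt_sub_fun (i : ZMod 2) (f g : X → M) (a : X →₀ R) :
    superExt 𝓡 i (fun x => f x - g x) a = superExt 𝓡 i f a - superExt 𝓡 i g a := by
  induction a using Finsupp.induction_linear with
  | zero => simp
  | add a b ha hb => simp only [map_add, ha, hb]; abel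
  | single x r => simp only [superExt_single, smul_sub]

theorem superExt_zero_fun (i : ZMod 2) (a : X →₀ R) :
    superExt 𝓡 i (fun _ => (0 : M)) a = 0 := by
  induction a using Finsupp.induction_linear with
  | zero => simp
  | add a b ha hb => simp only [map_add, ha, hb, add_zero]
  | single x r => rw [superExt_single, smul_zero]

theorem superExt_basis (a : X →₀ R) :
    superExt 𝓡 0 (fun x => Finsupp.single x (1 : R)) a = a := by
  induction a using Finsupp.induction_linear with
  | zero => simp
  | add a b ha hb => simp only [map_add, ha, hb]
  | single x r => rw [superExt_single, twist_zero]; simp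

theorem superExt_mem_supported (i : ZMod 2) {S : Set X} {N : Submodule R M} {f : X → M}
    (hf : ∀ x ∈ S, f x ∈ N) {a : X →₀ R} (ha : a ∈ supported R R S) :
    superExt 𝓡 i f a ∈ N := by
  rw [superExt, Finsupp.liftAddHom_apply]
  refine sum_mem fun x hx => N.smul_mem _ (hf x (ha hx))

theorem superExt_congr_supported (i : ZMod 2) {S : Set X} {f g : X → M}
    (hf : ∀ x ∈ S, f x = g x) {a : X →₀ R} (ha : a ∈ supported R R S) :
    superExt 𝓡 i f a = superExt 𝓡 i g a := by
  rw [superExt, superExt, Finsupp.liftAddHom_apply, Finsupp.liftAddHom_apply]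
  refine Finset.sum_congr rfl fun x hx => ?_
  show twist 𝓡 i (a x) • f x = twist 𝓡 i (a x) • g x
  rw [hf x (ha hx)]

end Ext

section Parity

variable {X Y Z : Type*} [Par X] [Par Y] [Par Z]

theorem smul_mem_parSub {i j : ZMod 2} {r : R} (hr : r ∈ 𝓡 i) {a : X →₀ R}
    (ha : a ∈ parSub 𝓡 j) : r • a ∈ parSub 𝓡 (i + j) := fun x => by
  rw [Finsupp.smul_apply, smul_eq_mul, add_assoc]
  exact SetLike.mul_mem_graded hr (ha x)

theorem single_mem_parSub (x : X) : Finsupp.single x (1 : R) ∈ parSub 𝓡 (par x) := fun y => by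
  by_cases h : x = y
  · subst h
    rw [Finsupp.single_eq_same, CharTwo.add_self_eq_zero]
    exact SetLike.one_mem_graded 𝓡
  · rw [Finsupp.single_eq_of_ne' h]
    exact zero_mem _

theorem single_mem_parSub' {i : ZMod 2} {r : R} {x : X} (h : r ∈ 𝓡 (i + par x)) :
    Finsupp.single x r ∈ parSub 𝓡 i := fun y => by
  by_cases h' : x = y
  · subst h'
    rwa [Finsupp.single_eq_same]
  · rw [Finsupp.single_eq_of_ne' h']
    exact zero_mem _

theorem parSub_induction {i : ZMod 2} (P : (X →₀ R) → Prop) (h0 : P 0)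
    (hadd : ∀ a b, P a → P b → P (a + b))
    (hs : ∀ x r, r ∈ 𝓡 (i + par x) → P (Finsupp.single x r)) {a : X →₀ R}
    (ha : a ∈ parSub 𝓡 i) : P a := by
  rw [← Finsupp.sum_single a]
  exact Finset.sum_induction _ P hadd h0 fun x _ => hs x _ (ha x)

theorem superExt_mem_parSub {i j : ZMod 2} {f : X → (Y →₀ R)} (hf : HomF 𝓡 i f) {a : X →₀ R}
    (ha : a ∈ parSub 𝓡 j) : superExt 𝓡 i f a ∈ parSub 𝓡 (i + j) := by
  refine parSub_induction 𝓡 (fun a => superExt 𝓡 i f a ∈ parSub 𝓡 (i + j))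
    (by rw [map_zero]; exact zero_mem _) (fun a b ha hb => by rw [map_add]; exact add_mem ha hb) (fun x r hr => ?_) ha
  rw [superExt_single]
  have := smul_mem_parSub 𝓡 (twist_mem 𝓡 i _ r hr) (hf x)
  rwa [show j + par x + (i + par x) = i + j by grind] at this

theorem HomF.comp {i j : ZMod 2} {f : X → (Y →₀ R)} {g : Y → (Z →₀ R)} (hf : HomF 𝓡 i f)
    (hg : HomF 𝓡 j g) : HomF 𝓡 (j + i) fun x => superExt 𝓡 j g (f x) := fun x => by
  rw [add_assoc]
  exact superExt_mem_parSub 𝓡 hg (hf x)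

theorem homF_single : HomF 𝓡 0 fun x : X => Finsupp.single x (1 : R) := fun x => by
  rw [zero_add]
  exact single_mem_parSub 𝓡 x

end Parity

/-! ### Products of tensors -/

section Tm

variable {X Y Z W : Type*} [Par X] [Par Y] [Par Z] [Par W]

/-- The tensor product of elements of free modules. -/
def tm : (X →₀ R) →+ (Y →₀ R) →+ (X × Y →₀ R) :=
  Finsupp.liftAddHom fun x => AddMonoidHom.mk' (fun r => Finsupp.liftAddHom fun y =>
      (Finsupp.singleAddHom (x, y)).comp
        ((AddMonoidHom.mulLeft r).comp (twist 𝓡 (par x)).toAddMonoidHom))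
    (fun r r' => by
      refine Finsupp.addHom_ext fun y s => ?_
      simp [add_mul])

theorem tm_single_single (x : X) (y : Y) (r s : R) :
    tm 𝓡 (Finsupp.single x r) (Finsupp.single y s) =
      Finsupp.single (x, y) (r * twist 𝓡 (par x) s) := by
  simp [tm]

theorem tm_one_one (x : X) (y : Y) :
    tm 𝓡 (Finsupp.single x 1) (Finsupp.single y 1) = Finsupp.single (x, y) (1 : R) := by
  rw [tm_single_single, twist_one, mul_one]

theorem smul_tm (r : R) (a : X →₀ R) (b : Y →₀ R) : tm 𝓡 (r • a) b = r • tm 𝓡 a b := by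
  induction a using Finsupp.induction_linear with
  | zero => simp
  | add a a' ha ha' => simp only [smul_add, map_add, AddMonoidHom.add_apply, ha, ha']
  | single x s =>
    induction b using Finsupp.induction_linear with
    | zero => simp
    | add b b' hb hb' => simp only [smul_add, map_add, hb, hb']
    | single y t =>
      rw [Finsupp.smul_single, tm_single_single, tm_single_single, Finsupp.smul_single,
        smul_eq_mul, smul_eq_mul, mul_assoc]

theorem tm_smul (hR : IsSuperComm 𝓡) {i : ZMod 2} {a : X →₀ R} (ha : a ∈ parSub 𝓡 i) (r : R)
    (b : Y →₀ R) : tm 𝓡 a (r • b) = twist 𝓡 i r • tm 𝓡 a b := by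
  refine parSub_induction 𝓡 (fun a => tm 𝓡 a (r • b) = twist 𝓡 i r • tm 𝓡 a b) (by simp)
    (fun a a' ha ha' => by simp only [smul_add, map_add, AddMonoidHom.add_apply, ha, ha'])
    (fun x s hs => ?_) ha
  induction b using Finsupp.induction_linear with
  | zero => simp
  | add b b' hb hb' => simp only [smul_add, map_add, hb, hb']
  | single y t =>
    simp only [Finsupp.smul_single, tm_single_single, smul_eq_mul, twist_mul]
    rw [← mul_assoc, mul_eq_twist_mul 𝓡 hR hs, ← twist_add, mul_assoc,
      show i + par x + par x = i by grind]

theorem tm_mem_parSub {i j : ZMod 2} {a : X →₀ R} {b : Y →₀ R} (ha : a ∈ parSub 𝓡 i)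
    (hb : b ∈ parSub 𝓡 j) : tm 𝓡 a b ∈ parSub 𝓡 (i + j) := by
  refine parSub_induction 𝓡 (fun a => tm 𝓡 a b ∈ parSub 𝓡 (i + j))
    (by simp) (fun a a' ha ha' => by
    rw [map_add, AddMonoidHom.add_apply]; exact add_mem ha ha') (fun x r hr => ?_) ha
  refine parSub_induction 𝓡 (fun b => tm 𝓡 (Finsupp.single x r) b ∈ parSub 𝓡 (i + j))
    (by simp) (fun a a' ha ha' => by
    rw [map_add]; exact add_mem ha ha') (fun y s hs => ?_) hb
  rw [tm_single_single]
  refine single_mem_parSub' 𝓡 ?_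
  have := SetLike.mul_mem_graded hr (twist_mem 𝓡 (par x) _ s hs)
  show _ ∈ 𝓡 (i + j + (par x + par y))
  rwa [show i + j + (par x + par y) = i + par x + (j + par y) by ring]

/-- Exchange of the factors with the Koszul sign. -/
def rot (p : X × Y) : Y × X →₀ R := sgn (par p.1 * par p.2) • Finsupp.single (p.2, p.1) 1

theorem homF_rot : HomF 𝓡 0 (rot (R := R) (X := X) (Y := Y)) := fun p => by
  refine zsmul_mem ?_ _
  have := single_mem_parSub (R := R) 𝓡 (p.2, p.1)
  rwa [show (par (p.2, p.1) : ZMod 2) = 0 + par p by show _ + _ = 0 + (_ + _); ring] at this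

theorem rot_tm (hR : IsSuperComm 𝓡) {i j : ZMod 2} {a : X →₀ R} {b : Y →₀ R}
    (ha : a ∈ parSub 𝓡 i) (hb : b ∈ parSub 𝓡 j) :
    superExt 𝓡 0 rot (tm 𝓡 a b) = sgn (i * j) • tm 𝓡 b a := by
  refine parSub_induction 𝓡 (fun a => superExt 𝓡 0 rot (tm 𝓡 a b) = sgn (i * j) • tm 𝓡 b a)
    (by simp) (fun a a' ha ha' => by
    simp only [map_add, AddMonoidHom.add_apply, ha, ha', smul_add]) (fun x r hr => ?_) ha
  refine parSub_induction 𝓡 (fun b => superExt 𝓡 0 rot (tm 𝓡 (Finsupp.single x r) b) =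
    sgn (i * j) • tm 𝓡 b (Finsupp.single x r)) (by simp) (fun a a' ha ha' => by
    simp only [map_add, AddMonoidHom.add_apply, ha, ha', smul_add]) (fun y s hs => ?_) hb
  rw [tm_single_single, superExt_single, tm_single_single, twist_zero, rot,
    twist_of_mem 𝓡 _ _ _ hr, twist_of_mem 𝓡 _ _ _ hs, mul_smul_comm, mul_smul_comm,
    superComm_swap 𝓡 hR hr hs, smul_comm, Finsupp.smul_single, smul_eq_mul, mul_one,
    Finsupp.smul_single, Finsupp.smul_single]
  congr 1
  rw [sgn_smul_sgn_smul, sgn_smul_sgn_smul, sgn_smul_sgn_smul]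
  refine sgn_smul_congr ?_ rfl
  grind

end Tm

end SuperLinear

open Par

/-! ### The algebra and coalgebra of tensors -/

/-- A basis element. -/
abbrev wd {R X : Type*} [Ring R] (x : X) : X →₀ R := Finsupp.single x 1

section Tensors

variable {K R : Type*} [Field K] [Ring R] [Algebra K R]
variable (𝓡 : ZMod 2 → Submodule K R) [GradedAlgebra 𝓡]
variable {Ob Ob' Ob'' : Type*} {Q : HomBasis Ob} {Q' : HomBasis Ob'} {Q'' : HomBasis Ob''}

/-- Concatenation of a pair of words. -/
def app (p : List Q.B × List Q.B) : List Q.B →₀ R := wd (p.1 ++ p.2)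

/-- Concatenation of tensors as a biadditive map. -/
def catHom : (List Q.B →₀ R) →+ (List Q.B →₀ R) →+ (List Q.B →₀ R) :=
  (tm 𝓡).compr₂ (superExt 𝓡 0 app)

theorem catHom_apply (s t : List Q.B →₀ R) : (catHom 𝓡 s) t = superExt 𝓡 0 app (tm 𝓡 s t) := rfl

theorem cat_single_single (w w' : List Q.B) (r s : R) :
    catHom 𝓡 (Finsupp.single w r) (Finsupp.single w' s) =
      Finsupp.single (w ++ w') (r * twist 𝓡 (Q.eps w) s) := by
  rw [catHom_apply, tm_single_single, superExt_single, twist_zero, app, Finsupp.smul_single,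
    smul_eq_mul, mul_one]
  rfl

theorem wd_cat_wd (w w' : List Q.B) :
    catHom 𝓡 (wd w) (wd w') = (wd (w ++ w') : List Q.B →₀ R) := by
  rw [cat_single_single, twist_one, mul_one]

theorem cat_eq (s t : List Q.B →₀ R) : Q.cat 𝓡 s t = catHom 𝓡 s t := by
  have h : catHom 𝓡 s t = s.sum fun w f => t.sum fun w' g =>
      catHom 𝓡 (Finsupp.single w f) (Finsupp.single w' g) := by
    conv_lhs => rw [← Finsupp.sum_single s, ← Finsupp.sum_single t]
    simp only [Finsupp.sum, map_sum, AddMonoidHom.finsetSum_apply]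
    exact Finset.sum_comm
  rw [h, HomBasis.cat]
  simp only [cat_single_single]

theorem cat_zsmul (n : ℤ) (s t : List Q.B →₀ R) : catHom 𝓡 s (n • t) = n • catHom 𝓡 s t :=
  map_zsmul _ _ _

theorem zsmul_cat (n : ℤ) (s t : List Q.B →₀ R) : catHom 𝓡 (n • s) t = n • catHom 𝓡 s t := by
  rw [map_zsmul, AddMonoidHom.smul_apply]

theorem add_cat (s s' t : List Q.B →₀ R) :
    catHom 𝓡 (s + s') t = catHom 𝓡 s t + catHom 𝓡 s' t := by
  rw [map_add, AddMonoidHom.add_apply]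

theorem zero_cat (t : List Q.B →₀ R) : catHom 𝓡 0 t = 0 := by
  rw [map_zero, AddMonoidHom.zero_apply]

theorem zero_tm {X Y : Type*} [Par X] (t : Y →₀ R) : tm 𝓡 (0 : X →₀ R) t = 0 := by
  rw [map_zero, AddMonoidHom.zero_apply]

theorem add_tm {X Y : Type*} [Par X] (s s' : X →₀ R) (t : Y →₀ R) :
    tm 𝓡 (s + s') t = tm 𝓡 s t + tm 𝓡 s' t := by
  rw [map_add, AddMonoidHom.add_apply]

theorem splitSum_cat {B : Type*} (l : List B) (f : List B → List B → (List Q.B →₀ R))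
    (t : List Q.B →₀ R) :
    catHom 𝓡 (splitSum l f) t = splitSum l fun u v => catHom 𝓡 (f u v) t := by
  rw [map_splitSum, splitSum_apply]

theorem tm_splitSum {B X Y : Type*} [Par X] (l : List B) (f : List B → List B → (Y →₀ R))
    (t : X →₀ R) : tm 𝓡 t (splitSum l f) = splitSum l fun u v => tm 𝓡 t (f u v) :=
  map_splitSum _ _ _

theorem splitSum_tm {B X Y : Type*} [Par X] (l : List B) (f : List B → List B → (X →₀ R))
    (b : Y →₀ R) : tm 𝓡 (splitSum l f) b = splitSum l fun u v => tm 𝓡 (f u v) b := by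
  rw [map_splitSum, splitSum_apply]

theorem tm_zsmul {X Y : Type*} [Par X] (n : ℤ) (a : X →₀ R) (b : Y →₀ R) :
    tm 𝓡 a (n • b) = n • tm 𝓡 a b :=
  map_zsmul _ _ _

theorem zsmul_tm {X Y : Type*} [Par X] (n : ℤ) (a : X →₀ R) (b : Y →₀ R) :
    tm 𝓡 (n • a) b = n • tm 𝓡 a b := by
  rw [map_zsmul, AddMonoidHom.smul_apply]

theorem cat_splitSum {B : Type*} (l : List B) (f : List B → List B → (List Q.B →₀ R))
    (t : List Q.B →₀ R) :
    catHom 𝓡 t (splitSum l f) = splitSum l fun u v => catHom 𝓡 t (f u v) :=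
  map_splitSum _ _ _

theorem smul_cat (r : R) (s t : List Q.B →₀ R) : catHom 𝓡 (r • s) t = r • catHom 𝓡 s t := by
  rw [catHom_apply, catHom_apply, smul_tm, superExt_smul, twist_zero]

theorem cat_smul (hR : IsSuperComm 𝓡) {i : ZMod 2} {s : List Q.B →₀ R} (hs : s ∈ parSub 𝓡 i)
    (r : R) (t : List Q.B →₀ R) : catHom 𝓡 s (r • t) = twist 𝓡 i r • catHom 𝓡 s t := by
  rw [catHom_apply, catHom_apply, tm_smul 𝓡 hR hs, superExt_smul, twist_zero]

theorem homF_app : HomF 𝓡 0 (app (R := R) (Q := Q)) := fun p => by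
  rw [zero_add, show par p = par (p.1 ++ p.2) from (Q.eps_append _ _).symm]
  exact single_mem_parSub 𝓡 _

theorem cat_mem_parSub {i j : ZMod 2} {s t : List Q.B →₀ R} (hs : s ∈ parSub 𝓡 i)
    (ht : t ∈ parSub 𝓡 j) : catHom 𝓡 s t ∈ parSub 𝓡 (i + j) := by
  have := superExt_mem_parSub 𝓡 (homF_app 𝓡) (tm_mem_parSub 𝓡 hs ht)
  rwa [zero_add] at this

theorem one_cat (t : List Q.B →₀ R) : catHom 𝓡 (wd []) t = t := by
  induction t using Finsupp.induction_linear with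
  | zero => simp
  | add a b ha hb => rw [map_add, ha, hb]
  | single w r => rw [cat_single_single, Q.eps_nil, twist_zero, one_mul]; rfl

theorem cat_one (t : List Q.B →₀ R) : catHom 𝓡 t (wd []) = t := by
  induction t using Finsupp.induction_linear with
  | zero => simp
  | add a b ha hb => rw [add_cat, ha, hb]
  | single w r => rw [cat_single_single, twist_one, mul_one, List.append_nil]

theorem cat_assoc (s t u : List Q.B →₀ R) :
    catHom 𝓡 (catHom 𝓡 s t) u = catHom 𝓡 s (catHom 𝓡 t u) := by
  induction s using Finsupp.induction_linear with
  | zero => simp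
  | add a b ha hb => simp only [map_add, AddMonoidHom.add_apply, ha, hb]
  | single w r =>
    induction t using Finsupp.induction_linear with
    | zero => simp
    | add a b ha hb => simp only [map_add, AddMonoidHom.add_apply, ha, hb]
    | single w' r' =>
      induction u using Finsupp.induction_linear with
      | zero => simp
      | add a b ha hb => simp only [map_add, ha, hb]
      | single w'' r'' =>
        simp only [cat_single_single, List.append_assoc, Q.eps_append, twist_add, twist_mul,
          mul_assoc]

theorem wd_cons_eq (x : Q.B) (l : List Q.B) :
    (wd (x :: l) : List Q.B →₀ R) = catHom 𝓡 (wd [x]) (wd l) := by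
  rw [wd_cat_wd, List.singleton_append]

/-- A morphism as a tensor of length one. -/
def letH : (Q.B →₀ R) →+ (List Q.B →₀ R) := Finsupp.mapDomain.addMonoidHom fun x => [x]

theorem toTen_eq (a : Q.B →₀ R) : Q.toTen a = letH a := rfl

theorem letH_single (x : Q.B) (r : R) : letH (Finsupp.single x r) = Finsupp.single [x] r :=
  Finsupp.mapDomain_single

theorem letH_smul (r : R) (a : Q.B →₀ R) : letH (r • a) = r • letH a :=
  Finsupp.mapDomain_smul r a

theorem letH_mem_parSub {i : ZMod 2} {c : Q.B →₀ R} (hc : c ∈ parSub 𝓡 i) :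
    letH c ∈ parSub 𝓡 i := by
  refine parSub_induction 𝓡 (fun c => letH c ∈ parSub 𝓡 i) (by simp)
    (fun a b ha hb => by rw [map_add]; exact add_mem ha hb) (fun x r hr => ?_) hc
  rw [letH_single]
  refine single_mem_parSub' 𝓡 ?_
  rwa [show (par [x] : ZMod 2) = par x from by simp [par, HomBasis.eps]]

/-! ### Deconcatenation -/

/-- Deconcatenation of a word. -/
def deco (l : List Q.B) : List Q.B × List Q.B →₀ R := splitSum l fun a b => wd (a, b)

/-- Deconcatenation with nonempty first factor. -/
def decoP : List Q.B → (List Q.B × List Q.B →₀ R)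
  | [] => 0
  | x :: t => splitSum t fun a b => wd (x :: a, b)

theorem splitSum_mem {B M : Type*} [AddCommGroup M] {N : AddSubgroup M} {l : List B}
    {f : List B → List B → M} (h : ∀ a b, a ++ b = l → f a b ∈ N) : splitSum l f ∈ N :=
  sum_mem fun i _ => h _ _ (List.take_append_drop i l)

theorem homF_deco : HomF 𝓡 0 (deco (R := R) (Q := Q)) := fun l => by
  refine splitSum_mem fun a b hab => ?_
  subst hab
  rw [zero_add, show par (a ++ b) = par (a, b) from Q.eps_append _ _]
  exact single_mem_parSub 𝓡 _

theorem homF_decoP : HomF 𝓡 0 (decoP (R := R) (Q := Q)) := fun l => by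
  cases l with
  | nil => exact zero_mem _
  | cons x l =>
    refine splitSum_mem (f := fun a b => wd (x :: a, b)) fun a b hab => ?_
    subst hab
    rw [zero_add, ← List.cons_append, show par (x :: a ++ b) = par (x :: a, b) from
      Q.eps_append (x :: a) b]
    exact single_mem_parSub 𝓡 _

/-- Left multiplication on the first factor of a tensor product by an element of parity `σ`. -/
def lact (σ : ZMod 2) (s : List Q.B →₀ R) :
    (List Q.B × List Q.B →₀ R) →+ (List Q.B × List Q.B →₀ R) :=
  superExt 𝓡 σ fun p => tm 𝓡 (catHom 𝓡 s (wd p.1)) (wd p.2)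

theorem lact_tm (hR : IsSuperComm 𝓡) {σ : ZMod 2} {s : List Q.B →₀ R} (hs : s ∈ parSub 𝓡 σ)
    (a b : List Q.B →₀ R) : lact 𝓡 σ s (tm 𝓡 a b) = tm 𝓡 (catHom 𝓡 s a) b := by
  induction a using Finsupp.induction_linear with
  | zero => simp
  | add a a' ha ha' => simp only [map_add, AddMonoidHom.add_apply, ha, ha']
  | single u r =>
    induction b using Finsupp.induction_linear with
    | zero => simp
    | add b b' hb hb' => simp only [map_add, hb, hb']
    | single v t =>
      have hu : (Finsupp.single u r : List Q.B →₀ R) = r • wd u := by simp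
      have hv : (Finsupp.single v t : List Q.B →₀ R) = t • wd v := by simp
      rw [tm_single_single, lact, superExt_single, hu, cat_smul 𝓡 hR hs, smul_tm, hv,
        tm_smul 𝓡 hR (cat_mem_parSub 𝓡 hs (single_mem_parSub 𝓡 u)), smul_smul, twist_mul,
        ← twist_add]

theorem decoP_cat (hR : IsSuperComm 𝓡) {γ : ZMod 2} {c : Q.B →₀ R} (hc : c ∈ parSub 𝓡 γ)
    (b : List Q.B →₀ R) :
    superExt 𝓡 0 decoP (catHom 𝓡 (letH c) b) = lact 𝓡 γ (letH c) (superExt 𝓡 0 deco b) := by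
  induction b using Finsupp.induction_linear with
  | zero => simp
  | add b b' hb hb' => simp only [map_add, hb, hb']
  | single t s =>
    have ht : (Finsupp.single t s : List Q.B →₀ R) = s • wd t := by simp
    rw [ht, cat_smul 𝓡 hR (letH_mem_parSub 𝓡 hc), superExt_smul, superExt_smul, twist_zero,
      twist_zero, lact, superExt_smul, superExt_single_one, deco, map_splitSum]
    congr 1
    simp only [superExt_single_one]
    refine parSub_induction 𝓡 (fun c => superExt 𝓡 0 decoP (catHom 𝓡 (letH c) (wd t)) =
      splitSum t fun a b => tm 𝓡 (catHom 𝓡 (letH c) (wd a)) (wd b)) ?_ ?_ ?_ hc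
    · simp [splitSum_zero]
    · intro a b ha hb
      simp only [map_add, AddMonoidHom.add_apply, ha, hb, splitSum_add]
    · intro x r _
      rw [letH_single, cat_single_single, twist_one, mul_one, superExt_single, twist_zero,
        List.singleton_append, decoP, ← DistribSMul.toAddMonoidHom_apply _ r, map_splitSum]
      refine splitSum_congr fun a b _ => ?_
      rw [cat_single_single, twist_one, mul_one, tm_single_single, twist_one, mul_one,
        DistribSMul.toAddMonoidHom_apply]
      simp

theorem deco_letter_cat (hR : IsSuperComm 𝓡) {γ : ZMod 2} {c : Q.B →₀ R} (hc : c ∈ parSub 𝓡 γ)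
    (b : List Q.B →₀ R) :
    superExt 𝓡 0 deco (catHom 𝓡 (letH c) b) =
      tm 𝓡 (wd []) (catHom 𝓡 (letH c) b) + lact 𝓡 γ (letH c) (superExt 𝓡 0 deco b) := by
  rw [← decoP_cat 𝓡 hR hc]
  refine parSub_induction 𝓡 (fun c => superExt 𝓡 0 deco (catHom 𝓡 (letH c) b) =
      tm 𝓡 (wd []) (catHom 𝓡 (letH c) b) + superExt 𝓡 0 decoP (catHom 𝓡 (letH c) b)) ?_ ?_ ?_ hc
  · simp
  · intro a b ha hb
    simp only [map_add, AddMonoidHom.add_apply, ha, hb]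
    abel
  · intro x r _
    induction b using Finsupp.induction_linear with
    | zero => simp
    | add b b' hb hb' => simp only [map_add, hb, hb']; abel
    | single t s =>
      rw [letH_single, cat_single_single, superExt_single, superExt_single, twist_zero,
        List.singleton_append, decoP, deco, splitSum_cons, smul_add, tm_single_single,
        show (par ([] : List Q.B) : ZMod 2) = 0 from rfl, twist_zero, one_mul]
      simp

end Tensors

/-! ### Colinear operators on marked words -/

section Marked

variable {K R : Type*} [Field K] [Ring R] [Algebra K R]
variable (𝓡 : ZMod 2 → Submodule K R) [GradedAlgebra 𝓡]
variable {Ob Ob' Ob'' : Type*} {Q : HomBasis Ob} {Q' : HomBasis Ob'} {Q'' : HomBasis Ob''}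

theorem par_list (l : List Q.B) : par l = Q.eps l := rfl

theorem par_prod {X Y : Type*} [Par X] [Par Y] (p : X × Y) : par p = par p.1 + par p.2 := rfl

theorem smul_sgn_smul {M : Type*} [AddCommGroup M] [Module R M] (r : R) (i : ZMod 2) (x : M) :
    r • sgn i • x = sgn i • r • x := smul_comm _ _ _

/-- The operator `A ⊗ μ ⊗ A'` on a quadruple of words `((s₁, s₂), (t₁, t₂))`, `μ` acting on the
two words in the middle. -/
def xi (k c : ZMod 2) (A : List Q.B → (List Q'.B →₀ R)) (μ : List Q.B × List Q.B → (Q'.B →₀ R))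
    (A' : List Q.B → (List Q'.B →₀ R)) (p : (List Q.B × List Q.B) × (List Q.B × List Q.B)) :
    List Q'.B × List Q'.B →₀ R :=
  sgn (k * Q.eps p.1.1 + c * (Q.eps p.1.1 + Q.eps p.1.2 + Q.eps p.2.1)) •
    tm 𝓡 (A p.1.1) (catHom 𝓡 (letH (μ (p.1.2, p.2.1))) (A' p.2.2))

/-- The operator on marked words, where `(s, x :: t)` is the word `s ++ x :: t` with marked `x`,
that applies `μ` to a piece around the mark, `A` to what precedes and `A'` to what follows. -/
def gop (k c : ZMod 2) (A : List Q.B → (List Q'.B →₀ R))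
    (μ : List Q.B × List Q.B → (Q'.B →₀ R)) (A' : List Q.B → (List Q'.B →₀ R)) :
    List Q.B × List Q.B → (List Q'.B × List Q'.B →₀ R)
  | (_, []) => 0
  | (s, x :: t) => splitSum s fun s₁ s₂ => splitSum t fun t₁ t₂ =>
      sgn (k * Q.eps s₁ + c * (Q.eps s + Q.rdeg x + Q.eps t₁)) •
        tm 𝓡 (A s₁) (catHom 𝓡 (letH (μ (s₂, x :: t₁))) (A' t₂))

variable {a k c : ZMod 2} {A : List Q.B → (List Q'.B →₀ R)}
  {μ : List Q.B × List Q.B → (Q'.B →₀ R)} {A' : List Q.B → (List Q'.B →₀ R)}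

theorem xi_tm (hR : IsSuperComm 𝓡) (hA : HomF 𝓡 a A) (hμ : HomF 𝓡 k μ)
    {α₁ α₂ β₁ : ZMod 2} {a₁ a₂ b₁ : List Q.B →₀ R} (h₁ : a₁ ∈ parSub 𝓡 α₁)
    (h₂ : a₂ ∈ parSub 𝓡 α₂) (h₃ : b₁ ∈ parSub 𝓡 β₁) (b₂ : List Q.B →₀ R) :
    superExt 𝓡 (a + k + c) (xi 𝓡 k c A μ A') (tm 𝓡 (tm 𝓡 a₁ a₂) (tm 𝓡 b₁ b₂)) =
      sgn (k * α₁ + c * (α₁ + α₂ + β₁)) •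
        tm 𝓡 (superExt 𝓡 a A a₁)
          (catHom 𝓡 (letH (superExt 𝓡 k μ (tm 𝓡 a₂ b₁))) (superExt 𝓡 c A' b₂)) := by
  refine parSub_induction 𝓡 (fun a₁ => superExt 𝓡 (a + k + c) (xi 𝓡 k c A μ A')
    (tm 𝓡 (tm 𝓡 a₁ a₂) (tm 𝓡 b₁ b₂)) = sgn (k * α₁ + c * (α₁ + α₂ + β₁)) •
        tm 𝓡 (superExt 𝓡 a A a₁)
          (catHom 𝓡 (letH (superExt 𝓡 k μ (tm 𝓡 a₂ b₁))) (superExt 𝓡 c A' b₂)))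
    (by simp) (fun u v hu hv => by simp only [map_add, AddMonoidHom.add_apply, hu, hv, smul_add])
    (fun s₁ r₁ hr₁ => ?_) h₁
  refine parSub_induction 𝓡 (fun a₂ => superExt 𝓡 (a + k + c) (xi 𝓡 k c A μ A')
    (tm 𝓡 (tm 𝓡 (Finsupp.single s₁ r₁) a₂) (tm 𝓡 b₁ b₂)) =
      sgn (k * α₁ + c * (α₁ + α₂ + β₁)) • tm 𝓡 (superExt 𝓡 a A (Finsupp.single s₁ r₁))
          (catHom 𝓡 (letH (superExt 𝓡 k μ (tm 𝓡 a₂ b₁))) (superExt 𝓡 c A' b₂)))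
    (by simp) (fun u v hu hv => by simp only [map_add, AddMonoidHom.add_apply, hu, hv, smul_add])
    (fun s₂ r₂ hr₂ => ?_) h₂
  refine parSub_induction 𝓡 (fun b₁ => superExt 𝓡 (a + k + c) (xi 𝓡 k c A μ A')
    (tm 𝓡 (tm 𝓡 (Finsupp.single s₁ r₁) (Finsupp.single s₂ r₂)) (tm 𝓡 b₁ b₂)) =
      sgn (k * α₁ + c * (α₁ + α₂ + β₁)) • tm 𝓡 (superExt 𝓡 a A (Finsupp.single s₁ r₁))
        (catHom 𝓡 (letH (superExt 𝓡 k μ (tm 𝓡 (Finsupp.single s₂ r₂) b₁))) (superExt 𝓡 c A' b₂)))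
    (by simp) (fun u v hu hv => by simp only [map_add, AddMonoidHom.add_apply, hu, hv, smul_add])
    (fun t₁ r₃ hr₃ => ?_) h₃
  induction b₂ using Finsupp.induction_linear with
  | zero => simp
  | add u v hu hv => simp only [map_add, hu, hv, smul_add]
  | single t₂ r₄ =>
    have hA' := hA s₁
    have hm := letH_mem_parSub 𝓡 (hμ (s₂, t₁))
    simp only [par_list, par_prod] at hA' hm hr₁ hr₂ hr₃
    simp only [tm_single_single, superExt_single, xi, letH_smul, smul_cat, smul_tm, tm_smul 𝓡 hR hA',
      cat_smul 𝓡 hR hm, smul_smul, twist_mul, smul_sgn_smul]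
    rw [← smul_assoc, ← smul_assoc]
    congr 1
    simp only [par_list, par_prod, ← twist_add]
    simp only [twist_of_mem 𝓡 _ _ _ hr₁, twist_of_mem 𝓡 _ _ _ hr₂, twist_of_mem 𝓡 _ _ _ hr₃,
      smul_mul_assoc, mul_smul_comm, sgn_smul_sgn_smul, mul_assoc]
    refine sgn_smul_congr ?_ ?_
    · have h1 := zmod_two_mul_self (Q.eps s₁)
      have h2 := zmod_two_mul_self (Q.eps s₂)
      grind
    · congr 5
      ring

theorem homF_gop (hA : HomF 𝓡 a A) (hμ : HomF 𝓡 k μ) (hA' : HomF 𝓡 c A') :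
    HomF 𝓡 (a + k + c) (gop 𝓡 k c A μ A') := fun p => by
  obtain ⟨s, _ | ⟨x, t⟩⟩ := p
  · exact zero_mem _
  · rw [gop]
    refine splitSum_mem fun s₁ s₂ hs => splitSum_mem fun t₁ t₂ ht => zsmul_mem ?_ _
    subst hs ht
    have := tm_mem_parSub 𝓡 (hA s₁) (cat_mem_parSub 𝓡 (letH_mem_parSub 𝓡 (hμ (s₂, x :: t₁)))
      (hA' t₂))
    simp only [par_list, par_prod, Q.eps_append, Q.eps_cons] at this ⊢
    convert this using 2
    grind

theorem gop_tm (hR : IsSuperComm 𝓡) (u v : List Q.B →₀ R) :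
    superExt 𝓡 (a + k + c) (gop 𝓡 k c A μ A') (tm 𝓡 u v) =
      superExt 𝓡 (a + k + c) (xi 𝓡 k c A μ A')
        (tm 𝓡 (superExt 𝓡 0 deco u) (superExt 𝓡 0 decoP v)) := by
  induction u using Finsupp.induction_linear with
  | zero => simp
  | add u u' hu hu' => simp only [map_add, AddMonoidHom.add_apply, hu, hu']
  | single s r =>
    induction v using Finsupp.induction_linear with
    | zero => simp
    | add u u' hu hu' => simp only [map_add, hu, hu']
    | single t r' =>
      have hd := homF_deco 𝓡 (R := R) s
      rw [zero_add] at hd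
      rw [tm_single_single, superExt_single, superExt_single, superExt_single, twist_zero,
        twist_zero, smul_tm, tm_smul 𝓡 hR hd, smul_smul, superExt_smul]
      congr 1
      cases t with
      | nil => simp [gop, decoP]
      | cons x t =>
        rw [gop, deco, decoP, splitSum_tm, map_splitSum]
        refine splitSum_congr fun s₁ s₂ hs => ?_
        rw [tm_splitSum, map_splitSum]
        refine splitSum_congr fun t₁ t₂ ht => ?_
        subst hs
        rw [tm_one_one, superExt_single_one, xi, Q.eps_cons, Q.eps_append, add_assoc (_ + _)]

theorem gop_tm_cat (hR : IsSuperComm 𝓡) {γ : ZMod 2}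
    {x : Q.B →₀ R} (hx : x ∈ parSub 𝓡 γ) (u v : List Q.B →₀ R) :
    superExt 𝓡 (a + k + c) (gop 𝓡 k c A μ A') (tm 𝓡 u (catHom 𝓡 (letH x) v)) =
      superExt 𝓡 (a + k + c) (xi 𝓡 k c A μ A')
        (tm 𝓡 (superExt 𝓡 0 deco u) (lact 𝓡 γ (letH x) (superExt 𝓡 0 deco v))) := by
  rw [gop_tm 𝓡 hR, decoP_cat 𝓡 hR hx]

/-! ### Coderivations -/

/-- The operator `f ⋆ ψ ⋆ f`, applying `ψ` to one piece of a word and `f` to the rest. -/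
def der (f : List Q.B → (List Q'.B →₀ R)) (j : ZMod 2) (ψ : List Q.B → (Q'.B →₀ R))
    (l : List Q.B) : List Q'.B →₀ R :=
  splitSum l fun u r => splitSum r fun v w =>
    sgn (j * Q.eps u) • catHom 𝓡 (f u) (catHom 𝓡 (letH (ψ v)) (f w))

/-- `f = 1 + F ⋆ f` is the map of coalgebras with corestriction `F`. -/
structure IsBar (F : List Q.B → (Q'.B →₀ R)) (f : List Q.B → (List Q'.B →₀ R)) : Prop where
  hom : HomF 𝓡 0 F
  nil : F [] = 0
  bar_nil : f [] = wd []
  rec_left : ∀ l, l ≠ [] → f l = splitSum l fun u v => catHom 𝓡 (letH (F u)) (f v)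

/-- The corestriction of the identity map. -/
def idLet : List Q.B → (Q.B →₀ R)
  | [x] => wd x
  | _ => 0

theorem idLet_eq_zero {l : List Q.B} (h : l.length ≠ 1) : idLet (R := R) l = 0 := by
  match l, h with
  | [], _ => rfl
  | [x], h => exact absurd rfl h
  | _ :: _ :: _, _ => rfl

theorem isBar_id : IsBar 𝓡 (idLet (Q := Q) (R := R)) wd where
  hom l := by
    match l with
    | [] => exact zero_mem _
    | [x] =>
      rw [zero_add, show par [x] = par x by simp [par, HomBasis.eps]]
      exact single_mem_parSub 𝓡 x
    | _ :: _ :: _ => exact zero_mem _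
  nil := rfl
  bar_nil := rfl
  rec_left l hl := by
    cases l with
    | nil => exact absurd rfl hl
    | cons x l =>
      rw [splitSum_cons, splitSum_eq_left]
      · rw [idLet_eq_zero (by simp), idLet, map_zero, zero_cat, zero_add, letH_single, wd_cat_wd]
        rfl
      · intro a b _ ha
        rw [idLet_eq_zero (by simpa using ha), map_zero, zero_cat]

section Bar

variable {𝓡} {F : List Q.B → (Q'.B →₀ R)} {f : List Q.B → (List Q'.B →₀ R)}

theorem IsBar.rec_left' (h : IsBar 𝓡 F f) (l : List Q.B) :
    f l = (if l = [] then wd [] else 0) + splitSum l fun u v => catHom 𝓡 (letH (F u)) (f v) := by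
  by_cases hl : l = []
  · subst hl
    rw [splitSum_nil, h.nil, h.bar_nil]
    simp
  · rw [if_neg hl, zero_add, h.rec_left l hl]

theorem IsBar.homF (h : IsBar 𝓡 F f) : HomF 𝓡 0 f := fun l => by
  induction hn : l.length using Nat.strong_induction_on generalizing l with
  | _ n ih =>
    by_cases hl : l = []
    · subst hl
      rw [h.bar_nil, zero_add]
      exact single_mem_parSub 𝓡 ([] : List Q'.B)
    · rw [h.rec_left l hl]
      refine splitSum_mem fun u v huv => ?_
      by_cases hu : u = []
      · rw [hu, h.nil, map_zero, map_zero]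
        exact zero_mem _
      · have := cat_mem_parSub 𝓡 (letH_mem_parSub 𝓡 (h.hom u)) (ih v.length (by
          subst hn huv
          have := List.length_pos_iff.2 hu
          rw [List.length_append]
          omega) v rfl)
        subst huv
        rwa [zero_add, zero_add, par_list, par_list, ← Q.eps_append, ← zero_add (Q.eps _)] at this

theorem IsBar.ext (h : IsBar 𝓡 F f) {g : List Q.B → (List Q'.B →₀ R)}
    (hg : ∀ l, g l = (if l = [] then wd [] else 0) +
      splitSum l fun u v => catHom 𝓡 (letH (F u)) (g v)) (l : List Q.B) : g l = f l := by
  induction hn : l.length using Nat.strong_induction_on generalizing l with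
  | _ n ih =>
    rw [hg, h.rec_left' l]
    congr 1
    refine splitSum_congr fun u v huv => ?_
    by_cases hu : u = []
    · rw [hu, h.nil, map_zero, zero_cat, zero_cat]
    · rw [ih v.length (by
          subst hn huv
          have := List.length_pos_iff.2 hu
          rw [List.length_append]
          omega) v rfl]

theorem IsBar.rec_right (h : IsBar 𝓡 F f) (l : List Q.B) :
    f l = (if l = [] then wd [] else 0) + splitSum l fun u v => catHom 𝓡 (f u) (letH (F v)) := by
  symm
  refine h.ext (g := fun l => (if l = [] then wd [] else 0) +
    splitSum l fun u v => catHom 𝓡 (f u) (letH (F v))) (fun l => ?_) l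
  congr 1
  have e1 : (splitSum l fun u v => catHom 𝓡 (f u) (letH (F v))) = letH (F l) +
      splitSum l fun u r => splitSum r fun v w =>
        catHom 𝓡 (letH (F u)) (catHom 𝓡 (f v) (letH (F w))) := by
    rw [← splitSum_assoc l fun u v w => catHom 𝓡 (letH (F u)) (catHom 𝓡 (f v) (letH (F w)))]
    have : ∀ u v, catHom 𝓡 (f u) (letH (F v)) =
        catHom 𝓡 (if u = [] then wd [] else 0) (letH (F v)) +
          splitSum u fun u' v' => catHom 𝓡 (letH (F u')) (catHom 𝓡 (f v') (letH (F v))) := by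
      intro u v
      conv_lhs => rw [h.rec_left' u]
      rw [add_cat, splitSum_cat]
      simp only [cat_assoc]
    rw [splitSum_congr fun u v _ => this u v, splitSum_add]
    congr 1
    rw [splitSum_eq_left]
    · rw [if_pos rfl, one_cat]
    · intro u v _ hu
      rw [if_neg hu, map_zero, AddMonoidHom.zero_apply]
  rw [e1]
  simp only [map_add, splitSum_add, cat_splitSum]
  congr 1
  rw [splitSum_eq_right]
  · rw [if_pos rfl, cat_one]
  · intro u v _ hv
    rw [if_neg hv, map_zero]

theorem IsBar.deco_bar (hR : IsSuperComm 𝓡) (h : IsBar 𝓡 F f) (l : List Q.B) :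
    superExt 𝓡 0 deco (f l) = splitSum l fun u v => tm 𝓡 (f u) (f v) := by
  induction hn : l.length using Nat.strong_induction_on generalizing l with
  | _ n ih =>
    have e1 : superExt 𝓡 0 deco (f l) = (if l = [] then tm 𝓡 (wd []) (wd []) else 0) +
        splitSum l fun u v => tm 𝓡 (wd []) (catHom 𝓡 (letH (F u)) (f v)) +
          splitSum v fun v' w => tm 𝓡 (catHom 𝓡 (letH (F u)) (f v')) (f w) := by
      conv_lhs => rw [h.rec_left' l]
      rw [map_add, map_splitSum]
      congr 1
      · split_ifs
        · rw [superExt_single_one, deco, splitSum_nil, tm_one_one]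
        · rw [map_zero]
      · refine splitSum_congr fun u v huv => ?_
        by_cases hu : u = []
        · simp [hu, h.nil, splitSum_zero]
        · rw [deco_letter_cat 𝓡 hR (h.hom u), ih v.length (by
            subst hn huv
            have := List.length_pos_iff.2 hu
            rw [List.length_append]
            omega) v rfl, map_splitSum]
          simp only [lact_tm 𝓡 hR (letH_mem_parSub 𝓡 (h.hom u))]
    have e2 : (splitSum l fun u v => tm 𝓡 (f u) (f v)) =
        (splitSum l fun u v => tm 𝓡 (if u = [] then wd [] else 0) (f v)) +
        splitSum l fun u r => splitSum r fun v w =>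
          tm 𝓡 (catHom 𝓡 (letH (F u)) (f v)) (f w) := by
      rw [← splitSum_assoc l fun u v w => tm 𝓡 (catHom 𝓡 (letH (F u)) (f v)) (f w), ← splitSum_add]
      refine splitSum_congr fun u v _ => ?_
      conv_lhs => rw [h.rec_left' u]
      rw [add_tm, splitSum_tm]
    rw [e1, e2, splitSum_add, ← add_assoc]
    congr 1
    rw [splitSum_eq_left (l := l) (f := fun u v => tm 𝓡 (if u = [] then wd [] else 0) (f v))]
    · rw [if_pos rfl]
      conv_rhs => rw [h.rec_left' l]
      rw [map_add, tm_splitSum]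
      congr 1
      split_ifs <;> simp
    · intro u v _ hu
      rw [if_neg hu, map_zero, AddMonoidHom.zero_apply]

variable {j : ZMod 2} {ψ : List Q.B → (Q'.B →₀ R)}

theorem homF_der (hf : HomF 𝓡 0 f) (hψ : HomF 𝓡 j ψ) : HomF 𝓡 j (der 𝓡 f j ψ) := fun l => by
  refine splitSum_mem fun u r hr => splitSum_mem fun v w hw => zsmul_mem ?_ _
  subst hw hr
  have := cat_mem_parSub 𝓡 (hf u) (cat_mem_parSub 𝓡 (letH_mem_parSub 𝓡 (hψ v)) (hf w))
  simp only [par_list, Q.eps_append] at this ⊢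
  convert this using 2
  ring

theorem IsBar.der_rec (h : IsBar 𝓡 F f) (l : List Q.B) :
    der 𝓡 f j ψ l = splitSum l fun u v => catHom 𝓡 (letH (ψ u)) (f v) +
      sgn (j * Q.eps u) • catHom 𝓡 (letH (F u)) (der 𝓡 f j ψ v) := by
  have e1 : der 𝓡 f j ψ l = (splitSum l fun u r => splitSum r fun v w =>
      sgn (j * Q.eps u) • catHom 𝓡 (if u = [] then wd [] else 0) (catHom 𝓡 (letH (ψ v)) (f w))) +
      splitSum l fun u r => splitSum r fun v w => splitSum w fun w x =>
        sgn (j * Q.eps u + j * Q.eps v) •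
          catHom 𝓡 (letH (F u)) (catHom 𝓡 (f v) (catHom 𝓡 (letH (ψ w)) (f x))) := by
    rw [← splitSum_assoc l fun u v w => splitSum w fun w x => sgn (j * Q.eps u + j * Q.eps v) •
          catHom 𝓡 (letH (F u)) (catHom 𝓡 (f v) (catHom 𝓡 (letH (ψ w)) (f x))), ← splitSum_add]
    refine splitSum_congr fun u r _ => ?_
    rw [splitSum_comm, ← splitSum_add]
    refine splitSum_congr fun v w _ => ?_
    conv_lhs => rw [h.rec_left' u]
    rw [add_cat, smul_add, splitSum_cat]
    congr 1
    rw [← splitSum_zsmul]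
    refine splitSum_congr fun u' v' huv => ?_
    subst huv
    rw [cat_assoc, Q.eps_append, mul_add]
  rw [e1, splitSum_add]
  congr 1
  · rw [splitSum_eq_left]
    · simp only [if_pos, one_cat, Q.eps_nil, mul_zero, sgn_zero, one_smul]
    · intro u v _ hu
      simp [if_neg hu, splitSum_zero]
  · refine splitSum_congr fun u r _ => ?_
    rw [der, cat_splitSum, ← splitSum_zsmul]
    refine splitSum_congr fun v w _ => ?_
    rw [cat_splitSum, ← splitSum_zsmul]
    refine splitSum_congr fun w x _ => ?_
    rw [cat_zsmul, sgn_smul_sgn_smul]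

theorem IsBar.deco_der (hR : IsSuperComm 𝓡) (h : IsBar 𝓡 F f) (hψ : HomF 𝓡 j ψ) (l : List Q.B) :
    superExt 𝓡 0 deco (der 𝓡 f j ψ l) = splitSum l fun u v =>
      tm 𝓡 (der 𝓡 f j ψ u) (f v) + sgn (j * Q.eps u) • tm 𝓡 (f u) (der 𝓡 f j ψ v) := by
  induction hn : l.length using Nat.strong_induction_on generalizing l with
  | _ n ih =>
    have e1 : superExt 𝓡 0 deco (der 𝓡 f j ψ l) = tm 𝓡 (wd []) (der 𝓡 f j ψ l) +
        splitSum l fun u r => splitSum r fun v w =>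
          tm 𝓡 (catHom 𝓡 (letH (ψ u)) (f v)) (f w) + sgn (j * Q.eps u) •
            (tm 𝓡 (catHom 𝓡 (letH (F u)) (der 𝓡 f j ψ v)) (f w) +
              sgn (j * Q.eps v) • tm 𝓡 (catHom 𝓡 (letH (F u)) (f v)) (der 𝓡 f j ψ w)) := by
      rw [h.der_rec l, map_splitSum, tm_splitSum, ← splitSum_add]
      refine splitSum_congr fun u r huv => ?_
      rw [map_add, map_zsmul, deco_letter_cat 𝓡 hR (hψ u), h.deco_bar hR r, map_splitSum,
        map_add, tm_zsmul, splitSum_double]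
      simp only [lact_tm 𝓡 hR (letH_mem_parSub 𝓡 (hψ u))]
      have : superExt 𝓡 0 deco (catHom 𝓡 (letH (F u)) (der 𝓡 f j ψ r)) =
          tm 𝓡 (wd []) (catHom 𝓡 (letH (F u)) (der 𝓡 f j ψ r)) + splitSum r fun v w =>
            tm 𝓡 (catHom 𝓡 (letH (F u)) (der 𝓡 f j ψ v)) (f w) +
              sgn (j * Q.eps v) • tm 𝓡 (catHom 𝓡 (letH (F u)) (f v)) (der 𝓡 f j ψ w) := by
        by_cases hu : u = []
        · simp [hu, h.nil, splitSum_zero]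
        · rw [deco_letter_cat 𝓡 hR (h.hom u), ih r.length (by
            subst hn huv
            have := List.length_pos_iff.2 hu
            rw [List.length_append]
            omega) r rfl, map_splitSum]
          simp only [map_add, map_zsmul, lact_tm 𝓡 hR (letH_mem_parSub 𝓡 (h.hom u))]
      rw [this, smul_add]
      abel
    have e2 : (splitSum l fun u v => tm 𝓡 (der 𝓡 f j ψ u) (f v)) =
        splitSum l fun u r => splitSum r fun v w =>
          tm 𝓡 (catHom 𝓡 (letH (ψ u)) (f v)) (f w) + sgn (j * Q.eps u) •
            tm 𝓡 (catHom 𝓡 (letH (F u)) (der 𝓡 f j ψ v)) (f w) := by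
      rw [← splitSum_assoc l fun u v w => tm 𝓡 (catHom 𝓡 (letH (ψ u)) (f v)) (f w) +
        sgn (j * Q.eps u) • tm 𝓡 (catHom 𝓡 (letH (F u)) (der 𝓡 f j ψ v)) (f w)]
      refine splitSum_congr fun u v _ => ?_
      rw [h.der_rec u, splitSum_tm]
      simp only [add_tm, zsmul_tm]
    have e3 : (splitSum l fun u v => sgn (j * Q.eps u) • tm 𝓡 (f u) (der 𝓡 f j ψ v)) =
        tm 𝓡 (wd []) (der 𝓡 f j ψ l) + splitSum l fun u r => splitSum r fun v w =>
          sgn (j * Q.eps u) • sgn (j * Q.eps v) •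
            tm 𝓡 (catHom 𝓡 (letH (F u)) (f v)) (der 𝓡 f j ψ w) := by
      rw [← splitSum_assoc l fun u v w => sgn (j * Q.eps u) • sgn (j * Q.eps v) •
            tm 𝓡 (catHom 𝓡 (letH (F u)) (f v)) (der 𝓡 f j ψ w)]
      have : ∀ u v, sgn (j * Q.eps u) • tm 𝓡 (f u) (der 𝓡 f j ψ v) =
          sgn (j * Q.eps u) • tm 𝓡 (if u = [] then wd [] else 0) (der 𝓡 f j ψ v) +
          splitSum u fun u v' => sgn (j * Q.eps u) • sgn (j * Q.eps v') •
            tm 𝓡 (catHom 𝓡 (letH (F u)) (f v')) (der 𝓡 f j ψ v) := by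
        intro u v
        conv_lhs => rw [h.rec_left' u]
        rw [add_tm, smul_add, splitSum_tm, ← splitSum_zsmul]
        congr 1
        refine splitSum_congr fun u' v' huv => ?_
        subst huv
        rw [sgn_smul_sgn_smul, Q.eps_append, mul_add]
      rw [splitSum_congr fun u v _ => this u v, splitSum_add]
      congr 1
      rw [splitSum_eq_left]
      · simp [Q.eps_nil, sgn_zero]
      · intro u v _ hu
        simp [if_neg hu]
    rw [e1, splitSum_add, e2, e3]
    simp only [splitSum_add, smul_add]
    abel

end Bar

end Marked

section Marked

variable {K R : Type*} [Field K] [Ring R] [Algebra K R]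
variable (𝓡 : ZMod 2 → Submodule K R) [GradedAlgebra 𝓡]
variable {Ob Ob' Ob'' : Type*} {Q : HomBasis Ob} {Q' : HomBasis Ob'} {Q'' : HomBasis Ob''}

/-! ### Operators on marked words and coderivations -/

/-- The composition of `f` with the superlinear extension of `g`. -/
def cmp {X Y M : Type*} [AddCommGroup M] [Module R M] (i : ZMod 2) (g : Y → M) (f : X → (Y →₀ R))
    (x : X) : M := superExt 𝓡 i g (f x)

/-- A map on words, applied to marked words. -/
def unmark {M : Type*} (ψ : List Q.B → M) (p : List Q.B × List Q.B) : M := ψ (p.1 ++ p.2)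

theorem homF_unmark {X : Type*} [Par X] {j : ZMod 2} {ψ : List Q.B → (X →₀ R)}
    (hψ : HomF 𝓡 j ψ) : HomF 𝓡 j (unmark ψ) := fun p => by
  rw [show par p = par (p.1 ++ p.2) from (Q.eps_append _ _).symm]
  exact hψ _

theorem splitSum_middle {B B' M : Type*} [AddCommGroup M] (s : List B) (t : List B')
    (h : List B → List B → List B → List B' → List B' → List B' → M) :
    (splitSum s fun r w => splitSum t fun t₁ t₂ => splitSum r fun u v => splitSum t₂ fun v' w' =>
      h u v w t₁ v' w') =
    splitSum s fun u r => splitSum t fun t' w' => splitSum r fun v w => splitSum t' fun t₁ v' =>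
      h u v w t₁ v' w' := by
  have e1 : (splitSum s fun r w => splitSum t fun t₁ t₂ => splitSum r fun u v =>
      splitSum t₂ fun v' w' => h u v w t₁ v' w') =
      splitSum s fun r w => splitSum r fun u v => splitSum t fun t' w' => splitSum t' fun t₁ v' =>
        h u v w t₁ v' w' := by
    refine splitSum_congr fun r w _ => ?_
    rw [splitSum_comm]
    refine splitSum_congr fun u v _ => ?_
    rw [splitSum_assoc t fun t₁ v' w' => h u v w t₁ v' w']
  rw [e1, splitSum_assoc s fun u v w => splitSum t fun t' w' => splitSum t' fun t₁ v' =>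
        h u v w t₁ v' w']
  refine splitSum_congr fun u r _ => ?_
  rw [splitSum_comm]

variable {a k c j : ZMod 2} {A : List Q.B → (List Q'.B →₀ R)}
  {μ : List Q.B × List Q.B → (Q'.B →₀ R)} {A' : List Q.B → (List Q'.B →₀ R)}
  {ψ : List Q.B → (Q.B →₀ R)}

theorem gop_add_left (A B : List Q.B → (List Q'.B →₀ R)) (p : List Q.B × List Q.B) :
    gop 𝓡 k c (fun l => A l + B l) μ A' p = gop 𝓡 k c A μ A' p + gop 𝓡 k c B μ A' p := by
  obtain ⟨s, _ | ⟨x, t⟩⟩ := p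
  · simp [gop]
  · simp only [gop, add_tm, smul_add, splitSum_add]

theorem gop_zsmul_left (n : ℤ) (A : List Q.B → (List Q'.B →₀ R)) (p : List Q.B × List Q.B) :
    gop 𝓡 k c (fun l => n • A l) μ A' p = n • gop 𝓡 k c A μ A' p := by
  obtain ⟨s, _ | ⟨x, t⟩⟩ := p
  · simp [gop]
  · simp only [gop, zsmul_tm, smul_comm _ n, splitSum_zsmul]

theorem gop_add_mid (μ ν : List Q.B × List Q.B → (Q'.B →₀ R)) (p : List Q.B × List Q.B) :
    gop 𝓡 k c A (fun l => μ l + ν l) A' p = gop 𝓡 k c A μ A' p + gop 𝓡 k c A ν A' p := by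
  obtain ⟨s, _ | ⟨x, t⟩⟩ := p
  · simp [gop]
  · simp only [gop, map_add, AddMonoidHom.add_apply, smul_add, splitSum_add]

theorem gop_zsmul_mid (n : ℤ) (μ : List Q.B × List Q.B → (Q'.B →₀ R)) (p : List Q.B × List Q.B) :
    gop 𝓡 k c A (fun l => n • μ l) A' p = n • gop 𝓡 k c A μ A' p := by
  obtain ⟨s, _ | ⟨x, t⟩⟩ := p
  · simp [gop]
  · simp only [gop, map_zsmul, AddMonoidHom.smul_apply, smul_comm _ n, splitSum_zsmul]

theorem gop_congr {B B' : List Q.B → (List Q'.B →₀ R)} {ν : List Q.B × List Q.B → (Q'.B →₀ R)}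
    {s : List Q.B} {x : Q.B} {t : List Q.B} (hA : ∀ u v, u ++ v = s → A u = B u)
    (hμ : ∀ u v v' w, u ++ v = s → v' ++ w = t → μ (v, x :: v') = ν (v, x :: v'))
    (hA' : ∀ u v, u ++ v = t → A' v = B' v) :
    gop 𝓡 k c A μ A' (s, x :: t) = gop 𝓡 k c B ν B' (s, x :: t) := by
  rw [gop, gop]
  exact splitSum_congr fun u v huv => splitSum_congr fun v' w hvw => by
    rw [hA u v huv, hμ u v v' w huv hvw, hA' v' w hvw]

/-- The coderivation of the marked words with corestriction `ψ`. -/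
def dpsi (j : ZMod 2) (ψ : List Q.B → (Q.B →₀ R)) :
    List Q.B × List Q.B → (List Q.B × List Q.B →₀ R)
  | (_, []) => 0
  | (s, x :: t) => tm 𝓡 (der 𝓡 wd j ψ s) (wd (x :: t)) + gop 𝓡 j 0 wd (unmark ψ) wd (s, x :: t) +
      sgn (j * (Q.eps s + Q.rdeg x)) • tm 𝓡 (wd s) (catHom 𝓡 (wd [x]) (der 𝓡 wd j ψ t))

theorem deco_wd (l : List Q.B) :
    superExt 𝓡 0 deco (wd l) = splitSum l fun u v => tm 𝓡 (wd u) (wd v : List Q.B →₀ R) := by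
  rw [superExt_single_one, deco]
  simp only [tm_one_one]

theorem wd_mem (l : List Q.B) : (wd l : List Q.B →₀ R) ∈ parSub 𝓡 (Q.eps l) :=
  single_mem_parSub 𝓡 l

theorem homF_wd : HomF 𝓡 0 (wd : List Q.B → (List Q.B →₀ R)) := homF_single 𝓡

theorem letH_wd (x : Q.B) : letH (wd x) = (wd [x] : List Q.B →₀ R) := letH_single x 1

theorem wd_letter_mem (x : Q.B) : (wd x : Q.B →₀ R) ∈ parSub 𝓡 (Q.rdeg x) :=
  single_mem_parSub 𝓡 x

theorem wd_one_mem (x : Q.B) : (wd [x] : List Q.B →₀ R) ∈ parSub 𝓡 (Q.rdeg x) := by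
  rw [← letH_wd]
  exact letH_mem_parSub 𝓡 (wd_letter_mem 𝓡 x)

theorem gop_comp_left (hR : IsSuperComm 𝓡) (hA : HomF 𝓡 a A) (hμ : HomF 𝓡 k μ)
    (hψ : HomF 𝓡 j ψ) (s : List Q.B) (x : Q.B) (t : List Q.B) :
    superExt 𝓡 (a + k + c) (gop 𝓡 k c A μ A') (tm 𝓡 (der 𝓡 wd j ψ s) (wd (x :: t))) =
      sgn ((k + c) * j) • gop 𝓡 k c (cmp 𝓡 a A (der 𝓡 wd j ψ)) μ A' (s, x :: t) +
      sgn (c * j) • gop 𝓡 (k + j) c A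
        (fun p => superExt 𝓡 k μ (tm 𝓡 (der 𝓡 wd j ψ p.1) (wd p.2))) A' (s, x :: t) := by
  have hd := homF_der (homF_wd 𝓡) hψ
  rw [wd_cons_eq 𝓡, ← letH_wd, gop_tm_cat 𝓡 hR (wd_letter_mem 𝓡 x),
    (isBar_id 𝓡).deco_der hR hψ, deco_wd, map_splitSum (lact 𝓡 _ _), splitSum_tm, map_splitSum (superExt 𝓡 _ _), gop, gop,
    ← splitSum_zsmul, ← splitSum_zsmul, ← splitSum_add]
  refine splitSum_congr fun u v huv => ?_
  rw [tm_splitSum, map_splitSum, ← splitSum_zsmul, ← splitSum_zsmul, ← splitSum_add]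
  refine splitSum_congr fun v' w hvw => ?_
  subst huv hvw
  rw [lact_tm 𝓡 hR (letH_mem_parSub 𝓡 (wd_letter_mem 𝓡 x)), add_tm, zsmul_tm, map_add, map_zsmul]
  have hx := cat_mem_parSub 𝓡 (letH_mem_parSub 𝓡 (wd_letter_mem 𝓡 x)) (wd_mem 𝓡 v')
  rw [xi_tm 𝓡 hR hA hμ (hd u) (wd_mem 𝓡 v) hx, xi_tm 𝓡 hR hA hμ (wd_mem 𝓡 u) (hd v) hx,
    sgn_smul_sgn_smul, sgn_smul_sgn_smul, sgn_smul_sgn_smul]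
  simp only [letH_wd, wd_cat_wd, tm_one_one, superExt_single_one, List.singleton_append]
  simp only [par_list, Q.eps_append]
  refine congr_arg₂ _ (sgn_smul_congr ?_ rfl) (sgn_smul_congr ?_ rfl) <;> ring

theorem gop_comp_mid (hR : IsSuperComm 𝓡) (hA : HomF 𝓡 a A) (hμ : HomF 𝓡 k μ)
    (hψ : HomF 𝓡 j ψ) (s : List Q.B) (x : Q.B) (t : List Q.B) :
    superExt 𝓡 (a + k + c) (gop 𝓡 k c A μ A') (gop 𝓡 j 0 wd (unmark ψ) wd (s, x :: t)) =
      sgn (c * j) • gop 𝓡 (k + j) c A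
        (fun p => superExt 𝓡 k μ (gop 𝓡 j 0 wd (unmark ψ) wd p)) A' (s, x :: t) := by
  rw [gop, map_splitSum]
  have e1 : ∀ s₁ s₂ t₁ t₂, s₁ ++ s₂ = s → t₁ ++ t₂ = t →
      superExt 𝓡 (a + k + c) (gop 𝓡 k c A μ A')
        (sgn (j * Q.eps s₁ + 0 * (Q.eps s + Q.rdeg x + Q.eps t₁)) •
          tm 𝓡 (wd s₁) (catHom 𝓡 (letH (unmark ψ (s₂, x :: t₁))) (wd t₂))) =
      splitSum s₁ fun u v => splitSum t₂ fun v' w' =>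
        sgn (j * Q.eps v + (k + j) * Q.eps u + c * (j + Q.eps s + Q.rdeg x + Q.eps t₁ + Q.eps v')) •
          tm 𝓡 (A u) (catHom 𝓡 (letH (superExt 𝓡 k μ
            (tm 𝓡 (wd v) (catHom 𝓡 (letH (unmark ψ (s₂, x :: t₁))) (wd v'))))) (A' w')) := by
    intro s₁ s₂ t₁ t₂ hs ht
    have hm := homF_unmark 𝓡 hψ (s₂, x :: t₁)
    rw [map_zsmul, gop_tm_cat 𝓡 hR hm, deco_wd, deco_wd, splitSum_tm,
      map_splitSum, map_splitSum, ← splitSum_zsmul]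
    refine splitSum_congr fun u v huv => ?_
    rw [tm_splitSum, map_splitSum, ← splitSum_zsmul]
    refine splitSum_congr fun v' w' hvw => ?_
    subst huv hvw hs ht
    have hmm := letH_mem_parSub 𝓡 hm
    rw [lact_tm 𝓡 hR hmm, xi_tm 𝓡 hR hA hμ (wd_mem 𝓡 u) (wd_mem 𝓡 v)
      (cat_mem_parSub 𝓡 hmm (wd_mem 𝓡 v')), sgn_smul_sgn_smul]
    simp only [superExt_single_one]
    refine sgn_smul_congr ?_ rfl
    simp only [par_list, par_prod, Q.eps_append, Q.eps_cons]
    ring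
  rw [splitSum_congr fun s₁ s₂ hs => (map_splitSum (superExt 𝓡 (a + k + c) (gop 𝓡 k c A μ A')) _ _).trans
    (splitSum_congr fun t₁ t₂ ht => e1 s₁ s₂ t₁ t₂ hs ht),
    splitSum_middle s t fun u v s₂ t₁ v' w' =>
      sgn (j * Q.eps v + (k + j) * Q.eps u + c * (j + Q.eps s + Q.rdeg x + Q.eps t₁ + Q.eps v')) •
          tm 𝓡 (A u) (catHom 𝓡 (letH (superExt 𝓡 k μ
            (tm 𝓡 (wd v) (catHom 𝓡 (letH (unmark ψ (s₂, x :: t₁))) (wd v'))))) (A' w')),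
    gop, ← splitSum_zsmul]
  refine splitSum_congr fun u r _ => ?_
  rw [← splitSum_zsmul]
  refine splitSum_congr fun t' w' _ => ?_
  rw [gop, map_splitSum, map_splitSum, splitSum_cat, tm_splitSum, ← splitSum_zsmul,
    ← splitSum_zsmul]
  refine splitSum_congr fun v s₂ _ => ?_
  rw [map_splitSum, map_splitSum, splitSum_cat, tm_splitSum, ← splitSum_zsmul,
    ← splitSum_zsmul]
  refine splitSum_congr fun t₁ v' ht => ?_
  subst ht
  rw [map_zsmul, map_zsmul, zsmul_cat, tm_zsmul, sgn_smul_sgn_smul, sgn_smul_sgn_smul]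
  refine sgn_smul_congr ?_ rfl
  rw [Q.eps_append]
  ring

theorem gop_comp_right (hR : IsSuperComm 𝓡) (hA : HomF 𝓡 a A) (hμ : HomF 𝓡 k μ)
    (hψ : HomF 𝓡 j ψ) (s : List Q.B) (x : Q.B) (t : List Q.B) :
    superExt 𝓡 (a + k + c) (gop 𝓡 k c A μ A') (sgn (j * (Q.eps s + Q.rdeg x)) •
        tm 𝓡 (wd s) (catHom 𝓡 (wd [x]) (der 𝓡 wd j ψ t))) =
      sgn (c * j) • gop 𝓡 (k + j) c A
        (fun p => superExt 𝓡 k μ (match p with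
          | (_, []) => 0
          | (s, x :: t) => sgn (j * (Q.eps s + Q.rdeg x)) •
              tm 𝓡 (wd s) (catHom 𝓡 (wd [x]) (der 𝓡 wd j ψ t)))) A' (s, x :: t) +
      gop 𝓡 k (c + j) A μ (cmp 𝓡 c A' (der 𝓡 wd j ψ)) (s, x :: t) := by
  have hd := homF_der (homF_wd 𝓡) hψ
  have hx := letH_mem_parSub 𝓡 (wd_letter_mem 𝓡 x)
  rw [← letH_wd, map_zsmul, gop_tm_cat 𝓡 hR (wd_letter_mem 𝓡 x),
    (isBar_id 𝓡).deco_der hR hψ, deco_wd, map_splitSum (lact 𝓡 _ _), splitSum_tm, map_splitSum (superExt 𝓡 _ _), gop, gop,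
    ← splitSum_zsmul, ← splitSum_zsmul, ← splitSum_add]
  refine splitSum_congr fun u v huv => ?_
  rw [tm_splitSum, map_splitSum, ← splitSum_zsmul, ← splitSum_zsmul, ← splitSum_add]
  refine splitSum_congr fun v' w hvw => ?_
  subst huv hvw
  rw [map_add, map_zsmul, lact_tm 𝓡 hR hx, lact_tm 𝓡 hR hx, map_add, tm_zsmul, map_add, map_zsmul]
  rw [xi_tm 𝓡 hR hA hμ (wd_mem 𝓡 u) (wd_mem 𝓡 v) (cat_mem_parSub 𝓡 hx (hd v')),
    xi_tm 𝓡 hR hA hμ (wd_mem 𝓡 u) (wd_mem 𝓡 v) (cat_mem_parSub 𝓡 hx (wd_mem 𝓡 v')), smul_add]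
  simp only [map_zsmul, AddMonoidHom.smul_apply, sgn_smul_sgn_smul]
  simp only [letH_wd, wd_cat_wd, tm_one_one, superExt_single_one, List.singleton_append]
  simp only [par_list, Q.eps_append]
  refine congr_arg₂ _ (sgn_smul_congr ?_ rfl) (sgn_smul_congr ?_ rfl) <;> grind

theorem gop_dpsi (hR : IsSuperComm 𝓡) (hA : HomF 𝓡 a A) (hμ : HomF 𝓡 k μ)
    (hψ : HomF 𝓡 j ψ) (p : List Q.B × List Q.B) :
    superExt 𝓡 (a + k + c) (gop 𝓡 k c A μ A') (dpsi 𝓡 j ψ p) =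
      sgn ((k + c) * j) • gop 𝓡 k c (cmp 𝓡 a A (der 𝓡 wd j ψ)) μ A' p +
      sgn (c * j) • gop 𝓡 (k + j) c A (cmp 𝓡 k μ (dpsi 𝓡 j ψ)) A' p +
      gop 𝓡 k (c + j) A μ (cmp 𝓡 c A' (der 𝓡 wd j ψ)) p := by
  obtain ⟨s, _ | ⟨x, t⟩⟩ := p
  · simp [dpsi, gop]
  rw [dpsi, map_add, map_add, gop_comp_left 𝓡 hR hA hμ hψ, gop_comp_mid 𝓡 hR hA hμ hψ,
    gop_comp_right 𝓡 hR hA hμ hψ]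
  have e : gop 𝓡 (k + j) c A (cmp 𝓡 k μ (dpsi 𝓡 j ψ)) A' (s, x :: t) =
      gop 𝓡 (k + j) c A (fun p => superExt 𝓡 k μ (tm 𝓡 (der 𝓡 wd j ψ p.1) (wd p.2)) +
        superExt 𝓡 k μ (gop 𝓡 j 0 wd (unmark ψ) wd p) +
        superExt 𝓡 k μ (match p with
          | (_, []) => 0
          | (s, x :: t) => sgn (j * (Q.eps s + Q.rdeg x)) •
              tm 𝓡 (wd s) (catHom 𝓡 (wd [x]) (der 𝓡 wd j ψ t)))) A' (s, x :: t) := by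
    refine gop_congr 𝓡 (fun _ _ _ => rfl) (fun u v v' w _ _ => ?_) (fun _ _ _ => rfl)
    rw [cmp, dpsi, map_add, map_add]
  rw [e, gop_add_mid, gop_add_mid, smul_add, smul_add]
  abel

theorem homF_dpsi (hψ : HomF 𝓡 j ψ) : HomF 𝓡 j (dpsi 𝓡 j ψ) := fun p => by
  have hd := homF_der (homF_wd 𝓡) hψ
  obtain ⟨s, _ | ⟨x, t⟩⟩ := p
  · exact zero_mem _
  · rw [dpsi]
    refine add_mem (add_mem ?_ ?_) (zsmul_mem ?_ _)
    · have := tm_mem_parSub 𝓡 (hd s) (wd_mem 𝓡 (x :: t))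
      rwa [add_assoc] at this
    · have := homF_gop 𝓡 (homF_wd 𝓡) (homF_unmark 𝓡 hψ) (homF_wd 𝓡) (s, x :: t)
      rwa [zero_add, add_zero] at this
    · have := tm_mem_parSub 𝓡 (wd_mem 𝓡 s) (cat_mem_parSub 𝓡 (wd_one_mem 𝓡 x) (hd t))
      simp only [par_list, par_prod, Q.eps_cons] at this ⊢
      convert this using 2
      ring

end Marked

section Marked

variable {K R : Type*} [Field K] [Ring R] [Algebra K R]
variable (𝓡 : ZMod 2 → Submodule K R) [GradedAlgebra 𝓡]
variable {Ob Ob' Ob'' : Type*} {Q : HomBasis Ob} {Q' : HomBasis Ob'} {Q'' : HomBasis Ob''}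

variable {a k c j q p : ZMod 2} {A : List Q.B → (List Q'.B →₀ R)}
  {μ : List Q.B × List Q.B → (Q'.B →₀ R)} {A' : List Q.B → (List Q'.B →₀ R)}
  {ψ : List Q.B → (Q.B →₀ R)}

/-! ### Composition of coderivations with operators on marked words -/

theorem superExt_wd {X : Type*} (a : X →₀ R) : superExt 𝓡 0 wd a = a := superExt_basis 𝓡 a

theorem sgn_smul_smul {M : Type*} [AddCommGroup M] [Module R M] (i : ZMod 2) (r : R) (x : M) :
    (sgn i • r) • x = sgn i • r • x := smul_assoc _ _ _

theorem superExt_unmark {M : Type*} [AddCommGroup M] [Module R M] (g : List Q.B → M)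
    (t : List Q.B × List Q.B →₀ R) :
    superExt 𝓡 k (unmark g) t = superExt 𝓡 k g (superExt 𝓡 0 app t) := by
  rw [superExt_comp, add_zero]
  congr 2
  funext p
  rw [app, superExt_single_one, unmark]

theorem dpsi_tm_cat (hR : IsSuperComm 𝓡) (hψ : HomF 𝓡 j ψ) {α γ : ZMod 2} {s : List Q.B →₀ R}
    {y : Q.B →₀ R} (hs : s ∈ parSub 𝓡 α) (hy : y ∈ parSub 𝓡 γ) (t : List Q.B →₀ R) :
    superExt 𝓡 j (dpsi 𝓡 j ψ) (tm 𝓡 s (catHom 𝓡 (letH y) t)) =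
      tm 𝓡 (superExt 𝓡 j (der 𝓡 wd j ψ) s) (catHom 𝓡 (letH y) t) +
      superExt 𝓡 (0 + j + 0) (gop 𝓡 j 0 wd (unmark ψ) wd) (tm 𝓡 s (catHom 𝓡 (letH y) t)) +
      sgn (j * (α + γ)) • tm 𝓡 s (catHom 𝓡 (letH y) (superExt 𝓡 j (der 𝓡 wd j ψ) t)) := by
  refine parSub_induction 𝓡 (fun s => superExt 𝓡 j (dpsi 𝓡 j ψ) (tm 𝓡 s (catHom 𝓡 (letH y) t)) =
      tm 𝓡 (superExt 𝓡 j (der 𝓡 wd j ψ) s) (catHom 𝓡 (letH y) t) +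
      superExt 𝓡 (0 + j + 0) (gop 𝓡 j 0 wd (unmark ψ) wd) (tm 𝓡 s (catHom 𝓡 (letH y) t)) +
      sgn (j * (α + γ)) • tm 𝓡 s (catHom 𝓡 (letH y) (superExt 𝓡 j (der 𝓡 wd j ψ) t)))
    (by simp) (fun u v hu hv => by
      simp only [map_add, AddMonoidHom.add_apply, hu, hv, smul_add]; abel) (fun s r hr => ?_) hs
  refine parSub_induction 𝓡 (fun y => superExt 𝓡 j (dpsi 𝓡 j ψ)
      (tm 𝓡 (Finsupp.single s r) (catHom 𝓡 (letH y) t)) =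
      tm 𝓡 (superExt 𝓡 j (der 𝓡 wd j ψ) (Finsupp.single s r)) (catHom 𝓡 (letH y) t) +
      superExt 𝓡 (0 + j + 0) (gop 𝓡 j 0 wd (unmark ψ) wd)
        (tm 𝓡 (Finsupp.single s r) (catHom 𝓡 (letH y) t)) +
      sgn (j * (α + γ)) • tm 𝓡 (Finsupp.single s r)
        (catHom 𝓡 (letH y) (superExt 𝓡 j (der 𝓡 wd j ψ) t)))
    (by simp) (fun u v hu hv => by
      simp only [map_add, AddMonoidHom.add_apply, hu, hv, smul_add]; abel) (fun x r' hr' => ?_) hy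
  induction t using Finsupp.induction_linear with
  | zero => simp
  | add u v hu hv => simp only [map_add, hu, hv, smul_add]; abel
  | single t r'' =>
    have e1 : (Finsupp.single s r : List Q.B →₀ R) = r • wd s := by simp
    have e2 : (Finsupp.single x r' : Q.B →₀ R) = r' • wd x := by simp
    have e3 : (Finsupp.single t r'' : List Q.B →₀ R) = r'' • wd t := by simp
    have hx : letH (wd x) ∈ parSub 𝓡 (Q.rdeg x) := letH_mem_parSub 𝓡 (wd_letter_mem 𝓡 x)
    have hd := homF_der (homF_wd 𝓡) hψ
    simp only [par_list] at hr
    have hr2 : r' ∈ 𝓡 (γ + Q.rdeg x) := hr'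
    have hdd := hd s
    rw [par_list] at hdd
    simp only [e1, e2, e3, smul_tm, superExt_smul, letH_smul, smul_cat, cat_smul 𝓡 hR hx,
      tm_smul 𝓡 hR (wd_mem 𝓡 s), tm_smul 𝓡 hR hdd, zero_add, add_zero, smul_smul,
      superExt_single_one, twist_mul]
    rw [letH_wd, wd_cat_wd, tm_one_one, superExt_single_one, superExt_single_one,
      List.singleton_append, dpsi, smul_add, smul_add]
    simp only [map_zsmul, twist_of_mem 𝓡 _ _ _ hr, twist_of_mem 𝓡 _ _ _ hr2, ← twist_add,
      smul_sgn_smul (R := R), smul_mul_assoc, mul_smul_comm, sgn_smul_smul (R := R),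
      sgn_smul_sgn_smul]
    rw [show j + Q.eps s + Q.rdeg x = j + (Q.eps s + Q.rdeg x) by ring,
      show Q.eps s + (Q.rdeg x + j) = j + (Q.eps s + Q.rdeg x) by ring]
    refine congr_arg₂ _ (congr_arg₂ _ (sgn_smul_congr ?_ rfl) rfl) (sgn_smul_congr ?_ rfl)
    · ring
    · grind

/-- A summand of the coproduct of a map on words. -/
def dterm (q : ZMod 2) (P S : List Q.B → (List Q'.B →₀ R)) (l : List Q.B) :
    List Q'.B × List Q'.B →₀ R :=
  splitSum l fun u v => sgn (q * Q.eps u) • tm 𝓡 (P u) (S v)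

theorem xi_dterm (hR : IsSuperComm 𝓡) {k₁ : ZMod 2} {ν : List Q'.B × List Q'.B → (Q'.B →₀ R)}
    {P S : List Q.B → (List Q'.B →₀ R)} {F : List Q.B → (Q'.B →₀ R)}
    {f : List Q.B → (List Q'.B →₀ R)}
    (hν : HomF 𝓡 k₁ ν) (hP : HomF 𝓡 p P) (hS : HomF 𝓡 q S) (hμ : HomF 𝓡 k μ) (hf : IsBar 𝓡 F f)
    (s : List Q.B) (x : Q.B) (t : List Q.B) :
    (splitSum s fun s₁ s₂ => splitSum t fun t₁ t₂ => sgn (k * Q.eps s₁) •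
      superExt 𝓡 (0 + k₁ + 0) (xi 𝓡 k₁ 0 wd ν wd) (tm 𝓡 (dterm 𝓡 q P S s₁)
        (lact 𝓡 (k + par (s₂, x :: t₁)) (letH (μ (s₂, x :: t₁))) (superExt 𝓡 0 deco (f t₂))))) =
      sgn (k₁ * p) • gop 𝓡 (k₁ + (q + k)) 0 P (cmp 𝓡 k₁ ν (gop 𝓡 k 0 S μ f)) f (s, x :: t) := by
  have e1 : ∀ s₁ s₂ t₁ t₂, s₁ ++ s₂ = s → t₁ ++ t₂ = t →
      sgn (k * Q.eps s₁) • superExt 𝓡 (0 + k₁ + 0) (xi 𝓡 k₁ 0 wd ν wd) (tm 𝓡 (dterm 𝓡 q P S s₁)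
        (lact 𝓡 (k + par (s₂, x :: t₁)) (letH (μ (s₂, x :: t₁))) (superExt 𝓡 0 deco (f t₂)))) =
      splitSum s₁ fun u v => splitSum t₂ fun v' w' =>
        sgn (k₁ * p + (k₁ + q + k) * Q.eps u + k * Q.eps v) •
          tm 𝓡 (P u) (catHom 𝓡 (letH (superExt 𝓡 k₁ ν
            (tm 𝓡 (S v) (catHom 𝓡 (letH (μ (s₂, x :: t₁))) (f v'))))) (f w')) := by
    intro s₁ s₂ t₁ t₂ hs ht
    have hm := hμ (s₂, x :: t₁)
    rw [hf.deco_bar hR, dterm, splitSum_tm, map_splitSum (superExt 𝓡 _ _),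
      map_splitSum (lact 𝓡 _ _), ← splitSum_zsmul]
    refine splitSum_congr fun u v huv => ?_
    rw [tm_splitSum, map_splitSum (superExt 𝓡 _ _), ← splitSum_zsmul]
    refine splitSum_congr fun v' w' hvw => ?_
    subst huv hvw hs ht
    have hmm := letH_mem_parSub 𝓡 hm
    rw [lact_tm 𝓡 hR hmm, zsmul_tm, map_zsmul, xi_tm 𝓡 hR (homF_wd 𝓡) hν (hP u) (hS v)
      (cat_mem_parSub 𝓡 hmm (hf.homF v')), sgn_smul_sgn_smul, sgn_smul_sgn_smul]
    simp only [superExt_wd]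
    refine sgn_smul_congr ?_ rfl
    simp only [par_list, par_prod, Q.eps_append, Q.eps_cons]
    ring
  rw [splitSum_congr fun s₁ s₂ hs => splitSum_congr fun t₁ t₂ ht => e1 s₁ s₂ t₁ t₂ hs ht,
    splitSum_middle s t fun u v s₂ t₁ v' w' =>
        sgn (k₁ * p + (k₁ + q + k) * Q.eps u + k * Q.eps v) •
          tm 𝓡 (P u) (catHom 𝓡 (letH (superExt 𝓡 k₁ ν
            (tm 𝓡 (S v) (catHom 𝓡 (letH (μ (s₂, x :: t₁))) (f v'))))) (f w')),
    gop, ← splitSum_zsmul]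
  refine splitSum_congr fun u r _ => ?_
  rw [← splitSum_zsmul]
  refine splitSum_congr fun t' w' _ => ?_
  rw [cmp, gop, map_splitSum (superExt 𝓡 _ _), map_splitSum (letH (R := R) (Q := Q')), splitSum_cat, tm_splitSum,
    ← splitSum_zsmul, ← splitSum_zsmul]
  refine splitSum_congr fun v s₂ _ => ?_
  rw [map_splitSum (superExt 𝓡 _ _), map_splitSum (letH (R := R) (Q := Q')), splitSum_cat, tm_splitSum,
    ← splitSum_zsmul, ← splitSum_zsmul]
  refine splitSum_congr fun t₁ v' ht => ?_
  rw [map_zsmul, map_zsmul, zsmul_cat, tm_zsmul, sgn_smul_sgn_smul, sgn_smul_sgn_smul]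
  refine sgn_smul_congr ?_ rfl
  ring

/-- The composition of a coderivation with the operator `A ⊗ μ ⊗ f`. -/
theorem dpsi_gop (hR : IsSuperComm 𝓡) {p' q' : ZMod 2} {P S P' S' : List Q.B → (List Q'.B →₀ R)}
    {ψ : List Q'.B → (Q'.B →₀ R)}
    {F : List Q.B → (Q'.B →₀ R)} {f : List Q.B → (List Q'.B →₀ R)} (hψ : HomF 𝓡 j ψ)
    (hA : HomF 𝓡 a A) (hP : HomF 𝓡 p P) (hS : HomF 𝓡 q S) (hP' : HomF 𝓡 p' P')
    (hS' : HomF 𝓡 q' S')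
    (hdA : ∀ l, superExt 𝓡 0 deco (A l) = dterm 𝓡 q P S l + dterm 𝓡 q' P' S' l)
    (hμ : HomF 𝓡 k μ) (hf : IsBar 𝓡 F f) (p₀ : List Q.B × List Q.B) :
    superExt 𝓡 j (dpsi 𝓡 j ψ) (gop 𝓡 k 0 A μ f p₀) =
      gop 𝓡 k 0 (cmp 𝓡 j (der 𝓡 wd j ψ) A) μ f p₀ +
      (sgn (j * p) • gop 𝓡 (j + (q + k)) 0 P (cmp 𝓡 j (unmark ψ) (gop 𝓡 k 0 S μ f)) f p₀ +
        sgn (j * p') •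
          gop 𝓡 (j + (q' + k)) 0 P' (cmp 𝓡 j (unmark ψ) (gop 𝓡 k 0 S' μ f)) f p₀) +
      sgn (j * (a + k)) • gop 𝓡 k j A μ (cmp 𝓡 j (der 𝓡 wd j ψ) f) p₀ := by
  obtain ⟨s, _ | ⟨x, t⟩⟩ := p₀
  · simp [gop]
  have hu := homF_unmark 𝓡 hψ
  rw [← xi_dterm 𝓡 hR hu hP hS hμ hf, ← xi_dterm 𝓡 hR hu hP' hS' hμ hf]
  simp only [gop]
  rw [map_splitSum (superExt 𝓡 _ _), ← splitSum_zsmul, ← splitSum_add, ← splitSum_add,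
    ← splitSum_add]
  refine splitSum_congr fun s₁ s₂ hs => ?_
  rw [map_splitSum (superExt 𝓡 _ _), ← splitSum_zsmul, ← splitSum_add, ← splitSum_add,
    ← splitSum_add]
  refine splitSum_congr fun t₁ t₂ ht => ?_
  subst hs ht
  rw [map_zsmul, dpsi_tm_cat 𝓡 hR hψ (hA s₁) (hμ _),
    gop_tm_cat 𝓡 hR (hμ _), hdA, add_tm, map_add, smul_add, smul_add, smul_add]
  simp only [sgn_smul_sgn_smul]
  refine congr_arg₂ _ (congr_arg₂ _ (sgn_smul_congr ?_ rfl) (congr_arg₂ _ (sgn_smul_congr ?_ rfl)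
    (sgn_smul_congr ?_ rfl))) (sgn_smul_congr ?_ rfl)
  · ring
  · ring
  · ring
  · simp only [par_list, par_prod, Q.eps_append, Q.eps_cons]
    ring

end Marked

section Marked

variable {K R : Type*} [Field K] [Ring R] [Algebra K R]
variable (𝓡 : ZMod 2 → Submodule K R) [GradedAlgebra 𝓡]
variable {Ob Ob' Ob'' : Type*} {Q : HomBasis Ob} {Q' : HomBasis Ob'} {Q'' : HomBasis Ob''}

variable {a k c j q p : ZMod 2} {A : List Q.B → (List Q'.B →₀ R)}
  {μ : List Q.B × List Q.B → (Q'.B →₀ R)} {A' : List Q.B → (List Q'.B →₀ R)}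

/-! ### Supports -/

section Support

theorem tm_mem_supported {X Y : Type*} [Par X] [Par Y] {S : Set X} {T : Set Y} {U : Set (X × Y)}
    (h : ∀ x ∈ S, ∀ y ∈ T, (x, y) ∈ U) {a : X →₀ R} {b : Y →₀ R}
    (ha : a ∈ supported R R S) (hb : b ∈ supported R R T) :
    tm 𝓡 a b ∈ supported R R U := by
  classical
  rw [← Finsupp.sum_single a, ← Finsupp.sum_single b, Finsupp.sum, Finsupp.sum, map_sum (tm 𝓡),
    AddMonoidHom.finsetSum_apply]
  refine sum_mem fun x hx => ?_
  rw [map_sum]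
  refine sum_mem fun y hy => ?_
  rw [tm_single_single]
  exact single_mem_supported R _ (h x (ha hx) y (hb hy))

theorem superExt_mem_supported' {X Y : Type*} (i : ZMod 2) {S : Set X} {U : Set Y}
    {f : X → (Y →₀ R)} (hf : ∀ x ∈ S, f x ∈ supported R R U) {a : X →₀ R}
    (ha : a ∈ supported R R S) : superExt 𝓡 i f a ∈ supported R R U :=
  superExt_mem_supported 𝓡 i hf ha

theorem cat_mem_supported {S T U : Set (List Q.B)} (h : ∀ x ∈ S, ∀ y ∈ T, x ++ y ∈ U)
    {a b : List Q.B →₀ R} (ha : a ∈ supported R R S)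
    (hb : b ∈ supported R R T) : catHom 𝓡 a b ∈ supported R R U := by
  refine superExt_mem_supported' 𝓡 0 (S := {p | p.1 ++ p.2 ∈ U}) (fun p hp => ?_)
    (tm_mem_supported 𝓡 h ha hb)
  exact single_mem_supported R _ hp

theorem letH_mem_supported {S : Set Q.B} {U : Set (List Q.B)} (h : ∀ x ∈ S, [x] ∈ U)
    {a : Q.B →₀ R} (ha : a ∈ supported R R S) : letH a ∈ supported R R U := by
  classical
  rw [← Finsupp.sum_single a, Finsupp.sum, map_sum]
  refine sum_mem fun x hx => ?_
  rw [letH_single]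
  exact single_mem_supported R _ (h x (ha hx))

theorem splitSum_mem' {B M : Type*} [AddCommGroup M] [Module R M] {N : Submodule R M} {l : List B}
    {f : List B → List B → M} (h : ∀ a b, a ++ b = l → f a b ∈ N) : splitSum l f ∈ N :=
  sum_mem fun i _ => h _ _ (List.take_append_drop i l)

theorem mem_supported_univ {X : Type*} (a : X →₀ R) : a ∈ supported R R Set.univ := by
  simp

theorem zsmul_mem' {M : Type*} [AddCommGroup M] [Module R M] {N : Submodule R M} {x : M}
    (h : x ∈ N) (n : ℤ) : n • x ∈ N :=
  N.toAddSubgroup.zsmul_mem h n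

/-- The span of the marked words. -/
def marked : Set (List Q.B × List Q.B) := {p | p.2 ≠ []}

theorem tm_cat_mem_marked (s : List Q.B →₀ R) (y : Q.B →₀ R) (t : List Q.B →₀ R) :
    tm 𝓡 s (catHom 𝓡 (letH y) t) ∈ supported R R (marked (Q := Q)) := by
  refine tm_mem_supported 𝓡 (S := Set.univ) (T := {l | l ≠ []}) (fun _ _ _ h => h)
    (mem_supported_univ _) (cat_mem_supported 𝓡 (S := {l | l ≠ []}) (T := Set.univ) ?_
      (letH_mem_supported (S := Set.univ) (fun x _ => List.cons_ne_nil _ _)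
        (mem_supported_univ _)) (mem_supported_univ _))
  intro x hx y _ h
  exact hx (List.append_eq_nil_iff.1 h).1

theorem gop_mem_marked (p : List Q.B × List Q.B) :
    gop 𝓡 k c A μ A' p ∈ supported R R (marked (Q := Q')) := by
  obtain ⟨s, _ | ⟨x, t⟩⟩ := p
  · exact zero_mem _
  · rw [gop]
    exact splitSum_mem' fun _ _ _ => splitSum_mem' fun _ _ _ =>
      zsmul_mem' (tm_cat_mem_marked 𝓡 _ _ _) _

end Support

/-! ### Bar maps and coderivations at a marked word -/

theorem mult_gop (s : List Q.B) (x : Q.B) (t : List Q.B) :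
    superExt 𝓡 0 app (gop 𝓡 k c A μ A' (s, x :: t)) =
      splitSum s fun s₁ s₂ => splitSum t fun t₁ t₂ =>
        sgn (k * Q.eps s₁ + c * (Q.eps s + Q.rdeg x + Q.eps t₁)) •
          catHom 𝓡 (A s₁) (catHom 𝓡 (letH (μ (s₂, x :: t₁))) (A' t₂)) := by
  simp only [gop, map_splitSum, map_zsmul]
  rfl

/-- The operator `ψ ⋆ f`. -/
def lder (f : List Q.B → (List Q'.B →₀ R)) (ψ : List Q.B → (Q'.B →₀ R)) (l : List Q.B) :
    List Q'.B →₀ R := splitSum l fun v w => catHom 𝓡 (letH (ψ v)) (f w)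

section Bar

variable {𝓡} {F : List Q.B → (Q'.B →₀ R)} {f : List Q.B → (List Q'.B →₀ R)}

theorem IsBar.append (h : IsBar 𝓡 F f) (s : List Q.B) (x : Q.B) (t : List Q.B) :
    f (s ++ x :: t) = splitSum s fun s₁ s₂ => splitSum t fun t₁ t₂ =>
      catHom 𝓡 (f s₁) (catHom 𝓡 (letH (F (s₂ ++ x :: t₁))) (f t₂)) := by
  induction hn : s.length using Nat.strong_induction_on generalizing s with
  | _ n ih =>
    rw [h.rec_left _ (by simp), splitSum_append]
    have e1 : (splitSum s fun a b => catHom 𝓡 (letH (F a)) (f (b ++ x :: t))) =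
        splitSum s fun r s₂ => splitSum r fun a s₁ => splitSum t fun t₁ t₂ =>
          catHom 𝓡 (letH (F a)) (catHom 𝓡 (f s₁)
            (catHom 𝓡 (letH (F (s₂ ++ x :: t₁))) (f t₂))) := by
      rw [splitSum_assoc s fun a s₁ s₂ => splitSum t fun t₁ t₂ =>
          catHom 𝓡 (letH (F a)) (catHom 𝓡 (f s₁)
            (catHom 𝓡 (letH (F (s₂ ++ x :: t₁))) (f t₂)))]
      refine splitSum_congr fun a b hab => ?_
      by_cases ha : a = []
      · subst ha
        simp [h.nil, splitSum_zero]
      · rw [ih b.length (by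
          subst hn hab
          have := List.length_pos_iff.2 ha
          rw [List.length_append]
          omega) b rfl, cat_splitSum]
        simp only [cat_splitSum]
    have e2 : ∀ s₁ s₂, (splitSum t fun t₁ t₂ =>
        catHom 𝓡 (f s₁) (catHom 𝓡 (letH (F (s₂ ++ x :: t₁))) (f t₂))) =
        (splitSum t fun t₁ t₂ => catHom 𝓡 (if s₁ = [] then wd [] else 0)
          (catHom 𝓡 (letH (F (s₂ ++ x :: t₁))) (f t₂))) +
        splitSum s₁ fun a s₁ => splitSum t fun t₁ t₂ =>
          catHom 𝓡 (letH (F a)) (catHom 𝓡 (f s₁)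
            (catHom 𝓡 (letH (F (s₂ ++ x :: t₁))) (f t₂))) := by
      intro s₁ s₂
      rw [splitSum_comm, ← splitSum_add]
      refine splitSum_congr fun t₁ t₂ _ => ?_
      conv_lhs => rw [h.rec_left' s₁]
      rw [add_cat, splitSum_cat]
      simp only [cat_assoc]
    rw [e1, splitSum_congr fun s₁ s₂ _ => e2 s₁ s₂, splitSum_add, add_comm]
    congr 1
    refine Eq.trans ?_ (splitSum_eq_left ?_).symm
    · simp [one_cat]
    · intro u v _ hu
      simp [if_neg hu, splitSum_zero]

theorem IsBar.append' (h : IsBar 𝓡 F f) (s : List Q.B) (x : Q.B) (t : List Q.B) :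
    f (s ++ x :: t) = superExt 𝓡 0 app (gop 𝓡 0 0 f (unmark F) f (s, x :: t)) := by
  rw [h.append, mult_gop]
  simp only [zero_mul, add_zero, sgn_zero, one_smul]
  rfl

variable {ψ : List Q.B → (Q'.B →₀ R)}

theorem IsBar.lder_append (h : IsBar 𝓡 F f) (ψ : List Q.B → (Q'.B →₀ R)) (s : List Q.B)
    (x : Q.B) (t : List Q.B) :
    lder 𝓡 f ψ (s ++ x :: t) =
      (splitSum s fun s₁ s₂ => splitSum t fun t₁ t₂ =>
        catHom 𝓡 (lder 𝓡 f ψ s₁)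
          (catHom 𝓡 (letH (F (s₂ ++ x :: t₁))) (f t₂))) +
      splitSum t fun t₁ t₂ => catHom 𝓡 (letH (ψ (s ++ x :: t₁))) (f t₂) := by
  rw [lder, splitSum_append]
  congr 1
  simp only [lder, h.append, cat_splitSum, splitSum_cat, cat_assoc]
  rw [← splitSum_assoc s fun v w s₂ => splitSum t fun t₁ t₂ => catHom 𝓡 (letH (ψ v))
    (catHom 𝓡 (f w) (catHom 𝓡 (letH (F (s₂ ++ x :: t₁))) (f t₂)))]
  exact splitSum_congr fun _ _ _ => splitSum_comm _ _ _

theorem der_eq (l : List Q.B) : der 𝓡 f j ψ l = splitSum l fun u r => sgn (j * Q.eps u) •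
    catHom 𝓡 (f u) (lder 𝓡 f ψ r) := by
  simp only [der, lder, cat_splitSum, ← splitSum_zsmul]

theorem IsBar.der_append (h : IsBar 𝓡 F f) (s : List Q.B) (x : Q.B) (t : List Q.B) :
    der 𝓡 f j ψ (s ++ x :: t) = superExt 𝓡 0 app
      (gop 𝓡 0 0 (der 𝓡 f j ψ) (unmark F) f (s, x :: t) +
        gop 𝓡 j 0 f (unmark ψ) f (s, x :: t) +
        gop 𝓡 0 j f (unmark F) (der 𝓡 f j ψ) (s, x :: t)) := by
  rw [map_add, map_add, mult_gop, mult_gop, mult_gop, der_eq, splitSum_append]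
  simp only [h.lder_append ψ]
  congr 1
  · simp only [map_add, smul_add, splitSum_add]
    congr 1
    · simp only [zero_mul, add_zero, sgn_zero, one_smul, der_eq]
      simp only [splitSum_cat, cat_splitSum, ← splitSum_zsmul, zsmul_cat, cat_assoc]
      rw [← splitSum_assoc s fun u r s₂ => splitSum t fun t₁ t₂ => sgn (j * Q.eps u) •
        catHom 𝓡 (f u) (catHom 𝓡 (lder 𝓡 f ψ r) (catHom 𝓡 (letH (F (s₂ ++ x :: t₁))) (f t₂)))]
      exact splitSum_congr fun _ _ _ => splitSum_comm _ _ _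
    · simp only [zero_mul, add_zero, cat_splitSum, ← splitSum_zsmul]
      rfl
  · simp only [zero_mul, zero_add, der_eq, h.append]
    simp only [splitSum_cat, cat_splitSum, ← splitSum_zsmul, cat_zsmul, cat_assoc,
      sgn_smul_sgn_smul]
    rw [splitSum_comm]
    refine splitSum_congr fun s₁ s₂ _ => ?_
    rw [← splitSum_assoc t fun t₁ u r => sgn (j * (Q.eps s + Q.rdeg x + Q.eps t₁) + j * Q.eps u) •
      catHom 𝓡 (f s₁) (catHom 𝓡 (letH (unmark F (s₂, x :: t₁))) (catHom 𝓡 (f u) (lder 𝓡 f ψ r)))]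
    refine splitSum_congr fun u r _ => splitSum_congr fun t₁ t₂ ht => sgn_smul_congr ?_ rfl
    subst ht
    simp only [Q.eps_append, Q.eps_cons]
    ring

end Bar

end Marked

section Marked

variable {K R : Type*} [Field K] [Ring R] [Algebra K R]
variable (𝓡 : ZMod 2 → Submodule K R) [GradedAlgebra 𝓡]
variable {Ob Ob' Ob'' : Type*} {Q : HomBasis Ob} {Q' : HomBasis Ob'} {Q'' : HomBasis Ob''}

variable {a k c i j q p : ZMod 2} {A : List Q.B → (List Q'.B →₀ R)}
  {μ : List Q.B × List Q.B → (Q'.B →₀ R)} {A' : List Q.B → (List Q'.B →₀ R)}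

/-! ### Coderivations and the concatenation of a marked word -/

theorem gop_idLet (A A' : List Q.B → (List Q.B →₀ R)) (s : List Q.B) (x : Q.B) (t : List Q.B) :
    gop 𝓡 k c A (unmark idLet) A' (s, x :: t) = sgn (k * Q.eps s + c * (Q.eps s + Q.rdeg x)) •
      tm 𝓡 (A s) (catHom 𝓡 (wd [x]) (A' t)) := by
  rw [gop, splitSum_eq_right, splitSum_eq_left]
  · simp [unmark, idLet, letH_wd, Q.eps_nil]
  · intro u v _ hu
    rw [unmark, idLet_eq_zero (by simpa using hu)]
    simp
  · intro u v _ hv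
    refine splitSum_eq_zero fun u' v' _ => ?_
    rw [unmark, idLet_eq_zero (by have := List.length_pos_iff.2 hv; simp; omega)]
    simp

theorem mult_dpsi (ψ : List Q.B → (Q.B →₀ R)) (s : List Q.B) (x : Q.B) (t : List Q.B) :
    superExt 𝓡 0 app (dpsi 𝓡 j ψ (s, x :: t)) = der 𝓡 wd j ψ (s ++ x :: t) := by
  rw [(isBar_id 𝓡).der_append, gop_idLet, gop_idLet, dpsi]
  simp [wd_cat_wd, sgn_zero]

theorem mult_dpsi_ext (ψ : List Q.B → (Q.B →₀ R)) {t : List Q.B × List Q.B →₀ R}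
    (ht : t ∈ supported R R (marked (Q := Q))) :
    superExt 𝓡 0 app (superExt 𝓡 j (dpsi 𝓡 j ψ) t) =
      superExt 𝓡 j (der 𝓡 wd j ψ) (superExt 𝓡 0 app t) := by
  rw [superExt_comp, superExt_comp, zero_add, add_zero]
  refine superExt_congr_supported 𝓡 j (fun p hp => ?_) ht
  obtain ⟨s, _ | ⟨x, t⟩⟩ := p
  · exact absurd rfl hp
  · rw [mult_dpsi, app, superExt_single_one]

theorem superExt_idLet_letH (y : Q.B →₀ R) : superExt 𝓡 i (idLet (Q := Q) (R := R)) (letH y) =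
    superExt 𝓡 i wd y := by
  induction y using Finsupp.induction_linear with
  | zero => simp
  | add u v hu hv => simp only [map_add, hu, hv]
  | single x r => rw [letH_single, superExt_single, superExt_single, idLet]

theorem superExt_idLet_cat {u v : List Q.B} (y : Q.B →₀ R) (h : u ≠ [] ∨ v ≠ []) :
    superExt 𝓡 i (idLet (Q := Q) (R := R)) (catHom 𝓡 (wd u) (catHom 𝓡 (letH y) (wd v))) = 0 := by
  induction y using Finsupp.induction_linear with
  | zero => simp
  | add u v hu hv => simp only [map_add, AddMonoidHom.add_apply, hu, hv, add_zero]
  | single x r =>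
    rw [letH_single, cat_single_single, cat_single_single, superExt_single, idLet_eq_zero, smul_zero]
    rcases h with h | h
    · have := List.length_pos_iff.2 h
      simp; omega
    · have := List.length_pos_iff.2 h
      simp; omega

theorem superExt_idLet_der (ψ : List Q.B → (Q.B →₀ R)) (l : List Q.B) :
    superExt 𝓡 0 idLet (der 𝓡 wd j ψ l) = ψ l := by
  rw [der, map_splitSum, splitSum_eq_left, map_splitSum, splitSum_eq_right]
  · simp [one_cat, cat_one, Q.eps_nil, sgn_zero, superExt_idLet_letH, superExt_wd]
  · intro u v _ hv
    rw [map_zsmul, superExt_idLet_cat 𝓡 _ (Or.inr hv), smul_zero]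
  · intro u v _ hu
    rw [map_splitSum]
    refine splitSum_eq_zero fun a b _ => ?_
    rw [map_zsmul, superExt_idLet_cat 𝓡 _ (Or.inl hu), smul_zero]

/-! ### Compositions of coderivations with the operators of a coalgebra map -/

section Rules

variable {𝓡} {F : List Q.B → (Q'.B →₀ R)} {f : List Q.B → (List Q'.B →₀ R)}

theorem homF_zero {X Y : Type*} [Par X] [Par Y] : HomF 𝓡 i (fun _ : X => (0 : Y →₀ R)) :=
  fun _ => zero_mem _

theorem dterm_zero (l : List Q.B) :
    dterm 𝓡 q (fun _ => (0 : List Q'.B →₀ R)) (fun _ => 0) l = 0 := by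
  simp [dterm, splitSum_zero]

theorem gop_zero_left (r : List Q.B × List Q.B) :
    gop 𝓡 k c (fun _ => (0 : List Q'.B →₀ R)) μ A' r = 0 := by
  obtain ⟨s, _ | ⟨x, t⟩⟩ := r
  · rfl
  · simp [gop, splitSum_zero]

theorem IsBar.dpsi_gop_bar (hR : IsSuperComm 𝓡) (h : IsBar 𝓡 F f) {ψ : List Q'.B → (Q'.B →₀ R)}
    (hψ : HomF 𝓡 j ψ) (hμ : HomF 𝓡 k μ) (r : List Q.B × List Q.B) :
    superExt 𝓡 j (dpsi 𝓡 j ψ) (gop 𝓡 k 0 f μ f r) =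
      gop 𝓡 k 0 (cmp 𝓡 j (der 𝓡 wd j ψ) f) μ f r +
      gop 𝓡 (j + k) 0 f (cmp 𝓡 j (unmark ψ) (gop 𝓡 k 0 f μ f)) f r +
      sgn (j * k) • gop 𝓡 k j f μ (cmp 𝓡 j (der 𝓡 wd j ψ) f) r := by
  rw [dpsi_gop 𝓡 hR hψ h.homF h.homF h.homF (homF_zero (i := 0)) (homF_zero (i := 0)) (fun l => by
    rw [h.deco_bar hR, dterm_zero, add_zero, dterm]
    simp only [zero_mul, sgn_zero, one_smul]) hμ h, gop_zero_left]
  simp only [mul_zero, sgn_zero, one_smul, smul_zero, add_zero, zero_add]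

theorem IsBar.dpsi_gop_der (hR : IsSuperComm 𝓡) (h : IsBar 𝓡 F f) {ψ : List Q'.B → (Q'.B →₀ R)}
    (hψ : HomF 𝓡 j ψ) {φ : List Q.B → (Q'.B →₀ R)} (hφ : HomF 𝓡 i φ)
    (hμ : HomF 𝓡 k μ) (r : List Q.B × List Q.B) :
    superExt 𝓡 j (dpsi 𝓡 j ψ) (gop 𝓡 k 0 (der 𝓡 f i φ) μ f r) =
      gop 𝓡 k 0 (cmp 𝓡 j (der 𝓡 wd j ψ) (der 𝓡 f i φ)) μ f r +
      (sgn (j * i) •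
          gop 𝓡 (j + k) 0 (der 𝓡 f i φ) (cmp 𝓡 j (unmark ψ) (gop 𝓡 k 0 f μ f)) f r +
        gop 𝓡 (j + (i + k)) 0 f (cmp 𝓡 j (unmark ψ) (gop 𝓡 k 0 (der 𝓡 f i φ) μ f)) f r) +
      sgn (j * (i + k)) • gop 𝓡 k j (der 𝓡 f i φ) μ (cmp 𝓡 j (der 𝓡 wd j ψ) f) r := by
  have hd := homF_der h.homF hφ
  rw [dpsi_gop 𝓡 hR hψ hd hd h.homF h.homF hd (fun l => by
    rw [h.deco_der hR hφ, dterm, dterm, splitSum_add]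
    simp only [zero_mul, sgn_zero, one_smul]) hμ h]
  simp only [mul_zero, sgn_zero, one_smul, zero_add]

end Rules

/-! ### A-infinity structures -/

/-- An A-infinity structure, as a map on words. -/
structure IsDiff (m : List Q.B → (Q.B →₀ R)) : Prop where
  hom : HomF 𝓡 1 m
  nil : m [] = 0
  ainf : ∀ l, superExt 𝓡 1 m (der 𝓡 wd 1 m l) = 0

/-- An A-infinity map, satisfying its equation on the words in `P`. -/
structure IsMor (P : List Q.B → Prop) (m : List Q.B → (Q.B →₀ R)) (m' : List Q'.B → (Q'.B →₀ R))
    (F : List Q.B → (Q'.B →₀ R)) (f : List Q.B → (List Q'.B →₀ R)) : Prop where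
  bar : IsBar 𝓡 F f
  sub : ∀ u v, P (u ++ v) → P u ∧ P v
  ainf : ∀ l, P l → superExt 𝓡 1 m' (f l) = superExt 𝓡 0 F (der 𝓡 wd 1 m l)

variable {𝓡} {m : List Q.B → (Q.B →₀ R)} {m' : List Q'.B → (Q'.B →₀ R)}
  {F : List Q.B → (Q'.B →₀ R)} {f : List Q.B → (List Q'.B →₀ R)} {P : List Q.B → Prop}

theorem isMor_id (m : List Q.B → (Q.B →₀ R)) : IsMor 𝓡 (fun _ => True) m m idLet wd where
  bar := isBar_id 𝓡
  sub _ _ _ := ⟨trivial, trivial⟩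
  ainf l _ := by rw [superExt_single_one, superExt_idLet_der]

theorem der_nil {ψ : List Q.B → (Q'.B →₀ R)} (h : ψ [] = 0) : der 𝓡 f j ψ [] = 0 := by
  simp [der, splitSum_nil, h]

theorem IsDiff.dpsi_dpsi (hR : IsSuperComm 𝓡) (h : IsDiff 𝓡 m) (s : List Q.B) (x : Q.B)
    (t : List Q.B) :
    superExt 𝓡 1 (dpsi 𝓡 1 m) (dpsi 𝓡 1 m (s, x :: t)) =
      tm 𝓡 (superExt 𝓡 1 (der 𝓡 wd 1 m) (der 𝓡 wd 1 m s)) (wd (x :: t)) +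
      tm 𝓡 (wd s) (catHom 𝓡 (wd [x]) (superExt 𝓡 1 (der 𝓡 wd 1 m) (der 𝓡 wd 1 m t))) := by
  have hd := homF_der (homF_wd 𝓡) h.hom
  have hu := homF_unmark 𝓡 h.hom
  have hx := wd_letter_mem 𝓡 x
  have e0 : ∀ r, superExt 𝓡 (0 + 1 + 0) (gop 𝓡 1 0 wd (unmark m) wd) (dpsi 𝓡 1 m r) =
      -gop 𝓡 1 0 (der 𝓡 wd 1 m) (unmark m) wd r + gop 𝓡 1 1 wd (unmark m) (der 𝓡 wd 1 m) r := by
    intro r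
    rw [gop_dpsi 𝓡 hR (homF_wd 𝓡) hu h.hom]
    have z : gop 𝓡 (1 + 1) 0 wd (cmp 𝓡 1 (unmark m) (dpsi 𝓡 1 m)) wd r = 0 := by
      obtain ⟨s, _ | ⟨x, t⟩⟩ := r
      · rfl
      refine (gop_congr 𝓡 (fun _ _ _ => rfl) (ν := fun _ => 0) (fun u v v' w _ _ => ?_)
        (fun _ _ _ => rfl)).trans ?_
      · rw [cmp, superExt_unmark, mult_dpsi, h.ainf]
      · simp [gop, splitSum_zero]
    have e : ∀ A : List Q.B → (List Q.B →₀ R), cmp 𝓡 0 wd A = A := fun A => by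
      funext l
      rw [cmp, superExt_wd]
    rw [z, e, zero_add, add_zero, one_mul, zero_mul, sgn_one, sgn_zero, smul_zero, add_zero,
      neg_smul, one_smul]
  have e1 := dpsi_tm_cat 𝓡 hR h.hom (hd s) hx (wd t)
  have e2 := dpsi_tm_cat 𝓡 hR h.hom (wd_mem 𝓡 s) hx (der 𝓡 wd 1 m t)
  have e3 := (isBar_id 𝓡).dpsi_gop_bar hR h.hom hu (s, x :: t)
  rw [letH_wd, wd_cat_wd, List.singleton_append] at e1
  rw [letH_wd] at e2
  have e4 := e0 (s, x :: t)
  have e5 := gop_comp_mid 𝓡 hR (c := 0) (A' := wd) (homF_wd 𝓡) hu h.hom s x t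
  have e6 : ∀ l, cmp 𝓡 1 (der 𝓡 wd 1 m) wd l = der 𝓡 wd 1 m l := fun l => by
    rw [cmp, superExt_single_one]
  rw [funext e6] at e3
  simp only [one_mul, zero_mul, sgn_zero, one_smul, sgn_one, neg_smul] at e3 e5
  rw [dpsi, map_add, map_add, map_zsmul] at e4
  rw [dpsi, map_add, map_add, map_zsmul, e1, e2, e3]
  simp only [superExt_single_one, par_list, smul_add, one_mul, sgn_smul_self] at e4 ⊢
  have e7 : ∀ y : List Q.B × List Q.B →₀ R, sgn (1 + Q.eps s + Q.rdeg x) • y =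
      -(sgn (Q.eps s + Q.rdeg x) • y) := fun y => by
    rw [add_assoc, add_comm, sgn_add_one_smul]
  rw [e7]
  rw [e5] at e4
  have e8 : gop 𝓡 (1 + 1) 0 wd (fun r => superExt 𝓡 1 (unmark m) (gop 𝓡 1 0 wd (unmark m) wd r)) wd
      (s, x :: t) = gop 𝓡 (1 + 1) 0 wd (cmp 𝓡 1 (unmark m) (gop 𝓡 1 0 wd (unmark m) wd)) wd
      (s, x :: t) := rfl
  rw [e8] at e4
  rw [← sub_eq_zero] at e4 ⊢
  rw [← e4]
  abel

theorem IsDiff.sq (hR : IsSuperComm 𝓡) (h : IsDiff 𝓡 m) (l : List Q.B) :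
    superExt 𝓡 1 (der 𝓡 wd 1 m) (der 𝓡 wd 1 m l) = 0 := by
  induction l with
  | nil => rw [der_nil h.nil, map_zero]
  | cons x l ih =>
    have h1 := h.dpsi_dpsi hR [] x l
    rw [der_nil h.nil, map_zero, ih] at h1
    have h2 := congr_arg (superExt 𝓡 0 (app (R := R) (Q := Q))) h1
    have h3 : dpsi 𝓡 1 m ([], x :: l) ∈ supported R R (marked (Q := Q)) := by
      rw [dpsi]
      refine add_mem (add_mem ?_ (gop_mem_marked 𝓡 _)) (zsmul_mem' ?_ _)
      · rw [wd_cons_eq 𝓡, ← letH_wd]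
        exact tm_cat_mem_marked 𝓡 _ _ _
      · rw [← letH_wd]
        exact tm_cat_mem_marked 𝓡 _ _ _
    rw [mult_dpsi_ext 𝓡 m h3, mult_dpsi] at h2
    simpa using h2

theorem IsDiff.dpsi_sq (hR : IsSuperComm 𝓡) (h : IsDiff 𝓡 m) (r : List Q.B × List Q.B) :
    superExt 𝓡 1 (dpsi 𝓡 1 m) (dpsi 𝓡 1 m r) = 0 := by
  obtain ⟨s, _ | ⟨x, t⟩⟩ := r
  · simp [dpsi]
  · rw [h.dpsi_dpsi hR, h.sq hR, h.sq hR]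
    simp

end Marked

section Marked

variable {K R : Type*} [Field K] [Ring R] [Algebra K R]
variable {𝓡 : ZMod 2 → Submodule K R} [GradedAlgebra 𝓡]
variable {Ob Ob' Ob'' : Type*} {Q : HomBasis Ob} {Q' : HomBasis Ob'} {Q'' : HomBasis Ob''}

variable {a k c i j q p : ZMod 2} {A : List Q.B → (List Q'.B →₀ R)}
  {μ : List Q.B × List Q.B → (Q'.B →₀ R)} {A' : List Q.B → (List Q'.B →₀ R)}
variable {m : List Q.B → (Q.B →₀ R)} {m' : List Q'.B → (Q'.B →₀ R)}
  {F : List Q.B → (Q'.B →₀ R)} {f : List Q.B → (List Q'.B →₀ R)} {P : List Q.B → Prop}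

/-! ### The identities of an A-infinity map on marked words -/

theorem IsMor.sub_left (h : IsMor 𝓡 P m m' F f) {u v l : List Q.B} (hl : u ++ v = l) (hP : P l) :
    P u := by
  subst hl
  exact (h.sub u v hP).1

theorem IsMor.sub_right (h : IsMor 𝓡 P m m' F f) {u v l : List Q.B} (hl : u ++ v = l)
    (hP : P l) : P v := by
  subst hl
  exact (h.sub u v hP).2

theorem IsMor.sub_mid (h : IsMor 𝓡 P m m' F f) {s t u v v' w : List Q.B} {x : Q.B}
    (hs : u ++ v = s) (ht : v' ++ w = t) (hP : P (s ++ x :: t)) : P (v ++ x :: v') := by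
  refine h.sub_left (v := w) rfl (h.sub_right (u := u) (l := s ++ x :: t) ?_ hP)
  subst hs ht
  simp

/-- The operator `G_F = f ⊗ F ⊗ f`. -/
abbrev gbar (𝓡 : ZMod 2 → Submodule K R) [GradedAlgebra 𝓡] (f : List Q.B → (List Q'.B →₀ R))
    (F : List Q.B → (Q'.B →₀ R)) : List Q.B × List Q.B → (List Q'.B × List Q'.B →₀ R) :=
  gop 𝓡 0 0 f (unmark F) f

theorem IsBar.homF_gbar (h : IsBar 𝓡 F f) : HomF 𝓡 0 (gbar 𝓡 f F) := by
  have := homF_gop 𝓡 h.homF (homF_unmark 𝓡 h.hom) h.homF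
  rwa [add_zero, add_zero] at this

theorem IsMor.dpsi_gbar_aux (hR : IsSuperComm 𝓡) (hm : HomF 𝓡 1 m) (hm' : HomF 𝓡 1 m')
    (h : IsMor 𝓡 P m m' F f) {s : List Q.B} {x : Q.B} {t : List Q.B} (hP : P (s ++ x :: t))
    (hs : ∀ u v, u ++ v = s → cmp 𝓡 1 (der 𝓡 wd 1 m') f u = cmp 𝓡 0 f (der 𝓡 wd 1 m) u)
    (ht : ∀ u v, u ++ v = t → cmp 𝓡 1 (der 𝓡 wd 1 m') f v = cmp 𝓡 0 f (der 𝓡 wd 1 m) v) :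
    superExt 𝓡 1 (dpsi 𝓡 1 m') (gbar 𝓡 f F (s, x :: t)) =
      superExt 𝓡 0 (gbar 𝓡 f F) (dpsi 𝓡 1 m (s, x :: t)) := by
  have e1 := gop_dpsi 𝓡 hR (c := 0) (A' := f) h.bar.homF (homF_unmark 𝓡 h.bar.hom) hm (s, x :: t)
  have e2 := h.bar.dpsi_gop_bar hR hm' (homF_unmark 𝓡 h.bar.hom) (s, x :: t)
  simp only [add_zero, zero_add, zero_mul, mul_zero, sgn_zero, one_smul] at e1 e2
  rw [e1, e2]
  refine congr_arg₂ _ (congr_arg₂ _ ?_ ?_) ?_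
  · exact gop_congr 𝓡 hs (fun _ _ _ _ _ _ => rfl) (fun _ _ _ => rfl)
  · refine gop_congr 𝓡 (fun _ _ _ => rfl) (fun u v v' w h1 h2 => ?_) (fun _ _ _ => rfl)
    rw [cmp, cmp, superExt_unmark, superExt_unmark, mult_dpsi, ← h.bar.append']
    exact h.ainf _ (h.sub_mid h1 h2 hP)
  · exact gop_congr 𝓡 (fun _ _ _ => rfl) (fun _ _ _ _ _ _ => rfl) ht

theorem dpsi_mem_marked (ψ : List Q.B → (Q.B →₀ R)) (r : List Q.B × List Q.B) :
    dpsi 𝓡 j ψ r ∈ supported R R (marked (Q := Q)) := by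
  obtain ⟨s, _ | ⟨x, t⟩⟩ := r
  · exact zero_mem _
  rw [dpsi]
  refine add_mem (add_mem ?_ (gop_mem_marked 𝓡 _)) (zsmul_mem' ?_ _)
  · rw [wd_cons_eq 𝓡, ← letH_wd]
    exact tm_cat_mem_marked 𝓡 _ _ _
  · rw [← letH_wd]
    exact tm_cat_mem_marked 𝓡 _ _ _

theorem IsBar.mult_gbar_ext (h : IsBar 𝓡 F f) {t : List Q.B × List Q.B →₀ R}
    (ht : t ∈ supported R R (marked (Q := Q))) :
    superExt 𝓡 0 app (superExt 𝓡 0 (gbar 𝓡 f F) t) = superExt 𝓡 0 f (superExt 𝓡 0 app t) := by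
  rw [superExt_comp, superExt_comp]
  refine superExt_congr_supported 𝓡 _ (fun p hp => ?_) ht
  obtain ⟨s, _ | ⟨x, t⟩⟩ := p
  · exact absurd rfl hp
  · rw [gbar, ← h.append', app, superExt_single_one]

theorem IsMor.comm (hR : IsSuperComm 𝓡) (hm : IsDiff 𝓡 m) (hm' : IsDiff 𝓡 m')
    (h : IsMor 𝓡 P m m' F f) (l : List Q.B) (hP : P l) :
    cmp 𝓡 1 (der 𝓡 wd 1 m') f l = cmp 𝓡 0 f (der 𝓡 wd 1 m) l := by
  induction hn : l.length using Nat.strong_induction_on generalizing l with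
  | _ n ih =>
    cases l with
    | nil => rw [cmp, cmp, der_nil hm.nil, h.bar.bar_nil, superExt_single_one, der_nil hm'.nil,
        map_zero]
    | cons x l =>
      have h1 := h.dpsi_gbar_aux hR hm.hom hm'.hom (s := []) hP (fun u v huv => by
          obtain ⟨rfl, rfl⟩ := List.append_eq_nil_iff.1 huv
          rw [cmp, cmp, der_nil hm.nil, h.bar.bar_nil, superExt_single_one, der_nil hm'.nil,
            map_zero]) (fun u v huv => ih v.length (by
          subst hn huv
          simp) v (h.sub_right (u := x :: u) (by rw [List.cons_append, huv]) hP) rfl)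
      have h2 := congr_arg (superExt 𝓡 0 (app (R := R) (Q := Q'))) h1
      rw [mult_dpsi_ext 𝓡 m' (gop_mem_marked 𝓡 _), ← h.bar.append',
        h.bar.mult_gbar_ext (dpsi_mem_marked _ _), mult_dpsi] at h2
      exact h2

theorem IsMor.dpsi_gbar (hR : IsSuperComm 𝓡) (hm : IsDiff 𝓡 m) (hm' : IsDiff 𝓡 m')
    (h : IsMor 𝓡 P m m' F f) {s : List Q.B} {x : Q.B} {t : List Q.B} (hP : P (s ++ x :: t)) :
    superExt 𝓡 1 (dpsi 𝓡 1 m') (gbar 𝓡 f F (s, x :: t)) =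
      superExt 𝓡 0 (gbar 𝓡 f F) (dpsi 𝓡 1 m (s, x :: t)) :=
  h.dpsi_gbar_aux hR hm.hom hm'.hom hP
    (fun _ _ e => h.comm hR hm hm' _ (h.sub_left e (h.sub_left rfl hP)))
    (fun _ _ e => h.comm hR hm hm' _ (h.sub_right (u := s ++ [x]) (l := s ++ x :: t) (by simp)
      hP |> h.sub_right e))

/-- The operator `δ ⊗ F ⊗ f` with `δ = f ⋆ ψ ⋆ f`. -/
abbrev lpsi (𝓡 : ZMod 2 → Submodule K R) [GradedAlgebra 𝓡] (f : List Q.B → (List Q'.B →₀ R))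
    (F : List Q.B → (Q'.B →₀ R)) (j : ZMod 2) (ψ : List Q.B → (Q'.B →₀ R)) :
    List Q.B × List Q.B → (List Q'.B × List Q'.B →₀ R) :=
  gop 𝓡 0 0 (der 𝓡 f j ψ) (unmark F) f

/-- The operator `f ⊗ (m ∘ L_ψ) ⊗ f`. -/
abbrev gpsi (𝓡 : ZMod 2 → Submodule K R) [GradedAlgebra 𝓡] (m' : List Q'.B → (Q'.B →₀ R))
    (f : List Q.B → (List Q'.B →₀ R)) (F : List Q.B → (Q'.B →₀ R)) (j : ZMod 2)
    (ψ : List Q.B → (Q'.B →₀ R)) : List Q.B × List Q.B → (List Q'.B × List Q'.B →₀ R) :=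
  gop 𝓡 (1 + j) 0 f (cmp 𝓡 1 (unmark m') (lpsi 𝓡 f F j ψ)) f

/-- The operator `φ̂ ⊗ 1` on marked words. -/
def kphi (𝓡 : ZMod 2 → Submodule K R) [GradedAlgebra 𝓡] (j : ZMod 2) (φ : List Q.B → (Q.B →₀ R))
    (r : List Q.B × List Q.B) : List Q.B × List Q.B →₀ R :=
  tm 𝓡 (der 𝓡 wd j φ r.1) (wd r.2)

/-- The operator `f ⊗ (F ∘ (φ̂ ⊗ 1)) ⊗ f`. -/
abbrev gphi (𝓡 : ZMod 2 → Submodule K R) [GradedAlgebra 𝓡] (f : List Q.B → (List Q'.B →₀ R))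
    (F : List Q.B → (Q'.B →₀ R)) (j : ZMod 2) (φ : List Q.B → (Q.B →₀ R)) :
    List Q.B × List Q.B → (List Q'.B × List Q'.B →₀ R) :=
  gop 𝓡 j 0 f (cmp 𝓡 0 (unmark F) (kphi 𝓡 j φ)) f

theorem lpsi_id (ψ : List Q.B → (Q.B →₀ R)) (s : List Q.B) (x : Q.B) (t : List Q.B) :
    lpsi 𝓡 wd idLet j ψ (s, x :: t) = kphi 𝓡 j ψ (s, x :: t) := by
  rw [lpsi, gop_idLet, kphi]
  simp [wd_cat_wd, sgn_zero]

theorem superExt_kphi_tm (φ : List Q.B → (Q.B →₀ R)) (u v : List Q.B →₀ R)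
    (hR : IsSuperComm 𝓡) (hφ : HomF 𝓡 j φ) :
    superExt 𝓡 j (kphi 𝓡 j φ) (tm 𝓡 u v) = tm 𝓡 (superExt 𝓡 j (der 𝓡 wd j φ) u) v := by
  have hd := homF_der (homF_wd 𝓡) hφ
  induction u using Finsupp.induction_linear with
  | zero => simp
  | add u u' hu hu' => simp only [map_add, AddMonoidHom.add_apply, hu, hu']
  | single s r =>
    induction v using Finsupp.induction_linear with
    | zero => simp
    | add u u' hu hu' => simp only [map_add, hu, hu']
    | single t r' =>
      have e1 : (Finsupp.single t r' : List Q.B →₀ R) = r' • wd t := by simp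
      rw [tm_single_single, superExt_single, superExt_single, kphi, smul_tm, e1,
        tm_smul 𝓡 hR (hd s), smul_smul, twist_mul, ← twist_add]

theorem kphi_gbar (hR : IsSuperComm 𝓡) {φ : List Q'.B → (Q'.B →₀ R)} (hφ : HomF 𝓡 j φ)
    (r : List Q.B × List Q.B) :
    superExt 𝓡 j (kphi 𝓡 j φ) (gbar 𝓡 f F r) =
      gop 𝓡 0 0 (cmp 𝓡 j (der 𝓡 wd j φ) f) (unmark F) f r := by
  obtain ⟨s, _ | ⟨x, t⟩⟩ := r
  · simp [gop]
  · simp only [gop, map_splitSum, map_zsmul, superExt_kphi_tm _ _ _ hR hφ]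
    rfl

theorem IsBar.gbar_kphi (hR : IsSuperComm 𝓡) (h : IsBar 𝓡 F f) {φ : List Q.B → (Q.B →₀ R)}
    (hφ : HomF 𝓡 j φ) (s : List Q.B) (x : Q.B) (t : List Q.B) :
    superExt 𝓡 0 (gbar 𝓡 f F) (kphi 𝓡 j φ (s, x :: t)) =
      gop 𝓡 0 0 (cmp 𝓡 0 f (der 𝓡 wd j φ)) (unmark F) f (s, x :: t) +
        gphi 𝓡 f F j φ (s, x :: t) := by
  have e := gop_comp_left 𝓡 hR (c := 0) (A' := f) h.homF (homF_unmark 𝓡 h.hom) hφ s x t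
  simp only [add_zero, zero_add, zero_mul, sgn_zero, one_smul] at e
  exact e

theorem IsMor.dpsi_lpsi (hR : IsSuperComm 𝓡) (hm : IsDiff 𝓡 m) (hm' : IsDiff 𝓡 m')
    (h : IsMor 𝓡 P m m' F f) {ψ : List Q.B → (Q'.B →₀ R)} (hψ : HomF 𝓡 j ψ)
    {s : List Q.B} {x : Q.B} {t : List Q.B} (hP : P (s ++ x :: t)) :
    superExt 𝓡 1 (dpsi 𝓡 1 m') (lpsi 𝓡 f F j ψ (s, x :: t)) =
      sgn j • superExt 𝓡 j (lpsi 𝓡 f F j ψ) (dpsi 𝓡 1 m (s, x :: t)) +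
      gpsi 𝓡 m' f F j ψ (s, x :: t) +
      (gop 𝓡 0 0 (cmp 𝓡 1 (der 𝓡 wd 1 m') (der 𝓡 f j ψ)) (unmark F) f (s, x :: t) -
        sgn j • gop 𝓡 0 0 (cmp 𝓡 j (der 𝓡 f j ψ) (der 𝓡 wd 1 m)) (unmark F) f (s, x :: t)) := by
  have e1 := gop_dpsi 𝓡 hR (c := 0) (A' := f) (homF_der h.bar.homF hψ)
    (homF_unmark 𝓡 h.bar.hom) hm.hom (s, x :: t)
  have e2 := h.bar.dpsi_gop_der hR hm'.hom hψ (homF_unmark 𝓡 h.bar.hom) (s, x :: t)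
  simp only [add_zero, zero_add, zero_mul, sgn_zero, one_smul, one_mul] at e1 e2
  rw [e1, e2]
  have e3 : gop 𝓡 1 0 (der 𝓡 f j ψ) (cmp 𝓡 1 (unmark m') (gop 𝓡 0 0 f (unmark F) f)) f
      (s, x :: t) =
      gop 𝓡 1 0 (der 𝓡 f j ψ) (cmp 𝓡 0 (unmark F) (dpsi 𝓡 1 m)) f (s, x :: t) := by
    refine gop_congr 𝓡 (fun _ _ _ => rfl) (fun u v v' w h1 h2 => ?_) (fun _ _ _ => rfl)
    rw [cmp, cmp, superExt_unmark, superExt_unmark, mult_dpsi, ← h.bar.append']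
    exact h.ainf _ (h.sub_mid h1 h2 hP)
  have e4 : gop 𝓡 0 1 (der 𝓡 f j ψ) (unmark F) (cmp 𝓡 1 (der 𝓡 wd 1 m') f) (s, x :: t) =
      gop 𝓡 0 1 (der 𝓡 f j ψ) (unmark F) (cmp 𝓡 0 f (der 𝓡 wd 1 m)) (s, x :: t) :=
    gop_congr 𝓡 (fun _ _ _ => rfl) (fun _ _ _ _ _ _ => rfl)
      (fun _ _ e => h.comm hR hm hm' _ (h.sub_right (u := s ++ [x]) (l := s ++ x :: t) (by simp)
      hP |> h.sub_right e))
  rw [e3, e4]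
  simp only [smul_add]
  abel

/-! ### Derivations acting on coefficients -/

section Deriv

variable {v : R →ₗ[K] R}

theorem coeffMap_single {X : Type*} (v : R →ₗ[K] R) (x : X) (r : R) :
    coeffMap v (Finsupp.single x r) = Finsupp.single x (v r) := by
  simp [coeffMap]

theorem superDer_one (hv : v ∈ superDer 𝓡 i) : v 1 = 0 := by
  have := hv.2 1 1
  rw [mul_one, mul_one, twist_one, one_mul] at this
  simpa using this

theorem coeffMap_wd {X : Type*} (hv : v ∈ superDer 𝓡 i) (x : X) :
    coeffMap v (wd x : X →₀ R) = 0 := by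
  rw [coeffMap_single, superDer_one hv, Finsupp.single_zero]

theorem superDer_twist (hv : v ∈ superDer 𝓡 i) (j : ZMod 2) (r : R) :
    v (twist 𝓡 j r) = sgn (i * j) • twist 𝓡 j (v r) := by
  induction r using DirectSum.Decomposition.inductionOn 𝓡 with
  | zero => simp
  | add a b ha hb => simp only [map_add, ha, hb, smul_add]
  | @homogeneous k a =>
    rw [twist_of_mem 𝓡 j k _ a.2, twist_of_mem 𝓡 j _ _ (hv.1 _ _ a.2), map_zsmul,
      sgn_smul_sgn_smul]
    refine sgn_smul_congr ?_ rfl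
    grind

theorem coeffMap_smul {X : Type*} (hv : v ∈ superDer 𝓡 i) (r : R) (a : X →₀ R) :
    coeffMap v (r • a) = v r • a + twist 𝓡 i r • coeffMap v a := by
  ext x
  simp [coeffMap, hv.2]

theorem coeffMap_superExt {X Y : Type*} (hv : v ∈ superDer 𝓡 i) (j : ZMod 2)
    (g : X → (Y →₀ R)) (a : X →₀ R) :
    coeffMap v (superExt 𝓡 j g a) = sgn (i * j) • superExt 𝓡 j g (coeffMap v a) +
      superExt 𝓡 (i + j) (fun x => coeffMap v (g x)) a := by
  induction a using Finsupp.induction_linear with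
  | zero => simp
  | add a b ha hb => simp only [map_add, ha, hb, smul_add]; abel
  | single x r =>
    rw [superExt_single, coeffMap_single, superExt_single, superExt_single, coeffMap_smul hv,
      superDer_twist hv, twist_add, sgn_smul_smul]

theorem coeffMap_cat (hv : v ∈ superDer 𝓡 i) {α : ZMod 2} {s : List Q.B →₀ R}
    (hs : s ∈ parSub 𝓡 α) (t : List Q.B →₀ R) :
    coeffMap v (catHom 𝓡 s t) =
      catHom 𝓡 (coeffMap v s) t + sgn (i * α) • catHom 𝓡 s (coeffMap v t) := by
  refine parSub_induction 𝓡 (fun s => coeffMap v (catHom 𝓡 s t) =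
      catHom 𝓡 (coeffMap v s) t + sgn (i * α) • catHom 𝓡 s (coeffMap v t)) (by simp)
    (fun a b ha hb => by
      simp only [map_add, AddMonoidHom.add_apply, ha, hb, smul_add]; abel) (fun x r hr => ?_) hs
  induction t using Finsupp.induction_linear with
  | zero => simp
  | add a b ha hb => simp only [map_add, ha, hb, smul_add]; abel
  | single y r' =>
    rw [cat_single_single, coeffMap_single, coeffMap_single, coeffMap_single, cat_single_single,
      cat_single_single, hv.2, superDer_twist hv, twist_of_mem 𝓡 i _ _ hr, Finsupp.single_add,
      Finsupp.smul_single]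
    congr 2
    rw [smul_mul_assoc, mul_smul_comm, sgn_smul_sgn_smul]
    refine sgn_smul_congr ?_ rfl
    simp only [par_list]
    grind

theorem coeffMap_letH (v : R →ₗ[K] R) (y : Q.B →₀ R) :
    coeffMap v (letH y) = letH (coeffMap v y) := by
  induction y using Finsupp.induction_linear with
  | zero => simp
  | add a b ha hb => simp only [map_add, ha, hb]
  | single x r => rw [letH_single, coeffMap_single, coeffMap_single, letH_single]

theorem coeffMap_mem_parSub {X : Type*} [Par X] (hv : v ∈ superDer 𝓡 i) {a : X →₀ R}
    (ha : a ∈ parSub 𝓡 j) : coeffMap v a ∈ parSub 𝓡 (i + j) := fun x => by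
  have := hv.1 _ _ (ha x)
  rwa [← add_assoc] at this

theorem homF_coeffMap {X Y : Type*} [Par X] [Par Y] (hv : v ∈ superDer 𝓡 i)
    {g : X → (Y →₀ R)} (hg : HomF 𝓡 j g) : HomF 𝓡 (i + j) fun x => coeffMap v (g x) := fun x => by
  have := coeffMap_mem_parSub hv (hg x)
  rwa [← add_assoc] at this

theorem coeffMap_der_wd (hv : v ∈ superDer 𝓡 i) (φ : List Q.B → (Q.B →₀ R)) (l : List Q.B) :
    coeffMap v (der 𝓡 wd j φ l) = der 𝓡 wd (i + j) (fun l => coeffMap v (φ l)) l := by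
  simp only [der, map_splitSum]
  refine splitSum_congr fun u r _ => splitSum_congr fun y w _ => ?_
  have hw := coeffMap_wd (X := List Q.B) hv
  rw [map_zsmul, coeffMap_cat hv (wd_mem 𝓡 u), hw, zero_cat, zero_add]
  have : coeffMap v (catHom 𝓡 (letH (φ y)) (wd w)) =
      catHom 𝓡 (letH (coeffMap v (φ y))) (wd w) := by
    generalize φ y = z
    induction z using Finsupp.induction_linear with
    | zero => simp
    | add a b ha hb => simp only [map_add, AddMonoidHom.add_apply, ha, hb]
    | single x r =>
      rw [letH_single, coeffMap_single, letH_single, cat_single_single, cat_single_single,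
        twist_one, mul_one, mul_one, coeffMap_single]
  rw [this, sgn_smul_sgn_smul]
  exact sgn_smul_congr (by ring) rfl

theorem IsBar.coeffMap_bar (h : IsBar 𝓡 F f) (hv : v ∈ superDer 𝓡 i) (l : List Q.B) :
    coeffMap v (f l) = der 𝓡 f i (fun l => coeffMap v (F l)) l := by
  induction hn : l.length using Nat.strong_induction_on generalizing l with
  | _ n ih =>
    by_cases hl : l = []
    · subst hl
      rw [h.bar_nil, coeffMap_wd hv, der_nil]
      simp [h.nil]
    · rw [h.der_rec]
      conv_lhs => rw [h.rec_left l hl]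
      rw [map_splitSum]
      refine splitSum_congr fun u w huw => ?_
      rw [coeffMap_cat hv (letH_mem_parSub 𝓡 (h.hom u)), coeffMap_letH, zero_add, par_list]
      by_cases hu : u = []
      · simp [hu, h.nil]
      · rw [ih w.length (by
          subst hn huw
          have := List.length_pos_iff.2 hu
          rw [List.length_append]
          omega) w rfl]

theorem IsDiff.coeffMap_comm (hR : IsSuperComm 𝓡) (hm : IsDiff 𝓡 m) (hv : v ∈ superDer 𝓡 i)
    (l : List Q.B) :
    sgn i • superExt 𝓡 1 (der 𝓡 wd 1 m) (der 𝓡 wd (i + 1) (fun l => coeffMap v (m l)) l) +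
      superExt 𝓡 (i + 1) (der 𝓡 wd (i + 1) fun l => coeffMap v (m l)) (der 𝓡 wd 1 m l) = 0 := by
  have := congr_arg (coeffMap v) (hm.sq hR l)
  rw [coeffMap_superExt hv, map_zero, coeffMap_der_wd hv, mul_one] at this
  simpa only [coeffMap_der_wd hv] using this

theorem IsMor.coeffMap_comm (hR : IsSuperComm 𝓡) (hm : IsDiff 𝓡 m) (hm' : IsDiff 𝓡 m')
    (h : IsMor 𝓡 P m m' F f) (hv : v ∈ superDer 𝓡 i) (l : List Q.B) (hP : P l) :
    sgn i • cmp 𝓡 1 (der 𝓡 wd 1 m') (der 𝓡 f i fun l => coeffMap v (F l)) l +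
      cmp 𝓡 (i + 1) (der 𝓡 wd (i + 1) fun l => coeffMap v (m' l)) f l =
      cmp 𝓡 0 f (der 𝓡 wd (i + 1) fun l => coeffMap v (m l)) l +
      cmp 𝓡 i (der 𝓡 f i fun l => coeffMap v (F l)) (der 𝓡 wd 1 m) l := by
  have := congr_arg (coeffMap v) (h.comm hR hm hm' l hP)
  rw [cmp, cmp, coeffMap_superExt hv, coeffMap_superExt hv, mul_one, mul_zero, sgn_zero, one_smul,
    add_zero, coeffMap_der_wd hv, h.bar.coeffMap_bar hv] at this
  simp only [coeffMap_der_wd hv, h.bar.coeffMap_bar hv] at this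
  exact this

/-- The fundamental homotopy identity on marked words. -/
theorem IsMor.homotopy (hR : IsSuperComm 𝓡) (hm : IsDiff 𝓡 m) (hm' : IsDiff 𝓡 m')
    (h : IsMor 𝓡 P m m' F f) (hv : v ∈ superDer 𝓡 i)
    {s : List Q.B} {x : Q.B} {t : List Q.B} (hP : P (s ++ x :: t)) :
    sgn i • gpsi 𝓡 m' f F i (fun l => coeffMap v (F l)) (s, x :: t) -
      gphi 𝓡 f F (i + 1) (fun l => coeffMap v (m l)) (s, x :: t) =
    sgn i • superExt 𝓡 1 (dpsi 𝓡 1 m') (lpsi 𝓡 f F i (fun l => coeffMap v (F l)) (s, x :: t)) -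
      superExt 𝓡 i (lpsi 𝓡 f F i fun l => coeffMap v (F l)) (dpsi 𝓡 1 m (s, x :: t)) +
      superExt 𝓡 (i + 1) (kphi 𝓡 (i + 1) fun l => coeffMap v (m' l)) (gbar 𝓡 f F (s, x :: t)) -
      superExt 𝓡 0 (gbar 𝓡 f F) (kphi 𝓡 (i + 1) (fun l => coeffMap v (m l)) (s, x :: t)) := by
  have hF := homF_coeffMap hv h.bar.hom
  rw [add_zero] at hF
  rw [h.dpsi_lpsi hR hm hm' hF hP, kphi_gbar hR (homF_coeffMap hv hm'.hom),
    h.bar.gbar_kphi hR (homF_coeffMap hv hm.hom)]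
  have e : sgn i • gop 𝓡 0 0 (cmp 𝓡 1 (der 𝓡 wd 1 m') (der 𝓡 f i fun l => coeffMap v (F l)))
        (unmark F) f (s, x :: t) +
      gop 𝓡 0 0 (cmp 𝓡 (i + 1) (der 𝓡 wd (i + 1) fun l => coeffMap v (m' l)) f)
        (unmark F) f (s, x :: t) =
      gop 𝓡 0 0 (cmp 𝓡 0 f (der 𝓡 wd (i + 1) fun l => coeffMap v (m l))) (unmark F) f (s, x :: t) +
      gop 𝓡 0 0 (cmp 𝓡 i (der 𝓡 f i fun l => coeffMap v (F l)) (der 𝓡 wd 1 m)) (unmark F) f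
        (s, x :: t) := by
    rw [← gop_zsmul_left, ← gop_add_left, ← gop_add_left]
    exact gop_congr 𝓡 (fun _ _ e => h.coeffMap_comm hR hm hm' hv _
      (h.sub_left e (h.sub_left rfl hP))) (fun _ _ _ _ _ _ => rfl) (fun _ _ _ => rfl)
  simp only [smul_add, smul_sub, sgn_smul_self]
  rw [← sub_eq_zero] at e ⊢
  rw [← neg_eq_zero, ← e]
  abel

theorem IsDiff.homotopy (hR : IsSuperComm 𝓡) (hm : IsDiff 𝓡 m) (hv : v ∈ superDer 𝓡 i)
    (s : List Q.B) (x : Q.B) (t : List Q.B) :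
    gpsi 𝓡 m wd idLet (i + 1) (fun l => coeffMap v (m l)) (s, x :: t) =
      superExt 𝓡 1 (dpsi 𝓡 1 m) (kphi 𝓡 (i + 1) (fun l => coeffMap v (m l)) (s, x :: t)) +
      sgn i • superExt 𝓡 (i + 1) (kphi 𝓡 (i + 1) fun l => coeffMap v (m l))
        (dpsi 𝓡 1 m (s, x :: t)) := by
  have h := isMor_id (𝓡 := 𝓡) m
  have e := h.dpsi_lpsi hR hm hm (homF_coeffMap hv hm.hom) (s := s) (x := x) (t := t) trivial
  have e1 : superExt 𝓡 (i + 1) (lpsi 𝓡 wd idLet (i + 1) fun l => coeffMap v (m l))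
      (dpsi 𝓡 1 m (s, x :: t)) =
      superExt 𝓡 (i + 1) (kphi 𝓡 (i + 1) fun l => coeffMap v (m l)) (dpsi 𝓡 1 m (s, x :: t)) := by
    refine superExt_congr_supported 𝓡 _ (fun p hp => ?_) (dpsi_mem_marked _ _)
    obtain ⟨s, _ | ⟨x, t⟩⟩ := p
    · exact absurd rfl hp
    · rw [lpsi_id]
  have e2 : sgn i • gop 𝓡 0 0 (cmp 𝓡 1 (der 𝓡 wd 1 m)
        (der 𝓡 wd (i + 1) fun l => coeffMap v (m l))) (unmark idLet) wd (s, x :: t) +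
      gop 𝓡 0 0 (cmp 𝓡 (i + 1) (der 𝓡 wd (i + 1) fun l => coeffMap v (m l)) (der 𝓡 wd 1 m))
        (unmark idLet) wd (s, x :: t) = 0 := by
    rw [← gop_zsmul_left, ← gop_add_left]
    refine (gop_congr 𝓡 (B := fun _ => 0) (fun u _ _ => ?_) (fun _ _ _ _ _ _ => rfl)
      (fun _ _ _ => rfl)).trans (gop_zero_left _)
    exact hm.coeffMap_comm hR hv u
  rw [lpsi_id, e1] at e
  rw [e, sgn_add_one_smul, sgn_add_one_smul]
  have e3 := congr_arg (fun y => sgn i • y) e2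
  simp only [smul_add, smul_zero, sgn_smul_self] at e3
  rw [← sub_eq_zero, ← neg_eq_zero, ← e3]
  abel

end Deriv

end Marked

section Cyclic

variable {K R : Type*} [Field K] [Ring R] [Algebra K R]
variable (𝓡 : ZMod 2 → Submodule K R) [GradedAlgebra 𝓡]
variable {Ob Ob' Ob'' : Type*} {Q : HomBasis Ob} {Q' : HomBasis Ob'} {Q'' : HomBasis Ob''}

variable {a k c i j q p : ZMod 2} {A : List Q.B → (List Q'.B →₀ R)}
  {μ : List Q.B × List Q.B → (Q'.B →₀ R)} {A' : List Q.B → (List Q'.B →₀ R)}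
variable {F : List Q.B → (Q'.B →₀ R)} {f : List Q.B → (List Q'.B →₀ R)}

/-! ### Cyclic rotations -/

/-- All cyclic rotations of a word, marked at its first letter. -/
def cyc (l : List Q.B) : List Q.B × List Q.B →₀ R := superExt 𝓡 0 rot (decoP l)

/-- The marked words with the mark at the beginning. -/
def prj (p : List Q.B × List Q.B) : List Q.B →₀ R := if p.1 = [] then wd p.2 else 0

theorem cyc_nil : cyc 𝓡 ([] : List Q.B) = 0 := by simp [cyc, decoP]

theorem cyc_cons (x : Q.B) (l : List Q.B) : cyc 𝓡 (x :: l) =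
    splitSum l fun l₁ l₂ => sgn (Q.eps l₂ * (Q.rdeg x + Q.eps l₁)) • wd (l₂, x :: l₁) := by
  rw [cyc, decoP, map_splitSum]
  refine splitSum_congr fun u v _ => ?_
  rw [superExt_single_one, rot]
  refine sgn_smul_congr ?_ rfl
  rw [par_list, par_list, Q.eps_cons, mul_comm]

theorem cyc_letH_cat (hR : IsSuperComm 𝓡) {γ : ZMod 2} {c : Q.B →₀ R} (hc : c ∈ parSub 𝓡 γ)
    (b : List Q.B →₀ R) :
    superExt 𝓡 0 (cyc 𝓡) (catHom 𝓡 (letH c) b) =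
      superExt 𝓡 0 rot (lact 𝓡 γ (letH c) (superExt 𝓡 0 deco b)) := by
  rw [← decoP_cat 𝓡 hR hc, superExt_comp, add_zero]
  rfl

theorem prj_tm_nil (b : List Q.B →₀ R) : superExt 𝓡 0 prj (tm 𝓡 (wd []) b) = b := by
  induction b using Finsupp.induction_linear with
  | zero => simp
  | add b b' hb hb' => simp only [map_add, hb, hb']
  | single t r =>
    rw [tm_single_single, superExt_single, prj, if_pos rfl, par_list, Q.eps_nil]
    simp [twist_zero]

theorem prj_tm_of_ne {a : List Q.B →₀ R} (ha : a ∈ supported R R {l | l ≠ []})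
    (b : List Q.B →₀ R) : superExt 𝓡 0 (prj (Q := Q) (R := R)) (tm 𝓡 a b) = 0 := by
  have h := tm_mem_supported 𝓡 (U := {p : List Q.B × List Q.B | p.1 ≠ []}) (fun _ h _ _ => h) ha
    (mem_supported_univ b)
  rw [superExt_congr_supported 𝓡 0 (f := prj) (g := fun _ => 0) (fun p hp => if_neg hp) h,
    superExt_zero_fun]

theorem letH_cat_mem_ne (y : Q.B →₀ R) (a : List Q.B →₀ R) :
    catHom 𝓡 (letH y) a ∈ supported R R {l : List Q.B | l ≠ []} := by
  refine cat_mem_supported 𝓡 (S := {l | l ≠ []}) (T := Set.univ) ?_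
      (letH_mem_supported (S := Set.univ) (fun x _ => List.cons_ne_nil _ _)
        (mem_supported_univ _)) (mem_supported_univ _)
  intro x hx y _ h
  exact hx (List.append_eq_nil_iff.1 h).1

theorem cat_letH_mem_ne (y : Q.B →₀ R) (a b : List Q.B →₀ R) :
    catHom 𝓡 a (catHom 𝓡 (letH y) b) ∈ supported R R {l : List Q.B | l ≠ []} := by
  refine cat_mem_supported 𝓡 (S := Set.univ) (T := {l | l ≠ []}) ?_ (mem_supported_univ _)
    (letH_cat_mem_ne 𝓡 _ _)
  intro x _ y hy h
  exact hy (List.append_eq_nil_iff.1 h).2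

theorem der_mem_ne (ψ : List Q.B → (Q'.B →₀ R)) (l : List Q.B) :
    der 𝓡 f j ψ l ∈ supported R R {l : List Q'.B | l ≠ []} :=
  splitSum_mem' fun _ _ _ => splitSum_mem' fun _ _ _ => zsmul_mem' (cat_letH_mem_ne 𝓡 _ _ _) _

variable {𝓡}

theorem IsBar.mem_ne (h : IsBar 𝓡 F f) {l : List Q.B} (hl : l ≠ []) :
    f l ∈ supported R R {l : List Q'.B | l ≠ []} := by
  rw [h.rec_left l hl]
  exact splitSum_mem' fun _ _ _ => letH_cat_mem_ne 𝓡 _ _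

/-- An operator on marked words, applied to the cyclic rotations of a word. -/
def cy (𝓡 : ZMod 2 → Submodule K R) [GradedAlgebra 𝓡] (k : ZMod 2)
    (G : List Q.B × List Q.B → (List Q'.B × List Q'.B →₀ R)) (l : List Q.B) : List Q'.B →₀ R :=
  superExt 𝓡 0 prj (superExt 𝓡 k G (cyc 𝓡 l))

theorem cy_nil (k : ZMod 2) (G : List Q.B × List Q.B → (List Q'.B × List Q'.B →₀ R)) :
    cy 𝓡 k G [] = 0 := by simp [cy, cyc_nil]

theorem IsBar.prj_gop (h : IsBar 𝓡 F f) (s : List Q.B) (x : Q.B) (t : List Q.B) :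
    superExt 𝓡 0 prj (gop 𝓡 k c f μ A' (s, x :: t)) = splitSum t fun t₁ t₂ =>
      sgn (c * (Q.eps s + Q.rdeg x + Q.eps t₁)) • catHom 𝓡 (letH (μ (s, x :: t₁))) (A' t₂) := by
  rw [gop, map_splitSum, splitSum_eq_left, map_splitSum]
  · refine splitSum_congr fun u v _ => ?_
    rw [map_zsmul, h.bar_nil, prj_tm_nil, Q.eps_nil, mul_zero, zero_add]
  · intro u v _ hu
    rw [map_splitSum]
    refine splitSum_eq_zero fun u' v' _ => ?_
    rw [map_zsmul, prj_tm_of_ne 𝓡 (h.mem_ne hu), smul_zero]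

theorem cy_cons (k' : ZMod 2) (G : List Q.B × List Q.B → (List Q'.B × List Q'.B →₀ R)) (x : Q.B)
    (l : List Q.B) : cy 𝓡 k' G (x :: l) = splitSum l fun l₁ l₂ =>
      sgn (Q.eps l₂ * (Q.rdeg x + Q.eps l₁)) • superExt 𝓡 0 prj (G (l₂, x :: l₁)) := by
  rw [cy, cyc_cons, map_splitSum, map_splitSum]
  simp only [map_zsmul, superExt_single_one]

theorem IsBar.cy_gop_cons (h : IsBar 𝓡 F f) (k' : ZMod 2) (x : Q.B) (l : List Q.B) :
    cy 𝓡 k' (gop 𝓡 k c f μ A') (x :: l) = splitSum l fun l₁ l₂ =>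
      sgn (Q.eps l₂ * (Q.rdeg x + Q.eps l₁)) • splitSum l₁ fun t₁ t₂ =>
        sgn (c * (Q.eps l₂ + Q.rdeg x + Q.eps t₁)) •
          catHom 𝓡 (letH (μ (l₂, x :: t₁))) (A' t₂) := by
  rw [cy_cons]
  refine splitSum_congr fun u v _ => ?_
  rw [h.prj_gop]

theorem IsBar.cyc_cy_gop (hR : IsSuperComm 𝓡) (h : IsBar 𝓡 F f) (hμ : HomF 𝓡 k μ)
    (l : List Q.B) :
    superExt 𝓡 0 (cyc 𝓡) (cy 𝓡 k (gop 𝓡 k 0 f μ f) l) =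
      superExt 𝓡 k (gop 𝓡 k 0 f μ f) (cyc 𝓡 l) := by
  cases l with
  | nil => simp [cy_nil, cyc_nil]
  | cons x l =>
    have e1 : superExt 𝓡 0 (cyc 𝓡) (cy 𝓡 k (gop 𝓡 k 0 f μ f) (x :: l)) =
        splitSum l fun l₁ s₂ => splitSum l₁ fun t₁ r => splitSum r fun t₂ s₁ =>
          sgn ((Q.eps s₁ + Q.eps s₂) * (Q.rdeg x + Q.eps t₁ + Q.eps t₂) + k * Q.eps s₁) •
            tm 𝓡 (f s₁) (catHom 𝓡 (letH (μ (s₂, x :: t₁))) (f t₂)) := by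
      rw [h.cy_gop_cons, map_splitSum]
      refine splitSum_congr fun l₁ s₂ _ => ?_
      rw [map_zsmul, map_splitSum, ← splitSum_zsmul]
      refine splitSum_congr fun t₁ r ht => ?_
      have hm := letH_mem_parSub 𝓡 (hμ (s₂, x :: t₁))
      rw [map_zsmul, cyc_letH_cat 𝓡 hR (hμ _), h.deco_bar hR, map_splitSum, map_splitSum,
        sgn_smul_sgn_smul, ← splitSum_zsmul]
      refine splitSum_congr fun t₂ s₁ hr => ?_
      have ht₂ := h.homF t₂
      have hs₁ := h.homF s₁
      rw [lact_tm 𝓡 hR hm, rot_tm 𝓡 hR (cat_mem_parSub 𝓡 hm ht₂) hs₁, sgn_smul_sgn_smul]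
      refine sgn_smul_congr ?_ rfl
      subst hr ht
      simp only [par_list, par_prod, Q.eps_append, Q.eps_cons]
      grind
    rw [e1, cyc_cons, map_splitSum]
    rw [splitSum_congr fun l₁ s₂ _ => (splitSum_assoc l₁ fun t₁ t₂ s₁ =>
          sgn ((Q.eps s₁ + Q.eps s₂) * (Q.rdeg x + Q.eps t₁ + Q.eps t₂) + k * Q.eps s₁) •
            tm 𝓡 (f s₁) (catHom 𝓡 (letH (μ (s₂, x :: t₁))) (f t₂))).symm,
      splitSum_assoc l fun l₁ s₁ s₂ => splitSum l₁ fun t₁ t₂ =>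
          sgn ((Q.eps s₁ + Q.eps s₂) * (Q.rdeg x + Q.eps t₁ + Q.eps t₂) + k * Q.eps s₁) •
            tm 𝓡 (f s₁) (catHom 𝓡 (letH (μ (s₂, x :: t₁))) (f t₂))]
    refine splitSum_congr fun l₁ l₂ _ => ?_
    rw [map_zsmul, superExt_single_one, gop, ← splitSum_zsmul]
    refine splitSum_congr fun s₁ s₂ hs => ?_
    rw [← splitSum_zsmul]
    refine splitSum_congr fun t₁ t₂ ht => ?_
    rw [sgn_smul_sgn_smul]
    refine sgn_smul_congr ?_ rfl
    subst hs ht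
    simp only [Q.eps_append]
    ring

theorem prj_dpsi (ψ : List Q.B → (Q.B →₀ R)) (s : List Q.B) (x : Q.B) (t : List Q.B) :
    superExt 𝓡 0 prj (dpsi 𝓡 j ψ (s, x :: t)) =
      superExt 𝓡 0 prj (gop 𝓡 j 0 wd (unmark ψ) wd (s, x :: t)) +
      if s = [] then sgn (j * Q.rdeg x) • catHom 𝓡 (wd [x]) (der 𝓡 wd j ψ t) else 0 := by
  rw [dpsi, map_add, map_add, prj_tm_of_ne 𝓡 (der_mem_ne 𝓡 _ _), zero_add, map_zsmul]
  congr 1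
  split_ifs with h
  · subst h
    rw [prj_tm_nil, Q.eps_nil, zero_add]
  · rw [prj_tm_of_ne 𝓡 ((isBar_id 𝓡).mem_ne h), smul_zero]

theorem cy_dpsi_cons (ψ : List Q.B → (Q.B →₀ R)) (x : Q.B) (l : List Q.B) :
    cy 𝓡 j (dpsi 𝓡 j ψ) (x :: l) = cy 𝓡 j (gop 𝓡 j 0 wd (unmark ψ) wd) (x :: l) +
      sgn (j * Q.rdeg x) • catHom 𝓡 (wd [x]) (der 𝓡 wd j ψ l) := by
  rw [cy_cons, cy_cons]
  simp only [prj_dpsi, smul_add, splitSum_add]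
  congr 1
  rw [splitSum_eq_right]
  · simp [Q.eps_nil, sgn_zero]
  · intro u v _ hv
    rw [if_neg hv, smul_zero]

theorem cyc_cy_dpsi (hR : IsSuperComm 𝓡) {ψ : List Q.B → (Q.B →₀ R)} (hψ : HomF 𝓡 j ψ)
    (l : List Q.B) :
    superExt 𝓡 0 (cyc 𝓡) (cy 𝓡 j (dpsi 𝓡 j ψ) l) = superExt 𝓡 j (dpsi 𝓡 j ψ) (cyc 𝓡 l) := by
  cases l with
  | nil => simp [cy_nil, cyc_nil]
  | cons x l =>
    have hx := letH_mem_parSub 𝓡 (wd_letter_mem 𝓡 x)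
    have hd := homF_der (homF_wd 𝓡) hψ
    rw [cy_dpsi_cons, map_add, (isBar_id 𝓡).cyc_cy_gop hR (homF_unmark 𝓡 hψ), map_zsmul, ← letH_wd,
      cyc_letH_cat 𝓡 hR (wd_letter_mem 𝓡 x), (isBar_id 𝓡).deco_der hR hψ, cyc_cons, map_splitSum,
      map_splitSum, map_splitSum, map_splitSum, ← splitSum_zsmul, ← splitSum_add]
    refine splitSum_congr fun l₁ l₂ _ => ?_
    rw [map_zsmul, map_zsmul, superExt_single_one, superExt_single_one, dpsi, map_add, map_zsmul,
      lact_tm 𝓡 hR hx, lact_tm 𝓡 hR hx, map_add, map_zsmul,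
      rot_tm 𝓡 hR (cat_mem_parSub 𝓡 hx (hd l₁)) (wd_mem 𝓡 l₂),
      rot_tm 𝓡 hR (cat_mem_parSub 𝓡 hx (wd_mem 𝓡 l₁)) (hd l₂)]
    simp only [smul_add, sgn_smul_sgn_smul, letH_wd, wd_cat_wd, List.singleton_append, par_list]
    rw [add_comm (sgn (j * Q.rdeg x + _) • _), ← add_assoc, add_comm _ (sgn _ • gop _ _ _ _ _ _ _)]
    refine congr_arg₂ _ (congr_arg₂ _ rfl (sgn_smul_congr ?_ rfl)) (sgn_smul_congr ?_ rfl)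
    · grind
    · grind

theorem homF_cyc : HomF 𝓡 0 (cyc 𝓡 (Q := Q)) := by
  have := (homF_decoP (Q := Q) 𝓡).comp 𝓡 (homF_rot 𝓡)
  rwa [add_zero] at this

theorem cyc_mem_marked (l : List Q.B) :
    cyc 𝓡 l ∈ supported R R (marked (Q := Q)) := by
  cases l with
  | nil => rw [cyc_nil]; exact zero_mem _
  | cons x l =>
    rw [cyc_cons]
    exact splitSum_mem' fun u v _ => zsmul_mem'
      (single_mem_supported R _ (List.cons_ne_nil _ _)) _

/-! ### Telescoping -/

/-- `r_ψ(w) = ∑ ± ψ(w₂) f(w₁)`. -/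
def rpsi (𝓡 : ZMod 2 → Submodule K R) [GradedAlgebra 𝓡] (f : List Q.B → (List Q'.B →₀ R))
    (ψ : List Q.B → (Q'.B →₀ R)) (w : List Q.B) : List Q'.B →₀ R :=
  splitSum w fun w₁ w₂ => sgn (Q.eps w₁ * Q.eps w₂) • catHom 𝓡 (letH (ψ w₂)) (f w₁)

/-- Rotation of the last letter of a word to its front. -/
def tau (w : List Q.B) : List Q.B →₀ R :=
  splitSum w fun a b => if b.length = 1 then sgn (Q.eps a * Q.eps b) • wd (b ++ a) else 0

theorem tau_concat (a : List Q.B) (y : Q.B) :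
    tau (R := R) (a ++ [y]) = sgn (Q.eps a * Q.rdeg y) • wd (y :: a) := by
  rw [tau, splitSum_append, splitSum_nil, splitSum_eq_right]
  · simp [Q.eps_cons, Q.eps_nil]
  · intro u v _ hv
    have := List.length_pos_iff.2 hv
    rw [if_neg (by simp; omega)]

theorem tau_cat_letH (hR : IsSuperComm 𝓡) {α γ : ZMod 2} {s : List Q.B →₀ R} {y : Q.B →₀ R}
    (hs : s ∈ parSub 𝓡 α) (hy : y ∈ parSub 𝓡 γ) :
    superExt 𝓡 0 tau (catHom 𝓡 s (letH y)) = sgn (α * γ) • catHom 𝓡 (letH y) s := by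
  refine parSub_induction 𝓡 (fun s => superExt 𝓡 0 tau (catHom 𝓡 s (letH y)) =
    sgn (α * γ) • catHom 𝓡 (letH y) s) (by simp) (fun u v hu hv => by
      simp only [map_add, AddMonoidHom.add_apply, hu, hv, smul_add]) (fun a r hr => ?_) hs
  refine parSub_induction 𝓡 (fun y => superExt 𝓡 0 tau (catHom 𝓡 (Finsupp.single a r) (letH y)) =
    sgn (α * γ) • catHom 𝓡 (letH y) (Finsupp.single a r)) (by simp) (fun u v hu hv => by
      simp only [map_add, AddMonoidHom.add_apply, hu, hv, smul_add]) (fun x r' hr' => ?_) hy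
  rw [letH_single, cat_single_single, cat_single_single, superExt_single, tau_concat, twist_zero]
  have hr2 : r' ∈ 𝓡 (γ + Q.rdeg x) := hr'
  have hr1 : r ∈ 𝓡 (α + Q.eps a) := hr
  rw [show Q.eps [x] = Q.rdeg x by simp [HomBasis.eps], twist_of_mem 𝓡 _ _ _ hr1,
    twist_of_mem 𝓡 _ _ _ hr2, mul_smul_comm, mul_smul_comm, superComm_swap 𝓡 hR hr1 hr2,
    smul_comm, List.singleton_append]
  rw [smul_assoc, smul_assoc]
  rw [show (r' * r) • (wd (x :: a) : List Q.B →₀ R) = Finsupp.single (x :: a) (r' * r) by simp,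
    ← Finsupp.smul_single, sgn_smul_sgn_smul, sgn_smul_sgn_smul, sgn_smul_sgn_smul]
  refine sgn_smul_congr ?_ rfl
  grind

theorem splitSum_rotate {B M : Type*} [AddCommGroup M] (l : List B)
    (h : List B → List B → List B → List B → List B → M) :
    (splitSum l fun l₁ l₂ => splitSum l₂ fun s₁ s₂ => splitSum l₁ fun t₁ r =>
      splitSum r fun t' t'' => h t₁ t' t'' s₁ s₂) =
    splitSum l fun l₁ l₂ => splitSum l₂ fun σ s₂ => splitSum l₁ fun t₁ t' =>
      splitSum σ fun t'' s₁ => h t₁ t' t'' s₁ s₂ := by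
  have e1 : (splitSum l fun l₁ l₂ => splitSum l₂ fun s₁ s₂ => splitSum l₁ fun t₁ r =>
      splitSum r fun t' t'' => h t₁ t' t'' s₁ s₂) =
      splitSum l fun p l₂ => splitSum l₂ fun t'' r => splitSum r fun s₁ s₂ =>
        splitSum p fun t₁ t' => h t₁ t' t'' s₁ s₂ := by
    rw [← splitSum_assoc l fun p t'' r => splitSum r fun s₁ s₂ =>
        splitSum p fun t₁ t' => h t₁ t' t'' s₁ s₂]
    refine splitSum_congr fun l₁ l₂ _ => ?_
    exact (splitSum_congr fun s₁ s₂ _ =>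
      (splitSum_assoc l₁ fun t₁ t' t'' => h t₁ t' t'' s₁ s₂).symm).trans (splitSum_comm _ _ _)
  rw [e1]
  refine splitSum_congr fun p l₂ _ => ?_
  rw [← splitSum_assoc l₂ fun t'' s₁ s₂ => splitSum p fun t₁ t' => h t₁ t' t'' s₁ s₂]
  refine splitSum_congr fun σ s₂ _ => ?_
  rw [splitSum_comm]

section Telescope

variable {ψ : List Q.B → (Q'.B →₀ R)}

theorem IsBar.rpsi_append (h : IsBar 𝓡 F f) (ψ : List Q.B → (Q'.B →₀ R)) (l₁ : List Q.B) (x : Q.B)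
    (l₂ : List Q.B) : rpsi 𝓡 f ψ (l₂ ++ x :: l₁) =
      (splitSum l₂ fun a b => sgn (Q.eps a * (Q.eps b + Q.rdeg x + Q.eps l₁)) •
        catHom 𝓡 (letH (ψ (b ++ x :: l₁))) (f a)) +
      splitSum l₁ fun t σ => splitSum l₂ fun w s₂ => splitSum t fun t₁ t' =>
        sgn ((Q.eps l₂ + Q.rdeg x + Q.eps t) * Q.eps σ) • catHom 𝓡 (letH (ψ σ))
          (catHom 𝓡 (f w) (catHom 𝓡 (letH (F (s₂ ++ x :: t₁))) (f t'))) := by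
  rw [rpsi, splitSum_append]
  congr 1
  · refine splitSum_congr fun a b _ => ?_
    rw [Q.eps_append, Q.eps_cons, add_assoc]
  · refine splitSum_congr fun t σ _ => ?_
    rw [h.append, cat_splitSum, ← splitSum_zsmul]
    refine splitSum_congr fun w s₂ _ => ?_
    rw [cat_splitSum, ← splitSum_zsmul, Q.eps_append, Q.eps_cons, add_assoc]

theorem mult_cyc (x : Q.B) (l : List Q.B) : superExt 𝓡 0 (app (R := R) (Q := Q)) (cyc 𝓡 (x :: l)) =
    splitSum l fun l₁ l₂ => sgn (Q.eps l₂ * (Q.rdeg x + Q.eps l₁)) • wd (l₂ ++ x :: l₁) := by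
  rw [cyc_cons, map_splitSum]
  refine splitSum_congr fun u v _ => ?_
  rw [map_zsmul, superExt_single_one, app]

theorem IsBar.rpsi_mult_cyc (h : IsBar 𝓡 F f) (ψ : List Q.B → (Q'.B →₀ R)) (x : Q.B)
    (l : List Q.B) : superExt 𝓡 j (rpsi 𝓡 f ψ) (superExt 𝓡 0 app (cyc 𝓡 (x :: l))) =
      cy 𝓡 j (gop 𝓡 j 0 f (unmark ψ) f) (x :: l) +
      splitSum l fun l₁ l₂ => splitSum l₂ fun σ s₂ => splitSum l₁ fun t₁ t' =>
        sgn ((Q.eps σ + Q.eps s₂) * (Q.rdeg x + Q.eps t₁ + Q.eps t')) • catHom 𝓡 (lder 𝓡 f ψ σ)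
          (catHom 𝓡 (letH (F (s₂ ++ x :: t₁))) (f t')) := by
  have e0 : superExt 𝓡 j (rpsi 𝓡 f ψ) (superExt 𝓡 0 app (cyc 𝓡 (x :: l))) =
      splitSum l fun l₁ l₂ => sgn (Q.eps l₂ * (Q.rdeg x + Q.eps l₁)) •
        rpsi 𝓡 f ψ (l₂ ++ x :: l₁) := by
    rw [mult_cyc, map_splitSum]
    refine splitSum_congr fun u v _ => ?_
    rw [map_zsmul, superExt_single_one]
  have e1 : cy 𝓡 j (gop 𝓡 j 0 f (unmark ψ) f) (x :: l) =
      splitSum l fun l₁ l₂ => splitSum l₂ fun a b =>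
        sgn (Q.eps b * (Q.rdeg x + Q.eps l₁ + Q.eps a)) •
          catHom 𝓡 (letH (ψ (b ++ x :: l₁))) (f a) := by
    rw [h.cy_gop_cons, ← splitSum_assoc l fun l₁ a b =>
      sgn (Q.eps b * (Q.rdeg x + Q.eps l₁ + Q.eps a)) • catHom 𝓡 (letH (ψ (b ++ x :: l₁))) (f a)]
    refine splitSum_congr fun l₁ l₂ _ => ?_
    rw [← splitSum_zsmul]
    refine splitSum_congr fun t₁ t₂ ht => ?_
    subst ht
    rw [zero_mul, sgn_zero, one_smul, Q.eps_append, add_assoc]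
    rfl
  have e2 : (splitSum l fun l₁ l₂ => splitSum l₂ fun σ s₂ => splitSum l₁ fun t₁ t' =>
        sgn ((Q.eps σ + Q.eps s₂) * (Q.rdeg x + Q.eps t₁ + Q.eps t')) • catHom 𝓡 (lder 𝓡 f ψ σ)
          (catHom 𝓡 (letH (F (s₂ ++ x :: t₁))) (f t'))) =
      splitSum l fun r l₂ => splitSum r fun t σ => splitSum l₂ fun w s₂ => splitSum t fun t₁ t' =>
        sgn ((Q.eps σ + Q.eps w + Q.eps s₂) * (Q.rdeg x + Q.eps t₁ + Q.eps t')) •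
          catHom 𝓡 (letH (ψ σ))
            (catHom 𝓡 (f w) (catHom 𝓡 (letH (F (s₂ ++ x :: t₁))) (f t'))) := by
    rw [splitSum_assoc l fun t σ l₂ => splitSum l₂ fun w s₂ => splitSum t fun t₁ t' =>
        sgn ((Q.eps σ + Q.eps w + Q.eps s₂) * (Q.rdeg x + Q.eps t₁ + Q.eps t')) •
          catHom 𝓡 (letH (ψ σ))
            (catHom 𝓡 (f w) (catHom 𝓡 (letH (F (s₂ ++ x :: t₁))) (f t')))]
    refine splitSum_congr fun t r _ => ?_
    rw [← splitSum_assoc r fun σ w s₂ => splitSum t fun t₁ t' =>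
        sgn ((Q.eps σ + Q.eps w + Q.eps s₂) * (Q.rdeg x + Q.eps t₁ + Q.eps t')) •
          catHom 𝓡 (letH (ψ σ))
            (catHom 𝓡 (f w) (catHom 𝓡 (letH (F (s₂ ++ x :: t₁))) (f t')))]
    refine splitSum_congr fun q s₂ _ => ?_
    rw [splitSum_comm]
    refine splitSum_congr fun t₁ t' _ => ?_
    rw [lder, splitSum_cat, ← splitSum_zsmul]
    refine splitSum_congr fun σ w hq => ?_
    subst hq
    rw [cat_assoc, Q.eps_append]
  rw [e0, e1, e2, ← splitSum_add]
  refine splitSum_congr fun l₁ l₂ _ => ?_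
  rw [h.rpsi_append, smul_add, ← splitSum_zsmul, ← splitSum_zsmul]
  congr 1
  · refine splitSum_congr fun a b hab => ?_
    rw [sgn_smul_sgn_smul]
    refine sgn_smul_congr ?_ rfl
    subst hab
    rw [Q.eps_append]
    grind
  · refine splitSum_congr fun t σ ht => ?_
    rw [← splitSum_zsmul]
    refine splitSum_congr fun w s₂ hs => ?_
    rw [← splitSum_zsmul]
    refine splitSum_congr fun t₁ t' ht' => ?_
    rw [sgn_smul_sgn_smul]
    refine sgn_smul_congr ?_ rfl
    subst ht' ht hs
    simp only [Q.eps_append]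
    grind

theorem IsBar.mult_lpsi_cyc (x : Q.B) (l : List Q.B) :
    superExt 𝓡 0 app (superExt 𝓡 j (lpsi 𝓡 f F j ψ) (cyc 𝓡 (x :: l))) =
      splitSum l fun l₁ l₂ => splitSum l₂ fun s₁ s₂ => splitSum l₁ fun t₁ t' =>
        sgn ((Q.eps s₁ + Q.eps s₂) * (Q.rdeg x + Q.eps t₁ + Q.eps t')) •
          catHom 𝓡 (der 𝓡 f j ψ s₁) (catHom 𝓡 (letH (F (s₂ ++ x :: t₁))) (f t')) := by
  rw [cyc_cons, map_splitSum, map_splitSum]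
  refine splitSum_congr fun l₁ l₂ _ => ?_
  rw [map_zsmul, superExt_single_one, map_zsmul, mult_gop, ← splitSum_zsmul]
  refine splitSum_congr fun s₁ s₂ hs => ?_
  rw [← splitSum_zsmul]
  refine splitSum_congr fun t₁ t' ht => ?_
  subst hs ht
  rw [zero_mul, zero_mul, add_zero, sgn_zero, one_smul]
  refine sgn_smul_congr ?_ rfl
  rw [Q.eps_append, Q.eps_append]
  ring

theorem IsBar.tau_piece (hR : IsSuperComm 𝓡) (h : IsBar 𝓡 F f) (hψ : HomF 𝓡 j ψ) (x : Q.B)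
    (s₁ s₂ t₁ t' : List Q.B) : superExt 𝓡 0 tau (catHom 𝓡 (der 𝓡 f j ψ s₁)
      (catHom 𝓡 (letH (F (s₂ ++ x :: t₁))) (f t'))) =
      (if t' = [] then sgn ((j + Q.eps s₁) * (Q.eps s₂ + Q.rdeg x + Q.eps t₁)) •
        catHom 𝓡 (letH (F (s₂ ++ x :: t₁))) (der 𝓡 f j ψ s₁) else 0) +
      splitSum t' fun t' t'' =>
        sgn ((j + Q.eps s₁ + Q.eps s₂ + Q.rdeg x + Q.eps t₁ + Q.eps t') * Q.eps t'') •
          catHom 𝓡 (letH (F t'')) (catHom 𝓡 (der 𝓡 f j ψ s₁)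
            (catHom 𝓡 (letH (F (s₂ ++ x :: t₁))) (f t'))) := by
  have hd := homF_der h.homF hψ
  have hF := h.hom (s₂ ++ x :: t₁)
  conv_lhs => rw [h.rec_right t']
  rw [map_add, map_add, map_add, cat_splitSum, cat_splitSum, map_splitSum]
  congr 1
  · split_ifs
    · rw [cat_one, tau_cat_letH hR (hd s₁) hF]
      refine sgn_smul_congr ?_ rfl
      simp only [par_list, Q.eps_append, Q.eps_cons]
      ring
    · simp
  · refine splitSum_congr fun u w _ => ?_
    rw [← cat_assoc, ← cat_assoc, cat_assoc 𝓡 (der 𝓡 f j ψ s₁),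
      tau_cat_letH hR (cat_mem_parSub 𝓡 (hd s₁)
        (cat_mem_parSub 𝓡 (letH_mem_parSub 𝓡 hF) (h.homF u))) (h.hom w)]
    refine sgn_smul_congr ?_ rfl
    simp only [par_list, Q.eps_append, Q.eps_cons]
    ring

theorem IsBar.tau_mult_lpsi_cyc (hR : IsSuperComm 𝓡) (h : IsBar 𝓡 F f) (hψ : HomF 𝓡 j ψ) (x : Q.B)
    (l : List Q.B) :
    superExt 𝓡 0 tau (superExt 𝓡 0 app (superExt 𝓡 j (lpsi 𝓡 f F j ψ) (cyc 𝓡 (x :: l)))) =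
      cy 𝓡 j (gop 𝓡 0 j f (unmark F) (der 𝓡 f j ψ)) (x :: l) +
      splitSum l fun l₁ l₂ => splitSum l₂ fun σ s₂ => splitSum l₁ fun t₁ t' =>
        sgn ((Q.eps σ + Q.eps s₂) * (Q.rdeg x + Q.eps t₁ + Q.eps t')) •
          catHom 𝓡 (splitSum σ fun t'' s₁ => sgn (j * Q.eps t'') •
            catHom 𝓡 (letH (F t'')) (der 𝓡 f j ψ s₁))
            (catHom 𝓡 (letH (F (s₂ ++ x :: t₁))) (f t')) := by
  have e1 : superExt 𝓡 0 tau (superExt 𝓡 0 app (superExt 𝓡 j (lpsi 𝓡 f F j ψ) (cyc 𝓡 (x :: l)))) =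
      splitSum l fun l₁ l₂ => splitSum l₂ fun s₁ s₂ => splitSum l₁ fun t₁ r =>
        (if r = [] then sgn ((Q.eps s₁ + Q.eps s₂) * (Q.rdeg x + Q.eps t₁ + Q.eps r) +
            (j + Q.eps s₁) * (Q.eps s₂ + Q.rdeg x + Q.eps t₁)) •
          catHom 𝓡 (letH (F (s₂ ++ x :: t₁))) (der 𝓡 f j ψ s₁) else 0) +
        splitSum r fun t' t'' => sgn ((Q.eps s₁ + Q.eps s₂) * (Q.rdeg x + Q.eps t₁ +
          (Q.eps t' + Q.eps t'')) +
          (j + Q.eps s₁ + Q.eps s₂ + Q.rdeg x + Q.eps t₁ + Q.eps t') * Q.eps t'') •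
          catHom 𝓡 (letH (F t'')) (catHom 𝓡 (der 𝓡 f j ψ s₁)
            (catHom 𝓡 (letH (F (s₂ ++ x :: t₁))) (f t'))) := by
    rw [IsBar.mult_lpsi_cyc, map_splitSum]
    refine splitSum_congr fun l₁ l₂ _ => ?_
    rw [map_splitSum]
    refine splitSum_congr fun s₁ s₂ _ => ?_
    rw [map_splitSum]
    refine splitSum_congr fun t₁ r _ => ?_
    rw [map_zsmul, h.tau_piece hR hψ, smul_add, ← splitSum_zsmul]
    congr 1
    · split_ifs
      · rw [sgn_smul_sgn_smul]
      · rw [smul_zero]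
    · refine splitSum_congr fun t' t'' hr => ?_
      subst hr
      rw [sgn_smul_sgn_smul, Q.eps_append]
  have e2 : cy 𝓡 j (gop 𝓡 0 j f (unmark F) (der 𝓡 f j ψ)) (x :: l) =
      splitSum l fun l₁ l₂ => splitSum l₂ fun s₁ s₂ =>
        sgn (Q.eps s₂ * (Q.rdeg x + Q.eps l₁ + Q.eps s₁) +
            j * (Q.eps s₂ + Q.rdeg x + Q.eps l₁)) •
          catHom 𝓡 (letH (F (s₂ ++ x :: l₁))) (der 𝓡 f j ψ s₁) := by
    rw [h.cy_gop_cons, ← splitSum_assoc l fun l₁ s₁ s₂ =>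
        sgn (Q.eps s₂ * (Q.rdeg x + Q.eps l₁ + Q.eps s₁) +
            j * (Q.eps s₂ + Q.rdeg x + Q.eps l₁)) •
          catHom 𝓡 (letH (F (s₂ ++ x :: l₁))) (der 𝓡 f j ψ s₁)]
    refine splitSum_congr fun l₁ l₂ _ => ?_
    rw [← splitSum_zsmul]
    refine splitSum_congr fun t₁ t₂ ht => ?_
    subst ht
    rw [sgn_smul_sgn_smul, Q.eps_append, add_assoc (Q.rdeg x)]
    rfl
  have e3 : (splitSum l fun l₁ l₂ => splitSum l₂ fun σ s₂ => splitSum l₁ fun t₁ t' =>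
        sgn ((Q.eps σ + Q.eps s₂) * (Q.rdeg x + Q.eps t₁ + Q.eps t')) •
          catHom 𝓡 (splitSum σ fun t'' s₁ => sgn (j * Q.eps t'') •
            catHom 𝓡 (letH (F t'')) (der 𝓡 f j ψ s₁))
            (catHom 𝓡 (letH (F (s₂ ++ x :: t₁))) (f t'))) =
      splitSum l fun l₁ l₂ => splitSum l₂ fun σ s₂ => splitSum l₁ fun t₁ t' =>
        splitSum σ fun t'' s₁ => sgn ((Q.eps t'' + Q.eps s₁ + Q.eps s₂) *
          (Q.rdeg x + Q.eps t₁ + Q.eps t') + j * Q.eps t'') • catHom 𝓡 (letH (F t''))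
            (catHom 𝓡 (der 𝓡 f j ψ s₁) (catHom 𝓡 (letH (F (s₂ ++ x :: t₁))) (f t'))) := by
    refine splitSum_congr fun l₁ l₂ _ => splitSum_congr fun σ s₂ _ =>
      splitSum_congr fun t₁ t' _ => ?_
    rw [splitSum_cat, ← splitSum_zsmul]
    refine splitSum_congr fun t'' s₁ hσ => ?_
    subst hσ
    rw [zsmul_cat, sgn_smul_sgn_smul, cat_assoc, Q.eps_append]
  rw [e1, e2, e3, ← splitSum_rotate l fun t₁ t' t'' s₁ s₂ =>
    sgn ((Q.eps t'' + Q.eps s₁ + Q.eps s₂) *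
          (Q.rdeg x + Q.eps t₁ + Q.eps t') + j * Q.eps t'') • catHom 𝓡 (letH (F t''))
            (catHom 𝓡 (der 𝓡 f j ψ s₁) (catHom 𝓡 (letH (F (s₂ ++ x :: t₁))) (f t'))),
    ← splitSum_add]
  refine splitSum_congr fun l₁ l₂ _ => ?_
  rw [← splitSum_add]
  refine splitSum_congr fun s₁ s₂ _ => ?_
  rw [splitSum_add]
  congr 1
  · rw [splitSum_eq_right]
    · rw [if_pos rfl]
      refine sgn_smul_congr ?_ rfl
      rw [Q.eps_nil]
      grind
    · intro u v _ hv
      rw [if_neg hv]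
  · refine splitSum_congr fun t₁ r _ => splitSum_congr fun t' t'' _ => sgn_smul_congr ?_ rfl
    grind

/-- The telescoping identity for the rotations of a word. -/
theorem IsBar.telescope (hR : IsSuperComm 𝓡) (h : IsBar 𝓡 F f) (hψ : HomF 𝓡 j ψ) (l : List Q.B) :
    superExt 𝓡 j (rpsi 𝓡 f ψ) (superExt 𝓡 0 app (cyc 𝓡 l)) -
      (superExt 𝓡 0 app (superExt 𝓡 j (lpsi 𝓡 f F j ψ) (cyc 𝓡 l)) -
        superExt 𝓡 0 tau (superExt 𝓡 0 app (superExt 𝓡 j (lpsi 𝓡 f F j ψ) (cyc 𝓡 l)))) =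
      cy 𝓡 j (gop 𝓡 j 0 f (unmark ψ) f) l +
        cy 𝓡 j (gop 𝓡 0 j f (unmark F) (der 𝓡 f j ψ)) l := by
  cases l with
  | nil => simp [cyc_nil, cy_nil]
  | cons x l =>
    rw [h.rpsi_mult_cyc, h.tau_mult_lpsi_cyc hR hψ, IsBar.mult_lpsi_cyc]
    obtain ⟨g, hg⟩ : ∃ g : List Q.B → (List Q'.B →₀ R), ∀ σ,
      (splitSum σ fun t'' s₁ => sgn (j * Q.eps t'') •
              catHom 𝓡 (letH (F t'')) (der 𝓡 f j ψ s₁)) = g σ := ⟨_, fun _ => rfl⟩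
    have e4 : ∀ σ, der 𝓡 f j ψ σ = lder 𝓡 f ψ σ + g σ := fun σ => by
      rw [h.der_rec, splitSum_add, lder, hg]
    simp only [hg]
    simp only [e4, add_cat, smul_add, splitSum_add]
    abel

end Telescope

end Cyclic

/-! ### The bar construction of an A-infinity functor -/

theorem sum_composition_succ {M : Type*} [AddCommMonoid M] (n : ℕ) (g : List ℕ → M) :
    ∑ c : Composition (n + 1), g c.blocks =
      ∑ i ∈ Finset.range (n + 1), ∑ c : Composition (n - i), g ((i + 1) :: c.blocks) := by
  rw [Finset.sum_sigma']
  symm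
  refine Finset.sum_bij (fun p hp => (⟨(p.1 + 1) :: p.2.blocks, ?_, ?_⟩ : Composition (n + 1)))
    (fun _ _ => Finset.mem_univ _) ?_ ?_ (fun _ _ => rfl)
  · intro i hi
    rcases List.mem_cons.1 hi with rfl | h
    · exact Nat.succ_pos _
    · exact p.2.blocks_pos h
  · have := Finset.mem_range.1 (Finset.mem_sigma.1 hp).1
    rw [List.sum_cons, p.2.blocks_sum]
    omega
  · rintro ⟨i, c⟩ _ ⟨i', c'⟩ _ h
    have h' := congr_arg Composition.blocks h
    simp only [List.cons.injEq, Nat.add_right_cancel_iff] at h'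
    obtain ⟨rfl, h2⟩ := h'
    exact congr_arg _ (Composition.ext h2)
  · intro c _
    obtain ⟨bs, hp, hs⟩ := c
    cases bs with
    | nil => simp at hs
    | cons b L =>
      have hb := hp (List.mem_cons_self ..)
      rw [List.sum_cons] at hs
      refine ⟨⟨b - 1, ⟨L, fun {i} hi => hp (List.mem_cons_of_mem _ hi), by
        show L.sum = n - (b - 1); omega⟩⟩,
        Finset.mem_sigma.2 ⟨Finset.mem_range.2 (show b - 1 < n + 1 by omega), Finset.mem_univ _⟩, ?_⟩
      refine Composition.ext ?_
      show (b - 1 + 1) :: L = b :: L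
      rw [Nat.sub_add_cancel hb]

section Links

variable {K R : Type*} [Field K] [Ring R] [Algebra K R]
variable {𝓡 : ZMod 2 → Submodule K R} [GradedAlgebra 𝓡]
variable {Ob Ob' : Type*}

theorem cats_nil {Q : HomBasis Ob} : Q.cats 𝓡 [] = wd [] := rfl

theorem cats_cons {Q : HomBasis Ob} (t : List Q.B →₀ R) (ts : List (List Q.B →₀ R)) :
    Q.cats 𝓡 (t :: ts) = catHom 𝓡 t (Q.cats 𝓡 ts) := cat_eq 𝓡 _ _

theorem cats_two {Q : HomBasis Ob} (a b : List Q.B →₀ R) :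
    Q.cats 𝓡 [a, b] = catHom 𝓡 a b := by
  rw [cats_cons, cats_cons, cats_nil, cat_one]

theorem cats_three {Q : HomBasis Ob} (a b c : List Q.B →₀ R) :
    Q.cats 𝓡 [a, b, c] = catHom 𝓡 a (catHom 𝓡 b c) := by
  rw [cats_cons, cats_two]

theorem word_eq {Q : HomBasis Ob} (l : List Q.B) : Q.word l = (wd l : List Q.B →₀ R) := rfl

theorem AInfCat.isDiff (C : AInfCat 𝓡 Ob) : IsDiff 𝓡 C.m where
  hom l y := by
    have := C.m_deg l y
    rwa [add_comm (C.eps l) 1] at this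
  nil := C.m_nil
  ainf l := by
    rw [← C.ainf l, der, map_splitSum]
    refine splitSum_congr fun l₁ r _ => ?_
    rw [map_splitSum]
    refine splitSum_congr fun l₂ l₃ _ => ?_
    rw [map_zsmul, cats_three, one_mul]
    rfl

theorem AInfFun.isBar {C : AInfCat 𝓡 Ob} {D : AInfCat 𝓡 Ob'} (F : AInfFun C D) :
    IsBar 𝓡 F.F F.bar where
  hom l y := by
    rw [zero_add]
    exact F.F_deg l y
  nil := F.F_nil
  bar_nil := by
    rw [AInfFun.bar]
    have : Subsingleton (Composition ([] : List C.B).length) :=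
      (Fintype.card_le_one_iff_subsingleton (α := Composition 0)).1 (by simp [composition_card])
    exact Fintype.sum_subsingleton _ (Composition.ones 0)
  rec_left l hl := by
    have key : ∀ n (l : List C.B), l.length = n → F.bar l = ∑ c : Composition n,
        D.cats 𝓡 ((l.splitWrtCompositionAux c.blocks).map F.one) := by
      rintro _ l rfl
      rfl
    obtain ⟨n, hn⟩ : ∃ n, l.length = n + 1 :=
      ⟨l.length - 1, by have := List.length_pos_iff.2 hl; omega⟩
    rw [key _ l hn, sum_composition_succ n fun bs =>
      D.cats 𝓡 ((l.splitWrtCompositionAux bs).map F.one), splitSum, hn]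
    conv_rhs => rw [Finset.sum_range_succ']
    rw [List.take_zero, F.F_nil, map_zero, zero_cat, add_zero]
    refine Finset.sum_congr rfl fun i hi => ?_
    rw [key (n - i) (l.drop (i + 1)) (by rw [List.length_drop]; omega), map_sum]
    refine Finset.sum_congr rfl fun c _ => ?_
    rw [List.splitWrtCompositionAux_cons, List.map_cons, cats_cons]
    rfl

/-- Two objects are joined by a composable word. -/
abbrev Comp (C : AInfCat 𝓡 Ob) (l : List C.B) : Prop := ∃ X Y, C.IsPath X l Y

theorem isPath_append {Q : HomBasis Ob} {u v : List Q.B} {X Y : Ob} :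
    Q.IsPath X (u ++ v) Y ↔ ∃ Z, Q.IsPath X u Z ∧ Q.IsPath Z v Y := by
  induction u generalizing X with
  | nil => simp [HomBasis.IsPath]
  | cons x u ih => simp [HomBasis.IsPath, ih, and_assoc]

theorem isPath_unique {Q : HomBasis Ob} {l : List Q.B} (hl : l ≠ []) {X Y X' Y' : Ob}
    (h : Q.IsPath X l Y) (h' : Q.IsPath X' l Y') : X = X' ∧ Y = Y' := by
  induction l generalizing X X' with
  | nil => exact absurd rfl hl
  | cons x l ih =>
    refine ⟨h.1.symm.trans h'.1, ?_⟩
    cases l with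
    | nil => exact Eq.trans (Eq.symm h.2) h'.2
    | cons y l => exact (ih (List.cons_ne_nil _ _) h.2 h'.2).2

theorem AInfFun.isMor {C : AInfCat 𝓡 Ob} {D : AInfCat 𝓡 Ob'} (F : AInfFun C D) :
    IsMor 𝓡 (Comp C) C.m D.m F.F F.bar where
  bar := F.isBar
  sub u v := by
    rintro ⟨X, Y, h⟩
    obtain ⟨Z, h1, h2⟩ := isPath_append.1 h
    exact ⟨⟨X, Z, h1⟩, ⟨Z, Y, h2⟩⟩
  ainf l := by
    rintro ⟨X, Y, h⟩
    rw [AInfFun.bar, map_sum]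
    refine (F.ainf l X Y h).symm.trans ?_
    rw [der, map_splitSum]
    refine splitSum_congr fun l₁ r _ => ?_
    rw [map_splitSum]
    refine splitSum_congr fun l₂ l₃ _ => ?_
    rw [map_zsmul, cats_three, one_mul]
    rfl

/-- A family of morphisms of `D`, indexed by the words of `C` and compatible with sources and
targets, that vanishes on the words with a unit. -/
structure IsCo (C : AInfCat 𝓡 Ob) (D : AInfCat 𝓡 Ob') (obj : Ob → Ob') (j : ZMod 2)
    (ψ : List C.B → (D.B →₀ R)) : Prop where
  hom : HomF 𝓡 j ψ
  nil : ψ [] = 0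
  path : ∀ l y, ψ l y ≠ 0 → ∃ X Y, C.IsPath X l Y ∧ D.src y = obj X ∧ D.tgt y = obj Y
  unit : ∀ l X, C.unit X ∈ l → ψ l = 0

/-- A strictly unital A-infinity map with underlying map of coalgebras `f`. -/
structure IsFun (C : AInfCat 𝓡 Ob) (D : AInfCat 𝓡 Ob') (obj : Ob → Ob')
    (F : List C.B → (D.B →₀ R)) (f : List C.B → (List D.B →₀ R)) : Prop where
  mor : IsMor 𝓡 (Comp C) C.m D.m F f
  path : ∀ l y, F l y ≠ 0 → ∃ X Y, C.IsPath X l Y ∧ D.src y = obj X ∧ D.tgt y = obj Y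
  unit : ∀ X, F [C.unit X] = wd (D.unit (obj X))
  unit_mem : ∀ (l : List C.B) (X : Ob), C.unit X ∈ l → l.length ≠ 1 → F l = 0

theorem AInfFun.isFun {C : AInfCat 𝓡 Ob} {D : AInfCat 𝓡 Ob'} (F : AInfFun C D) :
    IsFun C D F.obj F.F F.bar :=
  ⟨F.isMor, F.F_path, F.F_unit, F.F_unit_mem⟩

theorem isFun_id (C : AInfCat 𝓡 Ob) : IsFun C C id idLet wd where
  mor :=
    { bar := isBar_id 𝓡
      sub := fun u v => by
        rintro ⟨X, Y, h⟩
        obtain ⟨Z, h1, h2⟩ := isPath_append.1 h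
        exact ⟨⟨X, Z, h1⟩, ⟨Z, Y, h2⟩⟩
      ainf := fun l _ => (isMor_id (𝓡 := 𝓡) C.m).ainf l trivial }
  path l y h := by
    match l with
    | [] => exact absurd rfl h
    | [x] =>
      have hx : x = y := by
        by_contra hxy
        exact h (Finsupp.single_eq_of_ne' hxy)
      subst hx
      exact ⟨C.src x, C.tgt x, ⟨rfl, rfl⟩, rfl, rfl⟩
    | _ :: _ :: _ => exact absurd rfl h
  unit X := rfl
  unit_mem l X _ hl := idLet_eq_zero hl

theorem IsFun.bar {C : AInfCat 𝓡 Ob} {D : AInfCat 𝓡 Ob'} {obj : Ob → Ob'}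
    {F : List C.B → (D.B →₀ R)} {f : List C.B → (List D.B →₀ R)} (h : IsFun C D obj F f) :
    IsBar 𝓡 F f := h.mor.bar

theorem coeffMap_ne {X : Type*} {v : R →ₗ[K] R} {a : X →₀ R} {x : X}
    (h : coeffMap v a x ≠ 0) : a x ≠ 0 := fun h0 => h (by
  show v (a x) = 0
  rw [h0, map_zero])

variable {i : ZMod 2} {v : R →ₗ[K] R}

theorem IsFun.isCo {C : AInfCat 𝓡 Ob} {D : AInfCat 𝓡 Ob'} {obj : Ob → Ob'}
    {F : List C.B → (D.B →₀ R)} {f : List C.B → (List D.B →₀ R)} (h : IsFun C D obj F f)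
    (hv : v ∈ superDer 𝓡 i) : IsCo C D obj i fun l => coeffMap v (F l) where
  hom := by
    have := homF_coeffMap hv h.bar.hom
    rwa [add_zero] at this
  nil := by simp [h.bar.nil]
  path l y hy := h.path l y (coeffMap_ne hy)
  unit l X hX := by
    by_cases hl : l.length = 1
    · obtain ⟨x, rfl⟩ := List.length_eq_one_iff.1 hl
      rw [List.mem_singleton] at hX
      rw [← hX, h.unit, coeffMap_wd hv]
    · rw [h.unit_mem l X hX hl, map_zero]

theorem AInfCat.m_unit_pair (C : AInfCat 𝓡 Ob) {x y : C.B} {X : Ob} (h : C.unit X = x ∨ C.unit X = y) :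
    C.m [x, y] = 0 ∨ ∃ (n : ℤ) (z : C.B), C.m [x, y] = n • wd z := by
  by_cases h0 : C.m [x, y] = 0
  · exact Or.inl h0
  obtain ⟨z, hz⟩ := Finsupp.ne_iff.1 h0
  have hp := C.m_path _ _ hz
  have h1 : C.src y = C.tgt x := hp.2.1
  right
  rcases h with rfl | rfl
  · rw [C.tgt_unit] at h1
    subst h1
    exact ⟨1, y, by rw [C.m_unit_left, one_smul]⟩
  · rw [C.src_unit] at h1
    subst h1
    exact ⟨_, x, C.m_unit_right x⟩

theorem AInfCat.isCo (C : AInfCat 𝓡 Ob) (hv : v ∈ superDer 𝓡 i) :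
    IsCo C C id (i + 1) fun l => coeffMap v (C.m l) where
  hom := homF_coeffMap hv C.isDiff.hom
  nil := by simp [C.m_nil]
  path l y hy := ⟨_, _, C.m_path l y (coeffMap_ne hy), rfl, rfl⟩
  unit l X hX := by
    by_cases hl : l.length = 2
    · obtain ⟨x, y, rfl⟩ := List.length_eq_two.1 hl
      rcases C.m_unit_pair (x := x) (y := y) (X := X) (by simpa using hX) with h | ⟨n, z, h⟩
      · rw [h, map_zero]
      · rw [h, map_zsmul, coeffMap_wd hv, smul_zero]
    · rw [C.m_unit_mem l X hX hl, map_zero]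

end Links

/-! ### Composable words -/

section Paths

variable {K R : Type*} [Field K] [Ring R] [Algebra K R]
variable {𝓡 : ZMod 2 → Submodule K R} [GradedAlgebra 𝓡]
variable {Ob Ob' Ob'' : Type*} {Q : HomBasis Ob} {Q' : HomBasis Ob'} {Q'' : HomBasis Ob''}

/-- The composable words from `X` to `Y`. -/
def pth (Q : HomBasis Ob) (X Y : Ob) : Set (List Q.B) := {w | Q.IsPath X w Y}

/-- The basis of the morphisms from `X` to `Y`. -/
def arr (Q : HomBasis Ob) (X Y : Ob) : Set Q.B := {y | Q.src y = X ∧ Q.tgt y = Y}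

/-- The marked composable words from `X` to `Y`. -/
def mpth (Q : HomBasis Ob) (X Y : Ob) : Set (List Q.B × List Q.B) :=
  {q | q.2 ≠ [] ∧ Q.IsPath X (q.1 ++ q.2) Y}

/-- The nonempty cyclically composable words. -/
def cpth (Q : HomBasis Ob) : Set (List Q.B) := {w | w ≠ [] ∧ ∃ X, Q.IsPath X w X}

/-- The marked cyclically composable words. -/
def cmpth (Q : HomBasis Ob) : Set (List Q.B × List Q.B) := {q | ∃ X, q ∈ mpth Q X X}

theorem cat_pth {X Y Z : Ob} {a b : List Q.B →₀ R} (ha : a ∈ supported R R (pth Q X Y))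
    (hb : b ∈ supported R R (pth Q Y Z)) :
    catHom 𝓡 a b ∈ supported R R (pth Q X Z) :=
  cat_mem_supported 𝓡 (S := pth Q X Y) (T := pth Q Y Z) (U := pth Q X Z)
    (fun _ hx _ hy => isPath_append.2 ⟨_, hx, hy⟩) ha hb

theorem letH_arr {X Y : Ob} {a : Q.B →₀ R} (ha : a ∈ supported R R (arr Q X Y)) :
    letH a ∈ supported R R (pth Q X Y) :=
  letH_mem_supported (fun _ hx => hx) ha

theorem wd_pth {X Y : Ob} {w : List Q.B} (h : Q.IsPath X w Y) :
    (wd w : List Q.B →₀ R) ∈ supported R R (pth Q X Y) :=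
  single_mem_supported R _ h

theorem mem_inter {X : Type*} {S T : Set X} {a : X →₀ R} (hS : a ∈ supported R R S)
    (hT : a ∈ supported R R T) : a ∈ supported R R (S ∩ T) := by
  rw [Finsupp.supported_inter]
  exact ⟨hS, hT⟩

/-- Compatibility with sources and targets of a map on words with values in tensors. -/
def PathMap (obj : Ob → Ob') (f : List Q.B → (List Q'.B →₀ R)) : Prop :=
  ∀ X l Y, Q.IsPath X l Y → f l ∈ supported R R (pth Q' (obj X) (obj Y))

/-- Compatibility with sources and targets of a map on words with values in morphisms. -/
def ArrMap (obj : Ob → Ob') (f : List Q.B → (Q'.B →₀ R)) : Prop :=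
  ∀ X l Y, Q.IsPath X l Y → f l ∈ supported R R (arr Q' (obj X) (obj Y))

/-- Compatibility with sources and targets of a map on marked words with values in morphisms. -/
def MArrMap (obj : Ob → Ob') (f : List Q.B × List Q.B → (Q'.B →₀ R)) : Prop :=
  ∀ X Y, ∀ p ∈ mpth Q X Y, f p ∈ supported R R (arr Q' (obj X) (obj Y))

/-- Compatibility with sources and targets of an operator on marked words. -/
def MPathMap (obj : Ob → Ob') (f : List Q.B × List Q.B → (List Q'.B × List Q'.B →₀ R)) : Prop :=
  ∀ X Y, ∀ p ∈ mpth Q X Y, f p ∈ supported R R (mpth Q' (obj X) (obj Y))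

variable {obj : Ob → Ob'}

theorem arrMap_of_path {ψ : List Q.B → (Q'.B →₀ R)} (h0 : ψ [] = 0)
    (h : ∀ l y, ψ l y ≠ 0 → ∃ X Y, Q.IsPath X l Y ∧ Q'.src y = obj X ∧ Q'.tgt y = obj Y) :
    ArrMap obj ψ := by
  intro X l Y hl y hy
  rcases eq_or_ne l [] with rfl | hne
  · rw [h0] at hy
    simp at hy
  obtain ⟨X', Y', h1, h2, h3⟩ := h l y (Finsupp.mem_support_iff.1 hy)
  obtain ⟨rfl, rfl⟩ := isPath_unique hne hl h1
  exact ⟨h2, h3⟩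

theorem IsBar.pathMap {F : List Q.B → (Q'.B →₀ R)} {f : List Q.B → (List Q'.B →₀ R)}
    (h : IsBar 𝓡 F f) (hF : ArrMap obj F) : PathMap obj f := by
  intro X l Y hl
  induction hn : l.length using Nat.strong_induction_on generalizing X l with
  | _ n ih =>
    rcases eq_or_ne l [] with rfl | hne
    · rw [h.bar_nil]
      exact wd_pth (congr_arg obj hl)
    rw [h.rec_left l hne]
    refine splitSum_mem' fun u v huv => ?_
    rcases eq_or_ne u [] with rfl | hu
    · rw [h.nil, map_zero, zero_cat]
      exact zero_mem _
    subst huv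
    obtain ⟨Z, h1, h2⟩ := isPath_append.1 hl
    refine cat_pth (letH_arr (hF _ _ _ h1)) (ih v.length ?_ _ _ h2 rfl)
    have := List.length_pos_iff.2 hu
    rw [← hn, List.length_append]
    omega

theorem PathMap.der {f : List Q.B → (List Q'.B →₀ R)} {ψ : List Q.B → (Q'.B →₀ R)} {j : ZMod 2}
    (hf : PathMap obj f) (hψ : ArrMap obj ψ) : PathMap obj (der 𝓡 f j ψ) := by
  intro X l Y hl
  refine splitSum_mem' fun u r hr => splitSum_mem' fun v w hw => zsmul_mem' ?_ _
  subst hw hr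
  obtain ⟨Z, h1, h⟩ := isPath_append.1 hl
  obtain ⟨W, h2, h3⟩ := isPath_append.1 h
  exact cat_pth (hf _ _ _ h1) (cat_pth (letH_arr (hψ _ _ _ h2)) (hf _ _ _ h3))

theorem tm_letH_mpth {X Y Z W : Ob} {a b : List Q.B →₀ R} {y : Q.B →₀ R}
    (ha : a ∈ supported R R (pth Q X Y)) (hy : y ∈ supported R R (arr Q Y Z))
    (hb : b ∈ supported R R (pth Q Z W)) :
    tm 𝓡 a (catHom 𝓡 (letH y) b) ∈ supported R R (mpth Q X W) :=
  tm_mem_supported 𝓡 (S := pth Q X Y) (T := pth Q Y W ∩ {l | l ≠ []}) (U := mpth Q X W)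
    (fun _ hx _ hy => ⟨hy.2, isPath_append.2 ⟨_, hx, hy.1⟩⟩) ha
    (mem_inter (cat_pth (letH_arr hy) hb) (letH_cat_mem_ne 𝓡 _ _))

variable {a k c j i : ZMod 2} {A : List Q.B → (List Q'.B →₀ R)}
  {μ : List Q.B × List Q.B → (Q'.B →₀ R)} {A' : List Q.B → (List Q'.B →₀ R)}

theorem PathMap.gop (hA : PathMap obj A) (hμ : MArrMap obj μ) (hA' : PathMap obj A') :
    MPathMap obj (RelCyc.gop 𝓡 k c A μ A') := by
  rintro X Y ⟨s, _ | ⟨x, t⟩⟩ ⟨_, hp⟩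
  · exact zero_mem _
  rw [RelCyc.gop]
  refine splitSum_mem' fun s₁ s₂ hs => splitSum_mem' fun t₁ t₂ ht => zsmul_mem' ?_ _
  subst hs ht
  rw [List.append_assoc] at hp
  obtain ⟨Z, h1, h⟩ := isPath_append.1 hp
  rw [← List.cons_append, ← List.append_assoc] at h
  obtain ⟨W, h2, h3⟩ := isPath_append.1 h
  exact tm_letH_mpth (hA _ _ _ h1) (hμ _ _ _ ⟨List.cons_ne_nil _ _, h2⟩) (hA' _ _ _ h3)

theorem ArrMap.unmark {ψ : List Q.B → (Q'.B →₀ R)} (h : ArrMap obj ψ) :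
    MArrMap obj (unmark ψ) := fun _ _ _ hp => h _ _ _ hp.2

theorem MPathMap.cmp {obj' : Ob' → Ob''} {G : List Q.B × List Q.B → (List Q'.B × List Q'.B →₀ R)}
    (hG : MPathMap obj G) {m' : List Q'.B × List Q'.B → (Q''.B →₀ R)} (hm' : MArrMap obj' m') :
    MArrMap (obj' ∘ obj) (cmp 𝓡 i m' G) := fun X Y p hp =>
  superExt_mem_supported' 𝓡 i (fun _ hq => hm' _ _ _ hq) (hG X Y p hp)

theorem pathMap_wd : PathMap id (wd : List Q.B → (List Q.B →₀ R)) := fun _ _ _ h => wd_pth h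

theorem MPathMap.dpsi {ψ : List Q.B → (Q.B →₀ R)} (hψ : ArrMap id ψ) :
    MPathMap id (dpsi 𝓡 j ψ) := by
  rintro X Y ⟨s, _ | ⟨x, t⟩⟩ ⟨_, hp⟩
  · exact zero_mem _
  obtain ⟨Z, h1, h2⟩ := isPath_append.1 hp
  have hd := pathMap_wd.der (𝓡 := 𝓡) (j := j) hψ
  have hx : (wd x : Q.B →₀ R) ∈ supported R R (arr Q Z (Q.tgt x)) :=
    single_mem_supported R _ ⟨h2.1, rfl⟩
  rw [RelCyc.dpsi]
  refine add_mem (add_mem ?_ (pathMap_wd.gop hψ.unmark pathMap_wd _ _ _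
    ⟨List.cons_ne_nil _ _, hp⟩)) (zsmul_mem' ?_ _)
  · rw [wd_cons_eq 𝓡, ← letH_wd]
    exact tm_letH_mpth (hd _ _ _ h1) hx (wd_pth h2.2)
  · rw [← letH_wd]
    exact tm_letH_mpth (wd_pth h1) hx (hd _ _ _ h2.2)

theorem MPathMap.kphi {ψ : List Q.B → (Q.B →₀ R)} (hψ : ArrMap id ψ) :
    MPathMap id (kphi 𝓡 j ψ) := by
  rintro X Y ⟨s, _ | ⟨x, t⟩⟩ ⟨h, hp⟩
  · exact absurd rfl h
  obtain ⟨Z, h1, h2⟩ := isPath_append.1 hp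
  have hd := pathMap_wd.der (𝓡 := 𝓡) (j := j) hψ
  rw [RelCyc.kphi, wd_cons_eq 𝓡, ← letH_wd]
  exact tm_letH_mpth (hd _ _ _ h1) (single_mem_supported R _ ⟨h2.1, rfl⟩) (wd_pth h2.2)

theorem cyc_cmpth {w : List Q.B} (hw : w ∈ cpth Q) :
    cyc 𝓡 w ∈ supported R R (cmpth Q) := by
  obtain ⟨hne, X, hX⟩ := hw
  cases w with
  | nil => exact absurd rfl hne
  | cons x l =>
    rw [cyc_cons]
    refine splitSum_mem' fun u v huv => zsmul_mem' (single_mem_supported R _ ?_) _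
    subst huv
    obtain ⟨Z, h1, h2⟩ := isPath_append.1 (show Q.IsPath X ((x :: u) ++ v) X from hX)
    exact ⟨Z, List.cons_ne_nil _ _, isPath_append.2 ⟨X, h2, h1⟩⟩

theorem MPathMap.cmpth {G : List Q.B × List Q.B → (List Q'.B × List Q'.B →₀ R)}
    (hG : MPathMap obj G) {t : List Q.B × List Q.B →₀ R}
    (ht : t ∈ supported R R (cmpth Q)) :
    RelCyc.superExt 𝓡 i G t ∈ supported R R (cmpth Q') :=
  superExt_mem_supported' 𝓡 i (S := RelCyc.cmpth Q) (U := RelCyc.cmpth Q') (fun p ⟨X, hp⟩ =>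
    Finsupp.supported_mono (s := mpth Q' (obj X) (obj X)) (t := RelCyc.cmpth Q')
      (fun _ hq => ⟨_, hq⟩) (hG X X p hp)) ht

theorem app_cmpth {t : List Q.B × List Q.B →₀ R} (ht : t ∈ supported R R (cmpth Q)) :
    superExt 𝓡 i app t ∈ supported R R (cpth Q) := by
  refine superExt_mem_supported' 𝓡 i (S := cmpth Q) (U := cpth Q) (fun p ⟨X, hp⟩ => ?_) ht
  exact single_mem_supported R _ ⟨fun h => hp.1 (List.append_eq_nil_iff.1 h).2, X, hp.2⟩

theorem prj_cmpth {t : List Q.B × List Q.B →₀ R} (ht : t ∈ supported R R (cmpth Q)) :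
    superExt 𝓡 i prj t ∈ supported R R (cpth Q) := by
  refine superExt_mem_supported' 𝓡 i (S := cmpth Q) (U := cpth Q) (fun p ⟨X, hp⟩ => ?_) ht
  rw [prj]
  split_ifs with h
  · refine single_mem_supported R _ ⟨hp.1, X, ?_⟩
    have := hp.2
    rwa [h, List.nil_append] at this
  · exact zero_mem _

theorem MPathMap.cy {G : List Q.B × List Q.B → (List Q'.B × List Q'.B →₀ R)}
    (hG : MPathMap obj G) {w : List Q.B} (hw : w ∈ cpth Q) :
    cy 𝓡 i G w ∈ supported R R (cpth Q') :=
  prj_cmpth (hG.cmpth (cyc_cmpth hw))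

/-! ### Insertion of a unit at the beginning of a word -/

/-- The word with a unit inserted at the beginning. -/
def eW : List Q.B → (List Q.B →₀ R)
  | [] => 0
  | x :: l => wd (Q.unit (Q.src x) :: x :: l)

theorem eps_unit (X : Ob) : Q.eps [Q.unit X] = 1 := by
  rw [Q.eps_cons, Q.eps_nil, HomBasis.rdeg, Q.deg_unit]
  rfl

theorem rdeg_unit (X : Ob) : Q.rdeg (Q.unit X) = 1 := by
  rw [HomBasis.rdeg, Q.deg_unit]
  rfl

theorem homF_eW : HomF 𝓡 1 (eW (Q := Q) (R := R)) := fun l => by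
  cases l with
  | nil => exact zero_mem _
  | cons x l =>
    have := wd_mem (Q := Q) 𝓡 (Q.unit (Q.src x) :: x :: l)
    rwa [Q.eps_cons, rdeg_unit] at this

theorem unit_cat (X : Ob) (t : List Q.B →₀ R) : catHom 𝓡 (wd [Q.unit X]) t =
    superExt 𝓡 1 (fun l => wd (Q.unit X :: l) : List Q.B → (List Q.B →₀ R)) t := by
  induction t using Finsupp.induction_linear with
  | zero => simp
  | add u v hu hv => simp only [map_add, hu, hv]
  | single x r => rw [cat_single_single, superExt_single, eps_unit, one_mul]; simp

theorem eW_ext {X Y : Ob} {t : List Q.B →₀ R} (h1 : t ∈ supported R R (pth Q X Y))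
    (h2 : t ∈ supported R R {l : List Q.B | l ≠ []}) :
    superExt 𝓡 1 eW t = catHom 𝓡 (wd [Q.unit X]) t := by
  rw [unit_cat]
  refine superExt_congr_supported 𝓡 1 (fun l hl => ?_) (mem_inter h1 h2)
  obtain ⟨h1, h2⟩ := hl
  cases l with
  | nil => exact absurd rfl h2
  | cons x l => rw [eW, h1.1]

theorem eW_cpth {t : List Q.B →₀ R} (ht : t ∈ supported R R (cpth Q)) :
    superExt 𝓡 i eW t ∈ supported R R (cpth Q) := by
  refine superExt_mem_supported' 𝓡 i (S := cpth Q) (U := cpth Q) (fun l ⟨hne, X, hl⟩ => ?_) ht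
  cases l with
  | nil => exact absurd rfl hne
  | cons x l =>
    refine single_mem_supported R _ ⟨List.cons_ne_nil _ _, X, ?_⟩
    have h1 := hl.1
    exact ⟨(Q.src_unit _).trans h1, (Q.tgt_unit _).symm, hl.2⟩

end Paths

section Paths

variable {K R : Type*} [Field K] [Ring R] [Algebra K R]
variable {𝓡 : ZMod 2 → Submodule K R} [GradedAlgebra 𝓡]
variable {Ob Ob' : Type*} {C : AInfCat 𝓡 Ob} {D : AInfCat 𝓡 Ob'} {obj : Ob → Ob'} {j : ZMod 2}
  {F : List C.B → (D.B →₀ R)} {f : List C.B → (List D.B →₀ R)} {ψ : List C.B → (D.B →₀ R)}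

theorem IsFun.arrMap (h : IsFun C D obj F f) : ArrMap obj F := arrMap_of_path h.bar.nil h.path

theorem IsFun.pathMap (h : IsFun C D obj F f) : PathMap obj f := h.bar.pathMap h.arrMap

theorem IsCo.arrMap (h : IsCo C D obj j ψ) : ArrMap obj ψ := arrMap_of_path h.nil h.path

theorem AInfCat.arrMap (C : AInfCat 𝓡 Ob) : ArrMap id C.m :=
  arrMap_of_path C.m_nil fun l y h => ⟨_, _, C.m_path l y h, rfl, rfl⟩

theorem IsFun.gbar_path (h : IsFun C D obj F f) : MPathMap obj (gbar 𝓡 f F) :=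
  h.pathMap.gop h.arrMap.unmark h.pathMap

theorem IsFun.lpsi_path (h : IsFun C D obj F f) (hψ : IsCo C D obj j ψ) :
    MPathMap obj (lpsi 𝓡 f F j ψ) :=
  (h.pathMap.der hψ.arrMap).gop h.arrMap.unmark h.pathMap

theorem IsFun.gpsi_path (h : IsFun C D obj F f) (hψ : IsCo C D obj j ψ) :
    MPathMap obj (gpsi 𝓡 D.m f F j ψ) :=
  h.pathMap.gop ((h.lpsi_path hψ).cmp D.arrMap.unmark) h.pathMap

theorem IsFun.gphi_path (h : IsFun C D obj F f) {φ : List C.B → (C.B →₀ R)}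
    (hφ : IsCo C C id j φ) : MPathMap obj (gphi 𝓡 f F j φ) :=
  h.pathMap.gop ((MPathMap.kphi hφ.arrMap).cmp h.arrMap.unmark) h.pathMap

end Paths

/-! ### The operators on chains as operators on marked words -/

section Formulas

variable {K R : Type*} [Field K] [Ring R] [Algebra K R]
variable {𝓡 : ZMod 2 → Submodule K R} [GradedAlgebra 𝓡]
variable {Ob Ob' : Type*} {Q : HomBasis Ob} {Q' : HomBasis Ob'} {i j : ZMod 2}

/-- The operator on chains with the given values on words. -/
def ch (𝓡 : ZMod 2 → Submodule K R) [GradedAlgebra 𝓡] (i : ZMod 2)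
    (Φ : List Q.B → (List Q'.B →₀ R)) : Q.CC R →+ Q'.CC R :=
  superExt 𝓡 i fun w => Q'.toCC (Φ w.1)

theorem chainOp_eq {φ : Q.B → List Q.B → (List Q'.B →₀ R)} {Φ : List Q.B → (List Q'.B →₀ R)}
    (h : ∀ X x l, Q.IsPath X (x :: l) X → φ x l = Φ (x :: l)) : Q.chainOp 𝓡 i φ = ch 𝓡 i Φ := by
  rw [HomBasis.chainOp, ch]
  congr 1
  funext w
  obtain ⟨_ | ⟨x, l⟩, h1, ⟨X, h2⟩, h3⟩ := w
  · exact absurd rfl h1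
  · show Q'.toCC (φ x l) = _
    rw [h X x l h2]

theorem src_headD {Y Z : Ob} {u v : List Q.B} {x : Q.B} (h : Q.IsPath Z (u ++ x :: v) Y) :
    Q.src (u.headD x) = Z := by
  cases u with
  | nil => exact h.1
  | cons y u => exact h.1

theorem rotate_path {X : Ob} {u v : List Q.B} {x : Q.B} (h : Q.IsPath X (x :: (u ++ v)) X) :
    ∃ Z, Q.IsPath Z (v ++ x :: u) Z := by
  obtain ⟨Z, h1, h2⟩ := isPath_append.1 (show Q.IsPath X ((x :: u) ++ v) X from h)
  exact ⟨Z, isPath_append.2 ⟨X, h2, h1⟩⟩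

theorem mult_lpsi (f : List Q.B → (List Q'.B →₀ R)) (F ψ : List Q.B → (Q'.B →₀ R)) (s : List Q.B)
    (x : Q.B) (t : List Q.B) : superExt 𝓡 0 app (lpsi 𝓡 f F j ψ (s, x :: t)) =
      splitSum t fun t₁ t₂ => splitSum s fun s₁ r => splitSum r fun s₂ r => splitSum r fun s₃ s₄ =>
        sgn (j * Q.eps s₁) • catHom 𝓡 (f s₁) (catHom 𝓡 (letH (ψ s₂)) (catHom 𝓡 (f s₃)
          (catHom 𝓡 (letH (F (s₄ ++ x :: t₁))) (f t₂)))) := by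
  rw [mult_gop, splitSum_comm]
  refine splitSum_congr fun t₁ t₂ _ => ?_
  rw [← splitSum_assoc s fun s₁ s₂ r => splitSum r fun s₃ s₄ =>
        sgn (j * Q.eps s₁) • catHom 𝓡 (f s₁) (catHom 𝓡 (letH (ψ s₂)) (catHom 𝓡 (f s₃)
          (catHom 𝓡 (letH (F (s₄ ++ x :: t₁))) (f t₂))))]
  have e : (splitSum s fun r s₄ => splitSum r fun s₁ r => splitSum r fun s₂ s₃ =>
        sgn (j * Q.eps s₁) • catHom 𝓡 (f s₁) (catHom 𝓡 (letH (ψ s₂)) (catHom 𝓡 (f s₃)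
          (catHom 𝓡 (letH (F (s₄ ++ x :: t₁))) (f t₂))))) =
      splitSum s fun a r => splitSum a fun s₁ s₂ => splitSum r fun s₃ s₄ =>
        sgn (j * Q.eps s₁) • catHom 𝓡 (f s₁) (catHom 𝓡 (letH (ψ s₂)) (catHom 𝓡 (f s₃)
          (catHom 𝓡 (letH (F (s₄ ++ x :: t₁))) (f t₂)))) := by
    rw [splitSum_assoc s fun s₁ r s₄ => splitSum r fun s₂ s₃ =>
        sgn (j * Q.eps s₁) • catHom 𝓡 (f s₁) (catHom 𝓡 (letH (ψ s₂)) (catHom 𝓡 (f s₃)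
          (catHom 𝓡 (letH (F (s₄ ++ x :: t₁))) (f t₂)))),
      splitSum_assoc s fun s₁ s₂ r => splitSum r fun s₃ s₄ =>
        sgn (j * Q.eps s₁) • catHom 𝓡 (f s₁) (catHom 𝓡 (letH (ψ s₂)) (catHom 𝓡 (f s₃)
          (catHom 𝓡 (letH (F (s₄ ++ x :: t₁))) (f t₂))))]
    refine splitSum_congr fun s₁ r _ => ?_
    rw [splitSum_assoc r fun s₂ s₃ s₄ =>
        sgn (j * Q.eps s₁) • catHom 𝓡 (f s₁) (catHom 𝓡 (letH (ψ s₂)) (catHom 𝓡 (f s₃)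
          (catHom 𝓡 (letH (F (s₄ ++ x :: t₁))) (f t₂))))]
  rw [← e]
  refine splitSum_congr fun a s₄ _ => ?_
  rw [zero_mul, zero_mul, add_zero, sgn_zero, one_smul, der, splitSum_cat]
  refine splitSum_congr fun s₁ r _ => ?_
  rw [splitSum_cat]
  refine splitSum_congr fun s₂ s₃ _ => ?_
  rw [zsmul_cat, cat_assoc, cat_assoc]
  rfl

theorem mult_lpsi_id (ψ : List Q.B → (Q.B →₀ R)) (s : List Q.B) (x : Q.B) (t : List Q.B) :
    superExt 𝓡 0 app (lpsi 𝓡 wd idLet j ψ (s, x :: t)) =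
      splitSum s fun s₁ r => splitSum r fun s₂ s₃ =>
        sgn (j * Q.eps s₁) • catHom 𝓡 (wd s₁) (catHom 𝓡 (letH (ψ s₂)) (wd (s₃ ++ x :: t))) := by
  rw [lpsi_id, kphi, ← catHom_apply, der, splitSum_cat]
  refine splitSum_congr fun s₁ r _ => ?_
  rw [splitSum_cat]
  refine splitSum_congr fun s₂ s₃ _ => ?_
  rw [zsmul_cat, cat_assoc, cat_assoc, wd_cat_wd]

/-- The operator `𝐞[…]` applied to the products of `ψ` with the images of rotations. -/
def wQ (𝓡 : ZMod 2 → Submodule K R) [GradedAlgebra 𝓡] (f : List Q.B → (List Q'.B →₀ R))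
    (F : List Q.B → (Q'.B →₀ R)) (j : ZMod 2) (ψ : List Q.B → (Q'.B →₀ R)) (w : List Q.B) :
    List Q'.B →₀ R :=
  superExt 𝓡 1 eW (superExt 𝓡 0 app (superExt 𝓡 j (lpsi 𝓡 f F j ψ) (cyc 𝓡 w)))

/-- The Connes operator on words. -/
def wB (𝓡 : ZMod 2 → Submodule K R) [GradedAlgebra 𝓡] (w : List Q.B) : List Q.B →₀ R :=
  superExt 𝓡 1 eW (superExt 𝓡 0 app (cyc 𝓡 w))

theorem lpsi_cyc_cons (f : List Q.B → (List Q'.B →₀ R)) (F ψ : List Q.B → (Q'.B →₀ R))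
    (x : Q.B) (l : List Q.B) :
    wQ 𝓡 f F j ψ (x :: l) = splitSum l fun l₁ l₂ => sgn (Q.eps l₂ * (Q.rdeg x + Q.eps l₁)) •
      superExt 𝓡 1 eW (superExt 𝓡 0 app (lpsi 𝓡 f F j ψ (l₂, x :: l₁))) := by
  rw [wQ, cyc_cons, map_splitSum, map_splitSum, map_splitSum]
  refine splitSum_congr fun u v _ => ?_
  rw [map_zsmul, map_zsmul, map_zsmul, superExt_single_one]

end Formulas

section Formulas

variable {K R : Type*} [Field K] [Ring R] [Algebra K R]
variable {𝓡 : ZMod 2 → Submodule K R} [GradedAlgebra 𝓡]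
variable {Ob Ob' : Type*} {C : AInfCat 𝓡 Ob} {D : AInfCat 𝓡 Ob'} {obj : Ob → Ob'} {i j : ZMod 2}
  {v : R →ₗ[K] R}

theorem IsFun.eW_lpsi {F : List C.B → (D.B →₀ R)} {f : List C.B → (List D.B →₀ R)}
    {ψ : List C.B → (D.B →₀ R)} (h : IsFun C D obj F f) (hψ : IsCo C D obj j ψ) {X : Ob}
    {x : C.B} {u v : List C.B} (hp : C.IsPath X (x :: (u ++ v)) X) :
    superExt 𝓡 1 eW (superExt 𝓡 0 app (lpsi 𝓡 f F j ψ (v, x :: u))) =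
      catHom 𝓡 (wd [D.unit (obj (C.src (v.headD x)))])
        (superExt 𝓡 0 app (lpsi 𝓡 f F j ψ (v, x :: u))) := by
  obtain ⟨Z, hZ⟩ := rotate_path hp
  have hm := h.lpsi_path hψ Z Z (v, x :: u) ⟨List.cons_ne_nil _ _, hZ⟩
  rw [src_headD hZ]
  refine eW_ext (Y := obj Z) ?_ ?_
  · exact superExt_mem_supported' 𝓡 0 (S := mpth D.toHomBasis (obj Z) (obj Z))
      (fun p hp => single_mem_supported R _ hp.2) hm
  · refine superExt_mem_supported' 𝓡 0 (S := mpth D.toHomBasis (obj Z) (obj Z))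
      (U := {l : List D.B | l ≠ []}) (fun p hp => single_mem_supported R _ ?_) hm
    exact fun h => hp.1 (List.append_eq_nil_iff.1 h).2

theorem AInfCat.b_eq (C : AInfCat 𝓡 Ob) : C.b = ch 𝓡 1 (cy 𝓡 1 (dpsi 𝓡 1 C.m)) := by
  refine chainOp_eq fun X x l _ => ?_
  rw [cy_dpsi_cons, (isBar_id 𝓡).cy_gop_cons, der, cat_splitSum, ← splitSum_zsmul]
  simp only [splitSum_add]
  rw [add_comm]
  congr 1
  · rw [← splitSum_assoc l fun l₁ l₂ l₃ => sgn (C.eps l₃ * (C.rdeg x + C.eps l₁ + C.eps l₂)) •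
      C.cats 𝓡 [C.toTen (C.m (l₃ ++ x :: l₁)), C.word l₂]]
    refine splitSum_congr fun L l₃ _ => ?_
    rw [← splitSum_zsmul]
    refine splitSum_congr fun l₁ l₂ hL => ?_
    subst hL
    rw [cats_two, zero_mul, sgn_zero, one_smul, C.eps_append, ← add_assoc]
    rfl
  · refine splitSum_congr fun l₁ r _ => ?_
    rw [cat_splitSum, ← splitSum_zsmul]
    refine splitSum_congr fun l₂ l₃ _ => ?_
    rw [cats_three, cat_zsmul, sgn_smul_sgn_smul, ← cat_assoc 𝓡 (wd [x]), wd_cat_wd, one_mul, one_mul]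
    rfl

theorem AInfCat.connesB_eq (C : AInfCat 𝓡 Ob) : C.connesB = ch 𝓡 1 (wB 𝓡) := by
  refine chainOp_eq fun X x l _ => ?_
  rw [wB, mult_cyc, map_splitSum]
  refine splitSum_congr fun u v _ => ?_
  rw [map_zsmul, superExt_single_one, cats_two, AInfCat.unitAt, word_eq, word_eq, wd_cat_wd]
  cases v with
  | nil => rfl
  | cons y v => rfl

theorem AInfFun.push_eq (F : AInfFun C D) : F.push = ch 𝓡 0 (cy 𝓡 0 (gbar 𝓡 F.bar F.F)) := by
  refine chainOp_eq (Q' := D.toHomBasis) fun X x l _ => ?_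
  rw [F.isBar.cy_gop_cons, ← splitSum_assoc l fun l₁ l₂ l₃ =>
    sgn (C.eps l₃ * (C.rdeg x + C.eps l₁ + C.eps l₂)) •
      D.cats 𝓡 [F.one (l₃ ++ x :: l₁), F.bar l₂]]
  refine splitSum_congr fun L l₃ _ => ?_
  rw [← splitSum_zsmul]
  refine splitSum_congr fun l₁ l₂ hL => ?_
  subst hL
  rw [cats_two, zero_mul, sgn_zero, one_smul, C.eps_append, ← add_assoc]
  rfl

theorem AInfCat.B11_eq (C : AInfCat 𝓡 Ob) (hv : v ∈ superDer 𝓡 i) :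
    C.B11 i v = ch 𝓡 i fun w => sgn i • wQ 𝓡 wd idLet (i + 1) (fun l => coeffMap v (C.m l)) w := by
  refine chainOp_eq fun X x l hp => ?_
  rw [lpsi_cyc_cons, ← splitSum_zsmul]
  refine splitSum_congr fun l₁ r hl => ?_
  subst hl
  rw [(isFun_id C).eW_lpsi (C.isCo hv) hp, mult_lpsi_id, cat_splitSum, ← splitSum_zsmul,
    ← splitSum_zsmul]
  refine splitSum_congr fun l₂ r' hr => ?_
  rw [cat_splitSum, ← splitSum_zsmul, ← splitSum_zsmul]
  refine splitSum_congr fun l₃ l₄ hr' => ?_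
  subst hr hr'
  rw [cat_zsmul, sgn_smul_sgn_smul, sgn_smul_sgn_smul, cats_cons, cats_three, AInfCat.unitAt,
    List.append_assoc]
  refine sgn_smul_congr ?_ rfl
  simp only [C.eps_append]
  grind

theorem AInfCat.b11_eq (C : AInfCat 𝓡 Ob) (i : ZMod 2) (v : R →ₗ[K] R) :
    C.b11 i v = ch 𝓡 i fun w => sgn i •
      cy 𝓡 i (gpsi 𝓡 C.m wd idLet (i + 1) fun l => coeffMap v (C.m l)) w := by
  refine chainOp_eq fun X x l hp => ?_
  rw [(isBar_id 𝓡).cy_gop_cons, ← splitSum_zsmul, ← splitSum_assoc l fun l₁ l₂ r =>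
    splitSum r fun l₃ r => splitSum r fun l₄ l₅ =>
      sgn ((C.eps l₃ + C.eps l₄ + C.eps l₅) * (C.rdeg x + C.eps l₁ + C.eps l₂)
          + C.eps l₃ * (i + 1) + i) •
        C.cats 𝓡 [C.toTen (C.mT
          (C.cats 𝓡 [C.word l₃, C.toTen (C.vm v l₄), C.word (l₅ ++ x :: l₁)])), C.word l₂]]
  refine splitSum_congr fun L r _ => ?_
  rw [← splitSum_zsmul, ← splitSum_zsmul]
  refine splitSum_congr fun l₁ l₂ hL => ?_
  rw [cmp, superExt_unmark, mult_lpsi_id, map_splitSum, map_splitSum, splitSum_cat,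
    ← splitSum_zsmul, ← splitSum_zsmul, ← splitSum_zsmul]
  refine splitSum_congr fun l₃ r' hr => ?_
  rw [map_splitSum, map_splitSum, splitSum_cat, ← splitSum_zsmul, ← splitSum_zsmul,
    ← splitSum_zsmul]
  refine splitSum_congr fun l₄ l₅ hr' => ?_
  subst hr' hr hL
  rw [map_zsmul, map_zsmul, zsmul_cat, sgn_smul_sgn_smul, sgn_smul_sgn_smul, sgn_smul_sgn_smul,
    cats_two, cats_three]
  refine sgn_smul_congr ?_ rfl
  simp only [C.eps_append]
  grind

theorem AInfFun.H1_eq (F : AInfFun C D) (i : ZMod 2) (v : R →ₗ[K] R) :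
    F.H1 i v = ch 𝓡 (i + 1)
      (cy 𝓡 (i + 1) (gphi 𝓡 F.bar F.F (i + 1) fun l => coeffMap v (C.m l))) := by
  refine chainOp_eq (Q' := D.toHomBasis) fun X x l hp => ?_
  rw [F.isBar.cy_gop_cons, ← splitSum_assoc l fun l₁ l₂ r =>
    splitSum r fun l₃ r => splitSum r fun l₄ l₅ =>
      sgn ((C.eps l₃ + C.eps l₄ + C.eps l₅) * (C.rdeg x + C.eps l₁ + C.eps l₂)
          + C.eps l₃ * (i + 1)) •
        D.cats 𝓡 [D.toTen (F.FT
          (C.cats 𝓡 [C.word l₃, C.toTen (C.vm v l₄), C.word (l₅ ++ x :: l₁)])), F.bar l₂]]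
  refine splitSum_congr fun L r _ => ?_
  rw [← splitSum_zsmul]
  refine splitSum_congr fun l₁ l₂ hL => ?_
  rw [cmp, superExt_unmark, ← lpsi_id, mult_lpsi_id, map_splitSum, map_splitSum, splitSum_cat,
    ← splitSum_zsmul, ← splitSum_zsmul]
  refine splitSum_congr fun l₃ r' hr => ?_
  rw [map_splitSum, map_splitSum, splitSum_cat, ← splitSum_zsmul, ← splitSum_zsmul]
  refine splitSum_congr fun l₄ l₅ hr' => ?_
  subst hr' hr hL
  rw [map_zsmul, map_zsmul, zsmul_cat, sgn_smul_sgn_smul, sgn_smul_sgn_smul,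
    cats_two, cats_three]
  refine sgn_smul_congr ?_ rfl
  simp only [C.eps_append]
  grind

theorem AInfFun.H3_eq (F : AInfFun C D) (hv : v ∈ superDer 𝓡 i) :
    F.H3 i v = ch 𝓡 (i + 1)
      fun w => sgn i • wQ 𝓡 F.bar F.F i (fun l => coeffMap v (F.F l)) w := by
  refine chainOp_eq (Q' := D.toHomBasis) fun X x l hp => ?_
  rw [lpsi_cyc_cons, ← splitSum_zsmul, ← splitSum_assoc l fun l₁ l₂ r => splitSum r fun l₃ r =>
    splitSum r fun l₄ r => splitSum r fun l₅ l₆ =>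
      sgn ((C.eps l₃ + C.eps l₄ + C.eps l₅ + C.eps l₆) * (C.rdeg x + C.eps l₁ + C.eps l₂)
          + C.eps l₃ * i + i) •
        D.cats 𝓡 [D.word [D.unit (F.obj (C.src ((l₃ ++ l₄ ++ l₅ ++ l₆).headD x)))],
          F.bar l₃, F.vone v l₄, F.bar l₅, F.one (l₆ ++ x :: l₁), F.bar l₂]]
  refine splitSum_congr fun L r hl => ?_
  subst hl
  rw [F.isFun.eW_lpsi (F.isFun.isCo hv) hp, mult_lpsi, cat_splitSum, ← splitSum_zsmul,
    ← splitSum_zsmul]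
  refine splitSum_congr fun l₁ l₂ hL => ?_
  rw [cat_splitSum, ← splitSum_zsmul, ← splitSum_zsmul]
  refine splitSum_congr fun l₃ r₁ h1 => ?_
  rw [cat_splitSum, ← splitSum_zsmul, ← splitSum_zsmul]
  refine splitSum_congr fun l₄ r₂ h2 => ?_
  rw [cat_splitSum, ← splitSum_zsmul, ← splitSum_zsmul]
  refine splitSum_congr fun l₅ l₆ h3 => ?_
  subst h1 h2 h3 hL
  rw [cat_zsmul, sgn_smul_sgn_smul, sgn_smul_sgn_smul]
  simp only [cats_cons, cats_nil, cat_one]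
  refine sgn_smul_congr ?_ ?_
  · simp only [C.eps_append]
    grind
  · simp only [List.append_assoc]
    rfl

theorem AInfFun.H2_eq (F : AInfFun C D) (i : ZMod 2) (v : R →ₗ[K] R) :
    F.H2 i v = ch 𝓡 (i + 1) fun w => sgn i •
      cy 𝓡 (i + 1) (gpsi 𝓡 D.m F.bar F.F i fun l => coeffMap v (F.F l)) w := by
  refine chainOp_eq (Q' := D.toHomBasis) fun X x l hp => ?_
  have e : ∀ M : List C.B → List C.B → List C.B → List C.B → (List D.B →₀ R),
      (splitSum l fun l₁ r => splitSum r fun l₂ r => splitSum r fun l₃ L => M l₁ l₂ l₃ L) =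
      splitSum l fun L' L => splitSum L' fun t l₃ => splitSum t fun l₁ l₂ => M l₁ l₂ l₃ L := by
    intro M
    rw [← splitSum_assoc l fun l₁ l₂ r => splitSum r fun l₃ L => M l₁ l₂ l₃ L,
      splitSum_assoc l fun t l₃ L => splitSum t fun l₁ l₂ => M l₁ l₂ l₃ L]
    refine splitSum_congr fun t r _ => ?_
    rw [splitSum_comm]
  rw [e fun l₁ l₂ l₃ L => splitSum L fun l₄ r => splitSum r fun l₅ r => splitSum r fun l₆ l₇ =>
      sgn ((C.eps l₄ + C.eps l₅ + C.eps l₆ + C.eps l₇) *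
            (C.rdeg x + C.eps l₁ + C.eps l₂ + C.eps l₃) + C.eps l₄ * i + i) •
        D.cats 𝓡 [D.toTen (D.mT (D.cats 𝓡
          [F.bar l₄, F.vone v l₅, F.bar l₆, F.one (l₇ ++ x :: l₁), F.bar l₂])), F.bar l₃],
    F.isBar.cy_gop_cons, ← splitSum_zsmul]
  refine splitSum_congr fun L' L _ => ?_
  rw [← splitSum_zsmul, ← splitSum_zsmul]
  refine splitSum_congr fun t l₃ hL' => ?_
  rw [cmp, superExt_unmark, mult_lpsi, map_splitSum, map_splitSum, splitSum_cat,
    ← splitSum_zsmul, ← splitSum_zsmul, ← splitSum_zsmul]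
  refine splitSum_congr fun l₁ l₂ ht => ?_
  rw [map_splitSum, map_splitSum, splitSum_cat, ← splitSum_zsmul, ← splitSum_zsmul,
    ← splitSum_zsmul]
  refine splitSum_congr fun l₄ r₁ h1 => ?_
  rw [map_splitSum, map_splitSum, splitSum_cat, ← splitSum_zsmul, ← splitSum_zsmul,
    ← splitSum_zsmul]
  refine splitSum_congr fun l₅ r₂ h2 => ?_
  rw [map_splitSum, map_splitSum, splitSum_cat, ← splitSum_zsmul, ← splitSum_zsmul,
    ← splitSum_zsmul]
  refine splitSum_congr fun l₆ l₇ h3 => ?_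
  subst h1 h2 h3 hL' ht
  rw [map_zsmul, map_zsmul, zsmul_cat, sgn_smul_sgn_smul, sgn_smul_sgn_smul, sgn_smul_sgn_smul]
  simp only [cats_cons, cats_nil, cat_one]
  refine sgn_smul_congr ?_ rfl
  simp only [C.eps_append]
  grind

end Formulas

section Units

variable {K R : Type*} [Field K] [Ring R] [Algebra K R]
variable {𝓡 : ZMod 2 → Submodule K R} [GradedAlgebra 𝓡]
variable {Ob Ob' : Type*} {Q : HomBasis Ob} {Q' : HomBasis Ob'} {i j k : ZMod 2}

/-! ### Words that are long or contain a unit -/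

/-- The words of length at least `n`. -/
def big (Q : HomBasis Ob) (n : ℕ) : Set (List Q.B) := {w | n ≤ w.length}

/-- The words of length at least `n` that contain a unit. -/
def unw (Q : HomBasis Ob) (n : ℕ) : Set (List Q.B) := {w | (∃ X, Q.unit X ∈ w) ∧ n ≤ w.length}

theorem cat_big {m n : ℕ} {a b : List Q.B →₀ R} (ha : a ∈ supported R R (big Q m))
    (hb : b ∈ supported R R (big Q n)) :
    catHom 𝓡 a b ∈ supported R R (big Q (m + n)) :=
  cat_mem_supported 𝓡 (S := big Q m) (T := big Q n) (U := big Q (m + n)) (fun x hx y hy => by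
    show _ ≤ (x ++ y).length
    rw [List.length_append]
    exact add_le_add hx hy) ha hb

theorem cat_unw_left {m n : ℕ} {a b : List Q.B →₀ R} (ha : a ∈ supported R R (unw Q m))
    (hb : b ∈ supported R R (big Q n)) :
    catHom 𝓡 a b ∈ supported R R (unw Q (m + n)) :=
  cat_mem_supported 𝓡 (S := unw Q m) (T := big Q n) (U := unw Q (m + n)) (fun x hx y hy => by
    obtain ⟨⟨X, h1⟩, h2⟩ := hx
    refine ⟨⟨X, List.mem_append_left _ h1⟩, ?_⟩
    rw [List.length_append]
    exact add_le_add h2 hy) ha hb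

theorem cat_unw_right {m n : ℕ} {a b : List Q.B →₀ R} (ha : a ∈ supported R R (big Q m))
    (hb : b ∈ supported R R (unw Q n)) :
    catHom 𝓡 a b ∈ supported R R (unw Q (m + n)) :=
  cat_mem_supported 𝓡 (S := big Q m) (T := unw Q n) (U := unw Q (m + n)) (fun x hx y hy => by
    obtain ⟨⟨X, h1⟩, h2⟩ := hy
    refine ⟨⟨X, List.mem_append_right _ h1⟩, ?_⟩
    rw [List.length_append]
    exact add_le_add hx h2) ha hb

theorem big_zero (a : List Q.B →₀ R) : a ∈ supported R R (big Q 0) :=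
  fun _ _ => Nat.zero_le _

theorem big_one {a : List Q.B →₀ R} (h : a ∈ supported R R {l : List Q.B | l ≠ []}) :
    a ∈ supported R R (big Q 1) :=
  fun _ hx => List.length_pos_iff.2 (h hx)

theorem letH_big (y : Q.B →₀ R) : letH y ∈ supported R R (big Q 1) :=
  letH_mem_supported (S := Set.univ) (U := big Q 1) (fun _ _ => le_refl 1) (mem_supported_univ _)

theorem wd_unw {w : List Q.B} {X : Ob} (h : Q.unit X ∈ w) :
    (wd w : List Q.B →₀ R) ∈ supported R R (unw Q w.length) :=
  single_mem_supported R _ ⟨⟨X, h⟩, le_refl _⟩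

theorem unw_mono {m n : ℕ} (h : n ≤ m) {a : List Q.B →₀ R}
    (ha : a ∈ supported R R (unw Q m)) : a ∈ supported R R (unw Q n) :=
  fun _ hx => ⟨(ha hx).1, h.trans (ha hx).2⟩

theorem superExt_eq_zero {X M : Type*} [AddCommGroup M] [Module R M] {S : Set X} {g : X → M}
    (hg : ∀ x ∈ S, g x = 0) {a : X →₀ R} (ha : a ∈ supported R R S) :
    superExt 𝓡 i g a = 0 := by
  rw [superExt_congr_supported 𝓡 i (g := fun _ => 0) hg ha, superExt_zero_fun]

theorem superExt_letH_wd {M : Type*} [AddCommGroup M] [Module R M] (g : List Q.B → M)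
    (y : Q.B →₀ R) (w : List Q.B) :
    superExt 𝓡 i g (catHom 𝓡 (letH y) (wd w)) = superExt 𝓡 i (fun x => g (x :: w)) y := by
  induction y using Finsupp.induction_linear with
  | zero => simp
  | add u v hu hv => simp only [map_add, AddMonoidHom.add_apply, hu, hv]
  | single x r =>
    rw [letH_single, cat_single_single, twist_one, mul_one, superExt_single, superExt_single,
      List.singleton_append]

theorem superExt_one_sgn {X : Type*} [Par X] {γ : ZMod 2} {y : X →₀ R} (hy : y ∈ parSub 𝓡 γ) :
    superExt 𝓡 1 (fun x => sgn (par x + 1) • (wd x : X →₀ R)) y = sgn (γ + 1) • y := by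
  refine parSub_induction 𝓡 (fun y => superExt 𝓡 1 (fun x => sgn (par x + 1) • (wd x : X →₀ R)) y =
    sgn (γ + 1) • y) (by simp) (fun a b ha hb => by rw [map_add, smul_add, ha, hb])
    (fun x r hr => ?_) hy
  rw [superExt_single, twist_of_mem 𝓡 _ _ _ hr, smul_sgn_smul (R := R), sgn_smul_smul (R := R),
    sgn_smul_sgn_smul]
  refine sgn_smul_congr ?_ (by simp)
  grind

end Units

section Units

variable {K R : Type*} [Field K] [Ring R] [Algebra K R]
variable {𝓡 : ZMod 2 → Submodule K R} [GradedAlgebra 𝓡]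
variable {Ob Ob' : Type*} {C : AInfCat 𝓡 Ob} {D : AInfCat 𝓡 Ob'} {obj : Ob → Ob'} {i j k : ZMod 2}
  {v : R →ₗ[K] R} {F : List C.B → (D.B →₀ R)} {f : List C.B → (List D.B →₀ R)}
  {ψ : List C.B → (D.B →₀ R)} {φ : List C.B → (C.B →₀ R)}

theorem AInfCat.m_unw (C : AInfCat 𝓡 Ob) {a : List C.B →₀ R}
    (ha : a ∈ supported R R (unw C.toHomBasis 3)) : superExt 𝓡 i C.m a = 0 :=
  superExt_eq_zero (S := unw C.toHomBasis 3) (fun w hw => by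
    obtain ⟨⟨X, h1⟩, h2⟩ := hw
    exact C.m_unit_mem w X h1 (by omega)) ha

theorem IsFun.F_unw (h : IsFun C D obj F f) {a : List C.B →₀ R}
    (ha : a ∈ supported R R (unw C.toHomBasis 2)) : superExt 𝓡 i F a = 0 :=
  superExt_eq_zero (S := unw C.toHomBasis 2) (fun w hw => by
    obtain ⟨⟨X, h1⟩, h2⟩ := hw
    exact h.unit_mem w X h1 (by omega)) ha

theorem IsFun.F_around_unit (h : IsFun C D obj F f) {u v : List C.B} {X : Ob}
    (huv : u ≠ [] ∨ v ≠ []) : F (u ++ C.unit X :: v) = 0 := by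
  refine h.unit_mem _ X (by simp) ?_
  rw [List.length_append, List.length_cons]
  rcases huv with h | h
  · have := List.length_pos_iff.2 h
    omega
  · have := List.length_pos_iff.2 h
    omega

theorem AInfCat.m_unit_right_ext (C : AInfCat 𝓡 Ob) {γ : ZMod 2} {X Y : Ob} {y : C.B →₀ R}
    (hy : y ∈ parSub 𝓡 γ) (hy' : y ∈ supported R R (arr C.toHomBasis X Y)) :
    superExt 𝓡 1 C.m (catHom 𝓡 (letH y) (wd [C.unit Y])) = sgn (γ + 1) • y := by
  rw [superExt_letH_wd, ← superExt_one_sgn hy]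
  refine superExt_congr_supported 𝓡 1 (fun x hx => ?_) hy'
  obtain ⟨_, rfl⟩ := hx
  rw [C.m_unit_right]
  refine sgn_smul_congr ?_ rfl
  show _ = C.deg x + 1 + 1
  grind

/-! ### Values of the operators on words beginning with a unit -/

theorem IsFun.wF_unit (h : IsFun C D obj F f) (X : Ob) (w : List C.B) :
    cy 𝓡 k (gbar 𝓡 f F) (C.unit X :: w) = catHom 𝓡 (wd [D.unit (obj X)]) (f w) := by
  rw [h.bar.cy_gop_cons, splitSum_eq_right, splitSum_eq_left]
  · simp only [C.eps_nil, zero_mul, sgn_zero, one_smul, unmark, List.nil_append, h.unit, letH_wd]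
  · intro a b _ ha
    rw [unmark, h.F_around_unit (Or.inr ha), map_zero, zero_cat, smul_zero]
  · intro a b _ hb
    rw [splitSum_eq_zero, smul_zero]
    intro u v _
    rw [unmark, h.F_around_unit (Or.inl hb), map_zero, zero_cat, smul_zero]

theorem IsFun.wH1_unit (h : IsFun C D obj F f) (X : Ob) (w : List C.B) :
    cy 𝓡 k (gphi 𝓡 f F j φ) (C.unit X :: w) = 0 := by
  rw [h.bar.cy_gop_cons]
  refine splitSum_eq_zero fun a b _ => ?_
  rw [splitSum_eq_zero, smul_zero]
  intro u v _
  rw [cmp, superExt_unmark, kphi, ← catHom_apply, h.F_unw, map_zero, zero_cat, smul_zero]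
  refine unw_mono ?_ (cat_unw_right (big_one (der_mem_ne 𝓡 φ b)) (wd_unw (X := X) (by simp)))
  rw [List.length_cons]
  omega

theorem IsFun.m_der_unit (h : IsFun C D obj F f) (Y : Ob') (l : List C.B) :
    superExt 𝓡 i D.m (catHom 𝓡 (der 𝓡 f j ψ l) (wd [D.unit Y])) =
      superExt 𝓡 i D.m (catHom 𝓡 (letH (ψ l)) (wd [D.unit Y])) := by
  have hu := wd_unw (R := R) (Q := D.toHomBasis) (w := [D.unit Y]) (X := Y) (by simp)
  rw [der, splitSum_cat, map_splitSum, splitSum_eq_left, splitSum_cat, map_splitSum,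
    splitSum_eq_right]
  · rw [h.bar.bar_nil, C.eps_nil, mul_zero, sgn_zero, one_smul, one_cat, cat_one]
  · intro a b _ hb
    rw [zsmul_cat, map_zsmul, D.m_unw, smul_zero]
    exact cat_unw_right (m := 2) (cat_big (m := 0) (big_zero _) (cat_big (m := 1) (letH_big _)
      (big_one (h.bar.mem_ne hb)))) hu
  · intro a r _ ha
    rw [splitSum_cat, map_splitSum]
    refine splitSum_eq_zero fun b c _ => ?_
    rw [zsmul_cat, map_zsmul, D.m_unw, smul_zero]
    exact cat_unw_right (m := 2) (cat_big (m := 1) (big_one (h.bar.mem_ne ha))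
      (cat_big (m := 1) (n := 0) (letH_big _) (big_zero _))) hu

theorem IsFun.gpsi_unit (h : IsFun C D obj F f) (hψ : IsCo C D obj j ψ) {X Z : Ob}
    {u v : List C.B} (hu : C.IsPath Z u X) :
    cmp 𝓡 1 (unmark D.m) (lpsi 𝓡 f F j ψ) (u, C.unit X :: v) =
      if v = [] then sgn (j + C.eps u + 1) • ψ u else 0 := by
  have e : superExt 𝓡 0 app (lpsi 𝓡 f F j ψ (u, C.unit X :: v)) =
      catHom 𝓡 (der 𝓡 f j ψ u) (catHom 𝓡 (wd [D.unit (obj X)]) (f v)) := by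
    rw [mult_gop, splitSum_eq_right, splitSum_eq_left]
    · simp only [zero_mul, add_zero, sgn_zero, one_smul, unmark, List.nil_append, h.unit, letH_wd]
    · intro a b _ ha
      rw [unmark, h.F_around_unit (Or.inr ha), map_zero, zero_cat, map_zero, smul_zero]
    · intro a b _ hb
      refine splitSum_eq_zero fun a' b' _ => ?_
      rw [unmark, h.F_around_unit (Or.inl hb), map_zero, zero_cat, map_zero, smul_zero]
  rw [cmp, superExt_unmark, e]
  split_ifs with hv
  · subst hv
    rw [h.bar.bar_nil, cat_one, h.m_der_unit, D.m_unit_right_ext (hψ.hom u) (hψ.arrMap _ _ _ hu)]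
    rfl
  · refine D.m_unw (cat_unw_right (m := 1) (big_one (der_mem_ne 𝓡 ψ u)) (cat_unw_left (m := 1)
      (n := 1) (wd_unw (X := obj X) (by simp)) (big_one (h.bar.mem_ne hv))))

theorem IsFun.wP_unit (h : IsFun C D obj F f) (hψ : IsCo C D obj j ψ) {X : Ob} {w : List C.B}
    (hw : C.IsPath X w X) :
    cy 𝓡 k (gpsi 𝓡 D.m f F j ψ) (C.unit X :: w) = -(sgn j • rpsi 𝓡 f ψ w) := by
  rw [h.bar.cy_gop_cons, rpsi, ← splitSum_zsmul, ← splitSum_neg]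
  refine splitSum_congr fun a b hab => ?_
  subst hab
  obtain ⟨Z, h1, h2⟩ := isPath_append.1 hw
  rw [splitSum_eq_left]
  · rw [h.gpsi_unit hψ h2, if_pos rfl, map_zsmul, zsmul_cat]
    simp only [sgn_smul_sgn_smul]
    rw [← sgn_add_one_smul]
    refine sgn_smul_congr ?_ rfl
    rw [rdeg_unit]
    grind
  · intro a' b' _ ha
    rw [h.gpsi_unit hψ h2, if_neg ha, map_zero, zero_cat, smul_zero]

theorem AInfCat.m_around_unit (C : AInfCat 𝓡 Ob) {u v : List C.B} {X : Ob}
    (huv : u.length + v.length ≠ 1) : C.m (u ++ C.unit X :: v) = 0 := by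
  refine C.m_unit_mem _ X (by simp) ?_
  rw [List.length_append, List.length_cons]
  omega

theorem AInfCat.m_unit_left' (C : AInfCat 𝓡 Ob) {x : C.B} {X : Ob} (h : C.src x = X) :
    C.m [C.unit X, x] = wd x := by
  subst h
  exact C.m_unit_left x

theorem AInfCat.m_unit_right' (C : AInfCat 𝓡 Ob) {x : C.B} {X : Ob} (h : C.tgt x = X) :
    C.m [x, C.unit X] = sgn (C.rdeg x + 1) • wd x := by
  subst h
  rw [C.m_unit_right]
  refine sgn_smul_congr ?_ rfl
  show _ = C.deg x + 1 + 1
  grind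

theorem AInfCat.wb_unit (C : AInfCat 𝓡 Ob) {X : Ob} {w : List C.B} (hne : w ≠ [])
    (hw : C.IsPath X w X) :
    cy 𝓡 1 (dpsi 𝓡 1 C.m) (C.unit X :: w) =
      wd w - tau w - superExt 𝓡 1 eW (der 𝓡 wd 1 C.m w) := by
  have e1 : superExt 𝓡 1 eW (der 𝓡 wd 1 C.m w) = catHom 𝓡 (wd [C.unit X]) (der 𝓡 wd 1 C.m w) :=
    eW_ext (pathMap_wd.der C.arrMap X w X hw) (der_mem_ne 𝓡 _ _)
  rw [cy_dpsi_cons, e1, rdeg_unit, one_mul, sgn_one, neg_one_smul, ← sub_eq_add_neg]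
  congr 1
  rw [eq_sub_iff_add_eq, (isBar_id 𝓡).cy_gop_cons, tau, ← splitSum_add]
  have hz : ∀ a b : List C.B, b.length ≠ 1 → b ≠ [] → (splitSum a fun t₁ t₂ =>
      sgn (0 * (C.eps b + C.rdeg (C.unit X) + C.eps t₁)) •
        catHom 𝓡 (letH (unmark C.m (b, C.unit X :: t₁))) (wd t₂)) = 0 := by
    intro a b h1 h2
    refine splitSum_eq_zero fun u v _ => ?_
    have := List.length_pos_iff.2 h2
    rw [unmark, C.m_around_unit (by show b.length + u.length ≠ 1; omega), map_zero, zero_cat,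
      smul_zero]
  rw [splitSum_eq_right]
  · rw [if_neg (by simp), add_zero]
    cases w with
    | nil => exact absurd rfl hne
    | cons x l =>
      rw [splitSum_cons, splitSum_eq_left]
      · have h1 : C.m [C.unit X] = 0 := C.m_unit_mem _ X (by simp) (by simp)
        simp only [C.eps_nil, zero_mul, sgn_zero, one_smul, unmark, List.nil_append, h1, map_zero,
          AddMonoidHom.zero_apply, zero_add, C.m_unit_left' hw.1, letH_wd, wd_cat_wd, List.singleton_append]
      · intro a b _ ha
        have := List.length_pos_iff.2 ha
        rw [unmark, C.m_around_unit (by simp; omega), map_zero, zero_cat, smul_zero]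
  · intro a b hab hb
    split_ifs with hb1
    · obtain ⟨y, rfl⟩ := List.length_eq_one_iff.1 hb1
      subst hab
      obtain ⟨Z, h1, h2⟩ := isPath_append.1 hw
      rw [splitSum_eq_left]
      · rw [unmark, List.singleton_append, C.m_unit_right' h2.2, map_zsmul, zsmul_cat, letH_wd,
          wd_cat_wd]
        simp only [sgn_smul_sgn_smul]
        rw [rdeg_unit, C.eps_cons, C.eps_nil, add_zero, zero_mul, zero_add,
          show C.rdeg y * (1 + C.eps a) + (C.rdeg y + 1) = C.eps a * C.rdeg y + 1 by grind,
          sgn_add_one_smul, neg_add_cancel]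
      · intro u v _ hu
        have := List.length_pos_iff.2 hu
        rw [unmark, C.m_around_unit (by simp; omega), map_zero, zero_cat, smul_zero]
    · rw [hz a b hb1 hb, smul_zero, add_zero]

end Units

section Words

variable {K R : Type*} [Field K] [Ring R] [Algebra K R]
variable {𝓡 : ZMod 2 → Submodule K R} [GradedAlgebra 𝓡]
variable {Ob Ob' : Type*} {Q : HomBasis Ob} {Q' : HomBasis Ob'} {i j k : ZMod 2}

theorem cy_ext (G : List Q.B × List Q.B → (List Q'.B × List Q'.B →₀ R)) (t : List Q.B →₀ R) :
    superExt 𝓡 k (cy 𝓡 k G) t =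
      superExt 𝓡 0 prj (superExt 𝓡 k G (superExt 𝓡 0 (cyc 𝓡) t)) := by
  rw [superExt_comp, superExt_comp, add_zero, zero_add]
  congr 2
  funext w
  rw [cy, superExt_comp, zero_add]

theorem wQ_ext (f : List Q.B → (List Q'.B →₀ R)) (F ψ : List Q.B → (Q'.B →₀ R)) (hk : k = 1 + j)
    (t : List Q.B →₀ R) : superExt 𝓡 k (wQ 𝓡 f F j ψ) t = superExt 𝓡 1 eW
      (superExt 𝓡 0 app (superExt 𝓡 j (lpsi 𝓡 f F j ψ) (superExt 𝓡 0 (cyc 𝓡) t))) := by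
  subst hk
  rw [superExt_comp _ j 0 _ _ (superExt 𝓡 0 (cyc 𝓡) t), zero_add, superExt_comp, superExt_comp,
    add_zero]
  congr 2
  funext w
  rw [wQ, superExt_comp _ j 0, superExt_comp, zero_add]

theorem wB_ext (t : List Q.B →₀ R) : superExt 𝓡 1 (wB 𝓡) t =
    superExt 𝓡 1 eW (superExt 𝓡 0 app (superExt 𝓡 0 (cyc 𝓡) t)) := by
  rw [superExt_comp, superExt_comp]
  simp only [add_zero]
  congr 2
  funext w
  rw [wB, superExt_comp, add_zero]

theorem homF_lpsi {f : List Q.B → (List Q'.B →₀ R)} {F ψ : List Q.B → (Q'.B →₀ R)}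
    (h : IsBar 𝓡 F f) (hψ : HomF 𝓡 j ψ) : HomF 𝓡 j (lpsi 𝓡 f F j ψ) := by
  have := homF_gop 𝓡 (homF_der h.homF hψ) (homF_unmark 𝓡 h.hom) h.homF
  rwa [add_zero, add_zero] at this

theorem homF_gpsi_mid {m' : List Q'.B → (Q'.B →₀ R)} {f : List Q.B → (List Q'.B →₀ R)}
    {F ψ : List Q.B → (Q'.B →₀ R)} (hm' : HomF 𝓡 1 m') (h : IsBar 𝓡 F f) (hψ : HomF 𝓡 j ψ) :
    HomF 𝓡 (1 + j) (cmp 𝓡 1 (unmark m') (lpsi 𝓡 f F j ψ)) :=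
  (homF_lpsi h hψ).comp 𝓡 (homF_unmark 𝓡 hm')

theorem cyc_gpsi {m' : List Q'.B → (Q'.B →₀ R)} {f : List Q.B → (List Q'.B →₀ R)}
    {F ψ : List Q.B → (Q'.B →₀ R)} (hR : IsSuperComm 𝓡) (hm' : HomF 𝓡 1 m') (h : IsBar 𝓡 F f)
    (hψ : HomF 𝓡 j ψ) (hk : k = 1 + j) (w : List Q.B) :
    superExt 𝓡 0 (cyc 𝓡) (cy 𝓡 k (gpsi 𝓡 m' f F j ψ) w) =
      superExt 𝓡 k (gpsi 𝓡 m' f F j ψ) (cyc 𝓡 w) := by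
  subst hk
  exact h.cyc_cy_gop hR (homF_gpsi_mid hm' h hψ) w

theorem homF_kphi {φ : List Q.B → (Q.B →₀ R)} (hφ : HomF 𝓡 j φ) : HomF 𝓡 j (kphi 𝓡 j φ) :=
  fun p => by
  have := tm_mem_parSub 𝓡 (homF_der (homF_wd 𝓡) hφ p.1) (wd_mem 𝓡 p.2)
  rwa [add_assoc] at this

theorem cyc_gphi {f : List Q.B → (List Q'.B →₀ R)} {F : List Q.B → (Q'.B →₀ R)}
    {φ : List Q.B → (Q.B →₀ R)} (hR : IsSuperComm 𝓡) (h : IsBar 𝓡 F f) (hφ : HomF 𝓡 j φ)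
    (w : List Q.B) :
    superExt 𝓡 0 (cyc 𝓡) (cy 𝓡 j (gphi 𝓡 f F j φ) w) =
      superExt 𝓡 j (gphi 𝓡 f F j φ) (cyc 𝓡 w) := by
  have := (homF_kphi hφ).comp 𝓡 (homF_unmark 𝓡 h.hom)
  rw [zero_add] at this
  exact h.cyc_cy_gop hR this w

theorem IsBar.cyc_gbar {f : List Q.B → (List Q'.B →₀ R)} {F : List Q.B → (Q'.B →₀ R)}
    (hR : IsSuperComm 𝓡) (h : IsBar 𝓡 F f) (w : List Q.B) :
    superExt 𝓡 0 (cyc 𝓡) (cy 𝓡 0 (gbar 𝓡 f F) w) = superExt 𝓡 0 (gbar 𝓡 f F) (cyc 𝓡 w) :=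
  h.cyc_cy_gop hR (homF_unmark 𝓡 h.hom) w

theorem cy_sub (G G' : List Q.B × List Q.B → (List Q'.B × List Q'.B →₀ R)) (w : List Q.B) :
    cy 𝓡 k (fun p => G p - G' p) w = cy 𝓡 k G w - cy 𝓡 k G' w := by
  rw [cy, superExt_sub_fun, map_sub]
  rfl

theorem cy_zsmul (n : ℤ) (G : List Q.B × List Q.B → (List Q'.B × List Q'.B →₀ R))
    (w : List Q.B) : cy 𝓡 k (fun p => n • G p) w = n • cy 𝓡 k G w := by
  rw [cy, superExt_zsmul_fun, map_zsmul]
  rfl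

theorem IsDiff.dpsi_sq_ext {m : List Q.B → (Q.B →₀ R)} (hR : IsSuperComm 𝓡) (hm : IsDiff 𝓡 m)
    (t : List Q.B × List Q.B →₀ R) :
    superExt 𝓡 1 (dpsi 𝓡 1 m) (superExt 𝓡 1 (dpsi 𝓡 1 m) t) = 0 := by
  rw [superExt_comp]
  simp only [hm.dpsi_sq hR]
  exact superExt_zero_fun 𝓡 _ t

theorem IsDiff.homotopy_ext {m : List Q.B → (Q.B →₀ R)} {v : R →ₗ[K] R} (hR : IsSuperComm 𝓡)
    (hm : IsDiff 𝓡 m) (hv : v ∈ superDer 𝓡 i) {t : List Q.B × List Q.B →₀ R}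
    (ht : t ∈ supported R R (marked (Q := Q))) :
    superExt 𝓡 i (gpsi 𝓡 m wd idLet (i + 1) fun l => coeffMap v (m l)) t =
      superExt 𝓡 1 (dpsi 𝓡 1 m)
        (superExt 𝓡 (i + 1) (kphi 𝓡 (i + 1) fun l => coeffMap v (m l)) t) +
      sgn i • superExt 𝓡 (i + 1) (kphi 𝓡 (i + 1) fun l => coeffMap v (m l))
        (superExt 𝓡 1 (dpsi 𝓡 1 m) t) := by
  have h1 : (1 + (i + 1) : ZMod 2) = i := by grind
  have h2 : (i + 1 + 1 : ZMod 2) = i := by grind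
  rw [superExt_comp, superExt_comp, h1, h2, ← superExt_zsmul_fun, ← superExt_add_fun]
  refine superExt_congr_supported 𝓡 i (fun p hp => ?_) ht
  obtain ⟨s, _ | ⟨x, t⟩⟩ := p
  · exact absurd rfl hp
  · exact hm.homotopy hR hv s x t

theorem cmpth_marked {t : List Q.B × List Q.B →₀ R} (ht : t ∈ supported R R (cmpth Q)) :
    t ∈ supported R R (marked (Q := Q)) :=
  Finsupp.supported_mono (s := cmpth Q) (t := marked (Q := Q)) (fun _ h => h.choose_spec.1) ht

/-- The telescoping identity computes the derivative of the map induced on cyclic words. -/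
theorem IsBar.coeffMap_wF {f : List Q.B → (List Q'.B →₀ R)} {F : List Q.B → (Q'.B →₀ R)}
    {v : R →ₗ[K] R} (h : IsBar 𝓡 F f) (hv : v ∈ superDer 𝓡 i) (w : List Q.B) :
    coeffMap v (cy 𝓡 0 (gbar 𝓡 f F) w) =
      cy 𝓡 i (gop 𝓡 i 0 f (unmark fun l => coeffMap v (F l)) f) w +
        cy 𝓡 i (gop 𝓡 0 i f (unmark F) (der 𝓡 f i fun l => coeffMap v (F l))) w := by
  cases w with
  | nil => simp [cy_nil]
  | cons x l =>
    rw [h.cy_gop_cons, h.cy_gop_cons, h.cy_gop_cons, map_splitSum, ← splitSum_add]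
    refine splitSum_congr fun a b _ => ?_
    rw [map_zsmul, map_splitSum, ← smul_add, ← splitSum_add]
    congr 1
    refine splitSum_congr fun u w _ => ?_
    rw [map_zsmul, coeffMap_cat hv (letH_mem_parSub 𝓡 (homF_unmark 𝓡 h.hom (b, x :: u))),
      coeffMap_letH, h.coeffMap_bar hv, zero_mul, sgn_zero, one_smul, one_smul, par_prod, par_list,
      par_list, Q.eps_cons, zero_add, ← add_assoc]
    rfl

end Words

section Words

variable {K R : Type*} [Field K] [Ring R] [Algebra K R]
variable {𝓡 : ZMod 2 → Submodule K R} [GradedAlgebra 𝓡]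
variable {Ob Ob' : Type*} {Q : HomBasis Ob} {Q' : HomBasis Ob'} {i j k : ZMod 2}

/-- Composites of extensions agree if they agree on the basis. -/
theorem superExt_comp_congr {X Y : Type*} {M : Type*} [AddCommGroup M] [Module R M] {S : Set X}
    (hk : j + i = k) {f : X → (Y →₀ R)} {g : Y → M} {h : X → M}
    (H : ∀ x ∈ S, superExt 𝓡 j g (f x) = h x) {t : X →₀ R} (ht : t ∈ supported R R S) :
    superExt 𝓡 j g (superExt 𝓡 i f t) = superExt 𝓡 k h t := by
  rw [superExt_comp, hk]
  exact superExt_congr_supported 𝓡 k H ht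

theorem dpsi_mem_marked_ext (ψ : List Q.B → (Q.B →₀ R)) (t : List Q.B × List Q.B →₀ R) :
    superExt 𝓡 i (dpsi 𝓡 j ψ) t ∈ supported R R (marked (Q := Q)) :=
  superExt_mem_supported' 𝓡 i (S := Set.univ) (U := marked (Q := Q))
    (fun l _ => dpsi_mem_marked ψ l) (mem_supported_univ _)

theorem lpsi_id_ext (φ : List Q.B → (Q.B →₀ R)) {t : List Q.B × List Q.B →₀ R}
    (ht : t ∈ supported R R (marked (Q := Q))) :
    superExt 𝓡 i (lpsi 𝓡 wd idLet j φ) t = superExt 𝓡 i (kphi 𝓡 j φ) t := by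
  refine superExt_congr_supported 𝓡 i (fun p hp => ?_) ht
  obtain ⟨s, _ | ⟨x, t⟩⟩ := p
  · exact absurd rfl hp
  · exact lpsi_id φ s x t

/-- `b b^{1,1} = ± b^{1,1} b` on words. -/
theorem IsDiff.wb_wP {m : List Q.B → (Q.B →₀ R)} {v : R →ₗ[K] R} (hR : IsSuperComm 𝓡)
    (hm : IsDiff 𝓡 m) (hv : v ∈ superDer 𝓡 i) (w : List Q.B) :
    superExt 𝓡 1 (cy 𝓡 1 (dpsi 𝓡 1 m))
        (cy 𝓡 i (gpsi 𝓡 m wd idLet (i + 1) fun l => coeffMap v (m l)) w) =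
      sgn i • superExt 𝓡 i (cy 𝓡 i (gpsi 𝓡 m wd idLet (i + 1) fun l => coeffMap v (m l)))
        (cy 𝓡 1 (dpsi 𝓡 1 m) w) := by
  have hφ : HomF 𝓡 (i + 1) fun l => coeffMap v (m l) := homF_coeffMap hv hm.hom
  rw [cy_ext, cy_ext, cyc_gpsi hR hm.hom (isBar_id 𝓡) hφ (by grind), cyc_cy_dpsi hR hm.hom,
    hm.homotopy_ext hR hv (cyc_mem_marked w),
    hm.homotopy_ext hR hv (dpsi_mem_marked_ext m _), map_add, hm.dpsi_sq_ext hR,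
    hm.dpsi_sq_ext hR, zero_add, map_zsmul, map_zero, smul_zero, add_zero, map_zsmul]

/-- The derivative of the Hochschild differential on words. -/
theorem coeffMap_wb {m : List Q.B → (Q.B →₀ R)} {v : R →ₗ[K] R} (hm : HomF 𝓡 1 m)
    (hv : v ∈ superDer 𝓡 i) (w : List Q.B) : coeffMap v (cy 𝓡 1 (dpsi 𝓡 1 m) w) =
      cy 𝓡 (i + 1) (gop 𝓡 (i + 1) 0 wd (unmark fun l => coeffMap v (m l)) wd) w +
        cy 𝓡 (i + 1) (gop 𝓡 0 (i + 1) wd (unmark idLet)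
          (der 𝓡 wd (i + 1) fun l => coeffMap v (m l))) w := by
  cases w with
  | nil => simp [cy_nil]
  | cons x l =>
    have e : cy 𝓡 (i + 1) (gop 𝓡 0 (i + 1) wd (unmark idLet)
        (der 𝓡 wd (i + 1) fun l => coeffMap v (m l))) (x :: l) = sgn ((i + 1) * Q.rdeg x) •
          catHom 𝓡 (wd [x]) (der 𝓡 wd (i + 1) (fun l => coeffMap v (m l)) l) := by
      rw [cy_cons, splitSum_eq_right]
      · rw [gop_idLet, map_zsmul, prj_tm_nil]
        simp [Q.eps_nil, sgn_zero]
      · intro a b _ hb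
        rw [gop_idLet, map_zsmul, prj_tm_of_ne, smul_zero, smul_zero]
        exact single_mem_supported R _ hb
    rw [e, cy_dpsi_cons, map_add, map_zsmul, coeffMap_cat hv (wd_mem 𝓡 [x]), coeffMap_wd hv,
      zero_cat, zero_add, coeffMap_der_wd hv, (isBar_id 𝓡).cy_gop_cons, (isBar_id 𝓡).cy_gop_cons,
      map_splitSum, smul_smul, ← sgn_add]
    congr 1
    · refine splitSum_congr fun a b _ => ?_
      rw [map_zsmul, map_splitSum]
      congr 1
      refine splitSum_congr fun u w _ => ?_
      rw [map_zsmul, coeffMap_cat hv (letH_mem_parSub 𝓡 (homF_unmark 𝓡 hm (b, x :: u))),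
        coeffMap_letH, coeffMap_wd hv, map_zero, smul_zero, add_zero]
      rfl
    · refine sgn_smul_congr ?_ rfl
      rw [Q.eps_cons, Q.eps_nil]
      ring

theorem coeffMap_wB {v : R →ₗ[K] R} (hv : v ∈ superDer 𝓡 i) (w : List Q.B) :
    coeffMap v (wB 𝓡 w) = 0 := by
  cases w with
  | nil => simp [wB, cyc_nil]
  | cons x l =>
    rw [wB, mult_cyc, map_splitSum, map_splitSum]
    refine splitSum_eq_zero fun a b _ => ?_
    rw [map_zsmul, superExt_single_one, map_zsmul]
    cases b with
    | nil => rw [List.nil_append, eW, coeffMap_wd hv, smul_zero]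
    | cons y b => rw [List.cons_append, eW, coeffMap_wd hv, smul_zero]

end Words

section Units

variable {K R : Type*} [Field K] [Ring R] [Algebra K R]
variable {𝓡 : ZMod 2 → Submodule K R} [GradedAlgebra 𝓡]
variable {Ob Ob' : Type*} {C : AInfCat 𝓡 Ob} {D : AInfCat 𝓡 Ob'} {obj : Ob → Ob'}
  {i j k : ZMod 2} {F : List C.B → (D.B →₀ R)} {f : List C.B → (List D.B →₀ R)}
  {ψ : List C.B → (D.B →₀ R)}

theorem AInfCat.wb_eW (C : AInfCat 𝓡 Ob) {t : List C.B →₀ R}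
    (ht : t ∈ supported R R (cpth C.toHomBasis)) :
    superExt 𝓡 1 (cy 𝓡 1 (dpsi 𝓡 1 C.m)) (superExt 𝓡 1 eW t) =
      t - superExt 𝓡 0 tau t - superExt 𝓡 1 eW (superExt 𝓡 1 (der 𝓡 wd 1 C.m) t) := by
  conv_rhs => enter [1, 1]; rw [← superExt_wd 𝓡 t]
  rw [superExt_comp 𝓡 1 1 (der 𝓡 wd 1 C.m) eW, show (1 + 1 : ZMod 2) = 0 from rfl,
    ← superExt_sub_fun, ← superExt_sub_fun]
  refine superExt_comp_congr rfl (fun w hw => ?_) ht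
  obtain ⟨hne, X, hX⟩ := hw
  cases w with
  | nil => exact absurd rfl hne
  | cons x l =>
    rw [eW, superExt_single_one, hX.1]
    exact C.wb_unit hne hX

theorem IsFun.wP_eW (h : IsFun C D obj F f) (hψ : IsCo C D obj j ψ) (hk : k = 1 + j)
    {t : List C.B →₀ R} (ht : t ∈ supported R R (cpth C.toHomBasis)) :
    superExt 𝓡 k (cy 𝓡 k (gpsi 𝓡 D.m f F j ψ)) (superExt 𝓡 1 eW t) =
      -(sgn j • superExt 𝓡 j (rpsi 𝓡 f ψ) t) := by
  rw [← neg_smul, ← superExt_zsmul_fun]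
  refine superExt_comp_congr (by grind) (fun w hw => ?_) ht
  obtain ⟨hne, X, hX⟩ := hw
  cases w with
  | nil => exact absurd rfl hne
  | cons x l =>
    rw [eW, superExt_single_one, hX.1]
    rw [h.wP_unit hψ hX, neg_smul]

theorem IsFun.wF_eW (h : IsFun C D obj F f) {t : List C.B →₀ R}
    (ht : t ∈ supported R R (cpth C.toHomBasis)) :
    superExt 𝓡 0 (cy 𝓡 0 (gbar 𝓡 f F)) (superExt 𝓡 1 eW t) =
      superExt 𝓡 1 eW (superExt 𝓡 0 f t) := by
  rw [superExt_comp 𝓡 0 1 f eW]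
  refine superExt_comp_congr rfl (fun w hw => ?_) ht
  obtain ⟨hne, X, hX⟩ := hw
  cases w with
  | nil => exact absurd rfl hne
  | cons x l =>
    rw [eW, superExt_single_one, hX.1, h.wF_unit, eW_ext (h.pathMap _ _ _ hX) (h.bar.mem_ne hne)]

theorem IsFun.wH1_eW (h : IsFun C D obj F f) {φ : List C.B → (C.B →₀ R)} {t : List C.B →₀ R}
    (ht : t ∈ supported R R (cpth C.toHomBasis)) :
    superExt 𝓡 i (cy 𝓡 k (gphi 𝓡 f F j φ)) (superExt 𝓡 1 eW t) = 0 := by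
  rw [superExt_comp]
  refine superExt_eq_zero (S := cpth C.toHomBasis) (fun w hw => ?_) ht
  obtain ⟨hne, X, hX⟩ := hw
  cases w with
  | nil => exact absurd rfl hne
  | cons x l =>
    rw [eW, superExt_single_one]
    exact h.wH1_unit _ _

end Units

section Identities

variable {K R : Type*} [Field K] [Ring R] [Algebra K R]
variable {𝓡 : ZMod 2 → Submodule K R} [GradedAlgebra 𝓡]
variable {Ob Ob' : Type*} {C : AInfCat 𝓡 Ob} {D : AInfCat 𝓡 Ob'} {obj : Ob → Ob'}
  {i j k : ZMod 2} {F : List C.B → (D.B →₀ R)} {f : List C.B → (List D.B →₀ R)}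
  {v : R →ₗ[K] R}

/-- The Hochschild differential on words. -/
abbrev AInfCat.wb (C : AInfCat 𝓡 Ob) : List C.B → (List C.B →₀ R) := cy 𝓡 1 (dpsi 𝓡 1 C.m)

/-- The operator `b^{1,1}(v(𝔪); -)` on words, up to sign. -/
abbrev AInfCat.wP (C : AInfCat 𝓡 Ob) (i : ZMod 2) (v : R →ₗ[K] R) : List C.B → (List C.B →₀ R) :=
  cy 𝓡 i (gpsi 𝓡 C.m wd idLet (i + 1) fun l => coeffMap v (C.m l))

/-- The operator `B^{1,1}(v(𝔪); -)` on words, up to sign. -/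
abbrev AInfCat.wQ (C : AInfCat 𝓡 Ob) (i : ZMod 2) (v : R →ₗ[K] R) : List C.B → (List C.B →₀ R) :=
  RelCyc.wQ 𝓡 wd idLet (i + 1) fun l => coeffMap v (C.m l)

theorem AInfCat.wb_wP (hR : IsSuperComm 𝓡) (C : AInfCat 𝓡 Ob) (hv : v ∈ superDer 𝓡 i)
    (w : List C.B) :
    superExt 𝓡 1 C.wb (C.wP i v w) = sgn i • superExt 𝓡 i (C.wP i v) (C.wb w) :=
  C.isDiff.wb_wP hR hv w

theorem AInfCat.homF_vm (C : AInfCat 𝓡 Ob) (hv : v ∈ superDer 𝓡 i) :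
    HomF 𝓡 (i + 1) fun l => coeffMap v (C.m l) :=
  homF_coeffMap hv C.isDiff.hom

theorem AInfCat.cyc_wP (hR : IsSuperComm 𝓡) (C : AInfCat 𝓡 Ob) (hv : v ∈ superDer 𝓡 i)
    (w : List C.B) : superExt 𝓡 0 (cyc 𝓡) (C.wP i v w) =
      superExt 𝓡 i (gpsi 𝓡 C.m wd idLet (i + 1) fun l => coeffMap v (C.m l)) (cyc 𝓡 w) :=
  cyc_gpsi hR C.isDiff.hom (isBar_id 𝓡) (C.homF_vm hv) (by grind) w

/-- `[v, b] = ± b^{1,1} B ± B^{1,1} b ± b B^{1,1} ± B b^{1,1}` on words. -/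
theorem AInfCat.coeffMap_wb (hR : IsSuperComm 𝓡) (C : AInfCat 𝓡 Ob) (hv : v ∈ superDer 𝓡 i)
    {w : List C.B} (hw : w ∈ cpth C.toHomBasis) :
    coeffMap v (C.wb w) = sgn i • superExt 𝓡 i (C.wP i v) (wB 𝓡 w) +
      sgn i • superExt 𝓡 (i + 1 + 1) (C.wQ i v) (C.wb w) - superExt 𝓡 1 C.wb (C.wQ i v w) -
      superExt 𝓡 1 (wB 𝓡) (C.wP i v w) := by
  have hN := cyc_cmpth (𝓡 := 𝓡) hw
  have hM := cmpth_marked hN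
  have hco := C.isCo hv
  have hK := MPathMap.kphi (𝓡 := 𝓡) (j := i + 1) hco.arrMap
  have hKN : superExt 𝓡 (i + 1) (kphi 𝓡 (i + 1) fun l => coeffMap v (C.m l)) (cyc 𝓡 w) ∈
      supported R R (cmpth C.toHomBasis) := hK.cmpth hN
  have tel := (isBar_id 𝓡).telescope hR hco.hom w
  rw [RelCyc.coeffMap_wb C.isDiff.hom hv, ← tel, wB_ext, C.cyc_wP hR hv,
    C.isDiff.homotopy_ext hR hv hM, RelCyc.wQ_ext _ _ _ (by grind), cyc_cy_dpsi hR C.isDiff.hom,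
    lpsi_id_ext _ (dpsi_mem_marked_ext _ _), AInfCat.wQ, RelCyc.wQ, lpsi_id_ext _ hM,
    AInfCat.wb, C.wb_eW (app_cmpth hKN), ← mult_dpsi_ext (𝓡 := 𝓡) (j := 1) C.m (cmpth_marked hKN), wB,
    (isFun_id C).wP_eW hco (by grind) (app_cmpth hN)]
  simp only [map_add, map_zsmul, sgn_add_one_smul, neg_neg, sgn_smul_self]
  abel

variable (h : IsFun C D obj F f)

/-- The map `F_*` on words. -/
abbrev wF (𝓡 : ZMod 2 → Submodule K R) [GradedAlgebra 𝓡] {Q : HomBasis Ob} {Q' : HomBasis Ob'}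
    (F : List Q.B → (Q'.B →₀ R)) (f : List Q.B → (List Q'.B →₀ R)) :
    List Q.B → (List Q'.B →₀ R) := cy 𝓡 0 (gbar 𝓡 f F)

/-- The operator `H² - H¹` on words. -/
def wT (C : AInfCat 𝓡 Ob) (D : AInfCat 𝓡 Ob') (F : List C.B → (D.B →₀ R))
    (f : List C.B → (List D.B →₀ R)) (i : ZMod 2) (v : R →ₗ[K] R) (w : List C.B) :
    List D.B →₀ R :=
  sgn i • cy 𝓡 (i + 1) (gpsi 𝓡 D.m f F i fun l => coeffMap v (F l)) w -
    cy 𝓡 (i + 1) (gphi 𝓡 f F (i + 1) fun l => coeffMap v (C.m l)) w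

/-- The combination of operators on marked words that defines `wT`. -/
def jop (C : AInfCat 𝓡 Ob) (D : AInfCat 𝓡 Ob') (F : List C.B → (D.B →₀ R))
    (f : List C.B → (List D.B →₀ R)) (i : ZMod 2) (v : R →ₗ[K] R)
    (p : List C.B × List C.B) : List D.B × List D.B →₀ R :=
  sgn i • gpsi 𝓡 D.m f F i (fun l => coeffMap v (F l)) p -
    gphi 𝓡 f F (i + 1) (fun l => coeffMap v (C.m l)) p

theorem wT_eq : wT C D F f i v = cy 𝓡 (i + 1) (jop C D F f i v) := by
  funext w
  rw [wT, ← cy_zsmul, ← cy_sub]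
  rfl

include h

theorem IsFun.homF_vF (hv : v ∈ superDer 𝓡 i) : HomF 𝓡 i fun l => coeffMap v (F l) := by
  have := homF_coeffMap hv h.bar.hom
  rwa [add_zero] at this

theorem IsFun.cyc_wT (hR : IsSuperComm 𝓡) (hv : v ∈ superDer 𝓡 i) (w : List C.B) :
    superExt 𝓡 0 (cyc 𝓡) (wT C D F f i v w) = superExt 𝓡 (i + 1) (jop C D F f i v) (cyc 𝓡 w) := by
  have e : jop C D F f i v = fun p => sgn i • gpsi 𝓡 D.m f F i (fun l => coeffMap v (F l)) p -
    gphi 𝓡 f F (i + 1) (fun l => coeffMap v (C.m l)) p := rfl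
  rw [e, superExt_sub_fun, superExt_zsmul_fun, ← cyc_gphi hR h.bar (C.homF_vm hv),
    ← cyc_gpsi hR D.isDiff.hom h.bar (h.homF_vF hv) (by grind), wT, map_sub, map_zsmul]

theorem IsFun.jop_ext (hR : IsSuperComm 𝓡) (hv : v ∈ superDer 𝓡 i)
    {t : List C.B × List C.B →₀ R} (ht : t ∈ supported R R (cmpth C.toHomBasis)) :
    superExt 𝓡 (i + 1) (jop C D F f i v) t =
      sgn i • superExt 𝓡 1 (dpsi 𝓡 1 D.m)
        (superExt 𝓡 i (lpsi 𝓡 f F i fun l => coeffMap v (F l)) t) -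
      superExt 𝓡 i (lpsi 𝓡 f F i fun l => coeffMap v (F l)) (superExt 𝓡 1 (dpsi 𝓡 1 C.m) t) +
      superExt 𝓡 (i + 1) (kphi 𝓡 (i + 1) fun l => coeffMap v (D.m l))
        (superExt 𝓡 0 (gbar 𝓡 f F) t) -
      superExt 𝓡 0 (gbar 𝓡 f F)
        (superExt 𝓡 (i + 1) (kphi 𝓡 (i + 1) fun l => coeffMap v (C.m l)) t) := by
  have h1 : (1 + i : ZMod 2) = i + 1 := add_comm _ _
  rw [superExt_comp, superExt_comp, superExt_comp, superExt_comp, h1, add_zero, zero_add,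
    ← superExt_zsmul_fun, ← superExt_sub_fun, ← superExt_add_fun, ← superExt_sub_fun]
  refine superExt_congr_supported 𝓡 (i + 1) (fun p hp => ?_) ht
  obtain ⟨X, hp⟩ := hp
  obtain ⟨s, _ | ⟨x, t⟩⟩ := p
  · exact absurd rfl hp.1
  · exact h.mor.homotopy hR C.isDiff D.isDiff hv ⟨X, X, hp.2⟩

theorem IsFun.dpsi_gbar_ext (hR : IsSuperComm 𝓡)
    {t : List C.B × List C.B →₀ R} (ht : t ∈ supported R R (cmpth C.toHomBasis)) :
    superExt 𝓡 1 (dpsi 𝓡 1 D.m) (superExt 𝓡 0 (gbar 𝓡 f F) t) =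
      superExt 𝓡 0 (gbar 𝓡 f F) (superExt 𝓡 1 (dpsi 𝓡 1 C.m) t) := by
  rw [superExt_comp, superExt_comp, add_zero, zero_add]
  refine superExt_congr_supported 𝓡 1 (fun p hp => ?_) ht
  obtain ⟨X, hp⟩ := hp
  obtain ⟨s, _ | ⟨x, t⟩⟩ := p
  · exact absurd rfl hp.1
  · exact h.mor.dpsi_gbar hR C.isDiff D.isDiff ⟨X, X, hp.2⟩

theorem IsFun.wT_wb (hR : IsSuperComm 𝓡) (hv : v ∈ superDer 𝓡 i)
    {w : List C.B} (hw : w ∈ cpth C.toHomBasis) :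
    sgn i • superExt 𝓡 i (D.wP i v) (wF 𝓡 F f w) - sgn i • superExt 𝓡 0 (wF 𝓡 F f) (C.wP i v w) =
      superExt 𝓡 (i + 1) (wT C D F f i v) (C.wb w) +
        sgn i • superExt 𝓡 1 D.wb (wT C D F f i v w) := by
  have hN := cyc_cmpth (𝓡 := 𝓡) hw
  have hM := cmpth_marked hN
  have hd : MPathMap id (dpsi 𝓡 1 C.m) := MPathMap.dpsi C.arrMap
  have hK : MPathMap id (kphi 𝓡 (i + 1) fun l => coeffMap v (C.m l)) :=
    MPathMap.kphi (C.isCo hv).arrMap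
  have hGN : superExt 𝓡 0 (gbar 𝓡 f F) (cyc 𝓡 w) ∈ supported R R (cmpth D.toHomBasis) :=
    h.gbar_path.cmpth hN
  rw [wT_eq, cy_ext, cy_ext, cy_ext, cy_ext, ← wT_eq, h.cyc_wT hR hv, h.bar.cyc_gbar hR,
    C.cyc_wP hR hv, cyc_cy_dpsi hR C.isDiff.hom, h.jop_ext hR hv (hd.cmpth hN),
    h.jop_ext hR hv hN, C.isDiff.homotopy_ext hR hv hM,
    D.isDiff.homotopy_ext hR hv (cmpth_marked hGN), h.dpsi_gbar_ext hR hN]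
  simp only [map_add, map_sub, map_zsmul, smul_add, smul_sub, sgn_smul_self,
    C.isDiff.dpsi_sq_ext hR, D.isDiff.dpsi_sq_ext hR, map_zero, smul_zero,
    h.dpsi_gbar_ext hR (hK.cmpth hN)]
  abel

theorem IsFun.coeffMap_wF (hR : IsSuperComm 𝓡) (hv : v ∈ superDer 𝓡 i)
    {w : List C.B} (hw : w ∈ cpth C.toHomBasis) :
    -coeffMap v (wF 𝓡 F f w) - sgn i • superExt 𝓡 0 (wF 𝓡 F f) (C.wQ i v w) +
        sgn i • superExt 𝓡 (i + 1 + 1) (D.wQ i v) (wF 𝓡 F f w) =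
      superExt 𝓡 (i + 1) (wT C D F f i v) (wB 𝓡 w) +
        sgn i • superExt 𝓡 (i + 1) (wQ 𝓡 f F i fun l => coeffMap v (F l)) (C.wb w) +
        superExt 𝓡 1 D.wb (wQ 𝓡 f F i (fun l => coeffMap v (F l)) w) +
        sgn i • superExt 𝓡 1 (wB 𝓡) (wT C D F f i v w) := by
  have hN := cyc_cmpth (𝓡 := 𝓡) hw
  have hM := cmpth_marked hN
  have hco := h.isCo hv
  have hK : MPathMap id (kphi 𝓡 (i + 1) fun l => coeffMap v (C.m l)) :=
    MPathMap.kphi (C.isCo hv).arrMap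
  have hGN : superExt 𝓡 0 (gbar 𝓡 f F) (cyc 𝓡 w) ∈ supported R R (cmpth D.toHomBasis) :=
    h.gbar_path.cmpth hN
  have hLN : superExt 𝓡 i (lpsi 𝓡 f F i fun l => coeffMap v (F l)) (cyc 𝓡 w) ∈
      supported R R (cmpth D.toHomBasis) := (h.lpsi_path hco).cmpth hN
  have hKN : superExt 𝓡 (i + 1) (kphi 𝓡 (i + 1) fun l => coeffMap v (C.m l)) (cyc 𝓡 w) ∈
      supported R R (cmpth C.toHomBasis) := hK.cmpth hN
  have hT : superExt 𝓡 (i + 1) (wT C D F f i v) (wB 𝓡 w) =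
      -superExt 𝓡 i (rpsi 𝓡 f fun l => coeffMap v (F l)) (superExt 𝓡 0 app (cyc 𝓡 w)) := by
    have e : wT C D F f i v = fun w =>
      sgn i • cy 𝓡 (i + 1) (gpsi 𝓡 D.m f F i fun l => coeffMap v (F l)) w -
        cy 𝓡 (i + 1) (gphi 𝓡 f F (i + 1) fun l => coeffMap v (C.m l)) w := rfl
    rw [e, superExt_sub_fun, superExt_zsmul_fun, wB, h.wP_eW hco (by grind) (app_cmpth hN),
      h.wH1_eW (app_cmpth hN), smul_neg, sgn_smul_self, sub_zero]
  rw [hT, h.bar.coeffMap_wF hv, ← h.bar.telescope hR hco.hom, wB_ext, h.cyc_wT hR hv,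
    h.jop_ext hR hv hN, RelCyc.wQ_ext _ _ _ (by grind), RelCyc.wQ_ext _ _ _ (by grind),
    cyc_cy_dpsi hR C.isDiff.hom, h.bar.cyc_gbar hR, lpsi_id_ext _ (cmpth_marked hGN),
    AInfCat.wQ, RelCyc.wQ, lpsi_id_ext _ hM, h.wF_eW (app_cmpth hKN),
    ← h.bar.mult_gbar_ext (cmpth_marked hKN), RelCyc.wQ, D.wb_eW (app_cmpth hLN),
    ← mult_dpsi_ext (𝓡 := 𝓡) (j := 1) D.m (cmpth_marked hLN)]
  simp only [map_add, map_sub, map_zsmul, smul_add, smul_sub, sgn_smul_self]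
  abel

end Identities

section Tails

variable {K R : Type*} [Field K] [Ring R] [Algebra K R]
variable {𝓡 : ZMod 2 → Submodule K R} [GradedAlgebra 𝓡]
variable {Ob Ob' : Type*} {Q : HomBasis Ob} {Q' : HomBasis Ob'} {i j k : ZMod 2}

/-- The words with a unit behind the first letter. -/
def tun (Q : HomBasis Ob) : Set (List Q.B) := {w | ∃ X, Q.unit X ∈ w.tail}

theorem tun_cons {w : List Q.B} (h : w ∈ tun Q) : ∃ x l X, w = x :: l ∧ Q.unit X ∈ l := by
  obtain ⟨X, hX⟩ := h
  cases w with
  | nil => exact absurd hX List.not_mem_nil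
  | cons x l => exact ⟨x, l, X, rfl, hX⟩

theorem cat_tun {a b : List Q.B →₀ R} (ha : a ∈ supported R R (big Q 1))
    (hb : b ∈ supported R R (unw Q 1)) :
    catHom 𝓡 a b ∈ supported R R (tun Q) :=
  cat_mem_supported 𝓡 (S := big Q 1) (T := unw Q 1) (U := tun Q) (fun x hx y hy => by
    obtain ⟨⟨X, h1⟩, -⟩ := hy
    cases x with
    | nil => exact absurd hx (by simp [big])
    | cons z x => exact ⟨X, by simp [h1]⟩) ha hb

theorem wd_unw_one {w : List Q.B} {X : Ob} (h : Q.unit X ∈ w) :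
    (wd w : List Q.B →₀ R) ∈ supported R R (unw Q 1) :=
  single_mem_supported R _ ⟨⟨X, h⟩, List.length_pos_of_mem h⟩

theorem wd_big_one {w : List Q.B} (h : w ≠ []) :
    (wd w : List Q.B →₀ R) ∈ supported R R (big Q 1) :=
  single_mem_supported R _ (List.length_pos_iff.2 h)

theorem eW_tun {t : List Q.B →₀ R} (ht : t ∈ supported R R (unw Q 1)) :
    superExt 𝓡 i eW t ∈ supported R R (tun Q) := by
  refine superExt_mem_supported' 𝓡 i (S := unw Q 1) (U := tun Q) (fun w hw => ?_) ht
  obtain ⟨⟨X, h1⟩, -⟩ := hw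
  cases w with
  | nil => exact absurd h1 List.not_mem_nil
  | cons x l => exact single_mem_supported R _ ⟨X, h1⟩

/-- The marked words with a unit away from the mark. -/
def munw (Q : HomBasis Ob) : Set (List Q.B × List Q.B) :=
  {p | ∃ s x t X, p = (s, x :: t) ∧ (Q.unit X ∈ s ∨ Q.unit X ∈ t)}

theorem cyc_munw {w : List Q.B} (hw : w ∈ tun Q) :
    cyc 𝓡 w ∈ supported R R (munw Q) := by
  obtain ⟨x, l, X, rfl, h⟩ := tun_cons hw
  rw [cyc_cons]
  refine splitSum_mem' fun u v huv => zsmul_mem' (single_mem_supported R _ ?_) _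
  subst huv
  exact ⟨v, x, u, X, rfl, (List.mem_append.1 h).symm⟩

theorem wB_tun {w : List Q.B} (hw : w ∈ tun Q) : wB 𝓡 w ∈ supported R R (tun Q) := by
  refine eW_tun ?_
  refine superExt_mem_supported' 𝓡 0 (S := munw Q) (U := unw Q 1) ?_ (cyc_munw hw)
  rintro _ ⟨s, x, t, X, rfl, h⟩
  refine wd_unw_one (X := X) ?_
  rcases h with h | h <;> simp [h]

end Tails

section Tails

variable {K R : Type*} [Field K] [Ring R] [Algebra K R]
variable {𝓡 : ZMod 2 → Submodule K R} [GradedAlgebra 𝓡]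
variable {Ob Ob' : Type*} {C : AInfCat 𝓡 Ob} {D : AInfCat 𝓡 Ob'} {obj : Ob → Ob'}
  {i j k : ZMod 2} {F : List C.B → (D.B →₀ R)} {f : List C.B → (List D.B →₀ R)}
  {ψ : List C.B → (D.B →₀ R)}

theorem IsFun.f_unw (h : IsFun C D obj F f) {l : List C.B} {X : Ob} (hl : C.unit X ∈ l) :
    f l ∈ supported R R (unw D.toHomBasis 1) := by
  induction hn : l.length using Nat.strong_induction_on generalizing l with
  | _ n ih =>
    have hne : l ≠ [] := List.ne_nil_of_mem hl
    rw [h.bar.rec_left l hne]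
    refine splitSum_mem' fun u v huv => ?_
    subst huv
    by_cases hv : C.unit X ∈ v
    · by_cases hu : u = []
      · rw [hu, h.bar.nil, map_zero, zero_cat]
        exact zero_mem _
      · refine unw_mono (by omega) (cat_unw_right (letH_big _) (ih _ ?_ hv rfl))
        have := List.length_pos_iff.2 hu
        rw [← hn, List.length_append]
        omega
    · have hu : C.unit X ∈ u := (List.mem_append.1 hl).resolve_right hv
      by_cases h1 : u.length = 1
      · obtain ⟨y, rfl⟩ := List.length_eq_one_iff.1 h1
        rw [List.mem_singleton] at hu
        rw [← hu, h.unit, letH_wd]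
        exact unw_mono (by omega) (cat_unw_left (wd_unw_one (X := obj X) (by simp)) (big_zero _))
      · rw [h.unit_mem _ X hu h1, map_zero, zero_cat]
        exact zero_mem _

theorem IsFun.der_unw (h : IsFun C D obj F f) (hψ : IsCo C D obj j ψ) {l : List C.B} {X : Ob}
    (hl : C.unit X ∈ l) : der 𝓡 f i ψ l ∈ supported R R (unw D.toHomBasis 2) := by
  refine splitSum_mem' fun u r hr => splitSum_mem' fun v w hw => zsmul_mem' ?_ _
  subst hw hr
  rcases List.mem_append.1 hl with hu | hr
  · exact unw_mono (by omega) (cat_unw_left (h.f_unw hu) (cat_big (letH_big _) (big_zero _)))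
  rcases List.mem_append.1 hr with hv | hw
  · rw [hψ.unit _ _ hv, map_zero, zero_cat, map_zero]
    exact zero_mem _
  · exact unw_mono (by omega) (cat_unw_right (big_zero _) (cat_unw_right (letH_big _) (h.f_unw hw)))

theorem IsFun.lpsi_unw (h : IsFun C D obj F f) (hψ : IsCo C D obj j ψ) {s t : List C.B} {x : C.B}
    {X : Ob} (hX : C.unit X ∈ s ∨ C.unit X ∈ t) :
    superExt 𝓡 0 app (lpsi 𝓡 f F j ψ (s, x :: t)) ∈
      supported R R (unw D.toHomBasis 3) := by
  rw [lpsi, mult_gop]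
  refine splitSum_mem' fun s₁ s₂ hs => splitSum_mem' fun t₁ t₂ ht => zsmul_mem' ?_ _
  subst hs ht
  rw [List.mem_append, List.mem_append] at hX
  have hb : der 𝓡 f j ψ s₁ ∈ supported R R (big D.toHomBasis 1) :=
    big_one (der_mem_ne 𝓡 _ _)
  by_cases h1 : C.unit X ∈ s₁
  · exact unw_mono (by omega) (cat_unw_left (h.der_unw hψ h1) (cat_big (letH_big _) (big_zero _)))
  by_cases h2 : C.unit X ∈ t₂
  · exact unw_mono (by omega) (cat_unw_right hb (cat_unw_right (letH_big _) (h.f_unw h2)))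
  · have h3 : C.unit X ∈ s₂ ∨ C.unit X ∈ t₁ := by tauto
    rw [unmark, h.unit_mem (s₂ ++ x :: t₁) X, map_zero, zero_cat, map_zero]
    · exact zero_mem _
    · rcases h3 with h | h <;> simp [h]
    · rcases h3 with h | h <;> have := List.length_pos_of_mem h <;>
        rw [List.length_append, List.length_cons] <;> omega

theorem IsFun.wQ_tun (h : IsFun C D obj F f) (hψ : IsCo C D obj j ψ) {w : List C.B}
    (hw : w ∈ tun C.toHomBasis) :
    RelCyc.wQ 𝓡 f F j ψ w ∈ supported R R (tun D.toHomBasis) := by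
  refine eW_tun ?_
  rw [superExt_comp]
  refine superExt_mem_supported' 𝓡 _ (S := munw C.toHomBasis) (U := unw D.toHomBasis 1) ?_
    (cyc_munw hw)
  rintro _ ⟨s, x, t, X, rfl, hX⟩
  exact unw_mono (by omega) (h.lpsi_unw hψ hX)

theorem IsFun.cy_gop_tun (h : IsFun C D obj F f) {μ : List C.B × List C.B → (D.B →₀ R)}
    (hμ : ∀ s x t X, C.unit X ∈ s ∨ C.unit X ∈ t → μ (s, x :: t) = 0) {w : List C.B}
    (hw : w ∈ tun C.toHomBasis) :
    cy 𝓡 k (gop 𝓡 i 0 f μ f) w ∈ supported R R (tun D.toHomBasis) := by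
  obtain ⟨x, l, X, rfl, hX⟩ := tun_cons hw
  rw [h.bar.cy_gop_cons]
  refine splitSum_mem' fun u v hu => zsmul_mem' (splitSum_mem' fun t₁ t₂ ht => zsmul_mem' ?_ _) _
  subst hu ht
  by_cases h1 : C.unit X ∈ t₂
  · exact cat_tun (letH_big _) (h.f_unw h1)
  · rw [hμ v x t₁ X (by simp only [List.mem_append] at hX; tauto), map_zero, zero_cat]
    exact zero_mem _

theorem IsFun.wF_tun (h : IsFun C D obj F f) {w : List C.B} (hw : w ∈ tun C.toHomBasis) :
    wF 𝓡 F f w ∈ supported R R (tun D.toHomBasis) := by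
  refine h.cy_gop_tun (fun s x t X hX => ?_) hw
  refine h.unit_mem (s ++ x :: t) X ?_ ?_
  · rcases hX with h | h <;> simp [h]
  · rcases hX with h | h <;> have := List.length_pos_of_mem h <;>
      rw [List.length_append, List.length_cons] <;> omega

theorem IsFun.gpsi_tun (h : IsFun C D obj F f) (hψ : IsCo C D obj j ψ) {w : List C.B}
    (hw : w ∈ tun C.toHomBasis) :
    cy 𝓡 k (gpsi 𝓡 D.m f F j ψ) w ∈ supported R R (tun D.toHomBasis) := by
  refine h.cy_gop_tun (fun s x t X hX => ?_) hw
  rw [cmp, superExt_unmark]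
  exact D.m_unw (h.lpsi_unw hψ hX)

theorem IsFun.gphi_tun (h : IsFun C D obj F f) {φ : List C.B → (C.B →₀ R)}
    (hφ : IsCo C C id j φ) {w : List C.B} (hw : w ∈ tun C.toHomBasis) :
    cy 𝓡 k (gphi 𝓡 f F j φ) w ∈ supported R R (tun D.toHomBasis) := by
  refine h.cy_gop_tun (fun s x t X hX => ?_) hw
  rw [cmp, superExt_unmark, kphi, ← catHom_apply]
  refine h.F_unw ?_
  rcases hX with hX | hX
  · exact unw_mono (by omega) (cat_unw_left ((isFun_id C).der_unw hφ hX) (big_zero _))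
  · refine unw_mono (by omega) (cat_unw_right (n := 2) (big_zero _) ?_)
    exact single_mem_supported R _ ⟨⟨X, by simp [hX]⟩, by
      have := List.length_pos_of_mem hX
      rw [List.length_cons]
      omega⟩

theorem AInfCat.m_mid_unit (C : AInfCat 𝓡 Ob) {X Y Z : Ob} {s t : List C.B}
    (hp : C.IsPath Y (s ++ C.unit X :: t) Z) :
    superExt 𝓡 0 (app (R := R) (Q := C.toHomBasis))
        (gop 𝓡 1 0 wd (unmark C.m) wd (s, C.unit X :: t)) =
      (if t = [] then 0 else sgn (C.eps s) • (wd (s ++ t) : List C.B →₀ R)) -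
        (if s = [] then 0 else sgn (C.eps s) • (wd (s ++ t) : List C.B →₀ R)) := by
  rw [mult_gop]
  simp only [one_mul, zero_mul, add_zero, unmark]
  have hz : ∀ u v : List C.B, u.length + v.length ≠ 1 → C.m (u ++ C.unit X :: v) = 0 :=
    fun u v h => C.m_around_unit h
  obtain ⟨W, h1, h2⟩ := isPath_append.1 hp
  have e1 : (splitSum t fun t₁ t₂ => sgn (C.eps s) • catHom 𝓡 (wd s)
      (catHom 𝓡 (letH (C.m ([] ++ C.unit X :: t₁))) (wd t₂))) =
      if t = [] then 0 else sgn (C.eps s) • wd (s ++ t) := by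
    cases t with
    | nil => rw [splitSum_nil, hz _ _ (by simp), map_zero, zero_cat, map_zero, smul_zero, if_pos rfl]
    | cons y t =>
      rw [splitSum_cons, hz _ _ (by simp), map_zero, zero_cat, map_zero, smul_zero, zero_add,
        splitSum_eq_left, if_neg (List.cons_ne_nil _ _), List.nil_append,
        C.m_unit_left' (h2.2.1.trans (C.tgt_unit X)), letH_wd, wd_cat_wd, wd_cat_wd]
      · rfl
      · intro u v _ hu
        have := List.length_pos_iff.2 hu
        rw [hz _ _ (by simp; omega), map_zero, zero_cat, map_zero, smul_zero]
  rcases List.eq_nil_or_concat s with rfl | ⟨a, z, rfl⟩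
  · rw [splitSum_nil, e1, if_pos rfl, sub_zero]
  · rw [List.concat_eq_append] at *
    rw [splitSum_concat, e1, splitSum_eq_right, splitSum_eq_left, if_neg (show ¬a ++ [z] = [] by simp),
      sub_eq_add_neg,
      add_comm]
    · congr 1
      obtain ⟨V, -, h3⟩ := isPath_append.1 h1
      rw [List.nil_append, List.singleton_append,
        C.m_unit_right' (h3.2.trans (h2.1.symm.trans (C.src_unit X))), map_zsmul, letH_wd, zsmul_cat,
        cat_zsmul, wd_cat_wd, wd_cat_wd, smul_smul, ← sgn_add, ← sgn_add_one_smul]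
      refine sgn_smul_congr ?_ (by simp)
      rw [C.eps_append, C.eps_cons, C.eps_nil]
      ring
    · intro u v _ hu
      have := List.length_pos_iff.2 hu
      rw [hz _ _ (by simp; omega), map_zero, zero_cat, map_zero, smul_zero]
    · intro u v _ hv
      have := List.length_pos_iff.2 hv
      refine splitSum_eq_zero fun p q _ => ?_
      rw [hz _ _ (by simp; omega), map_zero, zero_cat, map_zero, smul_zero]

theorem AInfCat.wb_tun (C : AInfCat 𝓡 Ob) {w : List C.B} (hw : w ∈ tun C.toHomBasis)
    (hc : w ∈ cpth C.toHomBasis) :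
    C.wb w ∈ supported R R (tun C.toHomBasis) := by
  obtain ⟨x, l, X, rfl, hX⟩ := tun_cons hw
  obtain ⟨-, Y, hY⟩ := hc
  obtain ⟨a, c, rfl⟩ := List.append_of_mem hX
  set S := supported R R (tun C.toHomBasis) with hS
  have hx : (wd [x] : List C.B →₀ R) ∈ supported R R (big C.toHomBasis 1) :=
    wd_big_one (by simp)
  obtain ⟨hx0, hY'⟩ : C.src x = Y ∧ C.IsPath (C.tgt x) (a ++ C.unit X :: c) Y := hY
  obtain ⟨Z, ha, hc⟩ := isPath_append.1 hY'
  have hm : ∀ u : List C.B, u.length ≠ 2 → C.unit X ∈ u → C.m u = 0 :=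
    fun u h1 h2 => C.m_unit_mem u X h2 h1
  -- the wrapping terms
  have p1 : (splitSum a fun u v => sgn (C.eps (v ++ C.unit X :: c) * (C.rdeg x + C.eps u)) •
      splitSum u fun t₁ t₂ => sgn (0 * (C.eps (v ++ C.unit X :: c) + C.rdeg x + C.eps t₁)) •
        catHom 𝓡 (letH (unmark C.m (v ++ C.unit X :: c, x :: t₁))) (wd t₂)) =
      if c = [] then sgn (C.rdeg x + C.eps a) • wd (x :: a) else 0 := by
    rw [splitSum_eq_right, splitSum_eq_left]
    · split_ifs with h
      · subst h
        rw [unmark, List.nil_append, List.singleton_append,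
          C.m_unit_left' (hx0.trans (hc.2.symm.trans (C.tgt_unit X))), letH_wd, wd_cat_wd, zero_mul,
          sgn_zero, one_smul, eps_unit, one_mul, List.singleton_append]
      · have := List.length_pos_iff.2 h
        rw [unmark, hm _ (by simp; omega) (by simp), map_zero, zero_cat, smul_zero, smul_zero]
    · intro u v _ hu
      have := List.length_pos_iff.2 hu
      rw [unmark, hm _ (by simp; omega) (by simp), map_zero, zero_cat, smul_zero]
    · intro u v _ hv
      have := List.length_pos_iff.2 hv
      rw [splitSum_eq_zero, smul_zero]
      intro p q _
      rw [unmark, hm _ (by simp; omega) (by simp), map_zero, zero_cat, smul_zero]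
  have p2 : (splitSum c fun u v => sgn (C.eps v * (C.rdeg x + C.eps (a ++ C.unit X :: u))) •
      splitSum u fun p q => sgn (0 * (C.eps v + C.rdeg x + C.eps (a ++ C.unit X :: p))) •
        catHom 𝓡 (letH (unmark C.m (v, x :: (a ++ C.unit X :: p)))) (wd q)) =
      if a = [] then sgn (C.rdeg x + 1) • wd (x :: c) else 0 := by
    rw [splitSum_eq_right, splitSum_eq_left]
    · split_ifs with h
      · subst h
        rw [unmark]
        simp only [List.nil_append]
        rw [C.m_unit_right' (ha.trans (hc.1.symm.trans (C.src_unit X))), map_zsmul, zsmul_cat, letH_wd,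
          wd_cat_wd, C.eps_nil, zero_mul, zero_mul, sgn_zero, one_smul, one_smul,
          List.singleton_append]
      · have := List.length_pos_iff.2 h
        rw [unmark, hm _ (by simp; omega) (by simp), map_zero, zero_cat, smul_zero, smul_zero]
    · intro u v _ hu
      have := List.length_pos_iff.2 hu
      rw [unmark, hm _ (by simp; omega) (by simp), map_zero, zero_cat, smul_zero]
    · intro u v _ hv
      have := List.length_pos_iff.2 hv
      rw [splitSum_eq_zero, smul_zero]
      intro p q _
      rw [unmark, hm _ (by simp; omega) (by simp), map_zero, zero_cat, smul_zero]
  rw [AInfCat.wb, cy_dpsi_cons, (isBar_id 𝓡).cy_gop_cons, splitSum_append, p1]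
  simp only [splitSum_append, smul_add, splitSum_add]
  rw [p2, (isBar_id 𝓡).der_append]
  simp only [map_add]
  rw [C.m_mid_unit hY', gop_idLet, gop_idLet]
  simp only [map_zsmul]
  rw [← catHom_apply, ← catHom_apply]
  have s1 : (splitSum c fun u v => sgn (C.eps v * (C.rdeg x + C.eps (a ++ C.unit X :: u))) •
      splitSum a fun p q => sgn (0 * (C.eps v + C.rdeg x + C.eps p)) •
        catHom 𝓡 (letH (unmark C.m (v, x :: p))) (wd (q ++ C.unit X :: u))) ∈ S :=
    splitSum_mem' fun u v _ => zsmul_mem' (splitSum_mem' fun p q _ => zsmul_mem'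
      (cat_tun (letH_big _) (wd_unw_one (X := X) (by simp))) _) _
  have hu : (wd [C.unit X] : List C.B →₀ R) ∈ supported R R (unw C.toHomBasis 1) :=
    wd_unw_one (X := X) (by simp)
  have s2 : catHom 𝓡 (wd [x]) (catHom 𝓡 (der 𝓡 wd 1 C.m a) (catHom 𝓡 (wd [C.unit X]) (wd c))) ∈ S :=
    cat_tun hx (unw_mono (by omega) (cat_unw_right (big_zero _) (cat_unw_left hu (big_zero _))))
  have s3 : catHom 𝓡 (wd [x]) (catHom 𝓡 (wd a) (catHom 𝓡 (wd [C.unit X]) (der 𝓡 wd 1 C.m c))) ∈ S :=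
    cat_tun hx (unw_mono (by omega) (cat_unw_right (big_zero _) (cat_unw_left hu (big_zero _))))
  have s4 : ((if c = [] then sgn (C.rdeg x + C.eps a) • wd (x :: a) else 0) +
      (if a = [] then sgn (C.rdeg x + 1) • wd (x :: c) else 0) + sgn (1 * C.rdeg x) •
        catHom 𝓡 (wd [x]) ((if c = [] then 0 else sgn (C.eps a) • wd (a ++ c)) -
          (if a = [] then 0 else sgn (C.eps a) • wd (a ++ c))) : List C.B →₀ R) = 0 := by
    have e : ∀ u : List C.B, catHom 𝓡 (wd [x]) (wd u : List C.B →₀ R) = wd (x :: u) :=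
      fun u => wd_cat_wd 𝓡 _ _
    by_cases h1 : c = [] <;> by_cases h2 : a = []
    · subst h1 h2
      simp only [↓reduceIte, sub_self, map_zero, smul_zero, add_zero, C.eps_nil, sgn_add_one_smul,
        add_neg_cancel]
    · subst h1
      simp only [↓reduceIte, if_neg h2, zero_sub, map_neg, cat_zsmul, e, smul_neg, smul_smul,
        ← sgn_add, List.append_nil, add_zero, one_mul, add_neg_cancel]
    · subst h2
      simp only [↓reduceIte, if_neg h1, sub_zero, e, C.eps_nil, sgn_zero,
        sgn_add_one_smul, List.nil_append, one_smul, zero_add, one_mul, neg_add_cancel]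
    · simp only [if_neg h1, if_neg h2, sub_self, map_zero, smul_zero, add_zero]
  simp only [smul_add] at s4 ⊢
  have := add_mem s1 (add_mem (zsmul_mem' (zsmul_mem' s2 (sgn (0 * C.eps a + 0 * (C.eps a + C.rdeg (C.unit X))))) (sgn (1 * C.rdeg x)))
    (zsmul_mem' (zsmul_mem' s3 (sgn (0 * C.eps a + 1 * (C.eps a + C.rdeg (C.unit X))))) (sgn (1 * C.rdeg x))))
  rw [← add_zero (_ + (_ + _)), ← s4] at this
  convert this using 1
  abel

end Tails

section Chains

variable {K R : Type*} [Field K] [Ring R] [Algebra K R]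
variable {𝓡 : ZMod 2 → Submodule K R} [GradedAlgebra 𝓡]
variable {Ob Ob' Ob'' : Type*} {Q : HomBasis Ob} {Q' : HomBasis Ob'} {Q'' : HomBasis Ob''}
  {i j k : ZMod 2}

theorem homF_prj : HomF 𝓡 0 (prj (R := R) (Q := Q)) := fun p => by
  rw [prj]
  split_ifs with h
  · have := wd_mem (R := R) (Q := Q) 𝓡 p.2
    rwa [show par p = Q.eps p.2 by rw [par_prod, h, par_list, par_list, Q.eps_nil, zero_add],
      zero_add]
  · exact zero_mem _

theorem homF_cy {G : List Q.B × List Q.B → (List Q'.B × List Q'.B →₀ R)} (hG : HomF 𝓡 k G) :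
    HomF 𝓡 k (cy 𝓡 k G) := by
  have := (homF_cyc (𝓡 := 𝓡) (Q := Q)).comp 𝓡 hG
  have := this.comp 𝓡 (homF_prj (𝓡 := 𝓡) (Q := Q'))
  rwa [add_zero, zero_add] at this

theorem homF_wB : HomF 𝓡 1 (wB 𝓡 (Q := Q)) := by
  have := (homF_cyc (𝓡 := 𝓡) (Q := Q)).comp 𝓡 (homF_app 𝓡)
  have := this.comp 𝓡 (homF_eW (𝓡 := 𝓡) (Q := Q))
  rwa [add_zero, add_zero] at this

theorem IsBar.homF_wQ {f : List Q.B → (List Q'.B →₀ R)} {F ψ : List Q.B → (Q'.B →₀ R)}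
    (h : IsBar 𝓡 F f) (hψ : HomF 𝓡 j ψ) (hk : k = 1 + j) : HomF 𝓡 k (wQ 𝓡 f F j ψ) := by
  subst hk
  have := (homF_cyc (𝓡 := 𝓡) (Q := Q)).comp 𝓡 (homF_lpsi h hψ)
  have := this.comp 𝓡 (homF_app 𝓡)
  have := this.comp 𝓡 (homF_eW (𝓡 := 𝓡) (Q := Q'))
  rwa [add_zero, zero_add] at this

theorem IsBar.homF_gpsi {m' : List Q'.B → (Q'.B →₀ R)} {f : List Q.B → (List Q'.B →₀ R)}
    {F ψ : List Q.B → (Q'.B →₀ R)} (hm' : HomF 𝓡 1 m') (h : IsBar 𝓡 F f) (hψ : HomF 𝓡 j ψ)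
    (hk : k = 1 + j) : HomF 𝓡 k (gpsi 𝓡 m' f F j ψ) := by
  subst hk
  have := homF_gop 𝓡 h.homF (homF_gpsi_mid hm' h hψ) h.homF
  rwa [add_zero, zero_add] at this

theorem IsBar.homF_gphi {f : List Q.B → (List Q'.B →₀ R)} {F : List Q.B → (Q'.B →₀ R)}
    {φ : List Q.B → (Q.B →₀ R)} (h : IsBar 𝓡 F f) (hφ : HomF 𝓡 j φ) :
    HomF 𝓡 j (gphi 𝓡 f F j φ) := by
  have := (homF_kphi hφ).comp 𝓡 (homF_unmark 𝓡 h.hom)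
  rw [zero_add] at this
  have := homF_gop 𝓡 h.homF this h.homF
  rwa [add_zero, zero_add] at this

/-! ### Operators on words that act on the normalised chains -/

/-- A homogeneous operator on words that descends to the normalised chains. -/
structure IsOp (𝓡 : ZMod 2 → Submodule K R) (i : ZMod 2) (Φ : List Q.B → (List Q'.B →₀ R)) :
    Prop where
  hom : HomF 𝓡 i Φ
  path : ∀ w ∈ cpth Q, Φ w ∈ supported R R (cpth Q')
  tun : ∀ w ∈ cpth Q, w ∈ tun Q → Φ w ∈ supported R R (tun Q')

theorem homF_zsmul {X Y : Type*} [Par X] [Par Y] {f : X → (Y →₀ R)} (h : HomF 𝓡 i f) (n : ℤ) :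
    HomF 𝓡 i fun x => n • f x := fun x => zsmul_mem (h x) n

theorem IsOp.zsmul {Φ : List Q.B → (List Q'.B →₀ R)} (h : IsOp 𝓡 i Φ) (n : ℤ) :
    IsOp 𝓡 i fun w => n • Φ w :=
  ⟨homF_zsmul h.hom n, fun w hw => zsmul_mem' (h.path w hw) n,
    fun w hw ht => zsmul_mem' (h.tun w hw ht) n⟩

theorem IsOp.sub {Φ Ψ : List Q.B → (List Q'.B →₀ R)} (h : IsOp 𝓡 i Φ) (h' : IsOp 𝓡 i Ψ) :
    IsOp 𝓡 i fun w => Φ w - Ψ w :=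
  ⟨fun w => sub_mem (h.hom w) (h'.hom w), fun w hw => sub_mem (h.path w hw) (h'.path w hw),
    fun w hw ht => sub_mem (h.tun w hw ht) (h'.tun w hw ht)⟩

theorem isOp_wB : IsOp 𝓡 1 (wB 𝓡 (Q := Q)) :=
  ⟨homF_wB, fun _ hw => eW_cpth (app_cmpth (cyc_cmpth hw)), fun _ _ ht => wB_tun ht⟩

theorem not_tun {w : List Q.B} (h : Q.IsHochWord w) : w ∉ tun Q :=
  fun ⟨X, hX⟩ => h.2.2 _ hX X rfl

theorem hoch_iff {w : List Q.B} (h : w ∈ cpth Q) : Q.IsHochWord w ↔ w ∉ tun Q :=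
  ⟨not_tun, fun ht => ⟨h.1, h.2, fun _ hx X hX => ht ⟨X, hX ▸ hx⟩⟩⟩

/-- `toCC` as an additive map. -/
def toCCHom (Q : HomBasis Ob) (R : Type*) [Ring R] : (List Q.B →₀ R) →+ Q.CC R where
  toFun := Q.toCC
  map_zero' := Finsupp.subtypeDomain_zero
  map_add' _ _ := Finsupp.subtypeDomain_add

theorem toCC_apply (t : List Q.B →₀ R) (w : {w // Q.IsHochWord w}) : Q.toCC t w = t w.1 := rfl

theorem toCC_add (s t : List Q.B →₀ R) : Q.toCC (s + t) = Q.toCC s + Q.toCC t :=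
  map_add (toCCHom Q R) s t

theorem toCC_sub (s t : List Q.B →₀ R) : Q.toCC (s - t) = Q.toCC s - Q.toCC t :=
  map_sub (toCCHom Q R) s t

theorem toCC_zsmul (n : ℤ) (t : List Q.B →₀ R) : Q.toCC (n • t) = n • Q.toCC t :=
  map_zsmul (toCCHom Q R) n t

theorem toCC_smul (r : R) (t : List Q.B →₀ R) : Q.toCC (r • t) = r • Q.toCC t := by
  ext w
  rfl

theorem toCC_coeffMap (v : R →ₗ[K] R) (t : List Q.B →₀ R) :
    Q.toCC (coeffMap v t) = coeffMap v (Q.toCC t) := by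
  ext w
  rfl

theorem toCC_tun {t : List Q.B →₀ R} (ht : t ∈ supported R R (tun Q)) : Q.toCC t = 0 := by
  ext w
  by_contra h
  exact not_tun w.2 (ht (Finsupp.mem_support_iff.2 h))

theorem toCC_single {w : List Q.B} (h : Q.IsHochWord w) (r : R) :
    Q.toCC (Finsupp.single w r) = Finsupp.single ⟨w, h⟩ r := by
  classical
  ext w'
  rw [toCC_apply, Finsupp.single_apply, Finsupp.single_apply]
  simp [Subtype.ext_iff]

theorem IsOp.ch_toCC {Φ : List Q.B → (List Q'.B →₀ R)} (h : IsOp 𝓡 i Φ) (j : ZMod 2)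
    {t : List Q.B →₀ R} (ht : t ∈ supported R R (cpth Q)) :
    ch 𝓡 j Φ (Q.toCC t) = Q'.toCC (superExt 𝓡 j Φ t) := by
  classical
  rw [← Finsupp.sum_single t, Finsupp.sum, show Q.toCC (∑ w ∈ t.support, Finsupp.single w (t w)) =
    ∑ w ∈ t.support, Q.toCC (Finsupp.single w (t w)) from map_sum (toCCHom Q R) _ _, map_sum,
    map_sum, show Q'.toCC (∑ w ∈ t.support, superExt 𝓡 j Φ (Finsupp.single w (t w))) =
    ∑ w ∈ t.support, Q'.toCC (superExt 𝓡 j Φ (Finsupp.single w (t w))) from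
      map_sum (toCCHom Q' R) _ _]
  refine Finset.sum_congr rfl fun w hw => ?_
  have hc : w ∈ cpth Q := ht hw
  rw [superExt_single, toCC_smul]
  by_cases hh : Q.IsHochWord w
  · rw [toCC_single hh, ch, superExt_single]
  · have htun : w ∈ RelCyc.tun Q := by_contra fun h => hh ((hoch_iff hc).2 h)
    rw [toCC_tun (h.tun w hc htun), smul_zero, toCC_tun (single_mem_supported R _ htun),
      map_zero]

theorem ch_comp {Φ : List Q.B → (List Q'.B →₀ R)} {Ψ : List Q'.B → (List Q''.B →₀ R)}
    (hΦ : IsOp 𝓡 i Φ) (hΨ : IsOp 𝓡 j Ψ) (a : Q.CC R) :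
    ch 𝓡 j Ψ (ch 𝓡 i Φ a) = ch 𝓡 (j + i) (fun w => superExt 𝓡 j Ψ (Φ w)) a := by
  rw [ch, ch, superExt_comp]
  congr 2
  funext w
  exact hΨ.ch_toCC j (hΦ.path w.1 ⟨w.2.1, w.2.2.1⟩)

theorem ch_congr {Φ Φ' : List Q.B → (List Q'.B →₀ R)}
    (h : ∀ w ∈ cpth Q, Q'.toCC (Φ w) = Q'.toCC (Φ' w)) : ch 𝓡 i Φ = ch 𝓡 i Φ' := by
  rw [ch, ch]
  congr 1
  funext w
  exact h w.1 ⟨w.2.1, w.2.2.1⟩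

theorem ch_eq_zero {Φ : List Q.B → (List Q'.B →₀ R)}
    (h : ∀ w ∈ cpth Q, Φ w ∈ supported R R (tun Q')) (a : Q.CC R) : ch 𝓡 i Φ a = 0 := by
  rw [ch_congr (Φ' := fun _ => 0) fun w hw => by
    rw [toCC_tun (h w hw)]
    exact (map_zero (toCCHom Q' R)).symm]
  rw [ch, show (fun w : {w // Q.IsHochWord w} => Q'.toCC (0 : List Q'.B →₀ R)) = fun _ => 0 from
    funext fun _ => map_zero (toCCHom Q' R), superExt_zero_fun]

theorem ch_add (Φ Ψ : List Q.B → (List Q'.B →₀ R)) (a : Q.CC R) :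
    ch 𝓡 i (fun w => Φ w + Ψ w) a = ch 𝓡 i Φ a + ch 𝓡 i Ψ a := by
  rw [ch, ch, ch, ← superExt_add_fun]
  congr 2
  funext w
  exact toCC_add _ _

theorem ch_zsmul (n : ℤ) (Φ : List Q.B → (List Q'.B →₀ R)) (a : Q.CC R) :
    ch 𝓡 i (fun w => n • Φ w) a = n • ch 𝓡 i Φ a := by
  rw [ch, ch, ← superExt_zsmul_fun]
  congr 2
  funext w
  exact toCC_zsmul _ _

theorem ch_sub (Φ Ψ : List Q.B → (List Q'.B →₀ R)) (a : Q.CC R) :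
    ch 𝓡 i (fun w => Φ w - Ψ w) a = ch 𝓡 i Φ a - ch 𝓡 i Ψ a := by
  rw [ch, ch, ch, ← superExt_sub_fun]
  congr 2
  funext w
  exact toCC_sub _ _

theorem ch_neg (Φ : List Q.B → (List Q'.B →₀ R)) (a : Q.CC R) :
    ch 𝓡 i (fun w => -Φ w) a = -ch 𝓡 i Φ a := by
  have := ch_zsmul (𝓡 := 𝓡) (i := i) (-1) Φ a
  simpa only [neg_one_smul] using this

theorem coeffMap_ch {v : R →ₗ[K] R} (hv : v ∈ superDer 𝓡 i) (Φ : List Q.B → (List Q'.B →₀ R))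
    (a : Q.CC R) : coeffMap v (ch 𝓡 j Φ a) = sgn (i * j) • ch 𝓡 j Φ (coeffMap v a) +
      ch 𝓡 (i + j) (fun w => coeffMap v (Φ w)) a := by
  rw [ch, coeffMap_superExt hv, ch]
  congr 3
  funext w
  exact (toCC_coeffMap v _).symm

/-! ### Parity of chains -/

instance : Par {w : List Q.B // Q.IsHochWord w} := ⟨fun w => Q.eps w.1⟩

theorem par_hoch (w : {w : List Q.B // Q.IsHochWord w}) : par w = Q.eps w.1 := rfl

theorem toCC_mem_parSub {t : List Q.B →₀ R} (ht : t ∈ parSub 𝓡 j) : Q.toCC t ∈ parSub 𝓡 j :=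
  fun w => ht w.1

theorem mem_chainPar {a : Q.CC R} : a ∈ Q.chainPar 𝓡 j ↔ a ∈ parSub 𝓡 (j + 1) := by
  refine forall_congr' fun w => ?_
  rw [HomBasis.chainDeg, par_hoch, ← add_assoc, add_right_comm]

theorem IsOp.homF_ch {Φ : List Q.B → (List Q'.B →₀ R)} (h : IsOp 𝓡 i Φ) :
    HomF 𝓡 i fun w : {w : List Q.B // Q.IsHochWord w} => Q'.toCC (Φ w.1) :=
  fun w => toCC_mem_parSub (h.hom w.1)

theorem IsOp.ch_mem {Φ : List Q.B → (List Q'.B →₀ R)} (h : IsOp 𝓡 i Φ) {a : Q.CC R}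
    (ha : a ∈ Q.chainPar 𝓡 j) : ch 𝓡 i Φ a ∈ Q'.chainPar 𝓡 (i + j) := by
  rw [mem_chainPar] at ha ⊢
  rw [add_assoc]
  exact superExt_mem_parSub 𝓡 h.homF_ch ha

theorem coeffMap_mem_chainPar {v : R →ₗ[K] R} (hv : v ∈ superDer 𝓡 i) {a : Q.CC R}
    (ha : a ∈ Q.chainPar 𝓡 j) : coeffMap v a ∈ Q.chainPar 𝓡 (i + j) := by
  rw [mem_chainPar] at ha ⊢
  rw [add_assoc]
  exact coeffMap_mem_parSub hv ha

theorem chainPar_add {a b : Q.CC R} (ha : a ∈ Q.chainPar 𝓡 j) (hb : b ∈ Q.chainPar 𝓡 j) :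
    a + b ∈ Q.chainPar 𝓡 j := by
  rw [mem_chainPar] at ha hb ⊢
  exact add_mem ha hb

theorem chainPar_sub {a b : Q.CC R} (ha : a ∈ Q.chainPar 𝓡 j) (hb : b ∈ Q.chainPar 𝓡 j) :
    a - b ∈ Q.chainPar 𝓡 j := by
  rw [mem_chainPar] at ha hb ⊢
  exact sub_mem ha hb

theorem chainPar_zsmul {a : Q.CC R} (ha : a ∈ Q.chainPar 𝓡 j) (n : ℤ) :
    n • a ∈ Q.chainPar 𝓡 j := by
  rw [mem_chainPar] at ha ⊢
  exact zsmul_mem ha n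

theorem signInv_of_mem {a : Q.CC R} (ha : a ∈ Q.chainPar 𝓡 j) :
    Q.signInv 𝓡 a = sgn j • a := by
  rw [mem_chainPar] at ha
  have := superExt_one_sgn ha
  rw [add_assoc, CharTwo.add_self_eq_zero, add_zero] at this
  exact this

theorem signInv_mem {a : Q.CC R} (ha : a ∈ Q.chainPar 𝓡 j) :
    Q.signInv 𝓡 a ∈ Q.chainPar 𝓡 j := by
  rw [signInv_of_mem ha]
  exact chainPar_zsmul ha _

theorem IsOp.signInv_ch {Φ : List Q.B → (List Q'.B →₀ R)} (h : IsOp 𝓡 i Φ) (a : Q.CC R) :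
    Q'.signInv 𝓡 (ch 𝓡 i Φ a) = sgn i • ch 𝓡 i Φ (Q.signInv 𝓡 a) := by
  rw [HomBasis.signInv, HomBasis.signInv, ch, superExt_comp, superExt_comp, add_comm i,
    ← superExt_zsmul_fun]
  congr 2
  funext w
  have := superExt_one_sgn (h.homF_ch w)
  rw [map_zsmul, superExt_single_one, smul_smul, HomBasis.chainDeg, ← sgn_add, ← add_assoc]
  exact this

theorem signInv_coeffMap {v : R →ₗ[K] R} (hv : v ∈ superDer 𝓡 i) (a : Q.CC R) :
    Q.signInv 𝓡 (coeffMap v a) = sgn i • coeffMap v (Q.signInv 𝓡 a) := by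
  rw [HomBasis.signInv, coeffMap_superExt hv, mul_one, smul_add, sgn_smul_self]
  have : (fun w : {w : List Q.B // Q.IsHochWord w} =>
      coeffMap v (sgn (Q.chainDeg w.1) • Finsupp.single w (1 : R))) = fun _ => 0 := by
    funext w
    rw [map_zsmul, show Finsupp.single w (1 : R) = wd w from rfl, coeffMap_wd hv, smul_zero]
  rw [this, superExt_zero_fun, smul_zero, add_zero]

end Chains

section Operators

variable {K R : Type*} [Field K] [Ring R] [Algebra K R]
variable {𝓡 : ZMod 2 → Submodule K R} [GradedAlgebra 𝓡]
variable {Ob Ob' : Type*} {C : AInfCat 𝓡 Ob} {D : AInfCat 𝓡 Ob'} {obj : Ob → Ob'}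
  {i j k : ZMod 2} {F : List C.B → (D.B →₀ R)} {f : List C.B → (List D.B →₀ R)}
  {ψ : List C.B → (D.B →₀ R)} {v : R →ₗ[K] R}

theorem AInfCat.isOp_wb (C : AInfCat 𝓡 Ob) : IsOp 𝓡 1 C.wb :=
  ⟨homF_cy (homF_dpsi 𝓡 C.isDiff.hom), fun _ hw => (MPathMap.dpsi C.arrMap).cy hw,
    fun _ hw ht => C.wb_tun ht hw⟩

theorem IsFun.isOp_wQ (h : IsFun C D obj F f) (hψ : IsCo C D obj j ψ) (hk : k = 1 + j) :
    IsOp 𝓡 k (RelCyc.wQ 𝓡 f F j ψ) :=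
  ⟨h.bar.homF_wQ hψ.hom hk,
    fun _ hw => eW_cpth (app_cmpth ((h.lpsi_path hψ).cmpth (cyc_cmpth hw))),
    fun _ _ ht => h.wQ_tun hψ ht⟩

theorem IsFun.isOp_gpsi (h : IsFun C D obj F f) (hψ : IsCo C D obj j ψ) (hk : k = 1 + j) :
    IsOp 𝓡 k (cy 𝓡 k (gpsi 𝓡 D.m f F j ψ)) :=
  ⟨homF_cy (h.bar.homF_gpsi D.isDiff.hom hψ.hom hk), fun _ hw => (h.gpsi_path hψ).cy hw,
    fun _ _ ht => h.gpsi_tun hψ ht⟩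

theorem IsFun.isOp_gphi (h : IsFun C D obj F f) {φ : List C.B → (C.B →₀ R)}
    (hφ : IsCo C C id j φ) : IsOp 𝓡 j (cy 𝓡 j (gphi 𝓡 f F j φ)) :=
  ⟨homF_cy (h.bar.homF_gphi hφ.hom), fun _ hw => (h.gphi_path hφ).cy hw,
    fun _ _ ht => h.gphi_tun hφ ht⟩

theorem IsFun.isOp_wF (h : IsFun C D obj F f) : IsOp 𝓡 0 (wF 𝓡 F f) :=
  ⟨homF_cy h.bar.homF_gbar, fun _ hw => h.gbar_path.cy hw, fun _ _ ht => h.wF_tun ht⟩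

theorem AInfCat.isOp_wP (C : AInfCat 𝓡 Ob) (hv : v ∈ superDer 𝓡 i) : IsOp 𝓡 i (C.wP i v) :=
  (isFun_id C).isOp_gpsi (C.isCo hv) (by grind)

theorem AInfCat.isOp_wQ (C : AInfCat 𝓡 Ob) (hv : v ∈ superDer 𝓡 i) : IsOp 𝓡 i (C.wQ i v) :=
  (isFun_id C).isOp_wQ (C.isCo hv) (by grind)

theorem IsFun.isOp_wT (h : IsFun C D obj F f) (hv : v ∈ superDer 𝓡 i) :
    IsOp 𝓡 (i + 1) (wT C D F f i v) :=
  ((h.isOp_gpsi (h.isCo hv) (add_comm i 1)).zsmul _).sub (h.isOp_gphi (C.isCo hv))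

end Operators

section Units

variable {K R : Type*} [Field K] [Ring R] [Algebra K R]
variable {𝓡 : ZMod 2 → Submodule K R} [GradedAlgebra 𝓡]
variable {Ob : Type*} {Q : HomBasis Ob} {i : ZMod 2}

theorem eW_unw (t : List Q.B →₀ R) : superExt 𝓡 i eW t ∈ supported R R (unw Q 1) := by
  refine superExt_mem_supported' 𝓡 i (S := Set.univ) (U := unw Q 1) (fun w _ => ?_)
    (mem_supported_univ t)
  cases w with
  | nil => exact zero_mem _
  | cons x l => exact wd_unw_one (X := Q.src x) (by simp)

theorem cyc_unw {w : List Q.B} (hw : w ∈ unw Q 1) :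
    cyc 𝓡 w ∈ supported R R
      {p : List Q.B × List Q.B | ∃ s x t X, p = (s, x :: t) ∧ Q.unit X ∈ s ++ x :: t} := by
  obtain ⟨⟨X, hX⟩, -⟩ := hw
  cases w with
  | nil => exact absurd hX List.not_mem_nil
  | cons x l =>
    rw [cyc_cons]
    refine splitSum_mem' fun u v huv => zsmul_mem' (single_mem_supported R _ ?_) _
    subst huv
    refine ⟨v, x, u, X, rfl, ?_⟩
    simp only [List.mem_cons, List.mem_append] at hX ⊢
    tauto

theorem wB_unw {w : List Q.B} (hw : w ∈ unw Q 1) : wB 𝓡 w ∈ supported R R (tun Q) := by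
  refine eW_tun (superExt_mem_supported' 𝓡 0 (S := {p | ∃ s x t X, p = (s, x :: t) ∧
    Q.unit X ∈ s ++ x :: t}) (U := unw Q 1) ?_ (cyc_unw hw))
  rintro _ ⟨s, x, t, X, rfl, h⟩
  exact wd_unw_one h

end Units

section Units

variable {K R : Type*} [Field K] [Ring R] [Algebra K R]
variable {𝓡 : ZMod 2 → Submodule K R} [GradedAlgebra 𝓡]
variable {Ob Ob' : Type*} {C : AInfCat 𝓡 Ob} {D : AInfCat 𝓡 Ob'} {obj : Ob → Ob'}
  {i j k : ZMod 2} {F : List C.B → (D.B →₀ R)} {f : List C.B → (List D.B →₀ R)}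
  {ψ : List C.B → (D.B →₀ R)} {v : R →ₗ[K] R}

theorem IsFun.wQ_unw (h : IsFun C D obj F f) (hψ : IsCo C D obj j ψ) {w : List C.B}
    (hw : w ∈ unw C.toHomBasis 1) :
    RelCyc.wQ 𝓡 f F j ψ w ∈ supported R R (tun D.toHomBasis) := by
  refine eW_tun ?_
  rw [superExt_comp]
  refine superExt_mem_supported' 𝓡 _ (S := {p | ∃ s x t X, p = (s, x :: t) ∧
    C.unit X ∈ s ++ x :: t}) (U := unw D.toHomBasis 1) ?_ (cyc_unw hw)
  rintro _ ⟨s, x, t, X, rfl, hX⟩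
  by_cases hX' : C.unit X ∈ s ∨ C.unit X ∈ t
  · exact unw_mono (by omega) (h.lpsi_unw hψ hX')
  · have hx : x = C.unit X := by
      simp only [List.mem_append, List.mem_cons] at hX
      tauto
    subst hx
    rw [lpsi, mult_gop]
    refine splitSum_mem' fun s₁ s₂ hs => splitSum_mem' fun t₁ t₂ ht => zsmul_mem' ?_ _
    by_cases he : s₂ ≠ [] ∨ t₁ ≠ []
    · rw [unmark, h.F_around_unit he, map_zero, zero_cat, map_zero]
      exact zero_mem _
    · push Not at he
      rw [he.1, he.2, unmark, List.nil_append, h.unit, letH_wd]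
      exact unw_mono (by omega) (cat_unw_right (big_zero _)
        (cat_unw_left (wd_unw_one (X := obj X) (by simp)) (big_zero _)))

/-- A composite of operators one of which inserts a unit vanishes on the normalised chains if the
other one maps the words with a unit to words with a unit behind the first letter. -/
theorem ch_comp_eq_zero {Ob Ob' Ob'' : Type*} {Q : HomBasis Ob} {Q' : HomBasis Ob'}
    {Q'' : HomBasis Ob''} {Φ : List Q.B → (List Q'.B →₀ R)} {Ψ : List Q'.B → (List Q''.B →₀ R)}
    (hΦ : IsOp 𝓡 i Φ) (hΨ : IsOp 𝓡 j Ψ)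
    (h1 : ∀ w, Φ w ∈ supported R R (unw Q' 1))
    (h2 : ∀ w ∈ unw Q' 1, Ψ w ∈ supported R R (tun Q'')) (a : Q.CC R) :
    ch 𝓡 j Ψ (ch 𝓡 i Φ a) = 0 := by
  rw [ch_comp hΦ hΨ]
  exact ch_eq_zero (fun w _ => superExt_mem_supported' 𝓡 j (S := unw Q' 1) (U := tun Q'') h2
    (h1 w)) a

end Units

section Chains

variable {K R : Type*} [Field K] [Ring R] [Algebra K R]
variable {𝓡 : ZMod 2 → Submodule K R} [GradedAlgebra 𝓡]
variable {Ob Ob' : Type*} {C : AInfCat 𝓡 Ob} {D : AInfCat 𝓡 Ob'} {i j k : ZMod 2}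
  {v : R →ₗ[K] R}

theorem ch_word {Ob Ob' : Type*} {Q : HomBasis Ob} {Q' : HomBasis Ob'}
    {Φ Φ' : List Q.B → (List Q'.B →₀ R)} (h : ∀ w ∈ cpth Q, Φ w = Φ' w) (a : Q.CC R) :
    ch 𝓡 i Φ a = ch 𝓡 i Φ' a := by
  rw [ch_congr fun w hw => by rw [h w hw]]

theorem AInfCat.b_b11 (hR : IsSuperComm 𝓡) (C : AInfCat 𝓡 Ob) (hv : v ∈ superDer 𝓡 i)
    (a : C.CC R) : C.b (C.b11 i v a) = sgn i • C.b11 i v (C.b a) := by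
  have hb := C.isOp_wb
  have hP := C.isOp_wP hv
  rw [b_eq, b11_eq, ch_zsmul, ch_zsmul, map_zsmul, ch_comp hP hb, ch_comp hb hP, add_comm i 1,
    ch_word (fun w _ => C.wb_wP hR hv w), ch_zsmul]

theorem AInfCat.coeffMap_b (hR : IsSuperComm 𝓡) (C : AInfCat 𝓡 Ob) (hv : v ∈ superDer 𝓡 i)
    (a : C.CC R) : coeffMap v (C.b a) = sgn i • C.b (coeffMap v a) + C.b11 i v (C.connesB a) +
      C.B11 i v (C.b a) - sgn i • C.b (C.B11 i v a) - sgn i • C.connesB (C.b11 i v a) := by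
  have hb := C.isOp_wb
  have hP := C.isOp_wP hv
  have hQ := C.isOp_wQ hv
  have hB := isOp_wB (𝓡 := 𝓡) (Q := C.toHomBasis)
  have h2 : (i + 1 + 1 : ZMod 2) = i := by grind
  have key := ch_word (𝓡 := 𝓡) (i := i + 1) (fun w hw => C.coeffMap_wb hR hv hw) a
  simp only [ch_sub, ch_add, ch_zsmul, h2] at key
  rw [b_eq, b11_eq, B11_eq C hv, connesB_eq, coeffMap_ch hv, mul_one, key]
  simp only [ch_zsmul, map_zsmul, sgn_smul_self]
  rw [ch_comp hB hP, ch_comp hb hQ, ch_comp hQ hb, ch_comp hP hB, add_comm 1 i]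
  abel

theorem AInfCat.coeffMap_connesB (C : AInfCat 𝓡 Ob) (hv : v ∈ superDer 𝓡 i)
    (a : C.CC R) : coeffMap v (C.connesB a) = sgn i • C.connesB (coeffMap v a) := by
  rw [connesB_eq, coeffMap_ch hv, mul_one, ch_eq_zero (Φ := fun w => coeffMap v (wB 𝓡 w)), add_zero]
  intro w _
  rw [coeffMap_wB hv]
  exact zero_mem _

theorem AInfCat.B11_connesB (C : AInfCat 𝓡 Ob) (hv : v ∈ superDer 𝓡 i) (a : C.CC R) :
    C.B11 i v (C.connesB a) = 0 := by
  rw [B11_eq C hv, connesB_eq, ch_zsmul, ch_comp_eq_zero isOp_wB (C.isOp_wQ hv) (fun w => eW_unw _)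
    (fun w hw => (isFun_id C).wQ_unw (C.isCo hv) hw), smul_zero]

theorem AInfCat.connesB_B11 (C : AInfCat 𝓡 Ob) (hv : v ∈ superDer 𝓡 i) (a : C.CC R) :
    C.connesB (C.B11 i v a) = 0 := by
  rw [B11_eq C hv, connesB_eq, ch_zsmul, map_zsmul, ch_comp_eq_zero (C.isOp_wQ hv) isOp_wB
    (fun w => eW_unw _) (fun w hw => wB_unw hw), smul_zero]

variable (F : AInfFun C D)

theorem AInfFun.H2_sub_H1 (i : ZMod 2) (v : R →ₗ[K] R) (a : C.CC R) :
    F.H2 i v a - F.H1 i v a = ch 𝓡 (i + 1) (wT C D F.F F.bar i v) a := by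
  rw [H2_eq, H1_eq, ← ch_sub]
  rfl

theorem AInfFun.b11_push (hR : IsSuperComm 𝓡) (hv : v ∈ superDer 𝓡 i) (a : C.CC R) :
    D.b11 i v (F.push a) - F.push (C.b11 i v a) =
      (F.H2 i v (C.b a) - F.H1 i v (C.b a)) + sgn i • D.b (F.H2 i v a - F.H1 i v a) := by
  have hF := F.isFun.isOp_wF
  have hT := F.isFun.isOp_wT hv
  have hb := C.isOp_wb
  have hb' := D.isOp_wb
  have hP := C.isOp_wP hv
  have hP' := D.isOp_wP hv
  have key := ch_word (𝓡 := 𝓡) (i := i) (fun w hw => F.isFun.wT_wb hR hv hw) a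
  have h1 : (i + 1 + 1 : ZMod 2) = i := by grind
  have h2 : (1 + (i + 1) : ZMod 2) = i := by grind
  simp only [ch_sub, ch_add, ch_zsmul] at key
  rw [F.H2_sub_H1, F.H2_sub_H1, AInfCat.b11_eq, AInfCat.b11_eq, F.push_eq, AInfCat.b_eq,
    AInfCat.b_eq, ch_zsmul, ch_zsmul, map_zsmul, ch_comp hF hP', ch_comp hP hF, ch_comp hb hT,
    ch_comp hT hb', add_zero, zero_add, h1, h2]
  exact key

theorem AInfFun.coeffMap_push (hR : IsSuperComm 𝓡) (hv : v ∈ superDer 𝓡 i) (a : C.CC R) :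
    F.push (coeffMap v a) - coeffMap v (F.push a) - F.push (C.B11 i v a) +
        D.B11 i v (F.push a) =
      (F.H2 i v (C.connesB a) - F.H1 i v (C.connesB a)) + F.H3 i v (C.b a) +
        sgn i • D.b (F.H3 i v a) + sgn i • D.connesB (F.H2 i v a - F.H1 i v a) := by
  have hF := F.isFun.isOp_wF
  have hT := F.isFun.isOp_wT hv
  have hb := C.isOp_wb
  have hb' := D.isOp_wb
  have hB := isOp_wB (𝓡 := 𝓡) (Q := C.toHomBasis)
  have hB' := isOp_wB (𝓡 := 𝓡) (Q := D.toHomBasis)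
  have hQ := C.isOp_wQ hv
  have hQ' := D.isOp_wQ hv
  have hW := F.isFun.isOp_wQ (F.isFun.isCo hv) (add_comm i 1)
  have key := ch_word (𝓡 := 𝓡) (i := i) (fun w hw => F.isFun.coeffMap_wF hR hv hw) a
  have h1 : (i + 1 + 1 : ZMod 2) = i := by grind
  have h2 : (1 + (i + 1) : ZMod 2) = i := by grind
  simp only [ch_sub, ch_add, ch_zsmul, ch_neg, h1] at key
  rw [F.H2_sub_H1, F.H2_sub_H1, AInfCat.B11_eq C hv, AInfCat.B11_eq D hv, F.push_eq,
    AInfCat.b_eq, AInfCat.b_eq, F.H3_eq hv, AInfCat.connesB_eq, AInfCat.connesB_eq,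
    coeffMap_ch hv, mul_zero, sgn_zero, one_smul]
  simp only [ch_zsmul, map_zsmul, sgn_smul_self]
  rw [ch_comp hQ hF, ch_comp hF hQ', ch_comp hB hT, ch_comp hb hW, ch_comp hW hb',
    ch_comp hT hB']
  simp only [add_zero, zero_add, h1, h2]
  rw [← key]
  abel

theorem AInfFun.H3_connesB (hv : v ∈ superDer 𝓡 i) (a : C.CC R) :
    F.H3 i v (C.connesB a) = 0 := by
  rw [F.H3_eq hv, AInfCat.connesB_eq, ch_zsmul, ch_comp_eq_zero isOp_wB
    (F.isFun.isOp_wQ (F.isFun.isCo hv) (add_comm i 1)) (fun w => eW_unw _)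
    (fun w hw => F.isFun.wQ_unw (F.isFun.isCo hv) hw), smul_zero]

theorem AInfFun.connesB_H3 (hv : v ∈ superDer 𝓡 i) (a : C.CC R) :
    D.connesB (F.H3 i v a) = 0 := by
  rw [F.H3_eq hv, AInfCat.connesB_eq, ch_zsmul, map_zsmul, ch_comp_eq_zero
    (F.isFun.isOp_wQ (F.isFun.isCo hv) (add_comm i 1)) isOp_wB (fun w => eW_unw _)
    (fun w hw => wB_unw hw), smul_zero]

end Chains

section Laurent

variable {R V V' : Type*} [Ring R] [AddCommGroup V] [Module R V] [AddCommGroup V'] [Module R V']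

theorem Lau.coeff_uPow' (k : ℤ) (a : Lau R V) (n : ℤ) : (Lau.uPow k a).coeff n = a.coeff (n - k) := by
  obtain ⟨m, rfl⟩ : ∃ m, n = m + k := ⟨n - k, by ring⟩
  rw [Lau.coeff_uPow, add_sub_cancel_right]

theorem Lau.coeff_sub (a b : Lau R V) (n : ℤ) : (a - b).coeff n = a.coeff n - b.coeff n := rfl

theorem Lau.coeff_neg (a : Lau R V) (n : ℤ) : (-a).coeff n = -a.coeff n := rfl

/-- The coefficient of `u^n` as an additive map. -/
def Lau.coeffHom (n : ℤ) : Lau R V →+ V where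
  toFun a := a.coeff n
  map_zero' := rfl
  map_add' _ _ := rfl

theorem Lau.coeff_zsmul (m : ℤ) (a : Lau R V) (n : ℤ) : (m • a).coeff n = m • a.coeff n :=
  map_zsmul (Lau.coeffHom n) m a

theorem Lau.coeff_uDu (a : Lau R V) (n : ℤ) : (Lau.uDu a).coeff n = n • a.coeff n := rfl

end Laurent

section Coefficients

variable {K R : Type*} [Field K] [Ring R] [Algebra K R]
variable {𝓡 : ZMod 2 → Submodule K R} [GradedAlgebra 𝓡]
variable {Ob Ob' : Type*} {C : AInfCat 𝓡 Ob} {D : AInfCat 𝓡 Ob'} {F : AInfFun C D}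
  {i j k : ZMod 2} {v : R →ₗ[K] R}

theorem AInfCat.coeff_dMinus (C : AInfCat 𝓡 Ob) (a : C.CCu) (n : ℤ) :
    (C.dMinus a).coeff n = C.b (a.coeff n) + C.connesB (a.coeff (n - 1)) := by
  simp only [AInfCat.dMinus, AddMonoidHom.add_apply, AddMonoidHom.comp_apply, Lau.coeff_add,
    Lau.coeff_uPow', Lau.coeff_map]

theorem AInfCat.coeff_nabla (C : AInfCat 𝓡 Ob) (a : C.CCu) (n : ℤ) :
    (C.nabla i v a).coeff n =
      coeffMap v (a.coeff n) - C.b11 i v (a.coeff (n + 1)) - C.B11 i v (a.coeff n) := by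
  simp only [AInfCat.nabla, AddMonoidHom.sub_apply, AddMonoidHom.comp_apply, Lau.coeff_sub,
    Lau.coeff_uPow', Lau.coeff_map, sub_neg_eq_add]

theorem AInfFun.coeff_H (F : AInfFun C D) (a : C.CCu) (n : ℤ) :
    (F.H i v a).coeff n = F.H2 i v (a.coeff (n + 1)) - F.H1 i v (a.coeff (n + 1)) +
      F.H3 i v (a.coeff n) := by
  simp only [AInfFun.H, AddMonoidHom.add_apply, AddMonoidHom.comp_apply, Lau.coeff_add,
    Lau.coeff_uPow', Lau.coeff_map, AddMonoidHom.sub_apply, sub_neg_eq_add]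

theorem AInfCat.nabla_dMinus (hR : IsSuperComm 𝓡) (C : AInfCat 𝓡 Ob) (hv : v ∈ superDer 𝓡 i)
    (a : C.CCu) : C.nabla i v (C.dMinus a) = sgn i • C.dMinus (C.nabla i v a) := by
  apply Lau.ext
  intro n
  simp only [Lau.coeff_zsmul, C.coeff_nabla, C.coeff_dMinus, map_add, map_sub, smul_add, smul_sub,
    C.coeffMap_b hR hv, C.coeffMap_connesB hv, C.B11_connesB hv, C.connesB_B11 hv, C.b_b11 hR hv,
    sgn_smul_self, sub_add_cancel, add_sub_cancel_right, smul_zero]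
  abel

theorem AInfFun.push_nabla (hR : IsSuperComm 𝓡) (F : AInfFun C D) (hv : v ∈ superDer 𝓡 i)
    (a : C.CCu) : Lau.map F.push (C.nabla i v a) - D.nabla i v (Lau.map F.push a) =
      F.H i v (C.dMinus a) + sgn i • D.dMinus (F.H i v a) := by
  apply Lau.ext
  intro n
  have h1 := F.b11_push hR hv (a.coeff (n + 1))
  have h2 := F.coeffMap_push hR hv (a.coeff n)
  simp only [Lau.coeff_zsmul, Lau.coeff_add, Lau.coeff_sub, Lau.coeff_map, C.coeff_nabla,
    D.coeff_nabla, F.coeff_H, C.coeff_dMinus, D.coeff_dMinus, map_add, map_sub, smul_add, smul_sub,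
    sub_add_cancel, add_sub_cancel_right, F.H3_connesB hv, F.connesB_H3 hv] at h1 h2 ⊢
  rw [show F.push (coeffMap v (a.coeff n)) = F.push (coeffMap v (a.coeff n)) -
    coeffMap v (F.push (a.coeff n)) - F.push (C.B11 i v (a.coeff n)) +
    D.B11 i v (F.push (a.coeff n)) + coeffMap v (F.push (a.coeff n)) +
    F.push (C.B11 i v (a.coeff n)) - D.B11 i v (F.push (a.coeff n)) by abel, h2,
    show D.b11 i v (F.push (a.coeff (n + 1))) = D.b11 i v (F.push (a.coeff (n + 1))) -
      F.push (C.b11 i v (a.coeff (n + 1))) + F.push (C.b11 i v (a.coeff (n + 1))) by abel, h1]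
  simp only [smul_zero]
  abel

theorem AInfCat.signInv_dMinus (C : AInfCat 𝓡 Ob) (a : C.CCu) :
    Lau.map (C.signInv 𝓡) (C.dMinus a) = -C.dMinus (Lau.map (C.signInv 𝓡) a) := by
  apply Lau.ext
  intro n
  have h1 : sgn 1 = -1 := by decide
  simp only [Lau.coeff_neg, Lau.coeff_map, C.coeff_dMinus, map_add, C.b_eq, C.connesB_eq,
    C.isOp_wb.signInv_ch, isOp_wB.signInv_ch, h1, neg_smul, one_smul, neg_add]

theorem AInfCat.signInv_nabla (C : AInfCat 𝓡 Ob) (hv : v ∈ superDer 𝓡 i) (a : C.CCu) :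
    Lau.map (C.signInv 𝓡) (C.nabla i v a) =
      sgn i • C.nabla i v (Lau.map (C.signInv 𝓡) a) := by
  apply Lau.ext
  intro n
  simp only [Lau.coeff_zsmul, Lau.coeff_map, C.coeff_nabla, map_sub, smul_sub, C.b11_eq,
    C.B11_eq hv, ch_zsmul, map_zsmul, (C.isOp_wP hv).signInv_ch, (C.isOp_wQ hv).signInv_ch,
    signInv_coeffMap hv]

theorem AInfFun.nablaCone_dCone (hR : IsSuperComm 𝓡) (F : AInfFun C D) (hv : v ∈ superDer 𝓡 i)
    (a : F.Cone) : F.nablaCone i v (F.dCone a) = sgn i • F.dCone (F.nablaCone i v a) := by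
  refine Prod.ext (C.nabla_dMinus hR hv a.1) ?_
  show D.nabla i v (D.dMinus a.2 + Lau.map F.push (Lau.map (C.signInv 𝓡) a.1)) -
      F.H i v (Lau.map (C.signInv 𝓡) (C.dMinus a.1)) =
    sgn i • (D.dMinus (D.nabla i v a.2 - F.H i v (Lau.map (C.signInv 𝓡) a.1)) +
      Lau.map F.push (Lau.map (C.signInv 𝓡) (C.nabla i v a.1)))
  have h := F.push_nabla hR hv (Lau.map (C.signInv 𝓡) a.1)
  simp only [map_add, map_sub, smul_add, smul_sub, D.nabla_dMinus hR hv, C.signInv_dMinus,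
    C.signInv_nabla hv, map_zsmul, map_neg, sgn_smul_self, sub_neg_eq_add]
  rw [sub_eq_iff_eq_add] at h
  rw [h]
  abel

/-! ### Levels and parities -/

theorem AInfFun.nablaCone_level (F : AInfFun C D) {n : ℤ} {a : F.Cone} (ha : a ∈ F.level n) :
    F.nablaCone i v a ∈ F.level (n - 1) := by
  have h1 : ∀ l < n, a.1.coeff l = 0 := ha.1
  have h2 : ∀ l < n, a.2.coeff l = 0 := ha.2
  refine ⟨fun l hl => ?_, fun l hl => ?_⟩
  · show (C.nabla i v a.1).coeff l = 0
    rw [C.coeff_nabla, h1 l (by omega), h1 (l + 1) (by omega)]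
    simp only [map_zero, sub_zero]
  · show (D.nabla i v a.2 - F.H i v (Lau.map (C.signInv 𝓡) a.1)).coeff l = 0
    rw [Lau.coeff_sub, D.coeff_nabla, F.coeff_H, h2 l (by omega), h2 (l + 1) (by omega),
      Lau.coeff_map, Lau.coeff_map, h1 l (by omega), h1 (l + 1) (by omega)]
    simp only [map_zero, sub_zero, add_zero]

theorem AInfCat.nabla_par (C : AInfCat 𝓡 Ob) (hv : v ∈ superDer 𝓡 i) {a : C.CCu}
    (ha : ∀ n, a.coeff n ∈ C.chainPar 𝓡 j) (n : ℤ) :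
    (C.nabla i v a).coeff n ∈ C.chainPar 𝓡 (i + j) := by
  rw [C.coeff_nabla, C.b11_eq, C.B11_eq hv, ch_zsmul, ch_zsmul]
  exact chainPar_sub (chainPar_sub (coeffMap_mem_chainPar hv (ha _))
    (chainPar_zsmul ((C.isOp_wP hv).ch_mem (ha _)) _))
    (chainPar_zsmul ((C.isOp_wQ hv).ch_mem (ha _)) _)

theorem AInfFun.nablaCone_par (F : AInfFun C D) (hv : v ∈ superDer 𝓡 i) {a : F.Cone}
    (ha : a ∈ F.conePar j) : F.nablaCone i v a ∈ F.conePar (i + j) := by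
  refine ⟨fun n => ?_, fun n => ?_⟩
  · have := C.nabla_par hv ha.1 n
    rwa [← add_assoc] at this
  · show (D.nabla i v a.2 - F.H i v (Lau.map (C.signInv 𝓡) a.1)).coeff n ∈ _
    rw [Lau.coeff_sub, F.coeff_H, Lau.coeff_map, Lau.coeff_map, F.H2_sub_H1, F.H3_eq hv, ch_zsmul]
    have h : (i + 1 + (j + 1) : ZMod 2) = i + j := by grind
    refine chainPar_sub (D.nabla_par hv ha.2 n) (chainPar_add ?_ (chainPar_zsmul ?_ _))
    · exact h ▸ (F.isFun.isOp_wT hv).ch_mem (signInv_mem (ha.1 _))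
    · exact h ▸ (F.isFun.isOp_wQ (F.isFun.isCo hv) (add_comm i 1)).ch_mem (signInv_mem (ha.1 _))

end Coefficients

section Laurent

variable {R V V' : Type*} [Ring R] [AddCommGroup V] [Module R V] [AddCommGroup V'] [Module R V']

theorem Lau.exists_bound (a : Lau R V) (n : ℤ) :
    ∃ N : ℕ, 0 < N ∧ ∀ k : ℕ, N ≤ k → a.coeff (n - k) = 0 := by
  set x : HahnSeries ℤ V := (HahnModule.of R).symm a
  refine ⟨(n - x.order).toNat + 1, by omega, fun k hk => ?_⟩
  exact HahnSeries.coeff_eq_zero_of_lt_order (x := x) (by omega)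

theorem Lau.coeff_smul_eq_sum (f : R⟦X⟧) (a : Lau R V) (n : ℤ) {N : ℕ}
    (h : ∀ k : ℕ, N ≤ k → a.coeff (n - k) = 0) :
    (f • a).coeff n = ∑ k ∈ Finset.range N, PowerSeries.coeff k f • a.coeff (n - k) := by
  rw [Lau.coeff_smul]
  have hp0 : ∀ p : ℤ × ℤ, (HahnSeries.ofPowerSeries ℤ R f).coeff p.1 ≠ 0 → 0 ≤ p.1 := fun p hp => by
    by_contra hneg
    exact hp (Lau.coeff_ofPowerSeries_neg f (not_le.mp hneg))
  refine Finset.sum_of_injOn (fun p => p.1.toNat) ?_ ?_ ?_ ?_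
  · intro p hp q hq hpq
    simp only [Finset.mem_coe, Finset.mem_vaddAntidiagonal, HahnSeries.mem_support,
      vadd_eq_add] at hp hq hpq
    have h1 := hp0 p hp.1
    have h2 := hp0 q hq.1
    exact Prod.ext (by omega) (by omega)
  · intro p hp
    simp only [Finset.mem_coe, Finset.mem_vaddAntidiagonal, HahnSeries.mem_support,
      vadd_eq_add] at hp
    have h1 := hp0 p hp.1
    rw [Finset.coe_range, Set.mem_Iio]
    by_contra hlt
    apply hp.2.1
    have := h p.1.toNat (not_lt.1 hlt)
    rwa [show n - (p.1.toNat : ℤ) = p.2 by omega] at this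
  · intro k _ hk
    by_contra hne
    refine hk ⟨((k : ℤ), n - k), ?_, Int.toNat_natCast k⟩
    simp only [Finset.mem_coe, Finset.mem_vaddAntidiagonal, HahnSeries.mem_support,
      vadd_eq_add, HahnSeries.ofPowerSeries_apply_coeff]
    refine ⟨fun h0 => hne (by rw [h0, zero_smul]), fun h0 => hne ?_, by ring⟩
    rw [show a.coeff (n - k) = 0 from h0, smul_zero]
  · intro p hp
    simp only [Finset.mem_vaddAntidiagonal, HahnSeries.mem_support, vadd_eq_add] at hp
    have h1 := hp0 p hp.1
    have h2 : ((p.1.toNat : ℕ) : ℤ) = p.1 := by omega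
    rw [← HahnSeries.ofPowerSeries_apply_coeff (Γ := ℤ), h2, ← hp.2.2, add_sub_cancel_left]
    rfl

theorem Lau.map_smul_leibniz {δ σ : R →+ R} {T : V →+ V}
    (h : ∀ (r : R) (x : V), T (r • x) = δ r • x + σ r • T x) (f : R⟦X⟧) (a : Lau R V) :
    Lau.map T (f • a) = Lau.coeffwise δ f • a + Lau.coeffwise σ f • Lau.map T a := by
  apply Lau.ext
  intro n
  obtain ⟨N, -, hN⟩ := a.exists_bound n
  have hN' : ∀ k : ℕ, N ≤ k → (Lau.map T a).coeff (n - k) = 0 := fun k hk => by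
    rw [Lau.coeff_map, hN k hk, map_zero]
  rw [Lau.coeff_add, Lau.coeff_map, Lau.coeff_smul_eq_sum f a n hN,
    Lau.coeff_smul_eq_sum _ a n hN, Lau.coeff_smul_eq_sum _ _ n hN', map_sum,
    ← Finset.sum_add_distrib]
  refine Finset.sum_congr rfl fun k _ => ?_
  rw [h, Lau.coeff_map, Lau.coeffwise, Lau.coeffwise, PowerSeries.coeff_mk, PowerSeries.coeff_mk]

theorem Lau.coeff_C_smul (r : R) (a : Lau R V) (n : ℤ) :
    ((PowerSeries.C r : R⟦X⟧) • a).coeff n = r • a.coeff n := by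
  obtain ⟨N, h0, hN⟩ := a.exists_bound n
  rw [Lau.coeff_smul_eq_sum _ a n hN, Finset.sum_eq_single_of_mem 0 (Finset.mem_range.2 h0)]
  · simp
  · intro k _ hk
    rw [PowerSeries.coeff_C, if_neg hk, zero_smul]

theorem Lau.coeff_X_smul (a : Lau R V) (n : ℤ) :
    ((PowerSeries.X : R⟦X⟧) • a).coeff n = a.coeff (n - 1) := by
  obtain ⟨N, h0, hN⟩ := a.exists_bound n
  rw [Lau.coeff_smul_eq_sum _ a n (N := N + 1) fun k hk => hN k (by omega),
    Finset.sum_eq_single_of_mem 1 (Finset.mem_range.2 (by omega))]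
  · simp
  · intro k _ hk
    rw [PowerSeries.coeff_X, if_neg hk, zero_smul]

theorem Lau.uDu_smul (f : R⟦X⟧) (a : Lau R V) :
    Lau.uDu (f • a) = (PowerSeries.X * AInfFun.duU f) • a + f • Lau.uDu a := by
  apply Lau.ext
  intro n
  obtain ⟨N, -, hN⟩ := a.exists_bound n
  have hN' : ∀ k : ℕ, N ≤ k → (Lau.uDu a).coeff (n - k) = 0 := fun k hk => by
    rw [Lau.coeff_uDu, hN k hk, smul_zero]
  rw [Lau.coeff_add, Lau.coeff_uDu, Lau.coeff_smul_eq_sum f a n hN,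
    Lau.coeff_smul_eq_sum _ a n hN, Lau.coeff_smul_eq_sum _ _ n hN', Finset.smul_sum,
    ← Finset.sum_add_distrib]
  refine Finset.sum_congr rfl fun k _ => ?_
  have : PowerSeries.coeff k (PowerSeries.X * AInfFun.duU f) = (k : ℤ) • PowerSeries.coeff k f := by
    cases k with
    | zero => simp
    | succ k =>
      rw [PowerSeries.coeff_succ_X_mul, AInfFun.duU, PowerSeries.coeff_mk, zsmul_eq_mul]
      push_cast
      rfl
  rw [this, Lau.coeff_uDu, smul_comm (PowerSeries.coeff k f), smul_assoc, ← add_smul]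
  congr 1
  ring

theorem Lau.level_uPow {n k : ℤ} {a : Lau R V} (ha : a ∈ Lau.level (R := R) (V := V) n) :
    Lau.uPow k a ∈ Lau.level (R := R) (V := V) (n + k) := fun i hi => by
  rw [Lau.coeff_uPow']
  exact ha _ (by omega)

end Laurent

section Linearity

variable {K R : Type*} [Field K] [Ring R] [Algebra K R]
variable {𝓡 : ZMod 2 → Submodule K R} [GradedAlgebra 𝓡]
variable {Ob Ob' : Type*} {C : AInfCat 𝓡 Ob} {D : AInfCat 𝓡 Ob'} {F : AInfFun C D}
  {i j k : ZMod 2} {v w : R →ₗ[K] R} {r : R}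

theorem coeffMap_add_left {X : Type*} (a : X →₀ R) :
    coeffMap (v + w) a = coeffMap v a + coeffMap w a := by
  ext x
  rfl

theorem coeffMap_mulLeft {X : Type*} (a : X →₀ R) :
    coeffMap (LinearMap.mulLeft K r ∘ₗ v) a = r • coeffMap v a := by
  ext x
  rfl

theorem chainOp_add_fun {Q : HomBasis Ob} {Q' : HomBasis Ob'}
    {φ φ₁ φ₂ : Q.B → List Q.B → (List Q'.B →₀ R)} (h : ∀ x l, φ x l = φ₁ x l + φ₂ x l)
    (a : Q.CC R) : Q.chainOp 𝓡 i φ a = Q.chainOp 𝓡 i φ₁ a + Q.chainOp 𝓡 i φ₂ a := by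
  rw [HomBasis.chainOp, HomBasis.chainOp, HomBasis.chainOp, ← superExt_add_fun]
  congr 2
  funext w
  obtain ⟨w, hw⟩ := w
  cases w with
  | nil => exact absurd rfl hw.1
  | cons x l => exact (congrArg Q'.toCC (h x l)).trans (toCC_add _ _)

theorem chainOp_smul_fun (hR : IsSuperComm 𝓡) {Q : HomBasis Ob} {Q' : HomBasis Ob'}
    (hr : r ∈ 𝓡 j) (hk : k = j + i)
    {φ φ₁ : Q.B → List Q.B → (List Q'.B →₀ R)} (h : ∀ x l, φ x l = r • φ₁ x l)
    (a : Q.CC R) : Q.chainOp 𝓡 k φ a = r • Q.chainOp 𝓡 i φ₁ a := by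
  subst hk
  induction a using Finsupp.induction_linear with
  | zero => rw [map_zero, map_zero, smul_zero]
  | add a b ha hb => rw [map_add, map_add, smul_add, ha, hb]
  | single w s =>
    obtain ⟨w, hw⟩ := w
    rw [HomBasis.chainOp, HomBasis.chainOp, superExt_single, superExt_single, twist_add, smul_smul,
      mul_eq_twist_mul 𝓡 hR hr, mul_smul]
    congr 1
    cases w with
    | nil => exact absurd rfl hw.1
    | cons x l => exact (congrArg Q'.toCC (h x l)).trans (toCC_smul _ _)

theorem splitSum_smul {B M : Type*} [AddCommGroup M] [Module R M] (l : List B)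
    (f : List B → List B → M) :
    splitSum l (fun u v => r • f u v) = r • splitSum l f := Finset.smul_sum.symm

theorem sgn_smul_twist_smul {M : Type*} [AddCommGroup M] [Module R M] (hr : r ∈ 𝓡 j)
    {a b : ZMod 2} (h : a + k * j = b) (x : M) :
    sgn a • twist 𝓡 k r • x = r • sgn b • x := by
  rw [twist_of_mem 𝓡 k j r hr, smul_assoc, smul_smul, ← sgn_add, h, smul_sgn_smul]

theorem wd_mem_list {Q : HomBasis Ob} (l : List Q.B) : (wd l : List Q.B →₀ R) ∈ parSub 𝓡 (Q.eps l) :=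
  wd_mem 𝓡 l

variable (F)

theorem AInfCat.B11_add (C : AInfCat 𝓡 Ob) (a : C.CC R) : C.B11 i (v + w) a = C.B11 i v a + C.B11 i w a := by
  refine chainOp_add_fun (fun x l => ?_) a
  simp only [cats_cons, cats_nil, toTen_eq, AInfCat.vm, coeffMap_add_left, map_add, AddMonoidHom.add_apply,
    smul_add, splitSum_add]

theorem AInfCat.b11_add (C : AInfCat 𝓡 Ob) (a : C.CC R) : C.b11 i (v + w) a = C.b11 i v a + C.b11 i w a := by
  refine chainOp_add_fun (fun x l => ?_) a
  simp only [cats_cons, cats_nil, toTen_eq, AInfCat.vm, AInfCat.mT, coeffMap_add_left, map_add,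
    AddMonoidHom.add_apply, smul_add, splitSum_add]

theorem AInfFun.H1_add (a : C.CC R) : F.H1 i (v + w) a = F.H1 i v a + F.H1 i w a := by
  refine chainOp_add_fun (fun x l => ?_) a
  simp only [cats_cons, cats_nil, toTen_eq, AInfCat.vm, AInfFun.FT, coeffMap_add_left, map_add,
    AddMonoidHom.add_apply, smul_add, splitSum_add]

theorem AInfFun.H2_add (a : C.CC R) : F.H2 i (v + w) a = F.H2 i v a + F.H2 i w a := by
  refine chainOp_add_fun (fun x l => ?_) a
  simp only [cats_cons, cats_nil, toTen_eq, AInfFun.vone, AInfCat.mT, coeffMap_add_left, map_add,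
    AddMonoidHom.add_apply, smul_add, splitSum_add]

theorem AInfFun.H3_add (a : C.CC R) : F.H3 i (v + w) a = F.H3 i v a + F.H3 i w a := by
  refine chainOp_add_fun (fun x l => ?_) a
  simp only [cats_cons, cats_nil, toTen_eq, AInfFun.vone, coeffMap_add_left, map_add,
    AddMonoidHom.add_apply, smul_add, splitSum_add]

theorem AInfCat.nabla_add (C : AInfCat 𝓡 Ob) (a : C.CCu) : C.nabla i (v + w) a = C.nabla i v a + C.nabla i w a := by
  apply Lau.ext
  intro n
  simp only [Lau.coeff_add, C.coeff_nabla, coeffMap_add_left, C.B11_add, C.b11_add]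
  abel

theorem AInfFun.nablaCone_add (a : F.Cone) :
    F.nablaCone i (v + w) a = F.nablaCone i v a + F.nablaCone i w a := by
  refine Prod.ext (C.nabla_add a.1) ?_
  show D.nabla i (v + w) a.2 - F.H i (v + w) (Lau.map (C.signInv 𝓡) a.1) =
    D.nabla i v a.2 - F.H i v (Lau.map (C.signInv 𝓡) a.1) +
      (D.nabla i w a.2 - F.H i w (Lau.map (C.signInv 𝓡) a.1))
  have : F.H i (v + w) (Lau.map (C.signInv 𝓡) a.1) =
      F.H i v (Lau.map (C.signInv 𝓡) a.1) + F.H i w (Lau.map (C.signInv 𝓡) a.1) := by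
    apply Lau.ext
    intro n
    simp only [Lau.coeff_add, F.coeff_H, F.H1_add, F.H2_add, F.H3_add]
    abel
  rw [D.nabla_add, this]
  abel

theorem AInfCat.B11_mulLeft (C : AInfCat 𝓡 Ob) (hR : IsSuperComm 𝓡) (hr : r ∈ 𝓡 j) (a : C.CC R) :
    C.B11 (j + i) (LinearMap.mulLeft K r ∘ₗ v) a = r • C.B11 i v a := by
  refine chainOp_smul_fun hR hr rfl (fun x l => ?_) a
  simp only [← splitSum_smul]
  refine splitSum_congr fun l₁ _ _ => splitSum_congr fun l₂ _ _ => splitSum_congr fun l₃ l₄ _ => ?_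
  simp only [cats_cons, cats_nil, toTen_eq, word_eq, AInfCat.vm, coeffMap_mulLeft, letH_smul,
    smul_cat, AInfCat.unitAt]
  rw [cat_smul 𝓡 hR (wd_mem_list l₂), cat_smul 𝓡 hR (wd_mem_list _), ← twist_add, eps_unit]
  exact sgn_smul_twist_smul hr (by grind) _

theorem AInfCat.b11_mulLeft (C : AInfCat 𝓡 Ob) (hR : IsSuperComm 𝓡) (hr : r ∈ 𝓡 j) (a : C.CC R) :
    C.b11 (j + i) (LinearMap.mulLeft K r ∘ₗ v) a = r • C.b11 i v a := by
  refine chainOp_smul_fun hR hr rfl (fun x l => ?_) a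
  simp only [← splitSum_smul]
  refine splitSum_congr fun l₁ _ _ => splitSum_congr fun l₂ _ _ => splitSum_congr fun l₃ _ _ =>
    splitSum_congr fun l₄ l₅ _ => ?_
  simp only [cats_cons, cats_nil, toTen_eq, word_eq, AInfCat.vm, coeffMap_mulLeft, letH_smul,
    smul_cat]
  rw [cat_smul 𝓡 hR (wd_mem_list l₃), AInfCat.mT, superExt_smul, letH_smul, smul_cat, ← twist_add]
  exact sgn_smul_twist_smul hr (by grind) _

theorem AInfFun.H1_mulLeft (hR : IsSuperComm 𝓡) (hr : r ∈ 𝓡 j) (a : C.CC R) :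
    F.H1 (j + i) (LinearMap.mulLeft K r ∘ₗ v) a = r • F.H1 i v a := by
  refine chainOp_smul_fun hR hr (add_assoc j i 1) (fun x l => ?_) a
  simp only [← splitSum_smul]
  refine splitSum_congr fun l₁ _ _ => splitSum_congr fun l₂ _ _ => splitSum_congr fun l₃ _ _ =>
    splitSum_congr fun l₄ l₅ _ => ?_
  simp only [cats_cons, cats_nil, toTen_eq, word_eq, AInfCat.vm, coeffMap_mulLeft, letH_smul,
    smul_cat]
  rw [cat_smul 𝓡 hR (wd_mem_list l₃), AInfFun.FT, superExt_smul, letH_smul, smul_cat, ← twist_add]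
  exact sgn_smul_twist_smul hr (by grind) _

theorem AInfFun.H2_mulLeft (hR : IsSuperComm 𝓡) (hr : r ∈ 𝓡 j) (a : C.CC R) :
    F.H2 (j + i) (LinearMap.mulLeft K r ∘ₗ v) a = r • F.H2 i v a := by
  refine chainOp_smul_fun hR hr (add_assoc j i 1) (fun x l => ?_) a
  simp only [← splitSum_smul]
  refine splitSum_congr fun l₁ _ _ => splitSum_congr fun l₂ _ _ => splitSum_congr fun l₃ _ _ =>
    splitSum_congr fun l₄ _ _ => splitSum_congr fun l₅ _ _ => splitSum_congr fun l₆ l₇ _ => ?_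
  simp only [cats_cons, cats_nil, toTen_eq, AInfFun.vone, coeffMap_mulLeft, letH_smul,
    smul_cat]
  have h := F.isBar.homF l₄
  rw [zero_add, par_list] at h
  rw [cat_smul 𝓡 hR h, AInfCat.mT, superExt_smul, letH_smul, smul_cat, ← twist_add]
  exact sgn_smul_twist_smul hr (by grind) _

theorem AInfFun.H3_mulLeft (hR : IsSuperComm 𝓡) (hr : r ∈ 𝓡 j) (a : C.CC R) :
    F.H3 (j + i) (LinearMap.mulLeft K r ∘ₗ v) a = r • F.H3 i v a := by
  refine chainOp_smul_fun hR hr (add_assoc j i 1) (fun x l => ?_) a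
  simp only [← splitSum_smul]
  refine splitSum_congr fun l₁ _ _ => splitSum_congr fun l₂ _ _ => splitSum_congr fun l₃ _ _ =>
    splitSum_congr fun l₄ _ _ => splitSum_congr fun l₅ l₆ _ => ?_
  simp only [cats_cons, cats_nil, toTen_eq, word_eq, AInfFun.vone, coeffMap_mulLeft, letH_smul,
    smul_cat]
  have h := F.isBar.homF l₃
  rw [zero_add, par_list] at h
  rw [cat_smul 𝓡 hR h, cat_smul 𝓡 hR (wd_mem_list _), ← twist_add, eps_unit]
  exact sgn_smul_twist_smul hr (by grind) _

theorem AInfCat.nabla_mulLeft (C : AInfCat 𝓡 Ob) (hR : IsSuperComm 𝓡) (hr : r ∈ 𝓡 j) (a : C.CCu) :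
    C.nabla (j + i) (LinearMap.mulLeft K r ∘ₗ v) a = PowerSeries.C r • C.nabla i v a := by
  apply Lau.ext
  intro n
  simp only [Lau.coeff_C_smul, C.coeff_nabla, coeffMap_mulLeft, C.B11_mulLeft hR hr,
    C.b11_mulLeft hR hr, smul_sub]

theorem AInfFun.nablaCone_mulLeft (hR : IsSuperComm 𝓡) (hr : r ∈ 𝓡 j) (a : F.Cone) :
    F.nablaCone (j + i) (LinearMap.mulLeft K r ∘ₗ v) a = PowerSeries.C r • F.nablaCone i v a := by
  refine Prod.ext (C.nabla_mulLeft hR hr a.1) ?_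
  show D.nabla (j + i) _ a.2 - F.H (j + i) _ (Lau.map (C.signInv 𝓡) a.1) =
    PowerSeries.C r • (D.nabla i v a.2 - F.H i v (Lau.map (C.signInv 𝓡) a.1))
  rw [D.nabla_mulLeft hR hr, smul_sub]
  congr 1
  apply Lau.ext
  intro n
  simp only [Lau.coeff_C_smul, F.coeff_H, F.H1_mulLeft hR hr, F.H2_mulLeft hR hr,
    F.H3_mulLeft hR hr, smul_sub, smul_add]

/-! ### The Leibniz rule -/

theorem AInfCat.nabla_smul (C : AInfCat 𝓡 Ob) (hv : v ∈ superDer 𝓡 i) (f : R⟦X⟧) (a : C.CCu) :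
    C.nabla i v (f • a) =
      AInfFun.derU v f • a + AInfFun.derU (twist 𝓡 i) f • C.nabla i v a := by
  have h1 := Lau.map_smul_leibniz (δ := v.toAddMonoidHom) (σ := (twist 𝓡 i).toAddMonoidHom)
    (fun r x => coeffMap_smul hv r x) f a
  have h2 := Lau.map_smul (twist 𝓡 i).toAddMonoidHom (C.b11 i v)
    (fun r x => C.chainOp_smul 𝓡 i _ r x) f a
  have h3 := Lau.map_smul (twist 𝓡 i).toAddMonoidHom (C.B11 i v)
    (fun r x => C.chainOp_smul 𝓡 i _ r x) f a
  simp only [AInfCat.nabla, AddMonoidHom.sub_apply, AddMonoidHom.comp_apply, h1, h2, h3,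
    smul_sub, Lau.uPow_smul, AInfFun.derU]
  abel

theorem AInfFun.H_signInv_smul (f : R⟦X⟧) (a : C.CCu) :
    F.H i v (Lau.map (C.signInv 𝓡) (f • a)) =
      AInfFun.derU (twist 𝓡 i) f • F.H i v (Lau.map (C.signInv 𝓡) a) := by
  have hs := Lau.map_smul (twist 𝓡 1).toAddMonoidHom (C.signInv 𝓡)
    (fun r x => AInfFun.signInv_smul C.toHomBasis r x) f a
  have h : ∀ T : C.CC R →+ D.CC R, (∀ (r : R) x, T (r • x) = twist 𝓡 (i + 1) r • T x) →
      Lau.map T (Lau.map (C.signInv 𝓡) (f • a)) =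
        AInfFun.derU (twist 𝓡 i) f • Lau.map T (Lau.map (C.signInv 𝓡) a) := by
    intro T hT
    rw [hs, Lau.map_smul (twist 𝓡 (i + 1)).toAddMonoidHom T hT]
    congr 1
    ext n
    simp only [Lau.coeffwise, AInfFun.derU, PowerSeries.coeff_mk]
    show twist 𝓡 (i + 1) (twist 𝓡 1 _) = twist 𝓡 i _
    rw [twist_add, twist_twist]
  have h1 : ∀ (r : R) x, (F.H2 i v - F.H1 i v) (r • x) =
      twist 𝓡 (i + 1) r • (F.H2 i v - F.H1 i v) x := fun r x => by
    rw [AddMonoidHom.sub_apply, AddMonoidHom.sub_apply, smul_sub]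
    exact congrArg₂ _ (C.chainOp_smul 𝓡 (i + 1) _ r x) (C.chainOp_smul 𝓡 (i + 1) _ r x)
  simp only [AInfFun.H, AddMonoidHom.add_apply, AddMonoidHom.comp_apply, h _ h1,
    h (F.H3 i v) (fun r x => C.chainOp_smul 𝓡 (i + 1) _ r x), smul_add, Lau.uPow_smul]

theorem AInfFun.nablaCone_smul (hv : v ∈ superDer 𝓡 i) (f : R⟦X⟧) (a : F.Cone) :
    F.nablaCone i v (f • a) =
      AInfFun.derU v f • a + AInfFun.derU (twist 𝓡 i) f • F.nablaCone i v a := by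
  refine Prod.ext (C.nabla_smul hv f a.1) ?_
  show D.nabla i v (f • a.2) - F.H i v (Lau.map (C.signInv 𝓡) (f • a.1)) =
    AInfFun.derU v f • a.2 + AInfFun.derU (twist 𝓡 i) f •
      (D.nabla i v a.2 - F.H i v (Lau.map (C.signInv 𝓡) a.1))
  rw [D.nabla_smul hv, F.H_signInv_smul, smul_sub]
  abel

/-! ### Multiplication by powers of `u` -/

/-- Multiplication by `u^k` on the cone. -/
def AInfFun.coneUPow (k : ℤ) : F.Cone →+ F.Cone := (Lau.uPow k).prodMap (Lau.uPow k)

theorem AInfFun.dCone_uPow (k : ℤ) (a : F.Cone) :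
    F.dCone (F.coneUPow k a) = F.coneUPow k (F.dCone a) := by
  refine Prod.ext (AInfFun.dMinus_uPow C k a.1) ?_
  show D.dMinus (Lau.uPow k a.2) + Lau.map F.push (Lau.map (C.signInv 𝓡) (Lau.uPow k a.1)) =
    Lau.uPow k (D.dMinus a.2 + Lau.map F.push (Lau.map (C.signInv 𝓡) a.1))
  rw [AInfFun.dMinus_uPow, Lau.map_uPow, Lau.map_uPow, map_add]

theorem AInfCat.nabla_uPow (C : AInfCat 𝓡 Ob) (k : ℤ) (a : C.CCu) :
    C.nabla i v (Lau.uPow k a) = Lau.uPow k (C.nabla i v a) := by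
  apply Lau.ext
  intro n
  simp only [C.coeff_nabla, Lau.coeff_uPow', add_sub_right_comm]

theorem AInfFun.nablaCone_uPow (k : ℤ) (a : F.Cone) :
    F.nablaCone i v (F.coneUPow k a) = F.coneUPow k (F.nablaCone i v a) := by
  refine Prod.ext (C.nabla_uPow k a.1) ?_
  show D.nabla i v (Lau.uPow k a.2) - F.H i v (Lau.map (C.signInv 𝓡) (Lau.uPow k a.1)) =
    Lau.uPow k (D.nabla i v a.2 - F.H i v (Lau.map (C.signInv 𝓡) a.1))
  rw [D.nabla_uPow, map_sub, Lau.map_uPow]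
  congr 1
  apply Lau.ext
  intro n
  simp only [F.coeff_H, Lau.coeff_uPow', add_sub_right_comm]

theorem AInfFun.coneUPow_coneUPow (k l : ℤ) (a : F.Cone) :
    F.coneUPow k (F.coneUPow l a) = F.coneUPow (k + l) a := by
  refine Prod.ext ?_ ?_ <;>
  · apply Lau.ext
    intro n
    show (Lau.uPow k (Lau.uPow l _)).coeff n = (Lau.uPow (k + l) _).coeff n
    simp only [Lau.coeff_uPow', sub_sub]

theorem AInfFun.coneUPow_zero (a : F.Cone) : F.coneUPow 0 a = a := by
  refine Prod.ext ?_ ?_ <;>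
  · apply Lau.ext
    intro n
    show (Lau.uPow 0 _).coeff n = _
    rw [Lau.coeff_uPow', sub_zero]
    rfl

theorem AInfFun.coneUPow_level {n k : ℤ} {a : F.Cone} (ha : a ∈ F.level n) :
    F.coneUPow k a ∈ F.level (n + k) := ⟨Lau.level_uPow ha.1, Lau.level_uPow ha.2⟩

end Linearity

/-! ### Variation of operators under an even derivation -/

section Variation

variable {K R : Type*} [Field K] [Ring R] [Algebra K R]
variable {𝓡 : ZMod 2 → Submodule K R} [GradedAlgebra 𝓡]
variable {X Y Z W : Type*} {e : R →ₗ[K] R} {i j k : ZMod 2}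

/-- The operator on a free module given by `e` on coefficients and by `γ` on the basis. -/
def gx (𝓡 : ZMod 2 → Submodule K R) [GradedAlgebra 𝓡] (e : R →ₗ[K] R) (γ : X → (X →₀ R)) :
    (X →₀ R) →+ (X →₀ R) :=
  coeffMap e + superExt 𝓡 0 γ

theorem gx_apply (γ : X → (X →₀ R)) (a : X →₀ R) :
    gx 𝓡 e γ a = coeffMap e a + superExt 𝓡 0 γ a := rfl

theorem gx_smul (he : e ∈ superDer 𝓡 0) (γ : X → (X →₀ R)) (r : R) (a : X →₀ R) :
    gx 𝓡 e γ (r • a) = e r • a + r • gx 𝓡 e γ a := by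
  rw [gx_apply, gx_apply, coeffMap_smul he, superExt_smul, twist_zero, smul_add, add_assoc]

theorem gx_wd (he : e ∈ superDer 𝓡 0) (γ : X → (X →₀ R)) (x : X) : gx 𝓡 e γ (wd x) = γ x := by
  rw [gx_apply, coeffMap_wd he, zero_add, superExt_single_one]

variable {γ : X → (X →₀ R)} {γ' : Y → (Y →₀ R)} {γ'' : Z → (Z →₀ R)} {δ : W → (W →₀ R)}

/-- `Φ'` is the commutator with `Φ` of the operators given by `γ'` and `γ`. -/
def Var (𝓡 : ZMod 2 → Submodule K R) [GradedAlgebra 𝓡] (e : R →ₗ[K] R) (γ : X → (X →₀ R))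
    (γ' : Y → (Y →₀ R)) (i : ZMod 2) (Φ Φ' : X → (Y →₀ R)) : Prop :=
  ∀ x, gx 𝓡 e γ' (Φ x) = superExt 𝓡 i Φ (γ x) + Φ' x

variable {Φ Φ' : X → (Y →₀ R)} {Ψ Ψ' : Y → (Z →₀ R)}

theorem Var.ext (he : e ∈ superDer 𝓡 0) (h : Var 𝓡 e γ γ' i Φ Φ') (a : X →₀ R) :
    gx 𝓡 e γ' (superExt 𝓡 i Φ a) = superExt 𝓡 i Φ (gx 𝓡 e γ a) + superExt 𝓡 i Φ' a := by
  induction a using Finsupp.induction_linear with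
  | zero => simp
  | add a b ha hb => simp only [map_add, ha, hb]; abel
  | single x r =>
    rw [show Finsupp.single x r = r • (wd x : X →₀ R) by simp, superExt_smul, gx_smul he, gx_smul he,
      gx_wd he, superExt_single_one, h x, map_add, superExt_smul, superExt_smul, superExt_smul,
      superExt_single_one, superExt_single_one, superDer_twist he, zero_mul, sgn_zero, one_smul,
      smul_add, add_assoc]

theorem Var.comp (he : e ∈ superDer 𝓡 0) (hΦ : Var 𝓡 e γ γ' i Φ Φ') (hΨ : Var 𝓡 e γ' γ'' j Ψ Ψ') :
    Var 𝓡 e γ γ'' (j + i) (fun x => superExt 𝓡 j Ψ (Φ x))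
      (fun x => superExt 𝓡 j Ψ (Φ' x) + superExt 𝓡 j Ψ' (Φ x)) := fun x => by
  rw [hΨ.ext he, hΦ x, map_add, superExt_comp, add_assoc, add_comm j i]

theorem Var.congr {Φ'' : X → (Y →₀ R)} (h : Var 𝓡 e γ γ' i Φ Φ') (h' : ∀ x, Φ' x = Φ'' x) :
    Var 𝓡 e γ γ' i Φ Φ'' := fun x => by rw [h x, h']

theorem Var.add (h : Var 𝓡 e γ γ' i Φ Φ') {Ξ Ξ' : X → (Y →₀ R)} (h' : Var 𝓡 e γ γ' i Ξ Ξ') :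
    Var 𝓡 e γ γ' i (fun x => Φ x + Ξ x) (fun x => Φ' x + Ξ' x) := fun x => by
  rw [map_add, h x, h' x, superExt_add_fun, add_add_add_comm]

theorem Var.zsmul (h : Var 𝓡 e γ γ' i Φ Φ') (n : ℤ) :
    Var 𝓡 e γ γ' i (fun x => n • Φ x) (fun x => n • Φ' x) := fun x => by
  rw [map_zsmul, h x, superExt_zsmul_fun, smul_add]

theorem var_self (i : ZMod 2) (Φ : X → (Y →₀ R)) :
    Var 𝓡 e γ γ' i Φ fun x => gx 𝓡 e γ' (Φ x) - superExt 𝓡 i Φ (γ x) := fun _ =>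
  (add_sub_cancel _ _).symm

theorem var_wd (he : e ∈ superDer 𝓡 0) (γ : X → (X →₀ R)) : Var 𝓡 e γ γ 0 wd fun _ => 0 :=
  fun x => by rw [gx_wd he, superExt_basis, add_zero]

variable [Par X] [Par Y] [Par Z] [Par W]

/-- The operator on a tensor product of free modules. -/
def gpair (𝓡 : ZMod 2 → Submodule K R) [GradedAlgebra 𝓡] (γ : X → (X →₀ R)) (γ' : Y → (Y →₀ R))
    (p : X × Y) : X × Y →₀ R := tm 𝓡 (γ p.1) (wd p.2) + tm 𝓡 (wd p.1) (γ' p.2)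

theorem HomF.mem {f : X → (Y →₀ R)} (h : HomF 𝓡 0 f) (x : X) : f x ∈ parSub 𝓡 (par x) := by
  have := h x
  rwa [zero_add] at this

theorem gx_tm (hR : IsSuperComm 𝓡) (he : e ∈ superDer 𝓡 0) (hγ : HomF 𝓡 0 γ) (a : X →₀ R)
    (b : Y →₀ R) : gx 𝓡 e (gpair 𝓡 γ γ') (tm 𝓡 a b) =
      tm 𝓡 (gx 𝓡 e γ a) b + tm 𝓡 a (gx 𝓡 e γ' b) := by
  induction a using Finsupp.induction_linear with
  | zero => simp
  | add a a' ha ha' => simp only [map_add, AddMonoidHom.add_apply, ha, ha']; abel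
  | single x r =>
    induction b using Finsupp.induction_linear with
    | zero => simp
    | add b b' hb hb' => simp only [map_add, hb, hb']; abel
    | single y s =>
      have hx := single_mem_parSub (R := R) 𝓡 x
      rw [show Finsupp.single x r = r • (wd x : X →₀ R) by simp,
        show Finsupp.single y s = s • (wd y : Y →₀ R) by simp, smul_tm, tm_smul 𝓡 hR hx, tm_one_one,
        gx_smul he, gx_smul he, gx_smul he, gx_smul he, gx_wd he, gx_wd he, gx_wd he, map_add,
        map_add, AddMonoidHom.add_apply, smul_tm, smul_tm, tm_smul 𝓡 hR hx,
        tm_smul 𝓡 hR (hγ.mem x), smul_tm, smul_tm, tm_smul 𝓡 hR hx, tm_smul 𝓡 hR hx, tm_one_one,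
        superDer_twist he, zero_mul, sgn_zero, one_smul, gpair]
      simp only [smul_add]
      abel

theorem homF_gpair {γ : X → (X →₀ R)} {γ' : Y → (Y →₀ R)} (h : HomF 𝓡 0 γ) (h' : HomF 𝓡 0 γ') :
    HomF 𝓡 0 (gpair 𝓡 γ γ') := fun p => by
  rw [zero_add]
  exact add_mem (tm_mem_parSub 𝓡 (h.mem p.1) (single_mem_parSub 𝓡 p.2))
    (tm_mem_parSub 𝓡 (single_mem_parSub 𝓡 p.1) (h'.mem p.2))

/-- The tensor product of two homogeneous maps. -/
def tmap (𝓡 : ZMod 2 → Submodule K R) [GradedAlgebra 𝓡] (c : ZMod 2) (A : X → (Z →₀ R))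
    (B : Y → (W →₀ R)) (p : X × Y) : Z × W →₀ R := sgn (c * par p.1) • tm 𝓡 (A p.1) (B p.2)

theorem tmap_tm (hR : IsSuperComm 𝓡) {A : X → (Z →₀ R)} {B : Y → (W →₀ R)} (hA : HomF 𝓡 i A)
    {σ : ZMod 2} {s : X →₀ R} (hs : s ∈ parSub 𝓡 σ) (t : Y →₀ R) :
    superExt 𝓡 (i + j) (tmap 𝓡 j A B) (tm 𝓡 s t) =
      sgn (j * σ) • tm 𝓡 (superExt 𝓡 i A s) (superExt 𝓡 j B t) := by
  refine parSub_induction 𝓡 (fun s => superExt 𝓡 (i + j) (tmap 𝓡 j A B) (tm 𝓡 s t) =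
      sgn (j * σ) • tm 𝓡 (superExt 𝓡 i A s) (superExt 𝓡 j B t)) (by simp)
    (fun a a' ha ha' => by simp only [map_add, AddMonoidHom.add_apply, ha, ha', smul_add])
    (fun x r hr => ?_) hs
  induction t using Finsupp.induction_linear with
  | zero => simp
  | add b b' hb hb' => simp only [map_add, hb, hb', smul_add]
  | single y q =>
    have h1 : twist 𝓡 (i + j) r = sgn (j * (σ + par x)) • twist 𝓡 i r := by
      rw [twist_add, twist_of_mem 𝓡 j _ _ hr, map_zsmul]
    rw [tm_single_single, superExt_single, superExt_single, superExt_single, twist_mul, smul_tm,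
      tm_smul 𝓡 hR (hA x), ← twist_add, h1, tmap, smul_mul_assoc, smul_assoc, mul_smul,
      smul_sgn_smul, smul_sgn_smul, sgn_smul_sgn_smul,
      ← twist_add, show i + j + par x = i + par x + j by ring]
    exact sgn_smul_congr (by grind) rfl

theorem Var.tensor (hR : IsSuperComm 𝓡) (he : e ∈ superDer 𝓡 0) (hγ : HomF 𝓡 0 γ)
    (hγ'' : HomF 𝓡 0 γ'') {A A' : X → (Z →₀ R)} {B B' : Y → (W →₀ R)} (hA : HomF 𝓡 i A)
    (h : Var 𝓡 e γ γ'' i A A') (h' : Var 𝓡 e γ' δ j B B') :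
    Var 𝓡 e (gpair 𝓡 γ γ') (gpair 𝓡 γ'' δ) (i + j) (tmap 𝓡 j A B)
      (fun p => tmap 𝓡 j A' B p + tmap 𝓡 j A B' p) := fun p => by
  rw [gpair, map_add, tmap_tm hR hA (hγ.mem p.1), tmap_tm hR hA (single_mem_parSub 𝓡 p.1),
    superExt_single_one, superExt_single_one]
  simp only [tmap]
  rw [map_zsmul, gx_tm hR he hγ'', h, h', map_add, map_add, AddMonoidHom.add_apply]
  simp only [smul_add]
  abel

end Variation

/-! ### Variation of operators on words -/

section Words

variable {K R : Type*} [Field K] [Ring R] [Algebra K R]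
variable {𝓡 : ZMod 2 → Submodule K R} [GradedAlgebra 𝓡]
variable {Ob Ob' : Type*} {Q : HomBasis Ob} {Q' : HomBasis Ob'} {e : R →ₗ[K] R} {i j k : ZMod 2}

/-- The derivation `γ` acting on the letters of a word one by one. -/
def gw (𝓡 : ZMod 2 → Submodule K R) [GradedAlgebra 𝓡] (γ : Q.B → (Q.B →₀ R)) :
    List Q.B → (List Q.B →₀ R)
  | [] => 0
  | x :: l => catHom 𝓡 (letH (γ x)) (wd l) + catHom 𝓡 (wd [x]) (gw 𝓡 γ l)

variable {γ : Q.B → (Q.B →₀ R)} {γ' : Q'.B → (Q'.B →₀ R)}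

theorem gw_append (s t : List Q.B) :
    gw 𝓡 γ (s ++ t) = catHom 𝓡 (gw 𝓡 γ s) (wd t) + catHom 𝓡 (wd s) (gw 𝓡 γ t) := by
  induction s with
  | nil => rw [gw, zero_cat, zero_add, one_cat, List.nil_append]
  | cons x s ih =>
    rw [← List.singleton_append (x := x) (l := s), ← wd_cat_wd 𝓡, cat_assoc, List.append_assoc,
      List.singleton_append, List.singleton_append, gw, gw, ih, map_add, add_cat, cat_assoc,
      cat_assoc, wd_cat_wd, add_assoc]

theorem gw_singleton (x : Q.B) : gw 𝓡 γ [x] = letH (γ x) := by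
  rw [gw, gw, map_zero, add_zero, cat_one]

theorem homF_gw (hγ : HomF 𝓡 0 γ) : HomF 𝓡 0 (gw 𝓡 γ) := fun l => by
  rw [zero_add, par_list]
  induction l with
  | nil => exact zero_mem _
  | cons x l ih =>
    rw [Q.eps_cons]
    exact add_mem (cat_mem_parSub 𝓡 (letH_mem_parSub 𝓡 (hγ.mem x)) (wd_mem 𝓡 l))
      (cat_mem_parSub 𝓡 (letH_wd (R := R) x ▸ letH_mem_parSub 𝓡 (wd_letter_mem 𝓡 x)) ih)

theorem gw_mem {l : List Q.B} {S : Set (List Q.B)}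
    (h : ∀ u x v y, u ++ x :: v = l → γ x y ≠ 0 → u ++ y :: v ∈ S) :
    gw 𝓡 γ l ∈ supported R R S := by
  induction l generalizing S with
  | nil => exact zero_mem _
  | cons x l ih =>
    refine add_mem (cat_mem_supported 𝓡 (S := {w | ∃ y, w = [y] ∧ γ x y ≠ 0}) (T := {l}) ?_
      (letH_mem_supported (S := {y | γ x y ≠ 0}) (U := {w | ∃ y, w = [y] ∧ γ x y ≠ 0})
        (fun y hy => ⟨y, rfl, hy⟩)
        (fun y hy => Finsupp.mem_support_iff.1 hy)) (single_mem_supported R _ rfl))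
      (cat_mem_supported 𝓡 (S := {[x]}) (T := {w | x :: w ∈ S}) ?_
        (single_mem_supported R _ rfl)
        (ih fun u x' v y hu hy => h (x :: u) x' v y (by rw [← hu]; rfl) hy))
    · rintro _ ⟨y, rfl, hy⟩ _ rfl
      exact h [] x _ y rfl hy
    · rintro _ rfl w hw
      exact hw

theorem gw_mem_length (l : List Q.B) :
    gw 𝓡 γ l ∈ supported R R {w | w.length = l.length} :=
  gw_mem fun u x v y h _ => by rw [← h]; simp

theorem gw_mem_ne (l : List Q.B) : gw 𝓡 γ l ∈ supported R R {w : List Q.B | w ≠ []} :=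
  gw_mem fun u x v y _ _ => by simp

theorem var_app (he : e ∈ superDer 𝓡 0) :
     Var 𝓡 e (gpair 𝓡 (gw 𝓡 γ) (gw 𝓡 γ)) (gw 𝓡 γ) 0 app fun _ => 0 := fun p => by
  rw [app, gx_wd he, gw_append, add_zero, gpair, map_add]
  rfl

theorem gx_cat (hR : IsSuperComm 𝓡) (he : e ∈ superDer 𝓡 0) (hγ : HomF 𝓡 0 γ)
    (a b : List Q.B →₀ R) : gx 𝓡 e (gw 𝓡 γ) (catHom 𝓡 a b) =
    catHom 𝓡 (gx 𝓡 e (gw 𝓡 γ) a) b + catHom 𝓡 a (gx 𝓡 e (gw 𝓡 γ) b) := by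
  rw [catHom_apply, (var_app he).ext he, gx_tm hR he (homF_gw hγ), map_add,
    superExt_zero_fun, add_zero]
  rfl

theorem gx_letH (he : e ∈ superDer 𝓡 0) (a : Q.B →₀ R) : gx 𝓡 e (gw 𝓡 γ) (letH a) = letH (gx 𝓡 e γ a) := by
  induction a using Finsupp.induction_linear with
  | zero => simp
  | add a b ha hb => simp only [map_add, ha, hb]
  | single x r =>
    rw [show Finsupp.single x r = r • (wd x : Q.B →₀ R) by simp, letH_smul, letH_wd, gx_smul he,
      gx_smul he, gx_wd he, gx_wd he, gw_singleton, map_add, letH_smul, letH_smul, letH_wd]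

theorem var_lact (hR : IsSuperComm 𝓡) (he : e ∈ superDer 𝓡 0) (hγ : HomF 𝓡 0 γ)
    {σ : ZMod 2} {s : List Q.B →₀ R} (hs : s ∈ parSub 𝓡 σ) :
    Var 𝓡 e (gpair 𝓡 (gw 𝓡 γ) (gw 𝓡 γ)) (gpair 𝓡 (gw 𝓡 γ) (gw 𝓡 γ)) σ
      (fun p => tm 𝓡 (catHom 𝓡 s (wd p.1)) (wd p.2))
      (fun p => tm 𝓡 (catHom 𝓡 (gx 𝓡 e (gw 𝓡 γ) s) (wd p.1)) (wd p.2)) := fun p => by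
  have h : ∀ a b, superExt 𝓡 σ (fun p : List Q.B × List Q.B => tm 𝓡 (catHom 𝓡 s (wd p.1)) (wd p.2))
    (tm 𝓡 a b) = tm 𝓡 (catHom 𝓡 s a) b := lact_tm 𝓡 hR hs
  rw [gx_tm hR he (homF_gw hγ), gx_cat hR he hγ, gx_wd he, gx_wd he, gpair]
  simp only [map_add, h, AddMonoidHom.add_apply]
  abel

theorem gx_lact_deco (hR : IsSuperComm 𝓡) (he : e ∈ superDer 𝓡 0) (hγ : HomF 𝓡 0 γ)
    (x : Q.B) (l : List Q.B)
    (ih : gx 𝓡 e (gpair 𝓡 (gw 𝓡 γ) (gw 𝓡 γ)) (deco l) = superExt 𝓡 0 deco (gw 𝓡 γ l)) :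
    gx 𝓡 e (gpair 𝓡 (gw 𝓡 γ) (gw 𝓡 γ)) (lact 𝓡 (Q.rdeg x) (letH (wd x)) (deco l)) =
      superExt 𝓡 0 decoP (gw 𝓡 γ (x :: l)) := by
  have hx := letH_mem_parSub 𝓡 (wd_letter_mem (R := R) 𝓡 x)
  rw [lact, (var_lact hR he hγ hx).ext he, ih, gx_letH he, gx_wd he, gw, map_add,
    decoP_cat 𝓡 hR (hγ.mem x), ← letH_wd, decoP_cat 𝓡 hR (wd_letter_mem 𝓡 x), superExt_single_one,
    add_comm]
  rfl

theorem var_deco (hR : IsSuperComm 𝓡) (he : e ∈ superDer 𝓡 0) (hγ : HomF 𝓡 0 γ) :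
     Var 𝓡 e (gw 𝓡 γ) (gpair 𝓡 (gw 𝓡 γ) (gw 𝓡 γ)) 0 deco fun _ => 0 := fun l => by
  rw [add_zero]
  induction l with
  | nil =>
    rw [deco, splitSum_nil, gx_wd he, gw, gpair, gw, zero_tm, map_zero, map_zero, add_zero]
  | cons x l ih =>
    have hx := wd_letter_mem (R := R) (Q := Q) 𝓡 x
    have h := deco_letter_cat 𝓡 hR hx (wd l)
    have h' := gx_lact_deco hR he hγ x l ih
    have hn : gw 𝓡 γ ([] : List Q.B) = 0 := rfl
    rw [letH_wd, wd_cat_wd, superExt_single_one, superExt_single_one, List.singleton_append] at h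
    rw [h, map_add, gx_tm hR he (homF_gw hγ), gx_wd he, gx_wd he, hn, zero_tm, zero_add,
      ← letH_wd, h', gw, map_add, map_add, map_add, deco_letter_cat 𝓡 hR (hγ.mem x),
      decoP_cat 𝓡 hR (hγ.mem x), ← letH_wd, deco_letter_cat 𝓡 hR hx, decoP_cat 𝓡 hR hx]
    abel

theorem var_decoP (hR : IsSuperComm 𝓡) (he : e ∈ superDer 𝓡 0) (hγ : HomF 𝓡 0 γ) :
     Var 𝓡 e (gw 𝓡 γ) (gpair 𝓡 (gw 𝓡 γ) (gw 𝓡 γ)) 0 decoP fun _ => 0 := fun l => by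
  cases l with
  | nil => simp [decoP, gw]
  | cons x l =>
    have h := decoP_cat 𝓡 hR (wd_letter_mem (R := R) (Q := Q) 𝓡 x) (wd l)
    rw [letH_wd, wd_cat_wd, superExt_single_one, superExt_single_one, List.singleton_append] at h
    rw [h, add_zero, ← letH_wd]
    exact gx_lact_deco hR he hγ x l (by rw [var_deco hR he hγ l, add_zero])

theorem var_rot (hR : IsSuperComm 𝓡) (he : e ∈ superDer 𝓡 0) (hγ : HomF 𝓡 0 γ) :
     Var 𝓡 e (gpair 𝓡 (gw 𝓡 γ) (gw 𝓡 γ)) (gpair 𝓡 (gw 𝓡 γ) (gw 𝓡 γ)) 0 rot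
    fun _ => 0 := fun p => by
  have h1 := single_mem_parSub (R := R) 𝓡 p.1
  have h2 := single_mem_parSub (R := R) 𝓡 p.2
  rw [rot, map_zsmul, gx_wd he, gpair, gpair, map_add, rot_tm 𝓡 hR ((homF_gw hγ).mem _) h2,
    rot_tm 𝓡 hR h1 ((homF_gw hγ).mem _), add_zero, smul_add, add_comm]

theorem var_cyc (hR : IsSuperComm 𝓡) (he : e ∈ superDer 𝓡 0) (hγ : HomF 𝓡 0 γ) :
     Var 𝓡 e (gw 𝓡 γ) (gpair 𝓡 (gw 𝓡 γ) (gw 𝓡 γ)) 0 (cyc 𝓡) fun _ => 0 :=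
  ((var_decoP hR he hγ).comp he (var_rot hR he hγ)).congr fun x => by
    rw [map_zero, superExt_zero_fun, add_zero]

theorem var_prj (he : e ∈ superDer 𝓡 0) : Var 𝓡 e (gpair 𝓡 (gw 𝓡 γ) (gw 𝓡 γ)) (gw 𝓡 γ) 0 prj fun _ => 0 := fun p => by
  have hn : gw 𝓡 γ ([] : List Q.B) = 0 := rfl
  obtain ⟨s, t⟩ := p
  rw [prj, gpair, map_add, add_zero, prj_tm_of_ne 𝓡 (gw_mem_ne s), zero_add]
  by_cases hs : s = []
  · subst hs
    rw [if_pos rfl, gx_wd he, prj_tm_nil]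
  · rw [if_neg hs, map_zero, prj_tm_of_ne 𝓡 (single_mem_supported R _ hs)]

end Words

section Words

variable {K R : Type*} [Field K] [Ring R] [Algebra K R]
variable {𝓡 : ZMod 2 → Submodule K R} [GradedAlgebra 𝓡]
variable {Ob Ob' : Type*} {Q : HomBasis Ob} {Q' : HomBasis Ob'} {e : R →ₗ[K] R} {a i j k : ZMod 2}
  {γ : Q.B → (Q.B →₀ R)} {γ' : Q'.B → (Q'.B →₀ R)}

theorem Var.index {X Y : Type*} {γ : X → (X →₀ R)} {γ' : Y → (Y →₀ R)} {Φ Φ' : X → (Y →₀ R)}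
    (h : Var 𝓡 e γ γ' i Φ Φ') (hk : i = k) : Var 𝓡 e γ γ' k Φ Φ' := hk ▸ h

theorem letH_superExt {X : Type*} (f : X → (Q.B →₀ R)) (a : X →₀ R) :
    letH (superExt 𝓡 i f a) = superExt 𝓡 i (fun x => letH (f x)) a := by
  induction a using Finsupp.induction_linear with
  | zero => simp
  | add a b ha hb => simp only [map_add, ha, hb]
  | single x r => rw [superExt_single, superExt_single, letH_smul]

theorem Var.letH {X : Type*} {γ₁ : X → (X →₀ R)} (he : e ∈ superDer 𝓡 0) {F F' : X → (Q'.B →₀ R)}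
    (h : Var 𝓡 e γ₁ γ' i F F') :
    Var 𝓡 e γ₁ (gw 𝓡 γ') i (fun l => letH (F l)) (fun l => RelCyc.letH (F' l)) := fun l => by
  rw [gx_letH he, h l, map_add, letH_superExt]

/-- The convolution of two maps on words. -/
def conv (𝓡 : ZMod 2 → Submodule K R) [GradedAlgebra 𝓡] (c : ZMod 2)
    (A B : List Q.B → (List Q'.B →₀ R)) (l : List Q.B) : List Q'.B →₀ R :=
  splitSum l fun u v => sgn (c * Q.eps u) • catHom 𝓡 (A u) (B v)

variable {A A' B B' : List Q.B → (List Q'.B →₀ R)}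

theorem conv_eq (l : List Q.B) :
    conv 𝓡 j A B l = superExt 𝓡 0 app (superExt 𝓡 i (tmap 𝓡 j A B) (deco l)) := by
  rw [deco, map_splitSum, map_splitSum]
  refine splitSum_congr fun u v _ => ?_
  rw [superExt_single_one, tmap, map_zsmul]
  rfl

theorem Var.conv (hR : IsSuperComm 𝓡) (he : e ∈ superDer 𝓡 0) (hγ : HomF 𝓡 0 γ)
    (hγ' : HomF 𝓡 0 γ') (hA : HomF 𝓡 i A) (h : Var 𝓡 e (gw 𝓡 γ) (gw 𝓡 γ') i A A')
    (h' : Var 𝓡 e (gw 𝓡 γ) (gw 𝓡 γ') j B B') :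
    Var 𝓡 e (gw 𝓡 γ) (gw 𝓡 γ') (i + j) (conv 𝓡 j A B)
      (fun l => RelCyc.conv 𝓡 j A' B l + RelCyc.conv 𝓡 j A B' l) := by
  have h1 := ((var_deco hR he hγ).comp he
    (h.tensor hR he (homF_gw hγ) (homF_gw hγ') hA h')).comp he (var_app he)
  have h2 := (h1.congr (Φ'' := fun l => RelCyc.conv 𝓡 j A' B l + RelCyc.conv 𝓡 j A B' l) fun l => by
    rw [map_zero, zero_add, superExt_zero_fun, add_zero, superExt_add_fun, map_add,
      conv_eq (i := i + j), conv_eq (i := i + j)]).index (k := i + j) (by ring)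
  rwa [show (fun l => superExt 𝓡 0 app (superExt 𝓡 (i + j) (tmap 𝓡 j A B) (deco l))) =
    RelCyc.conv 𝓡 j A B from funext fun l => (conv_eq l).symm] at h2

theorem der_eq_conv (f : List Q.B → (List Q'.B →₀ R)) (j : ZMod 2) (ψ : List Q.B → (Q'.B →₀ R)) :
    der 𝓡 f j ψ = conv 𝓡 j f (conv 𝓡 0 (fun l => letH (ψ l)) f) := by
  funext l
  rw [der, conv]
  refine splitSum_congr fun u r _ => ?_
  rw [conv, cat_splitSum, ← splitSum_zsmul]
  refine splitSum_congr fun v w _ => ?_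
  rw [zero_mul, sgn_zero, one_smul]

variable {F : List Q.B → (Q'.B →₀ R)} {f : List Q.B → (List Q'.B →₀ R)}
  {ψ ψ' : List Q.B → (Q'.B →₀ R)}

theorem conv_zero_left (c : ZMod 2) (l : List Q.B) : conv 𝓡 c (fun _ => 0) B l = 0 :=
  splitSum_eq_zero fun u v _ => by rw [zero_cat, smul_zero]

theorem conv_zero_right (c : ZMod 2) (l : List Q.B) : conv 𝓡 c A (fun _ => 0) l = 0 :=
  splitSum_eq_zero fun u v _ => by rw [map_zero, smul_zero]

theorem Var.der (hR : IsSuperComm 𝓡) (he : e ∈ superDer 𝓡 0) (hγ : HomF 𝓡 0 γ)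
    (hγ' : HomF 𝓡 0 γ') (hf : HomF 𝓡 0 f) (hvf : Var 𝓡 e (gw 𝓡 γ) (gw 𝓡 γ') 0 f fun _ => 0)
    (hψ : HomF 𝓡 j ψ) (h : Var 𝓡 e (gw 𝓡 γ) γ' j ψ ψ') :
    Var 𝓡 e (gw 𝓡 γ) (gw 𝓡 γ') j (der 𝓡 f j ψ) (RelCyc.der 𝓡 f j ψ') := by
  have hl : HomF 𝓡 j fun l => RelCyc.letH (ψ l) := fun l => letH_mem_parSub 𝓡 (hψ l)
  have h1 := ((h.letH he).conv hR he hγ hγ' hl hvf).congr fun l => by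
    rw [conv_zero_right, add_zero]
  have h2 := hvf.conv hR he hγ hγ' hf (h1.index (add_zero j))
  rw [der_eq_conv, der_eq_conv]
  exact (h2.congr fun l => by rw [conv_zero_left, zero_add]).index (zero_add j)

/-- The map of coalgebras with an equivariant corestriction is equivariant. -/
theorem IsBar.var (hR : IsSuperComm 𝓡) (he : e ∈ superDer 𝓡 0) (hγ : HomF 𝓡 0 γ)
    (hγ' : HomF 𝓡 0 γ') (h : IsBar 𝓡 F f) (hF : Var 𝓡 e (gw 𝓡 γ) γ' 0 F fun _ => 0) :
    Var 𝓡 e (gw 𝓡 γ) (gw 𝓡 γ') 0 f fun _ => 0 := by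
  have hv := var_self (𝓡 := 𝓡) (e := e) (γ := gw 𝓡 γ) (γ' := gw 𝓡 γ') 0 f
  set δ : List Q.B → (List Q'.B →₀ R) :=
    fun l => gx 𝓡 e (gw 𝓡 γ') (f l) - superExt 𝓡 0 f (gw 𝓡 γ l) with hδ
  have hl : HomF 𝓡 0 fun l => RelCyc.letH (F l) := fun l => letH_mem_parSub 𝓡 (h.hom l)
  have hc := (hF.letH he).conv hR he hγ hγ' hl hv
  have hrec : ∀ l, f l = (if l = [] then wd [] else 0) + conv 𝓡 0 (fun l => RelCyc.letH (F l)) f l :=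
    fun l => by
    rw [conv]
    simp only [zero_mul, sgn_zero, one_smul]
    exact h.rec_left' l
  have hδl : ∀ l, δ l = conv 𝓡 0 (fun l => RelCyc.letH (F l)) δ l := fun l => by
    have h1 := hc l
    have h3 : superExt 𝓡 0 f (gw 𝓡 γ l) =
        superExt 𝓡 0 (conv 𝓡 0 (fun l => RelCyc.letH (F l)) f) (gw 𝓡 γ l) :=
      superExt_congr_supported 𝓡 0 (fun w (hw : w ≠ []) => by rw [hrec w, if_neg hw, zero_add])
        (gw_mem_ne l)
    have h2 : gx 𝓡 e (gw 𝓡 γ') (f l) =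
        gx 𝓡 e (gw 𝓡 γ') (conv 𝓡 0 (fun l => RelCyc.letH (F l)) f l) := by
      rw [hrec l, map_add]
      split_ifs with hn
      · rw [gx_wd he, gw, zero_add]
      · rw [map_zero, zero_add]
    refine (congrArg₂ (· - ·) (h2.trans h1) h3).trans ?_
    simp only [map_zero, conv_zero_left, zero_add, add_zero, add_sub_cancel_left]
  have hg := h.ext (g := fun l => f l + δ l) fun l => by
    conv_lhs => rw [hrec l, hδl l]
    rw [add_assoc, conv, conv, ← splitSum_add]
    congr 1
    refine splitSum_congr fun u v _ => ?_
    rw [zero_mul, sgn_zero, one_smul, one_smul, map_add]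
  exact hv.congr fun l => by
    have := hg l
    simpa using this

theorem var_idLet (he : e ∈ superDer 𝓡 0) :
    Var 𝓡 e (gw 𝓡 γ) γ 0 (idLet (Q := Q)) fun _ => 0 := fun l => by
  rw [add_zero]
  by_cases hl : l.length = 1
  · obtain ⟨x, rfl⟩ := List.length_eq_one_iff.1 hl
    rw [idLet, gx_wd he, gw_singleton]
    induction γ x using Finsupp.induction_linear with
    | zero => simp
    | add a b ha hb => rw [map_add, map_add, ← ha, ← hb]
    | single y r => rw [letH_single, superExt_single, idLet, twist_zero, Finsupp.smul_single_one]
  · rw [idLet_eq_zero hl, map_zero, superExt_congr_supported 𝓡 0 (g := fun _ => 0)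
      (f := idLet) (fun (w : List Q.B) (hw : w.length = l.length) =>
        idLet_eq_zero (fun h => hl (hw ▸ h))) (gw_mem_length l), superExt_zero_fun]

theorem Var.unmark {X : Type*} {γ₁ : X → (X →₀ R)} (he : e ∈ superDer 𝓡 0) {ψ ψ' : List Q.B → (X →₀ R)}
    (h : Var 𝓡 e (gw 𝓡 γ) γ₁ j ψ ψ') :
    Var 𝓡 e (gpair 𝓡 (gw 𝓡 γ) (gw 𝓡 γ)) γ₁ j (unmark ψ) (RelCyc.unmark ψ') := by
  have h1 := ((var_app he).comp he h).congr (Φ'' := RelCyc.unmark ψ') fun p => by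
    rw [map_zero, zero_add, app, superExt_single_one, RelCyc.unmark]
  rw [show (fun p : List Q.B × List Q.B => superExt 𝓡 j ψ (app p)) = RelCyc.unmark ψ from
    funext fun p => by rw [app, superExt_single_one, RelCyc.unmark]] at h1
  exact h1.index (add_zero j)

theorem Var.xi (hR : IsSuperComm 𝓡) (he : e ∈ superDer 𝓡 0) (hγ : HomF 𝓡 0 γ)
    (hγ' : HomF 𝓡 0 γ') {μ μ' : List Q.B × List Q.B → (Q'.B →₀ R)} (hA : HomF 𝓡 a A)
    (hμ : HomF 𝓡 k μ) (h : Var 𝓡 e (gw 𝓡 γ) (gw 𝓡 γ') a A A')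
    (h' : Var 𝓡 e (gpair 𝓡 (gw 𝓡 γ) (gw 𝓡 γ)) γ' k μ μ')
    (hB : Var 𝓡 e (gw 𝓡 γ) (gw 𝓡 γ') 0 B fun _ => 0) :
    Var 𝓡 e (gpair 𝓡 (gpair 𝓡 (gw 𝓡 γ) (gw 𝓡 γ)) (gpair 𝓡 (gw 𝓡 γ) (gw 𝓡 γ)))
      (gpair 𝓡 (gw 𝓡 γ') (gw 𝓡 γ')) (a + k + 0) (xi 𝓡 k 0 A μ B)
      (fun p => RelCyc.xi 𝓡 k 0 A' μ B p + RelCyc.xi 𝓡 k 0 A μ' B p) := by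
  rintro ⟨⟨u, v⟩, ⟨u', v'⟩⟩
  have hw := wd_mem (R := R) (Q := Q) 𝓡
  have hg := (homF_gw (𝓡 := 𝓡) hγ).mem
  have hμ' := h' (v, u')
  rw [gpair, map_add] at hμ'
  have e1 : (wd ((u, v), (u', v')) : (List Q.B × List Q.B) × (List Q.B × List Q.B) →₀ R) =
    tm 𝓡 (tm 𝓡 (wd u) (wd v)) (tm 𝓡 (wd u') (wd v')) := by rw [tm_one_one, tm_one_one, tm_one_one]
  have key := fun {α₁ α₂ β₁ : ZMod 2} {a₁ a₂ b₁ : List Q.B →₀ R} (h₁ : a₁ ∈ parSub 𝓡 α₁)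
    (h₂ : a₂ ∈ parSub 𝓡 α₂) (h₃ : b₁ ∈ parSub 𝓡 β₁) (b₂ : List Q.B →₀ R) =>
    xi_tm 𝓡 hR (A' := B) (c := 0) hA hμ h₁ h₂ h₃ b₂
  simp only [gpair, ← tm_one_one 𝓡, map_add, AddMonoidHom.add_apply]
  rw [key (hg u) (hw v) (hw u'), key (hw u) (hg v) (hw u'), key (hw u) (hw v) (hg u'),
    key (hw u) (hw v) (hw u')]
  simp only [tm_one_one, superExt_single_one, RelCyc.xi, map_zsmul]
  rw [gx_tm hR he (homF_gw hγ'), gx_cat hR he hγ', gx_letH he, h u, hμ', hB v', add_zero]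
  simp only [map_add, AddMonoidHom.add_apply, smul_add, par_list]
  abel

theorem gop_eq_xi (k c : ZMod 2) (μ : List Q.B × List Q.B → (Q'.B →₀ R)) (p : List Q.B × List Q.B) :
    gop 𝓡 k c A μ B p = superExt 𝓡 i (xi 𝓡 k c A μ B) (tmap 𝓡 0 deco decoP p) := by
  obtain ⟨s, t⟩ := p
  rw [tmap, zero_mul, sgn_zero, one_smul]
  cases t with
  | nil => rw [gop, decoP, map_zero, map_zero]
  | cons x t =>
    rw [gop, deco, decoP, splitSum_tm, map_splitSum]
    refine splitSum_congr fun s₁ s₂ hs => ?_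
    rw [tm_splitSum, map_splitSum]
    refine splitSum_congr fun t₁ t₂ ht => ?_
    subst hs
    rw [tm_one_one, superExt_single_one, xi, Q.eps_cons, Q.eps_append, add_assoc (_ + _)]

theorem Var.gop (hR : IsSuperComm 𝓡) (he : e ∈ superDer 𝓡 0) (hγ : HomF 𝓡 0 γ)
    (hγ' : HomF 𝓡 0 γ') {μ μ' : List Q.B × List Q.B → (Q'.B →₀ R)} (hA : HomF 𝓡 a A)
    (hμ : HomF 𝓡 k μ) (h : Var 𝓡 e (gw 𝓡 γ) (gw 𝓡 γ') a A A')
    (h' : Var 𝓡 e (gpair 𝓡 (gw 𝓡 γ) (gw 𝓡 γ)) γ' k μ μ')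
    (hB : Var 𝓡 e (gw 𝓡 γ) (gw 𝓡 γ') 0 B fun _ => 0) (hi : a + k = i) :
    Var 𝓡 e (gpair 𝓡 (gw 𝓡 γ) (gw 𝓡 γ)) (gpair 𝓡 (gw 𝓡 γ') (gw 𝓡 γ')) i (gop 𝓡 k 0 A μ B)
      (fun p => RelCyc.gop 𝓡 k 0 A' μ B p + RelCyc.gop 𝓡 k 0 A μ' B p) := by
  subst hi
  have hd := (var_deco hR he hγ).tensor hR he (homF_gw hγ) (homF_gpair (homF_gw hγ) (homF_gw hγ))
    (homF_deco 𝓡) (var_decoP hR he hγ)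
  have h1 := hd.comp he (Var.xi hR he hγ hγ' hA hμ h h' hB)
  have h2 := (h1.congr (Φ'' := fun p => RelCyc.gop 𝓡 k 0 A' μ B p + RelCyc.gop 𝓡 k 0 A μ' B p)
    fun p => by
    rw [superExt_add_fun, ← gop_eq_xi, ← gop_eq_xi]
    simp only [tmap, map_zero, AddMonoidHom.zero_apply, smul_zero, add_zero, zero_add]).index
      (k := a + k) (by ring)
  rwa [show (fun p => superExt 𝓡 (a + k + 0) (RelCyc.xi 𝓡 k 0 A μ B) (tmap 𝓡 0 deco decoP p)) =
    RelCyc.gop 𝓡 k 0 A μ B from funext fun p => (gop_eq_xi _ _ _ _).symm] at h2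

/-- The variation of an operator on marked words determines the one on cyclic words. -/
theorem Var.cy (hR : IsSuperComm 𝓡) (he : e ∈ superDer 𝓡 0) (hγ : HomF 𝓡 0 γ)
    {G G' : List Q.B × List Q.B → (List Q'.B × List Q'.B →₀ R)}
    (h : Var 𝓡 e (gpair 𝓡 (gw 𝓡 γ) (gw 𝓡 γ)) (gpair 𝓡 (gw 𝓡 γ') (gw 𝓡 γ')) k G G') :
    Var 𝓡 e (gw 𝓡 γ) (gw 𝓡 γ') k (cy 𝓡 k G) (RelCyc.cy 𝓡 k G') :=
  ((((var_cyc hR he hγ).comp he h).comp he (var_prj he)).congr (Φ'' := RelCyc.cy 𝓡 k G') fun l => by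
    rw [map_zero, zero_add, superExt_zero_fun, add_zero, RelCyc.cy]).index (by ring)

theorem var_eW (he : e ∈ superDer 𝓡 0) (hu : ∀ X, γ (Q.unit X) = -wd (Q.unit X))
    (hs : ∀ x y, γ x y ≠ 0 → Q.src y = Q.src x) :
    Var 𝓡 e (gw 𝓡 γ) (gw 𝓡 γ) 1 eW fun l => -eW l := fun l => by
  cases l with
  | nil => simp [eW, gw]
  | cons x l =>
    have h1 : gw 𝓡 γ (x :: l) ∈ supported R R
        {w : List Q.B | ∃ y t, w = y :: t ∧ Q.src y = Q.src x} := by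
      refine gw_mem fun u x' v y h hy => ?_
      cases u with
      | nil =>
        obtain ⟨rfl, rfl⟩ := List.cons.inj h
        exact ⟨y, _, rfl, hs _ _ hy⟩
      | cons z u =>
        obtain ⟨rfl, rfl⟩ := List.cons.inj h
        exact ⟨z, _, rfl, rfl⟩
    rw [eW, gx_wd he, gw, hu, map_neg, map_neg, AddMonoidHom.neg_apply, letH_wd, wd_cat_wd, unit_cat,
      superExt_congr_supported 𝓡 1 (g := eW) ?_ h1, add_comm]
    · rfl
    · rintro _ ⟨y, t, rfl, hy⟩
      rw [eW, hy]

/-- The variation of an operator that ends with the insertion of a unit. -/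
theorem Var.eW_cyc (hR : IsSuperComm 𝓡) (he : e ∈ superDer 𝓡 0) (hγ : HomF 𝓡 0 γ)
    (hu : ∀ X, γ' (Q'.unit X) = -wd (Q'.unit X)) (hs : ∀ x y, γ' x y ≠ 0 → Q'.src y = Q'.src x)
    {G G' : List Q.B × List Q.B → (List Q'.B × List Q'.B →₀ R)}
    (h : Var 𝓡 e (gpair 𝓡 (gw 𝓡 γ) (gw 𝓡 γ)) (gpair 𝓡 (gw 𝓡 γ') (gw 𝓡 γ')) k G G')
    (hj : 1 + k = j) : Var 𝓡 e (gw 𝓡 γ) (gw 𝓡 γ') j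
      (fun l => superExt 𝓡 1 eW (superExt 𝓡 0 app (superExt 𝓡 k G (cyc 𝓡 l))))
      (fun l => superExt 𝓡 1 eW (superExt 𝓡 0 app (superExt 𝓡 k G' (cyc 𝓡 l))) -
        superExt 𝓡 1 eW (superExt 𝓡 0 app (superExt 𝓡 k G (cyc 𝓡 l)))) :=
  (((((var_cyc hR he hγ).comp he h).comp he (var_app he)).comp he (var_eW he hu hs)).congr
    fun l => by
    have hn : ∀ t : List Q'.B →₀ R, superExt 𝓡 1 (fun l => -eW l) t = -superExt 𝓡 1 eW t := fun t => by
      have := superExt_zsmul_fun 𝓡 1 (-1) (eW (Q := Q') (R := R)) t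
      simpa only [neg_one_smul] using this
    rw [map_zero, zero_add, superExt_zero_fun, add_zero, hn, sub_eq_add_neg]).index
      (by rw [← hj]; ring)

theorem Var.cmp {X Y Z : Type*} {γ₁ : X → (X →₀ R)} {γ₂ : Y → (Y →₀ R)} {γ₃ : Z → (Z →₀ R)}
    (he : e ∈ superDer 𝓡 0) {Φ Φ' : X → (Y →₀ R)} {Ψ Ψ' : Y → (Z →₀ R)}
    (hΦ : Var 𝓡 e γ₁ γ₂ i Φ Φ') (hΨ : Var 𝓡 e γ₂ γ₃ j Ψ Ψ') (hk : j + i = k) :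
    Var 𝓡 e γ₁ γ₃ k (cmp 𝓡 j Ψ Φ) (fun x => RelCyc.cmp 𝓡 j Ψ Φ' x + RelCyc.cmp 𝓡 j Ψ' Φ x) :=
  (hΦ.comp he hΨ).index hk

end Words

/-! ### Variation of the structure operators -/

section Words

variable {K R : Type*} [Field K] [Ring R] [Algebra K R]
variable {𝓡 : ZMod 2 → Submodule K R} [GradedAlgebra 𝓡]
variable {Ob Ob' : Type*} {Q : HomBasis Ob} {Q' : HomBasis Ob'} {e : R →ₗ[K] R} {a c i j k : ZMod 2}
  {γ : Q.B → (Q.B →₀ R)} {γ' : Q'.B → (Q'.B →₀ R)} {A B : List Q.B → (List Q'.B →₀ R)}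
  {F : List Q.B → (Q'.B →₀ R)} {f : List Q.B → (List Q'.B →₀ R)} {ψ ψ' : List Q.B → (Q'.B →₀ R)}
  {φ φ' : List Q.B → (Q.B →₀ R)} {m : List Q.B → (Q.B →₀ R)} {m' : List Q'.B → (Q'.B →₀ R)}

theorem gop_zero_mid (p : List Q.B × List Q.B) :
    gop 𝓡 k c A (fun _ => (0 : Q'.B →₀ R)) B p = 0 := by
  simpa using gop_zsmul_mid (𝓡 := 𝓡) (k := k) (c := c) (A := A) (A' := B) 0 (fun _ => 0) p

theorem unmark_zero {M : Type*} [AddCommGroup M] :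
    unmark (Q := Q) (fun _ => (0 : M)) = fun _ => 0 := rfl

theorem cy_add (G G' : List Q.B × List Q.B → (List Q'.B × List Q'.B →₀ R)) (w : List Q.B) :
    cy 𝓡 k (fun p => G p + G' p) w = cy 𝓡 k G w + cy 𝓡 k G' w := by
  rw [cy, superExt_add_fun, map_add]
  rfl

/-- Equivariance of a map of coalgebras and its corestriction. -/
structure BarVar (𝓡 : ZMod 2 → Submodule K R) [GradedAlgebra 𝓡] (e : R →ₗ[K] R)
    (γ : Q.B → (Q.B →₀ R)) (γ' : Q'.B → (Q'.B →₀ R)) (F : List Q.B → (Q'.B →₀ R))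
    (f : List Q.B → (List Q'.B →₀ R)) : Prop where
  comm : IsSuperComm 𝓡
  even : e ∈ superDer 𝓡 0
  hom : HomF 𝓡 0 γ
  hom' : HomF 𝓡 0 γ'
  bar : IsBar 𝓡 F f
  var : Var 𝓡 e (gw 𝓡 γ) γ' 0 F fun _ => 0

theorem barVar_id (hR : IsSuperComm 𝓡) (he : e ∈ superDer 𝓡 0) (hγ : HomF 𝓡 0 γ) :
    BarVar 𝓡 e γ γ idLet wd :=
  ⟨hR, he, hγ, hγ, isBar_id 𝓡, var_idLet he⟩

theorem BarVar.var_bar (h : BarVar 𝓡 e γ γ' F f) :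
    Var 𝓡 e (gw 𝓡 γ) (gw 𝓡 γ') 0 f fun _ => 0 :=
  h.bar.var h.comm h.even h.hom h.hom' h.var

theorem BarVar.lpsi (h : BarVar 𝓡 e γ γ' F f) (hψ : HomF 𝓡 j ψ)
    (hv : Var 𝓡 e (gw 𝓡 γ) γ' j ψ ψ') :
    Var 𝓡 e (gpair 𝓡 (gw 𝓡 γ) (gw 𝓡 γ)) (gpair 𝓡 (gw 𝓡 γ') (gw 𝓡 γ')) j
      (lpsi 𝓡 f F j ψ) (lpsi 𝓡 f F j ψ') :=
  (Var.gop h.comm h.even h.hom h.hom' (homF_der h.bar.homF hψ) (homF_unmark 𝓡 h.bar.hom)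
    (Var.der h.comm h.even h.hom h.hom' h.bar.homF h.var_bar hψ hv) (h.var.unmark h.even)
    h.var_bar (add_zero j)).congr fun p => by rw [unmark_zero, gop_zero_mid, add_zero]

theorem BarVar.gop_mid (h : BarVar 𝓡 e γ γ' F f) {μ μ' : List Q.B × List Q.B → (Q'.B →₀ R)}
    (hμ : HomF 𝓡 k μ) (hv : Var 𝓡 e (gpair 𝓡 (gw 𝓡 γ) (gw 𝓡 γ)) γ' k μ μ') :
    Var 𝓡 e (gw 𝓡 γ) (gw 𝓡 γ') k (cy 𝓡 k (gop 𝓡 k 0 f μ f)) (cy 𝓡 k (gop 𝓡 k 0 f μ' f)) :=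
  Var.cy h.comm h.even h.hom ((Var.gop h.comm h.even h.hom h.hom' h.bar.homF hμ h.var_bar hv
    h.var_bar (zero_add k)).congr fun p => by rw [gop_zero_left, zero_add])

theorem BarVar.wF (h : BarVar 𝓡 e γ γ' F f) :
    Var 𝓡 e (gw 𝓡 γ) (gw 𝓡 γ') 0 (wF 𝓡 F f) fun _ => 0 :=
  (h.gop_mid (homF_unmark 𝓡 h.bar.hom) (h.var.unmark h.even)).congr fun w => by
    rw [show gop 𝓡 0 0 f (unmark fun _ => (0 : Q'.B →₀ R)) f = fun _ => 0 from
      funext fun p => gop_zero_mid p, cy, superExt_zero_fun, map_zero]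

theorem BarVar.gpsi (h : BarVar 𝓡 e γ γ' F f) (hm : HomF 𝓡 1 m')
    (hvm : Var 𝓡 e (gw 𝓡 γ') γ' 1 m' m') (hψ : HomF 𝓡 j ψ)
    (hv : Var 𝓡 e (gw 𝓡 γ) γ' j ψ ψ') (hk : k = 1 + j) :
    Var 𝓡 e (gw 𝓡 γ) (gw 𝓡 γ') k (cy 𝓡 k (gpsi 𝓡 m' f F j ψ))
      (fun w => cy 𝓡 k (gpsi 𝓡 m' f F j ψ') w + cy 𝓡 k (gpsi 𝓡 m' f F j ψ) w) := by
  subst hk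
  refine (h.gop_mid (homF_gpsi_mid hm h.bar hψ)
    ((h.lpsi hψ hv).cmp h.even (hvm.unmark h.even) rfl)).congr fun w => ?_
  rw [← cy_add]
  congr 2
  funext p
  exact gop_add_mid 𝓡 _ _ p

theorem BarVar.gphi (h : BarVar 𝓡 e γ γ' F f) (hφ : HomF 𝓡 j φ)
    (hv : Var 𝓡 e (gw 𝓡 γ) γ j φ φ') :
    Var 𝓡 e (gw 𝓡 γ) (gw 𝓡 γ') j (cy 𝓡 j (gphi 𝓡 f F j φ)) (cy 𝓡 j (gphi 𝓡 f F j φ')) := by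
  have hw := var_wd h.even (gw 𝓡 γ)
  have hd := Var.der h.comm h.even h.hom h.hom (homF_wd 𝓡) hw hφ hv
  have e1 : ∀ χ : List Q.B → (Q.B →₀ R), tmap 𝓡 0 (der 𝓡 wd j χ) wd = kphi 𝓡 j χ := fun χ => by
    funext p
    rw [tmap, zero_mul, sgn_zero, one_smul, kphi]
  have hk := (hd.tensor h.comm h.even (homF_gw h.hom) (homF_gw h.hom) (homF_der (homF_wd 𝓡) hφ) hw).congr
    (Φ'' := kphi 𝓡 j φ') fun p => by rw [e1]; simp only [tmap, map_zero, smul_zero, add_zero]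
  rw [e1] at hk
  have h0 := (homF_kphi hφ).comp 𝓡 (homF_unmark 𝓡 h.bar.hom)
  rw [zero_add] at h0
  refine h.gop_mid h0 (((hk.index (add_zero j)).cmp h.even (h.var.unmark h.even) (zero_add j)).congr
    fun p => ?_)
  rw [cmp, cmp, unmark_zero, superExt_zero_fun, add_zero]

theorem var_dpsi (hR : IsSuperComm 𝓡) (he : e ∈ superDer 𝓡 0) (hγ : HomF 𝓡 0 γ) (hm : HomF 𝓡 1 m)
    (hv : Var 𝓡 e (gw 𝓡 γ) γ 1 m m) :
    Var 𝓡 e (gw 𝓡 γ) (gw 𝓡 γ) 1 (cy 𝓡 1 (dpsi 𝓡 1 m)) (cy 𝓡 1 (dpsi 𝓡 1 m)) := by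
  have hb := barVar_id hR he hγ
  have h1 := hb.gop_mid (homF_unmark 𝓡 hm) (hv.unmark he)
  have hd := Var.der hR he hγ hγ (homF_wd 𝓡) hb.var_bar hm hv
  have h2 := ((hb.var.letH he).conv hR he hγ hγ (fun l => letH_mem_parSub 𝓡 (hb.bar.hom l)) hd).congr
    (Φ'' := conv 𝓡 1 (fun l => letH (idLet l)) (der 𝓡 wd 1 m)) fun l => by
      simp only [map_zero, conv_zero_left, zero_add]
  have e1 : cy 𝓡 1 (dpsi 𝓡 1 m) = fun w => cy 𝓡 1 (gop 𝓡 1 0 wd (unmark m) wd) w +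
      conv 𝓡 1 (fun l => letH (idLet l)) (der 𝓡 wd 1 m) w := by
    funext w
    cases w with
    | nil =>
      rw [cy_nil, cy_nil, conv, splitSum_nil, idLet_eq_zero (by simp), map_zero, zero_cat, smul_zero,
        add_zero]
    | cons x l =>
      rw [cy_dpsi_cons, conv, splitSum_cons, splitSum_eq_left]
      · simp only [idLet, map_zero, AddMonoidHom.zero_apply, smul_zero, zero_add, letH_wd, Q.eps_cons,
          Q.eps_nil, add_zero]
      · intro u v _ hu
        have := List.length_pos_iff.2 hu
        rw [idLet_eq_zero (by simp; omega), map_zero, zero_cat, smul_zero]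
  rw [e1]
  exact h1.add (h2.index (zero_add 1))

theorem BarVar.wQ (h : BarVar 𝓡 e γ γ' F f) (hu : ∀ X, γ' (Q'.unit X) = -wd (Q'.unit X))
    (hs : ∀ x y, γ' x y ≠ 0 → Q'.src y = Q'.src x) (hψ : HomF 𝓡 j ψ)
    (hv : Var 𝓡 e (gw 𝓡 γ) γ' j ψ ψ') (hk : k = 1 + j) :
    Var 𝓡 e (gw 𝓡 γ) (gw 𝓡 γ') k (wQ 𝓡 f F j ψ)
      (fun w => wQ 𝓡 f F j ψ' w - wQ 𝓡 f F j ψ w) :=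
  (h.lpsi hψ hv).eW_cyc h.comm h.even h.hom hu hs hk.symm

theorem var_wB (hR : IsSuperComm 𝓡) (he : e ∈ superDer 𝓡 0) (hγ : HomF 𝓡 0 γ)
    (hu : ∀ X, γ (Q.unit X) = -wd (Q.unit X)) (hs : ∀ x y, γ x y ≠ 0 → Q.src y = Q.src x) :
    Var 𝓡 e (gw 𝓡 γ) (gw 𝓡 γ) 1 (wB 𝓡) fun w => -wB 𝓡 w := by
  have h := ((var_wd he (gpair 𝓡 (gw 𝓡 γ) (gw 𝓡 γ))).eW_cyc hR he hγ hu hs (add_zero 1)).congr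
    (Φ'' := fun w => -wB 𝓡 w) fun w => by
      rw [superExt_zero_fun, map_zero, map_zero, zero_sub, superExt_wd, wB]
  rwa [show (fun w => superExt 𝓡 1 eW (superExt 𝓡 0 app (superExt 𝓡 0 wd (cyc 𝓡 w)))) = wB 𝓡 from
    funext fun w => by rw [superExt_wd, wB]] at h

variable {v : R →ₗ[K] R}

theorem superBracket_mem {w : R →ₗ[K] R} (hv : v ∈ superDer 𝓡 i) (hw : w ∈ superDer 𝓡 j) :
    superBracket i j v w ∈ superDer 𝓡 (i + j) := by
  refine ⟨fun k r hr => ?_, fun r s => ?_⟩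
  · refine sub_mem ?_ (zsmul_mem ?_ _)
    · have := hv.1 _ _ (hw.1 _ _ hr)
      rwa [← add_assoc] at this
    · have := hw.1 _ _ (hv.1 _ _ hr)
      rwa [← add_assoc, add_comm j] at this
  · simp only [superBracket, LinearMap.sub_apply, LinearMap.smul_apply, LinearMap.comp_apply]
    rw [hw.2, hv.2 r s, map_add, map_add, hv.2, hv.2, hw.2, hw.2, superDer_twist hv,
      superDer_twist hw, ← twist_add, ← twist_add, add_comm j i, mul_comm j i]
    simp only [smul_add, smul_mul_assoc, sgn_smul_self, sub_mul, mul_sub, mul_smul_comm]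
    abel

theorem coeffMap_superBracket {X : Type*} (a : X →₀ R) :
    coeffMap (superBracket 0 i e v) a = coeffMap e (coeffMap v a) - coeffMap v (coeffMap e a) := by
  ext x
  simp [superBracket, coeffMap, sgn_zero]

theorem coeffMap_gw (hv : v ∈ superDer 𝓡 i) (h : ∀ x, coeffMap v (γ x) = 0) (l : List Q.B) :
    coeffMap v (gw 𝓡 γ l) = 0 := by
  have hw := coeffMap_wd (X := List Q.B) hv
  have hl : ∀ (t : List Q.B →₀ R) l, coeffMap v (catHom 𝓡 t (wd l)) = catHom 𝓡 (coeffMap v t) (wd l) := by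
    intro t l
    induction t using Finsupp.induction_linear with
    | zero => simp
    | add a b ha hb => simp only [map_add, AddMonoidHom.add_apply, ha, hb]
    | single x r =>
      rw [coeffMap_single, cat_single_single, cat_single_single, twist_one, mul_one, mul_one,
        coeffMap_single]
  induction l with
  | nil => exact map_zero _
  | cons x l ih =>
    rw [gw, map_add, hl, coeffMap_letH, h, map_zero, zero_cat, zero_add,
      coeffMap_cat hv (wd_mem 𝓡 [x]), hw, zero_cat, ih, map_zero, smul_zero, add_zero]

/-- The variation of an operator with a derivation applied to the coefficients of its values. -/
theorem Var.coeffMap {X Y : Type*} {γ : X → (X →₀ R)} {γ' : Y → (Y →₀ R)} {Φ Φ' : X → (Y →₀ R)}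
    (h : Var 𝓡 e γ γ' j Φ Φ') (hv : v ∈ superDer 𝓡 i) (hγ : ∀ x, coeffMap v (γ x) = 0)
    (hγ' : ∀ x, coeffMap v (γ' x) = 0) :
    Var 𝓡 e γ γ' (i + j) (fun x => RelCyc.coeffMap v (Φ x))
      (fun x => RelCyc.coeffMap (superBracket 0 i e v) (Φ x) + RelCyc.coeffMap v (Φ' x)) :=
  fun x => by
  have h1 := congrArg (RelCyc.coeffMap v) (h x)
  rw [gx_apply, map_add, map_add, coeffMap_superExt hv, coeffMap_superExt hv, hγ, map_zero,
    smul_zero, zero_add, mul_zero, sgn_zero, one_smul, add_zero] at h1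
  simp only [hγ', superExt_zero_fun, add_zero] at h1
  simp only [gx_apply, coeffMap_superBracket]
  rw [eq_sub_of_add_eq' h1]
  abel

end Words

/-! ### Euler gradings on Hochschild chains -/

section Euler

variable {K R : Type*} [Field K] [Ring R] [Algebra K R]
variable {𝓡 : ZMod 2 → Submodule K R} [GradedAlgebra 𝓡]
variable {Ob Ob' : Type*} {C : AInfCat 𝓡 Ob} {D : AInfCat 𝓡 Ob'} {E : R →ₗ[K] R} {i j k : ZMod 2}
  {v : R →ₗ[K] R}

namespace EulerGrading

variable (g : EulerGrading C E)

/-- `Gr - 1` on basis elements. -/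
def gam (x : C.B) : C.B →₀ R := g.gr x - wd x

theorem homF_gam : HomF 𝓡 0 g.gam := fun x => by
  rw [zero_add]
  refine sub_mem (fun y => ?_) (single_mem_parSub 𝓡 x)
  have := g.gr_even x y
  rwa [show C.deg x + C.deg y = par x + par y by
    show _ = C.deg x + 1 + (C.deg y + 1); grind] at this

theorem gam_unit (X : Ob) : g.gam (C.unit X) = -wd (C.unit X) := by
  rw [gam, g.gr_unit, zero_sub]

theorem gam_ends {x y : C.B} (h : g.gam x y ≠ 0) : C.src y = C.src x ∧ C.tgt y = C.tgt x := by
  by_cases hxy : x = y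
  · exact hxy ▸ ⟨rfl, rfl⟩
  · refine g.gr_ends x y ?_
    rwa [gam, Finsupp.sub_apply, Finsupp.single_eq_of_ne' hxy, sub_zero] at h

theorem gw_gam (l : List C.B) :
    gw 𝓡 g.gam l = g.grWord l - (l.length : ℤ) • wd l := by
  induction l with
  | nil => simp [gw, grWord, splitSum_nil]
  | cons x l ih =>
    have h : g.grWord (x :: l) = catHom 𝓡 (letH (g.gr x)) (wd l) +
        catHom 𝓡 (wd [x]) (g.grWord l) := by
      rw [grWord, splitSum_cons, grWord, cat_splitSum]
      congr 1
      · exact (cats_three _ _ _).trans (one_cat 𝓡 _)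
      · refine splitSum_congr fun u r _ => ?_
        cases r with
        | nil => exact (map_zero _).symm
        | cons y r =>
          show C.cats 𝓡 [_, _, _] = catHom 𝓡 _ (C.cats 𝓡 [_, _, _])
          rw [cats_three, cats_three, word_eq, word_eq, ← List.singleton_append (x := x) (l := u),
            ← wd_cat_wd 𝓡, cat_assoc]
          rfl
    rw [gw, ih, h, gam, map_sub, map_sub, AddMonoidHom.sub_apply, map_sub, map_zsmul, letH_wd,
      wd_cat_wd, List.singleton_append, List.length_cons, Nat.cast_add, Nat.cast_one, add_smul,
      one_smul]
    abel

theorem two_mem (hE : E ∈ superDer 𝓡 0) : (2 : ℤ) • E ∈ superDer 𝓡 0 := zsmul_mem hE 2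

theorem gx_gam (a : C.B →₀ R) : gx 𝓡 ((2 : ℤ) • E) g.gam a = g.grHom a - a := by
  rw [gx_apply, grHom, AddMonoidHom.add_apply, add_sub_assoc]
  congr 1
  rw [eq_sub_iff_add_eq]
  nth_rw 2 [← superExt_wd 𝓡 a]
  rw [← superExt_add_fun]
  simp only [gam, sub_add_cancel]

theorem var_m : Var 𝓡 ((2 : ℤ) • E) (gw 𝓡 g.gam) g.gam 1 C.m C.m := fun l => by
  have h := g.gr_m l
  rw [gx_gam, gw_gam, map_sub, map_zsmul, superExt_single_one]
  refine (congrArg (· - C.m l) h).trans ?_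
  rw [sub_smul]
  show C.mT (g.grWord l) + _ - _ = C.mT (g.grWord l) - _ + _
  rw [two_smul]
  abel

/-- The operator `Gr + Γ` on words. -/
def grOp (l : List C.B) : List C.B →₀ R := gw 𝓡 g.gam l + wd l

theorem isOp_grOp : IsOp 𝓡 0 g.grOp := by
  refine ⟨fun w => add_mem (homF_gw g.homF_gam w) (homF_wd 𝓡 w), fun w hw => ?_, fun w hw ht => ?_⟩
  · refine add_mem (gw_mem fun u x t y h hy => ?_) (single_mem_supported R _ hw)
    subst h
    obtain ⟨-, X, hX⟩ := hw
    obtain ⟨Z, h1, h2, h3⟩ := isPath_append.1 hX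
    obtain ⟨e1, e2⟩ := g.gam_ends hy
    exact ⟨by simp, X, isPath_append.2 ⟨Z, h1, e1.trans h2, e2 ▸ h3⟩⟩
  · refine add_mem (gw_mem fun u x t y h hy => ?_) (single_mem_supported R _ ht)
    subst h
    obtain ⟨X, hX⟩ := ht
    refine ⟨X, ?_⟩
    cases u with
    | nil => exact hX
    | cons z u =>
      have hX' : C.unit X ∈ u ++ x :: t := hX
      show C.unit X ∈ u ++ y :: t
      rw [List.mem_append, List.mem_cons] at hX' ⊢
      refine hX'.imp_right (Or.imp_left ?_)
      rintro rfl
      by_contra hne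
      rw [g.gam_unit, Finsupp.neg_apply, Finsupp.single_eq_of_ne' hne, neg_zero] at hy
      exact hy rfl

theorem grChain_eq (a : C.CC R) : g.grChain a = coeffMap ((2 : ℤ) • E) a + ch 𝓡 0 g.grOp a := by
  rw [grChain, AddMonoidHom.add_apply, ch]
  congr 3
  funext w
  rw [grOp, gw_gam, toCC_add, toCC_sub, toCC_zsmul, toCC_single w.2, sub_smul, one_smul]
  abel

variable {g}

theorem grChain_ch {gC : EulerGrading C E} {gD : EulerGrading D E} (hE : E ∈ superDer 𝓡 0)
    {Φ Φ' : List C.B → (List D.B →₀ R)} (hΦ : IsOp 𝓡 i Φ)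
    (h : Var 𝓡 ((2 : ℤ) • E) (gw 𝓡 gC.gam) (gw 𝓡 gD.gam) i Φ Φ') (a : C.CC R) :
    gD.grChain (ch 𝓡 i Φ a) = ch 𝓡 i Φ (gC.grChain a) + ch 𝓡 i Φ' a := by
  rw [grChain_eq, grChain_eq, coeffMap_ch (two_mem hE), zero_mul, sgn_zero, one_smul, map_add,
    ch_comp hΦ gD.isOp_grOp, ch_comp gC.isOp_grOp hΦ, add_zero, zero_add, add_assoc, add_assoc,
    ← ch_add, ← ch_add]
  congr 3
  funext w
  have := h w
  rw [gx_apply] at this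
  rw [show superExt 𝓡 0 gD.grOp (Φ w) = superExt 𝓡 0 (gw 𝓡 gD.gam) (Φ w) + Φ w by
    rw [← superExt_wd 𝓡 (Φ w)]
    nth_rw 3 [← superExt_wd 𝓡 (Φ w)]
    rw [superExt_wd, ← superExt_add_fun]; rfl, ← add_assoc, this, grOp, map_add, superExt_single_one]
  abel

theorem grChain_mem (hE : E ∈ superDer 𝓡 0) {a : C.CC R} (ha : a ∈ C.chainPar 𝓡 j) :
    g.grChain a ∈ C.chainPar 𝓡 j := by
  rw [grChain_eq]
  have h1 := coeffMap_mem_chainPar (two_mem hE) ha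
  have h2 := g.isOp_grOp.ch_mem ha
  rw [zero_add] at h1 h2
  exact chainPar_add h1 h2

theorem grChain_signInv (hE : E ∈ superDer 𝓡 0) (a : C.CC R) :
    g.grChain (C.signInv 𝓡 a) = C.signInv 𝓡 (g.grChain a) := by
  rw [grChain_eq, grChain_eq, map_add, signInv_coeffMap (two_mem hE), g.isOp_grOp.signInv_ch,
    sgn_zero, one_smul, one_smul]

theorem bracket_mem (hE : E ∈ superDer 𝓡 0) (hv : v ∈ superDer 𝓡 i) :
    superBracket 0 i ((2 : ℤ) • E) v ∈ superDer 𝓡 i := by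
  have := superBracket_mem (two_mem hE) hv
  rwa [zero_add] at this

theorem Compatible.coeffMap_gam (h : g.Compatible) (hE : E ∈ superDer 𝓡 0) (hv : v ∈ superDer 𝓡 i)
    (x : C.B) : coeffMap v (g.gam x) = 0 := by
  have h1 := h i v hv (wd x)
  rw [coeffMap_wd hv, map_zero, zero_sub, coeffMap_wd (bracket_mem hE hv), neg_eq_zero, grHom,
    AddMonoidHom.add_apply, coeffMap_wd (two_mem hE), zero_add, superExt_single_one] at h1
  rw [gam, map_sub, h1, coeffMap_wd hv, sub_zero]

theorem Compatible.coeffMap_grChain (h : g.Compatible) (hE : E ∈ superDer 𝓡 0)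
    (hv : v ∈ superDer 𝓡 i) (a : C.CC R) : g.grChain (coeffMap v a) =
      coeffMap v (g.grChain a) + coeffMap (superBracket 0 i ((2 : ℤ) • E) v) a := by
  have h0 : ch 𝓡 (i + 0) (fun w => coeffMap v (g.grOp w)) a = 0 := by
    refine ch_eq_zero (fun w _ => ?_) a
    rw [grOp, map_add, coeffMap_gw hv (h.coeffMap_gam hE hv), coeffMap_wd hv, zero_add]
    exact zero_mem _
  rw [grChain_eq, grChain_eq, map_add, coeffMap_ch hv, h0, mul_zero, sgn_zero, one_smul,
    coeffMap_superBracket]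
  abel

theorem Compatible.var_vm (h : g.Compatible) (hE : E ∈ superDer 𝓡 0) (hv : v ∈ superDer 𝓡 i) :
    Var 𝓡 ((2 : ℤ) • E) (gw 𝓡 g.gam) g.gam (i + 1) (fun l => coeffMap v (C.m l))
      (fun l => coeffMap (superBracket 0 i ((2 : ℤ) • E) v + v) (C.m l)) :=
  (g.var_m.coeffMap hv (coeffMap_gw hv (h.coeffMap_gam hE hv)) (h.coeffMap_gam hE hv)).congr
    fun l => by rw [coeffMap_add_left]

variable (g) in
theorem barVar (hR : IsSuperComm 𝓡) (hE : E ∈ superDer 𝓡 0) :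
    BarVar 𝓡 ((2 : ℤ) • E) g.gam g.gam idLet wd := barVar_id hR (two_mem hE) g.homF_gam

variable (g)

theorem grChain_b (hR : IsSuperComm 𝓡) (hE : E ∈ superDer 𝓡 0) (a : C.CC R) :
    g.grChain (C.b a) = C.b (g.grChain a) + C.b a := by
  rw [C.b_eq]
  exact grChain_ch hE C.isOp_wb (var_dpsi hR (two_mem hE) g.homF_gam C.isDiff.hom g.var_m) a

theorem grChain_connesB (hR : IsSuperComm 𝓡) (hE : E ∈ superDer 𝓡 0) (a : C.CC R) :
    g.grChain (C.connesB a) = C.connesB (g.grChain a) - C.connesB a := by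
  rw [C.connesB_eq, sub_eq_add_neg, ← ch_neg]
  exact grChain_ch hE isOp_wB (var_wB hR (two_mem hE) g.homF_gam g.gam_unit
    fun x y h => (g.gam_ends h).1) a

variable {g}

theorem Compatible.grChain_b11 (h : g.Compatible) (hR : IsSuperComm 𝓡) (hE : E ∈ superDer 𝓡 0)
    (hv : v ∈ superDer 𝓡 i) (a : C.CC R) : g.grChain (C.b11 i v a) =
      C.b11 i v (g.grChain a) + C.b11 i (superBracket 0 i ((2 : ℤ) • E) v) a +
        (2 : ℤ) • C.b11 i v a := by
  have h1 := ((g.barVar hR hE).gpsi C.isDiff.hom g.var_m (C.homF_vm hv) (h.var_vm hE hv)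
    (k := i) (by grind)).zsmul (sgn i)
  rw [C.b11_eq, grChain_ch hE ((C.isOp_wP hv).zsmul _) h1]
  simp only [smul_add]
  rw [ch_add, ← C.b11_eq, ← C.b11_eq, C.b11_add, two_smul]
  abel

theorem Compatible.grChain_B11 (h : g.Compatible) (hR : IsSuperComm 𝓡) (hE : E ∈ superDer 𝓡 0)
    (hv : v ∈ superDer 𝓡 i) (a : C.CC R) : g.grChain (C.B11 i v a) =
      C.B11 i v (g.grChain a) + C.B11 i (superBracket 0 i ((2 : ℤ) • E) v) a := by
  have h1 := ((g.barVar hR hE).wQ g.gam_unit (fun x y h => (g.gam_ends h).1) (C.homF_vm hv)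
    (h.var_vm hE hv) (k := i) (by grind)).zsmul (sgn i)
  rw [C.B11_eq hv, grChain_ch hE ((C.isOp_wQ hv).zsmul _) h1]
  simp only [smul_sub]
  rw [ch_sub, ← C.B11_eq hv, ← C.B11_eq (add_mem (bracket_mem hE hv) hv), C.B11_add]
  abel

end EulerGrading

namespace AInfFun

open EulerGrading

variable {F : AInfFun C D} {gC : EulerGrading C E} {gD : EulerGrading D E}

theorem IsEulerGraded.var (h : F.IsEulerGraded gC gD) :
    Var 𝓡 ((2 : ℤ) • E) (gw 𝓡 gC.gam) gD.gam 0 F.F fun _ => 0 := fun l => by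
  refine Eq.trans ?_ (add_zero _).symm
  rw [gx_gam, gw_gam, map_sub, map_zsmul, superExt_single_one, h l, sub_smul, one_smul, FT]
  abel

theorem IsEulerGraded.barVar (h : F.IsEulerGraded gC gD) (hR : IsSuperComm 𝓡)
    (hE : E ∈ superDer 𝓡 0) : BarVar 𝓡 ((2 : ℤ) • E) gC.gam gD.gam F.F F.bar :=
  ⟨hR, two_mem hE, gC.homF_gam, gD.homF_gam, F.isBar, h.var⟩

theorem IsEulerGraded.var_vF (h : F.IsEulerGraded gC gD) (hC : gC.Compatible) (hD : gD.Compatible)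
    (hE : E ∈ superDer 𝓡 0) (hv : v ∈ superDer 𝓡 i) :
    Var 𝓡 ((2 : ℤ) • E) (gw 𝓡 gC.gam) gD.gam i (fun l => coeffMap v (F.F l))
      (fun l => coeffMap (superBracket 0 i ((2 : ℤ) • E) v) (F.F l)) :=
  ((h.var.coeffMap hv (coeffMap_gw hv (hC.coeffMap_gam hE hv)) (hD.coeffMap_gam hE hv)).congr
    fun l => by rw [map_zero, add_zero]).index (add_zero i)

theorem IsEulerGraded.grChain_push (h : F.IsEulerGraded gC gD) (hR : IsSuperComm 𝓡)
    (hE : E ∈ superDer 𝓡 0) (a : C.CC R) : gD.grChain (F.push a) = F.push (gC.grChain a) := by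
  rw [F.push_eq, grChain_ch hE F.isFun.isOp_wF (h.barVar hR hE).wF,
    ch_eq_zero (Φ := fun _ => 0) fun _ _ => zero_mem _, add_zero]

section Compat

variable (h : F.IsEulerGraded gC gD) (hC : gC.Compatible) (hD : gD.Compatible)
  (hR : IsSuperComm 𝓡) (hE : E ∈ superDer 𝓡 0) (hv : v ∈ superDer 𝓡 i) (a : C.CC R)
include h hC hR hE hv

theorem IsEulerGraded.grChain_H1 : gD.grChain (F.H1 i v a) =
    F.H1 i v (gC.grChain a) + F.H1 i (superBracket 0 i ((2 : ℤ) • E) v) a + F.H1 i v a := by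
  rw [F.H1_eq, grChain_ch hE (F.isFun.isOp_gphi (C.isCo hv))
    ((h.barVar hR hE).gphi (C.homF_vm hv) (hC.var_vm hE hv)), ← F.H1_eq, ← F.H1_eq, F.H1_add,
    add_assoc]

include hD

theorem IsEulerGraded.grChain_H2 : gD.grChain (F.H2 i v a) =
    F.H2 i v (gC.grChain a) + F.H2 i (superBracket 0 i ((2 : ℤ) • E) v) a + F.H2 i v a := by
  have hc := F.isFun.isCo hv
  have h1 := ((h.barVar hR hE).gpsi D.isDiff.hom gD.var_m hc.hom (h.var_vF hC hD hE hv)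
    (k := i + 1) (add_comm i 1)).zsmul (sgn i)
  rw [F.H2_eq, grChain_ch hE ((F.isFun.isOp_gpsi hc (add_comm i 1)).zsmul _) h1]
  simp only [smul_add]
  rw [ch_add, ← F.H2_eq, ← F.H2_eq, add_assoc]

theorem IsEulerGraded.grChain_H3 : gD.grChain (F.H3 i v a) =
    F.H3 i v (gC.grChain a) + F.H3 i (superBracket 0 i ((2 : ℤ) • E) v) a - F.H3 i v a := by
  have hc := F.isFun.isCo hv
  have h1 := ((h.barVar hR hE).wQ gD.gam_unit (fun x y h => (gD.gam_ends h).1) hc.hom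
    (h.var_vF hC hD hE hv) (k := i + 1) (add_comm i 1)).zsmul (sgn i)
  rw [F.H3_eq hv, grChain_ch hE ((F.isFun.isOp_wQ hc (add_comm i 1)).zsmul _) h1]
  simp only [smul_sub]
  rw [ch_sub, ← F.H3_eq hv, ← F.H3_eq (bracket_mem hE hv), add_sub_assoc]

end Compat

end AInfFun

end Euler

/-! ### Euler gradings on negative cyclic chains and on the cone -/

section Euler

variable {K R : Type*} [Field K] [Ring R] [Algebra K R]
variable {𝓡 : ZMod 2 → Submodule K R} [GradedAlgebra 𝓡]
variable {Ob Ob' : Type*} {C : AInfCat 𝓡 Ob} {D : AInfCat 𝓡 Ob'} {E : R →ₗ[K] R} {i j k : ZMod 2}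
  {v : R →ₗ[K] R}

namespace EulerGrading

variable (g : EulerGrading C E)

theorem coeff_grMinus (a : C.CCu) (n : ℤ) :
    (g.grMinus a).coeff n = g.grChain (a.coeff n) + (2 : ℤ) • n • a.coeff n := by
  rw [grMinus, AddMonoidHom.add_apply, Lau.coeff_add, Lau.coeff_map]
  rfl

theorem grMinus_dMinus (hR : IsSuperComm 𝓡) (hE : E ∈ superDer 𝓡 0) (a : C.CCu) :
    g.grMinus (C.dMinus a) = C.dMinus (g.grMinus a) + C.dMinus a := by
  apply Lau.ext
  intro n
  simp only [Lau.coeff_add, coeff_grMinus, C.coeff_dMinus, map_add, map_sub, g.grChain_b hR hE,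
    g.grChain_connesB hR hE, map_zsmul, smul_add, sub_smul, one_smul, smul_sub, two_smul]
  abel

theorem grMinus_signInv (hE : E ∈ superDer 𝓡 0) (a : C.CCu) :
    g.grMinus (Lau.map (C.signInv 𝓡) a) = Lau.map (C.signInv 𝓡) (g.grMinus a) := by
  apply Lau.ext
  intro n
  simp only [Lau.coeff_map, coeff_grMinus, grChain_signInv hE, map_add, map_zsmul]

theorem grMinus_smul (hE : E ∈ superDer 𝓡 0) (f : R⟦X⟧) (a : C.CCu) : g.grMinus (f • a) =
    ((2 : ℤ) • (PowerSeries.X * AInfFun.duU f) + (2 : ℤ) • AInfFun.derU E f) • a +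
      f • g.grMinus a := by
  have h : ∀ (r : R) (x : C.CC R), g.grChain (r • x) =
      ((2 : ℤ) • E).toAddMonoidHom r • x + AddMonoidHom.id R r • g.grChain x := fun r x => by
    rw [grChain_eq, grChain_eq, coeffMap_smul (two_mem hE), ch, superExt_smul, twist_zero, smul_add,
      add_assoc]
    rfl
  have h2 : Lau.coeffwise ((2 : ℤ) • E).toAddMonoidHom f = (2 : ℤ) • AInfFun.derU E f := by
    ext n
    rw [two_smul, two_smul, map_add]
    simp [Lau.coeffwise, AInfFun.derU]
  rw [grMinus, AddMonoidHom.add_apply, AddMonoidHom.add_apply, AddMonoidHom.smul_apply,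
    AddMonoidHom.smul_apply, Lau.map_smul_leibniz h, Lau.uDu_smul, AInfFun.coeffwise_id, h2]
  simp only [smul_add, add_smul, smul_assoc, smul_comm f (2 : ℤ)]
  abel

variable {g}

theorem Compatible.grMinus_nabla (h : g.Compatible) (hR : IsSuperComm 𝓡) (hE : E ∈ superDer 𝓡 0)
    (hv : v ∈ superDer 𝓡 i) (a : C.CCu) : g.grMinus (C.nabla i v a) =
      C.nabla i v (g.grMinus a) + C.nabla i (superBracket 0 i ((2 : ℤ) • E) v) a := by
  apply Lau.ext
  intro n
  simp only [Lau.coeff_add, coeff_grMinus, C.coeff_nabla, map_add, map_sub,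
    h.coeffMap_grChain hE hv, h.grChain_b11 hR hE hv, h.grChain_B11 hR hE hv,
    map_zsmul, smul_add, add_smul, one_smul, smul_sub, two_smul]
  abel

end EulerGrading

namespace AInfFun

open EulerGrading

variable {F : AInfFun C D} {gC : EulerGrading C E} {gD : EulerGrading D E}

theorem IsEulerGraded.grMinus_push (h : F.IsEulerGraded gC gD) (hR : IsSuperComm 𝓡)
    (hE : E ∈ superDer 𝓡 0) (a : C.CCu) :
    gD.grMinus (Lau.map F.push a) = Lau.map F.push (gC.grMinus a) := by
  apply Lau.ext
  intro n
  simp only [Lau.coeff_map, coeff_grMinus, h.grChain_push hR hE, map_add, map_zsmul]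

theorem IsEulerGraded.grMinus_H (h : F.IsEulerGraded gC gD) (hC : gC.Compatible)
    (hD : gD.Compatible) (hR : IsSuperComm 𝓡) (hE : E ∈ superDer 𝓡 0) (hv : v ∈ superDer 𝓡 i)
    (a : C.CCu) : gD.grMinus (F.H i v a) = F.H i v (gC.grMinus a) +
      F.H i (superBracket 0 i ((2 : ℤ) • E) v) a - F.H i v a := by
  apply Lau.ext
  intro n
  simp only [Lau.coeff_add, Lau.coeff_sub, coeff_grMinus, F.coeff_H, map_add, map_sub,
    h.grChain_H1 hC hR hE hv, h.grChain_H2 hC hD hR hE hv, h.grChain_H3 hC hD hR hE hv,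
    map_zsmul, smul_add, add_smul, one_smul, smul_sub, two_smul]
  abel

theorem IsEulerGraded.grCone_dCone (h : F.IsEulerGraded gC gD) (hR : IsSuperComm 𝓡)
    (hE : E ∈ superDer 𝓡 0) (a : F.Cone) :
    F.grCone gC gD (F.dCone a) = F.dCone (F.grCone gC gD a) + F.dCone a := by
  refine Prod.ext ?_ ?_
  · show gC.grMinus (C.dMinus a.1) - C.dMinus a.1 = C.dMinus (gC.grMinus a.1 - a.1) + C.dMinus a.1
    rw [grMinus_dMinus gC hR hE, map_sub]
    abel
  · show gD.grMinus (D.dMinus a.2 + Lau.map F.push (Lau.map (C.signInv 𝓡) a.1)) =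
      D.dMinus (gD.grMinus a.2) + Lau.map F.push (Lau.map (C.signInv 𝓡) (gC.grMinus a.1 - a.1)) +
        (D.dMinus a.2 + Lau.map F.push (Lau.map (C.signInv 𝓡) a.1))
    rw [map_add, grMinus_dMinus gD hR hE, h.grMinus_push hR hE, grMinus_signInv gC hE, map_sub,
      map_sub]
    abel

theorem IsEulerGraded.grCone_nablaCone (h : F.IsEulerGraded gC gD) (hC : gC.Compatible)
    (hD : gD.Compatible) (hR : IsSuperComm 𝓡) (hE : E ∈ superDer 𝓡 0) (hv : v ∈ superDer 𝓡 i)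
    (a : F.Cone) : F.grCone gC gD (F.nablaCone i v a) =
      F.nablaCone i v (F.grCone gC gD a) +
        F.nablaCone i (superBracket 0 i ((2 : ℤ) • E) v) a := by
  refine Prod.ext ?_ ?_
  · show gC.grMinus (C.nabla i v a.1) - C.nabla i v a.1 = C.nabla i v (gC.grMinus a.1 - a.1) + _
    rw [hC.grMinus_nabla hR hE hv, map_sub]
    exact add_sub_right_comm _ _ _
  · show gD.grMinus (D.nabla i v a.2 - F.H i v (Lau.map (C.signInv 𝓡) a.1)) =
      D.nabla i v (gD.grMinus a.2) - F.H i v (Lau.map (C.signInv 𝓡) (gC.grMinus a.1 - a.1)) +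
        (D.nabla i _ a.2 - F.H i _ (Lau.map (C.signInv 𝓡) a.1))
    rw [map_sub, hD.grMinus_nabla hR hE hv, h.grMinus_H hC hD hR hE hv, grMinus_signInv gC hE, map_sub,
      map_sub]
    abel

theorem grCone_level {n : ℤ} {a : F.Cone} (ha : a ∈ F.level n) : F.grCone gC gD a ∈ F.level n := by
  have h1 : ∀ l < n, a.1.coeff l = 0 := ha.1
  have h2 : ∀ l < n, a.2.coeff l = 0 := ha.2
  refine ⟨fun l hl => ?_, fun l hl => ?_⟩
  · show (gC.grMinus a.1 - a.1).coeff l = 0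
    rw [Lau.coeff_sub, coeff_grMinus, h1 l hl, map_zero, smul_zero, smul_zero, add_zero, sub_zero]
  · show (gD.grMinus a.2).coeff l = 0
    rw [coeff_grMinus, h2 l hl, map_zero, smul_zero, smul_zero, add_zero]

theorem grCone_par (hE : E ∈ superDer 𝓡 0) {a : F.Cone} (ha : a ∈ F.conePar j) :
    F.grCone gC gD a ∈ F.conePar j := by
  refine ⟨fun n => ?_, fun n => ?_⟩
  · show (gC.grMinus a.1 - a.1).coeff n ∈ _
    rw [Lau.coeff_sub, coeff_grMinus]
    exact chainPar_sub (chainPar_add (grChain_mem hE (ha.1 n))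
      (chainPar_zsmul (chainPar_zsmul (ha.1 n) _) _)) (ha.1 n)
  · show (gD.grMinus a.2).coeff n ∈ _
    rw [coeff_grMinus]
    exact chainPar_add (grChain_mem hE (ha.2 n)) (chainPar_zsmul (chainPar_zsmul (ha.2 n) _) _)

theorem grCone_smul (hE : E ∈ superDer 𝓡 0) (f : R⟦X⟧) (a : F.Cone) : F.grCone gC gD (f • a) =
    ((2 : ℤ) • (PowerSeries.X * duU f) + (2 : ℤ) • derU E f) • a + f • F.grCone gC gD a := by
  refine Prod.ext ?_ (gD.grMinus_smul hE f a.2)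
  show gC.grMinus (f • a.1) - f • a.1 = _ • a.1 + f • (gC.grMinus a.1 - a.1)
  rw [grMinus_smul gC hE, smul_sub, add_sub_assoc]

end AInfFun

end Euler

/-! ### The induced operators on homology -/

section Homology

variable {K R : Type*} [Field K] [Ring R] [Algebra K R]
variable {𝓡 : ZMod 2 → Submodule K R} [GradedAlgebra 𝓡]
variable {Ob Ob' : Type*} {C : AInfCat 𝓡 Ob} {D : AInfCat 𝓡 Ob'} {E : R →ₗ[K] R} {i j k : ZMod 2}
  {v w : R →ₗ[K] R} {r : R} {n l : ℤ}

theorem mulLeft_mem (hR : IsSuperComm 𝓡) (hr : r ∈ 𝓡 j) (hv : v ∈ superDer 𝓡 i) :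
    LinearMap.mulLeft K r ∘ₗ v ∈ superDer 𝓡 (j + i) := by
  refine ⟨fun k s hs => ?_, fun s t => ?_⟩
  · rw [add_assoc]
    exact SetLike.mul_mem_graded hr (hv.1 k s hs)
  · show r * v (s * t) = r * v s * t + twist 𝓡 (j + i) s * (r * v t)
    rw [hv.2, mul_add, mul_assoc, twist_add, ← mul_assoc (twist 𝓡 j _), ← mul_eq_twist_mul 𝓡 hR hr,
      mul_assoc r]

namespace AInfFun

variable {F : AInfFun C D}

theorem cls_surj (x : F.HC n) : ∃ a ha, x = F.cls (n := n) a ha := by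
  obtain ⟨⟨a, ha⟩, rfl⟩ := Submodule.mkQ_surjective _ x
  exact ⟨a, ha, rfl⟩

theorem cls_congr {a b : F.Cone} {ha : a ∈ F.cycles n} {hb : b ∈ F.cycles n} (h : a = b) :
    F.cls a ha = F.cls b hb := by
  subst h
  rfl

theorem cls_eq {a b c : F.Cone} {ha : a ∈ F.cycles n} {hb : b ∈ F.cycles n} (hc : c ∈ F.level n)
    (h : F.dCone c = a - b) : F.cls a ha = F.cls b hb :=
  (Submodule.Quotient.eq _).2 ⟨c, hc, h⟩

/-- An operator on the cone that maps cycles to cycles and boundaries to boundaries. -/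
structure Desc (F : AInfFun C D) (n l : ℤ) (T : F.Cone →+ F.Cone) : Prop where
  cycle : ∀ a ∈ F.cycles n, T a ∈ F.cycles l
  boundary : ∀ c ∈ F.level n, ∃ c' ∈ F.level l, F.dCone c' = T (F.dCone c)

/-- The induced map on homology. -/
def Desc.map {T : F.Cone →+ F.Cone} (h : F.Desc n l T) : F.HC n →+ F.HC l :=
  QuotientAddGroup.lift (F.boundaries n).toAddSubgroup
    ((F.boundaries l).mkQ.toAddMonoidHom.comp
      ((T.comp (F.cycles n).subtype.toAddMonoidHom).codRestrict (F.cycles l)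
        fun a => h.cycle a.1 a.2))
    (by
      rintro a ⟨c, hc, hc'⟩
      obtain ⟨c', h1, h2⟩ := h.boundary c hc
      refine (Submodule.Quotient.mk_eq_zero _).2 ⟨c', h1, ?_⟩
      rw [h2, hc']
      rfl)

theorem Desc.induces {T : F.Cone →+ F.Cone} (h : F.Desc n l T) : F.Induces T h.map :=
  fun a ha => ⟨h.cycle a ha, rfl⟩

theorem desc_nabla (hR : IsSuperComm 𝓡) (hv : v ∈ superDer 𝓡 i) :
    F.Desc n (n - 1) (F.nablaCone i v) := by
  have h : ∀ a, F.dCone (sgn i • F.nablaCone i v a) = F.nablaCone i v (F.dCone a) := fun a => by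
    rw [nablaCone_dCone hR F hv, map_zsmul]
  refine ⟨fun a ha => ⟨nablaCone_level F ha.1, ?_⟩, fun c hc => ⟨_, ?_, h c⟩⟩
  · have := h a
    rw [ha.2, map_zero, map_zsmul] at this
    rw [← sgn_smul_self i (F.dCone _), this, smul_zero]
  · exact zsmul_mem (nablaCone_level F hc) _

theorem IsEulerGraded.desc {gC : EulerGrading C E} {gD : EulerGrading D E}
    (h : F.IsEulerGraded gC gD) (hR : IsSuperComm 𝓡) (hE : E ∈ superDer 𝓡 0) :
    F.Desc n n (F.grCone gC gD) := by
  refine ⟨fun a ha => ⟨grCone_level ha.1, ?_⟩,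
    fun c hc => ⟨F.grCone gC gD c + c, add_mem (grCone_level hc) hc, ?_⟩⟩
  · have := h.grCone_dCone hR hE a
    rwa [ha.2, map_zero, add_zero, eq_comm] at this
  · rw [map_add, h.grCone_dCone hR hE]

section Structures

variable {nabla : ∀ (n : ℤ), ZMod 2 → (R →ₗ[K] R) → (F.HC n →+ F.HC (n - 1))}
  {gr : ∀ n : ℤ, F.HC n →+ F.HC n} {gC : EulerGrading C E} {gD : EulerGrading D E}

theorem isConnection (hR : IsSuperComm 𝓡)
    (hn : ∀ n i, ∀ v ∈ superDer 𝓡 i, F.Induces (F.nablaCone i v) (nabla n i v)) :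
    F.IsConnection nabla where
  add n i v hv w hw := by
    ext x
    obtain ⟨a, ha, rfl⟩ := cls_surj x
    obtain ⟨h1, e1⟩ := hn n i v hv a ha
    obtain ⟨h2, e2⟩ := hn n i w hw a ha
    obtain ⟨h3, e3⟩ := hn n i _ (add_mem hv hw) a ha
    rw [AddMonoidHom.add_apply, e1, e2, e3]
    exact cls_congr (hb := add_mem h1 h2) (F.nablaCone_add a)
  smul n i j v hv r hr x := by
    obtain ⟨a, ha, rfl⟩ := cls_surj x
    obtain ⟨h1, e1⟩ := hn n i v hv a ha
    obtain ⟨h2, e2⟩ := hn n (j + i) _ (mulLeft_mem hR hr hv) a ha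
    rw [e1, e2]
    exact cls_congr (hb := (F.cycles _).smul_mem _ h1) (F.nablaCone_mulLeft hR hr a)
  even n i j v hv x hx := by
    obtain ⟨a, ha, hp, rfl⟩ := hx
    obtain ⟨h1, e1⟩ := hn n i v hv a ha
    exact ⟨_, h1, nablaCone_par F hv hp, e1⟩
  leibniz n i v hv f x := by
    obtain ⟨a, ha, rfl⟩ := cls_surj x
    obtain ⟨h1, e1⟩ := hn n i v hv a ha
    obtain ⟨h2, e2⟩ := hn n i v hv (f • a) ((F.cycles n).smul_mem f ha)
    rw [e1]
    refine e2.trans (cls_congr (hb := add_mem ((F.cycles _).smul_mem _ ?_)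
      ((F.cycles _).smul_mem _ h1)) (F.nablaCone_smul hv f a))
    exact ⟨⟨fun l hl => ha.1.1 l (by omega), fun l hl => ha.1.2 l (by omega)⟩, ha.2⟩

theorem IsEulerGraded.isEulerGradingOf (h : F.IsEulerGraded gC gD) (hC : gC.Compatible)
    (hD : gD.Compatible) (hR : IsSuperComm 𝓡) (hE : E ∈ superDer 𝓡 0)
    (hn : ∀ n i, ∀ v ∈ superDer 𝓡 i, F.Induces (F.nablaCone i v) (nabla n i v))
    (hg : ∀ n, F.Induces (F.grCone gC gD) (gr n)) : F.IsEulerGradingOf E nabla gr where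
  even n j x hx := by
    obtain ⟨a, ha, hp, rfl⟩ := hx
    obtain ⟨h1, e1⟩ := hg n a ha
    exact ⟨_, h1, grCone_par hE hp, e1⟩
  leibniz n f x := by
    obtain ⟨a, ha, rfl⟩ := cls_surj x
    obtain ⟨h1, e1⟩ := hg n a ha
    obtain ⟨h2, e2⟩ := hg n (f • a) ((F.cycles n).smul_mem f ha)
    rw [e1]
    exact e2.trans (cls_congr (hb := add_mem ((F.cycles _).smul_mem _ ha)
      ((F.cycles _).smul_mem _ h1)) (grCone_smul hE f a))
  comm n i v hv x := by
    obtain ⟨a, ha, rfl⟩ := cls_surj x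
    obtain ⟨h1, e1⟩ := hn n i v hv a ha
    obtain ⟨h2, e2⟩ := hg (n - 1) _ h1
    obtain ⟨h3, e3⟩ := hg n a ha
    obtain ⟨h4, e4⟩ := hn n i v hv _ h3
    obtain ⟨h5, e5⟩ := hn n i _ (EulerGrading.bracket_mem hE hv) a ha
    rw [e1, e2, e3, e4, e5]
    refine cls_congr (ha := sub_mem h2 h4) ?_
    rw [h.grCone_nablaCone hC hD hR hE hv, add_sub_cancel_left]

/-! ### The connection in the direction of `u` -/

/-- The operator `Gr / (2u) - u⁻¹ ∇_E` on the cone. -/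
def uCone (gC : EulerGrading C E) (gD : EulerGrading D E) (a : F.Cone) : F.Cone :=
  (PowerSeries.C (algebraMap K R 2⁻¹) : R⟦X⟧) • F.coneUInv (F.grCone gC gD a) -
    F.coneUInv (F.nablaCone 0 E a)

theorem canonicalU_cls (hE : E ∈ superDer 𝓡 0)
    (hn : ∀ n i, ∀ v ∈ superDer 𝓡 i, F.Induces (F.nablaCone i v) (nabla n i v))
    (hg : ∀ n, F.Induces (F.grCone gC gD) (gr n)) (a : F.Cone) (ha : a ∈ F.cycles n) :
    ∃ h, F.canonicalU E nabla gr n (F.cls a ha) = F.cls (uCone gC gD a) h := by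
  obtain ⟨h1, e1⟩ := hg n a ha
  obtain ⟨h2, e2⟩ := hn n 0 E hE a ha
  have h3 : F.canonicalU E nabla gr n (F.cls a ha) =
    (PowerSeries.C (algebraMap K R 2⁻¹) : R⟦X⟧) • F.incl (n - 1) (F.uInv n (F.cls _ h1)) -
    F.uInv (n - 1) (F.cls _ h2) := by rw [← e1, ← e2]; rfl
  exact ⟨_, h3⟩

theorem smul_comm_algebraMap (f : R⟦X⟧) (c : K) (a : F.Cone) :
    f • (PowerSeries.C (algebraMap K R c) : R⟦X⟧) • a =
      (PowerSeries.C (algebraMap K R c) : R⟦X⟧) • f • a := by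
  rw [smul_smul, smul_smul]
  congr 1
  ext m
  rw [PowerSeries.coeff_mul_C, PowerSeries.coeff_C_mul, Algebra.commutes]

theorem half_smul [CharZero K] (a : F.Cone) :
    (PowerSeries.C (algebraMap K R 2⁻¹) : R⟦X⟧) • (2 : ℤ) • a = a := by
  rw [two_smul, smul_add, ← add_smul, ← map_add, ← map_add, ← two_mul,
    mul_inv_cancel₀ two_ne_zero, map_one, map_one, one_smul]

theorem X_smul_coneUInv (a : F.Cone) : (PowerSeries.X : R⟦X⟧) • F.coneUInv a = a := by
  refine Prod.ext ?_ ?_ <;>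
  · apply Lau.ext
    intro m
    refine (Lau.coeff_X_smul _ m).trans ?_
    show (Lau.uPow (-1) _).coeff _ = _
    rw [Lau.coeff_uPow', sub_neg_eq_add, sub_add_cancel]

theorem uCone_smul [CharZero K] (hE : E ∈ superDer 𝓡 0) (f : R⟦X⟧) (a : F.Cone) :
    uCone gC gD (f • a) = duU f • a + f • uCone gC gD a := by
  have h1 : derU (twist 𝓡 0) f = f := by
    ext m
    simp [derU, Lau.coeffwise, twist_zero]
  rw [uCone, uCone, grCone_smul hE, F.nablaCone_smul hE, h1, map_add, map_add, map_smul, map_smul,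
    map_smul, map_smul, ← smul_add (2 : ℤ), smul_assoc, smul_add, half_smul, smul_sub,
    smul_comm_algebraMap, add_smul, ← PowerSeries.commute_X, mul_smul, X_smul_coneUInv]
  abel

theorem conePar_sub {a b : F.Cone} (ha : a ∈ F.conePar j) (hb : b ∈ F.conePar j) :
    a - b ∈ F.conePar j :=
  ⟨fun m => chainPar_sub (ha.1 m) (hb.1 m), fun m => chainPar_sub (ha.2 m) (hb.2 m)⟩

theorem uCone_par (hE : E ∈ superDer 𝓡 0) {a : F.Cone} (ha : a ∈ F.conePar j) :
    uCone gC gD a ∈ F.conePar j := by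
  have hu : ∀ b : F.Cone, b ∈ F.conePar j → F.coneUInv b ∈ F.conePar j := fun b hb => by
    refine ⟨fun m => ?_, fun m => ?_⟩
    · show (Lau.uPow (-1) _).coeff _ ∈ _
      rw [Lau.coeff_uPow']
      exact hb.1 _
    · show (Lau.uPow (-1) _).coeff _ ∈ _
      rw [Lau.coeff_uPow']
      exact hb.2 _
  have hc : ∀ b : F.Cone, b ∈ F.conePar j →
      (PowerSeries.C (algebraMap K R 2⁻¹) : R⟦X⟧) • b ∈ F.conePar j := fun b hb => by
    refine ⟨fun m => ?_, fun m => ?_⟩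
    · show ((PowerSeries.C _ : R⟦X⟧) • b.1).coeff m ∈ _
      rw [Lau.coeff_C_smul]
      intro w
      rw [Finsupp.smul_apply, smul_eq_mul, ← Algebra.smul_def]
      exact (𝓡 _).smul_mem _ (hb.1 m w)
    · show ((PowerSeries.C _ : R⟦X⟧) • b.2).coeff m ∈ _
      rw [Lau.coeff_C_smul]
      intro w
      rw [Finsupp.smul_apply, smul_eq_mul, ← Algebra.smul_def]
      exact (𝓡 _).smul_mem _ (hb.2 m w)
  have h := nablaCone_par F hE ha
  rw [zero_add] at h
  exact conePar_sub (hc _ (hu _ (grCone_par hE ha))) (hu _ h)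

theorem isUConnection [CharZero K] (hE : E ∈ superDer 𝓡 0)
    (hn : ∀ n i, ∀ v ∈ superDer 𝓡 i, F.Induces (F.nablaCone i v) (nabla n i v))
    (hg : ∀ n, F.Induces (F.grCone gC gD) (gr n)) : F.IsUConnection (F.canonicalU E nabla gr) where
  add n x y := by
    simp only [canonicalU, map_add, smul_add]
    abel
  even n j x hx := by
    obtain ⟨a, ha, hp, rfl⟩ := hx
    obtain ⟨h1, e1⟩ := canonicalU_cls hE hn hg a ha
    exact ⟨_, h1, uCone_par hE hp, e1⟩
  leibniz n f x := by
    obtain ⟨a, ha, rfl⟩ := cls_surj x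
    obtain ⟨h1, e1⟩ := canonicalU_cls hE hn hg a ha
    obtain ⟨h2, e2⟩ := canonicalU_cls hE hn hg (f • a) ((F.cycles n).smul_mem f ha)
    rw [e1]
    refine e2.trans (cls_congr (hb := add_mem ((F.cycles _).smul_mem _ ?_)
      ((F.cycles _).smul_mem _ h1)) (uCone_smul hE f a))
    exact ⟨⟨fun l hl => ha.1.1 l (by omega), fun l hl => ha.1.2 l (by omega)⟩, ha.2⟩

/-! ### Flatness -/

theorem NablaFlat.exists (h : F.NablaFlat) (hv : v ∈ superDer 𝓡 i) (hw : w ∈ superDer 𝓡 j)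
    {a : F.Cone} (ha : a ∈ F.cycles n) : ∃ c ∈ F.level (n - 1 - 1), F.dCone c =
      F.nablaCone i v (F.nablaCone j w a) - sgn (i * j) • F.nablaCone j w (F.nablaCone i v a) -
        F.nablaCone (i + j) (superBracket i j v w) a := by
  have h0 : F.coneUPow (-n) a ∈ F.cycles 0 := by
    refine ⟨?_, by rw [F.dCone_uPow, ha.2, map_zero]⟩
    have := F.coneUPow_level (k := -n) ha.1
    rwa [add_neg_cancel] at this
  obtain ⟨c, hc, hd⟩ := h i j v hv w hw _ h0
  refine ⟨F.coneUPow n c, ?_, ?_⟩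
  · have := F.coneUPow_level (k := n) hc
    rwa [show -2 + n = n - 1 - 1 by ring] at this
  · rw [F.dCone_uPow, hd]
    simp only [F.nablaCone_uPow, map_sub, map_zsmul, F.coneUPow_coneUPow, add_neg_cancel,
      F.coneUPow_zero]

theorem NablaFlat.isFlat (h : F.NablaFlat)
    (hn : ∀ n i, ∀ v ∈ superDer 𝓡 i, F.Induces (F.nablaCone i v) (nabla n i v)) :
    F.IsFlat nabla := fun n i j v hv w hw x => by
  obtain ⟨a, ha, rfl⟩ := cls_surj x
  obtain ⟨h1, e1⟩ := hn n j w hw a ha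
  obtain ⟨h2, e2⟩ := hn (n - 1) i v hv _ h1
  obtain ⟨h3, e3⟩ := hn n i v hv a ha
  obtain ⟨h4, e4⟩ := hn (n - 1) j w hw _ h3
  obtain ⟨h5, e5⟩ := hn n (i + j) _ (superBracket_mem hv hw) a ha
  rw [e1, e2, e3, e4, e5]
  obtain ⟨c, hc, hd⟩ := h.exists hv hw ha
  exact cls_eq (ha := sub_mem h2 (zsmul_mem h4 _)) hc hd

theorem NablaFlat.uCommutes [CharZero K] (h : F.NablaFlat) (hF : F.IsEulerGraded gC gD)
    (hC : gC.Compatible) (hD : gD.Compatible) (hR : IsSuperComm 𝓡) (hE : E ∈ superDer 𝓡 0)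
    (hn : ∀ n i, ∀ v ∈ superDer 𝓡 i, F.Induces (F.nablaCone i v) (nabla n i v))
    (hg : ∀ n, F.Induces (F.grCone gC gD) (gr n)) :
    F.UCommutes nabla (F.canonicalU E nabla gr) := fun n i v hv x => by
  obtain ⟨a, ha, rfl⟩ := cls_surj x
  obtain ⟨h1, e1⟩ := hn n i v hv a ha
  obtain ⟨h2, e2⟩ := canonicalU_cls hE hn hg _ h1
  obtain ⟨h3, e3⟩ := canonicalU_cls hE hn hg a ha
  obtain ⟨h4, e4⟩ := hn (n - 1 - 1) i v hv _ h3
  rw [e1, e2, e3, e4]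
  obtain ⟨c, hc, hd⟩ := h.exists hE hv ha
  have hb : superBracket 0 i ((2 : ℤ) • E) v = superBracket 0 i E v + superBracket 0 i E v := by
    ext r
    simp only [superBracket, two_smul, LinearMap.sub_apply, LinearMap.add_apply,
      LinearMap.comp_apply, LinearMap.smul_apply, map_add, smul_add]
    abel
  have hK : ∀ c : K, v (algebraMap K R c) = 0 := fun c => by
    rw [Algebra.algebraMap_eq_smul_one, map_smul, superDer_one hv, smul_zero]
  have h5 : derU v (PowerSeries.C (algebraMap K R 2⁻¹)) = 0 := by
    ext m
    rw [derU, Lau.coeffwise, PowerSeries.coeff_mk, PowerSeries.coeff_C]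
    split_ifs
    · exact hK _
    · exact map_zero _
  have h6 : derU (twist 𝓡 i) (PowerSeries.C (algebraMap K R 2⁻¹)) =
      PowerSeries.C (algebraMap K R 2⁻¹) := by
    ext m
    rw [derU, Lau.coeffwise, PowerSeries.coeff_mk, PowerSeries.coeff_C]
    split_ifs
    · show twist 𝓡 i (algebraMap K R 2⁻¹) = _
      rw [Algebra.algebraMap_eq_smul_one, map_smul, twist_one]
    · exact map_zero _
  have hu : ∀ b, F.nablaCone i v (F.coneUInv b) = F.coneUInv (F.nablaCone i v b) :=
    F.nablaCone_uPow (-1)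
  refine cls_eq (c := -F.coneUInv c) (neg_mem (F.coneUPow_level (k := -1) hc)) ?_
  rw [map_neg, show F.dCone (F.coneUInv c) = F.coneUInv (F.dCone c) from F.dCone_uPow (-1) c, hd,
    uCone, uCone, hF.grCone_nablaCone hC hD hR hE hv, hb, F.nablaCone_add,
    map_sub (F.nablaCone i v), F.nablaCone_smul hv, h5, h6, hu, hu, map_add F.coneUInv, ← two_smul ℤ,
    map_zsmul, smul_add, half_smul]
  simp only [zero_smul, zero_add, zero_mul, sgn_zero, one_smul, map_sub]
  abel

end Structures

end AInfFun

end Homology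

end

end RelCyc

theorem mainTheorem6 {K R : Type*} [Field K] [CharZero K]
    [Ring R] [Algebra K R]
    (𝓡 : ZMod 2 → Submodule K R) [GradedAlgebra 𝓡] (hR : RelCyc.IsSuperComm 𝓡)
    {Ob Ob' : Type*}
    (C : RelCyc.AInfCat 𝓡 Ob) (D : RelCyc.AInfCat 𝓡 Ob')
    (F : RelCyc.AInfFun C D)
    (E : R →ₗ[K] R) (hE : E ∈ RelCyc.superDer 𝓡 0)
    (gC : RelCyc.EulerGrading C E) (gD : RelCyc.EulerGrading D E)
    (hF : F.IsEulerGraded gC gD) :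
    -- `[Gr^-_F, d^-_F] = d^-_F`, so `Gr^-_F` descends to homology
    (∀ x : F.Cone,
      F.grCone gC gD (F.dCone x) - F.dCone (F.grCone gC gD x) = F.dCone x) ∧
    (∀ n : ℤ, ∃ gr : F.HC n →+ F.HC n, F.Induces (F.grCone gC gD) gr) ∧
    (gC.Compatible → gD.Compatible →
      -- `[Gr^-, H_v] = H_{[2E, v]} - H_v`
      (∀ (i : ZMod 2), ∀ v ∈ RelCyc.superDer 𝓡 i, ∀ a : C.CCu,
        gD.grMinus (F.H i v a) - F.H i v (gC.grMinus a) =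
          F.H i (RelCyc.superBracket 0 i ((2 : ℤ) • E) v) a - F.H i v a) ∧
      -- `HC^-_*(F)` with the induced connection and grading
      ∃ (nabla : ∀ (n : ℤ), ZMod 2 → (R →ₗ[K] R) → (F.HC n →+ F.HC (n - 1)))
        (gr : ∀ n : ℤ, F.HC n →+ F.HC n),
        (∀ n i, ∀ v ∈ RelCyc.superDer 𝓡 i, F.Induces (F.nablaCone i v) (nabla n i v)) ∧
        (∀ n, F.Induces (F.grCone gC gD) (gr n)) ∧
        F.IsConnection nabla ∧
        F.IsEulerGradingOf E nabla gr ∧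
        F.IsUConnection (F.canonicalU E nabla gr) ∧
        (F.NablaFlat →
          F.IsFlat nabla ∧
          F.UCommutes nabla (F.canonicalU E nabla gr) ∧
          (F.HCFree → F.IsEulerGradedTStructure E nabla gr))) := by
  refine ⟨fun x => by rw [hF.grCone_dCone hR hE, add_sub_cancel_left],
    fun n => ⟨(hF.desc hR hE).map, (hF.desc hR hE).induces⟩, fun hC hD => ⟨fun i v hv a => ?_, ?_⟩⟩
  · rw [hF.grMinus_H hC hD hR hE hv a, add_sub_assoc, add_sub_cancel_left]
  classical
  let nabla : ∀ (n : ℤ), ZMod 2 → (R →ₗ[K] R) → (F.HC n →+ F.HC (n - 1)) := fun n i v =>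
    if hv : v ∈ RelCyc.superDer 𝓡 i then (RelCyc.AInfFun.desc_nabla hR hv).map else 0
  have hn : ∀ n i, ∀ v ∈ RelCyc.superDer 𝓡 i, F.Induces (F.nablaCone i v) (nabla n i v) := by
    intro n i v hv
    simp only [nabla, dif_pos hv]
    exact (RelCyc.AInfFun.desc_nabla hR hv).induces
  have hg : ∀ n, F.Induces (F.grCone gC gD) (hF.desc (n := n) hR hE).map := fun n =>
    (hF.desc hR hE).induces
  have hconn := RelCyc.AInfFun.isConnection hR hn
  have heuler := hF.isEulerGradingOf hC hD hR hE hn hg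
  exact ⟨nabla, _, hn, hg, hconn, heuler, RelCyc.AInfFun.isUConnection hE hn hg, fun hfl =>
    ⟨hfl.isFlat hn, hfl.uCommutes hF hC hD hR hE hn hg, fun hfree =>
      ⟨hfree, hconn, hfl.isFlat hn, heuler⟩⟩⟩
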